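/- **Conventions.** Let $M$ be a $3$-manifold (topological, without boundary). A handlebody of genus $g$ is a space homeomorphic to ($g$-punctured closed disk)$\,\times[0,1]$. A Heegaard splitting $M=V\cup W$ is an ordered decomposition of $M$ into two handlebodies $V,W$ of the same genus (the genus of the splitting) with $V\cap W=\partial V=\partial W$. Two splittings are isotopic if an ambient isotopy of $M$ starting at the identity carries $V$ to $V'$ and $W$ to $W'$. A stabilization of $V\cup W$ is a Heegaard splitting $V'\cup W'$ with $V'=V\cup h$ and $W'=\overline{W\setminus h}$, where $h\cong D^2\times[0,1]$ is a $1$-handle in $W$ with $h\cap\partial W=D^2\times\{0,1\}$ whose core is $\partial$-parallel in $W$: the core and an arc in $\partial W$ together bound an embedded disk in $W$, which meets $\partial W$ only in that arc and meets $h$ in a band (radius of $D^2$)$\,\times[0,1]$. Considering splittings up to isotopy, we call a Heegaard splitting $V\cup W$ a union stabilization of $V_1\cup W_1$ and $V_2\cup W_2$ if there are splittings $V_i'\cup W_i'$ isotopic to $V_i\cup W_i$ ($i=1,2$) such that $V\cup W$ is obtained from each of $V_1'\cup W_1'$ and $V_2'\cup W_2'$ by finitely many stabilizations, and $V=V_1'\cup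 V_2'$. **Proposition 2.1.** Let $V_1\cup W_1$ and $V_2\cup W_2$ be isotopic Heegaard splittings of a $3$-manifold $M$, and let $V_1\cup W_1$ have genus $g$. Then $V_2\cup W_2$ has genus $g$ as well, and there is a union stabilization of $V_1\cup W_1$ and $V_2\cup W_2$ of genus $g+1$. -/

import Mathlib

open Set Topology

/-- The standard handlebody of genus `g`, as a subset of `ℂ × ℝ`: the product of a round closed disk
with `g` disjoint open round holes (a `g`-punctured disk) and the interval `[0, 1]`. -/
def stdHandlebody (g : ℕ) : Set (ℂ × ℝ) :=
  {p | ‖p.1‖ ≤ 3 * g + 2 ∧ (∀ j : ℕ, 1 ≤ j → j ≤ g → 1 ≤ ‖p.1 - 3 * j‖) ∧ 0 ≤ p.2 ∧ p.2 ≤ 1}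

/-- `H ⊆ M` is a handlebody of genus `g` whose boundary surface is `S`: there is a homeomorphism from
the standard handlebody onto `H` taking the boundary of the standard handlebody onto `S`. -/
def IsHandlebody {M : Type*} [TopologicalSpace M] (g : ℕ) (H S : Set M) : Prop :=
  ∃ f : stdHandlebody g → M, IsEmbedding f ∧ range f = H ∧
    f '' {p | (p : ℂ × ℝ) ∈ frontier (stdHandlebody g)} = S

/-- A Heegaard splitting of `M`: a decomposition `M = V ∪ W` into two handlebodies (of the same genus)
that meet exactly in their common boundary. The pair `(V, W)` is ordered. -/
structure HeegaardSplitting (M : Type*) [TopologicalSpace M] where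
  V : Set M
  W : Set M
  union_eq : V ∪ W = univ
  exists_genus : ∃ g : ℕ, IsHandlebody g V (V ∩ W) ∧ IsHandlebody g W (V ∩ W)

namespace HeegaardSplitting

/-- The splitting has genus `g`. -/
def HasGenus {M : Type*} [TopologicalSpace M] (P : HeegaardSplitting M) (g : ℕ) : Prop :=
  IsHandlebody g P.V (P.V ∩ P.W) ∧ IsHandlebody g P.W (P.V ∩ P.W)

/-- Two splittings are isotopic: some ambient isotopy of `M` that starts at the identity ends with a
homeomorphism carrying `V` to `V'` and `W` to `W'`. -/
def Isotopic {M : Type*} [TopologicalSpace M] (P P' : HeegaardSplitting M) : Prop :=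
  ∃ F : unitInterval → M ≃ₜ M,
    Continuous (fun p : unitInterval × M => F p.1 p.2) ∧
    (∀ x, F 0 x = x) ∧ F 1 '' P.V = P'.V ∧ F 1 '' P.W = P'.W

end HeegaardSplitting

/-- `φ : D² × [0, 1] → W` parametrizes a `1`-handle lying in `W` and attached along the boundary
surface `S` of `W`: it is an embedding that meets `S` exactly in the two ends `D² × {0, 1}`. -/
def IsOneHandle {M : Type*} [TopologicalSpace M] (W S : Set M)
    (φ : Metric.closedBall (0 : ℂ) 1 × unitInterval → M) : Prop :=
  IsEmbedding φ ∧ range φ ⊆ W ∧ ∀ p, φ p ∈ S ↔ p.2 = 0 ∨ p.2 = 1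

/-- The core `φ ({0} × [0, 1])` of a `1`-handle is parallel in `W` to the boundary surface `S` of `W`:
there is an embedded square `ψ` in `W`, one side of which is the core (`ψ (s, 0) = φ (0, s)`), while the
three other sides form an arc in `S` and the rest of the square is disjoint from `S`. As usual for
tame objects, the square is in good position with respect to the handle: it meets it in the band
`{radius of D²} × [0, 1]`, which is the half `t ≤ 1 / 2` of the square. -/
def CoreIsBoundaryParallel {M : Type*} [TopologicalSpace M] (W S : Set M)
    (φ : Metric.closedBall (0 : ℂ) 1 × unitInterval → M) : Prop :=
  ∃ ψ : unitInterval × unitInterval → M,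
    IsEmbedding ψ ∧ range ψ ⊆ W ∧
    (∀ p, ψ p ∈ S ↔ p.1 = 0 ∨ p.1 = 1 ∨ p.2 = 1) ∧
    (∀ (s t : unitInterval) (z : Metric.closedBall (0 : ℂ) 1),
      (z : ℂ) = ((2 * (t : ℝ) : ℝ) : ℂ) → ψ (s, t) = φ (z, s)) ∧
    (∀ s t : unitInterval, 1 / 2 < (t : ℝ) → ψ (s, t) ∉ range φ)

namespace HeegaardSplitting

/-- `P'` results from `P` by one stabilization: a `1`-handle in `W` whose core is boundary parallel in
`W` is added to `V` and removed from `W`, and the result is again a Heegaard splitting. -/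
def StabilizesTo {M : Type*} [TopologicalSpace M] (P P' : HeegaardSplitting M) : Prop :=
  ∃ φ : Metric.closedBall (0 : ℂ) 1 × unitInterval → M,
    IsOneHandle P.W (P.V ∩ P.W) φ ∧ CoreIsBoundaryParallel P.W (P.V ∩ P.W) φ ∧
    P'.V = P.V ∪ range φ ∧ P'.W = closure (P.W \ range φ)

/-- `P` results from `Q` by a finite sequence of stabilizations. -/
def IsStabilizationOf {M : Type*} [TopologicalSpace M] (P Q : HeegaardSplitting M) : Prop :=
  Relation.ReflTransGen StabilizesTo Q P

/-- `P` is a union stabilization of `P₁` and `P₂`, where `P₁` and `P₂` are considered up to isotopy: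
after replacing `P₁` and `P₂` by isotopic splittings `Q₁` and `Q₂`, the splitting `P` is a common
stabilization of `Q₁` and `Q₂`, and its first handlebody is the union of theirs. -/
def IsUnionStabilization {M : Type*} [TopologicalSpace M] (P P₁ P₂ : HeegaardSplitting M) : Prop :=
  ∃ Q₁ Q₂ : HeegaardSplitting M, P₁.Isotopic Q₁ ∧ P₂.Isotopic Q₂ ∧
    P.IsStabilizationOf Q₁ ∧ P.IsStabilizationOf Q₂ ∧ P.V = Q₁.V ∪ Q₂.V

end HeegaardSplitting

open Filter Metric

/-! Since the two splittings are isotopic, both can be modified starting from the same one, `V ∪ W`.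
In a suitable box the pair looks like the wedge `p ≥ 0`, `q ≥ 0`, `|t| ≤ 1` and the closure of its
complement. Dig into `V` a trench from the face `p = 0`, occupying `p < 3`, `|q - 5/2| < 1/2`. This
only pushes the surface inwards and gives an isotopic splitting with first handlebody `V₁`. A second
trench, dug from the face `q = 0` with the roles of `p` and `q` exchanged, gives `V₂`. The two
trenches meet in the straight tunnel `|p - 5/2| < 1/2`, `|q - 5/2| < 1/2`, so `V₁ ∪ V₂` is `V` with
a tunnel drilled through the wedge from `t = -1` to `t = 1`. Seen from `V₁`, the trench has been
filled again for `p ≤ 2`, which is a bridge across it, that is, a one-handle. The square spanned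
between the core of the bridge and the floor `p = 3` of the trench shows that the core is boundary
parallel (`IsTrenchSplitting.stabilizesTo`). The same holds for `V₂` by symmetry, so the union is a
single stabilization of each.

It remains to see handlebodies of genus `g + 1` on both sides. They arise by adding the bridge to
`V₁` and the tunnel to `W`, that is, by attaching a one-handle along two squares in a disk of the
boundary surface. `IsHandlebody.attach` treats this case: the standard handlebody of genus `g + 1`,
cut along the vertical line through the centre of its last hole, is a standard handlebody of genus
`g` together with a band (`exists_attachingModel`), and the given handlebody is reparametrized so
that the feet of the handle agree with those of the band (`IsHandlebody.exists_isParam_match`).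

Everything is merely topological, so the reparametrization needs planar topology: two disks in the
boundary of a handlebody can be matched, up to a reflection, by a homeomorphism of the handlebody
(`Transportable.exists_match`). Homeomorphisms of a disk that fix its boundary extend over a collar
by Alexander's trick. The essential input is `exists_flatten`, a statement of Schoenflies type: an
embedded planar disk can be reparametrized, without change on the boundary, to be linear up to
reflection near its centre. It follows from the Riemann map, its Carathéodory extension to the
boundary, and a radial extension of the resulting circle homeomorphism. -/

/-! ### Limits of bounded holomorphic functions. -/

theorem tendstoLocallyUniformlyOn_of_forall_tendsto_of_norm_le_one {ι : Type*} {l : Filter ι}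
    [l.NeBot] {F : ι → ℂ → ℂ} {f : ℂ → ℂ} {U : Set ℂ} (hU : IsOpen U)
    (hd : ∀ n, DifferentiableOn ℂ (F n) U) (hb : ∀ n, ∀ z ∈ U, ‖F n z‖ ≤ 1)
    (hf : ∀ z ∈ U, Tendsto (fun n ↦ F n z) l (𝓝 (f z))) :
    TendstoLocallyUniformlyOn F f l U := by
  rw [Metric.tendstoLocallyUniformlyOn_iff]
  intro ε hε z₀ hz₀
  obtain ⟨s, hs, hsU⟩ := Metric.isOpen_iff.1 hU z₀ hz₀
  set r := s / 2 with hr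
  have hr0 : 0 < r := by positivity
  -- Cauchy's estimate bounds all derivatives on a common ball. The family is therefore
  -- equi-Lipschitz there, and for an equicontinuous family pointwise convergence is locally
  -- uniform.
  have hder : ∀ n, ∀ z ∈ ball z₀ r, ‖deriv (F n) z‖ ≤ 1 / r := by
    intro n z hz
    have hsub : ∀ r' < r, 0 < r' → closedBall z r' ⊆ U := by
      intro r' h1 h2 w hw; apply hsU
      rw [mem_ball] at hz ⊢; rw [mem_closedBall] at hw
      linarith [dist_triangle w z z₀]
    have key : ∀ r' < r, 0 < r' → ‖deriv (F n) z‖ * r' ≤ 1 := by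
      intro r' h1 h2
      have := Complex.norm_deriv_le_of_forall_mem_sphere_norm_le h2 (f := F n) (c := z) (C := 1)
        (((hd n).mono (hsub r' h1 h2)).diffContOnCl_ball subset_rfl)
        (fun w hw ↦ hb n w (hsub r' h1 h2 (sphere_subset_closedBall hw)))
      rwa [le_div_iff₀ h2] at this
    rw [le_div_iff₀ hr0]
    by_contra! hcon
    have hpos : 0 < ‖deriv (F n) z‖ := by
      by_contra! h0
      nlinarith [norm_nonneg (deriv (F n) z)]
    have h1 : 1 / ‖deriv (F n) z‖ < r := by rw [div_lt_iff₀ hpos]; linarith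
    have h2 := key ((1 / ‖deriv (F n) z‖ + r) / 2) (by linarith) (by positivity)
    have h3 : ‖deriv (F n) z‖ * (1 / ‖deriv (F n) z‖) = 1 := by field_simp
    nlinarith
  have hlip : ∀ n, ∀ z ∈ ball z₀ r, ‖F n z - F n z₀‖ ≤ 1 / r * ‖z - z₀‖ := fun n z hz ↦
    (convex_ball z₀ r).norm_image_sub_le_of_norm_deriv_le
      (fun w hw ↦ (hd n).differentiableAt (hU.mem_nhds (hsU (ball_subset_ball (by linarith) hw))))
      (hder n) (mem_ball_self hr0) hz
  have hlipf : ∀ z ∈ ball z₀ r, ‖f z - f z₀‖ ≤ 1 / r * ‖z - z₀‖ := fun z hz ↦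
    le_of_tendsto (((hf z (hsU (ball_subset_ball (by linarith) hz))).sub (hf z₀ hz₀)).norm)
      (Eventually.of_forall fun n ↦ hlip n z hz)
  refine ⟨ball z₀ (min r (r * ε / 4)), mem_nhdsWithin_of_mem_nhds
    (ball_mem_nhds _ (by positivity)), ?_⟩
  filter_upwards [(Metric.tendsto_nhds.1 (hf z₀ hz₀)) (ε / 4) (by positivity)] with n hn z hz
  have hzr : z ∈ ball z₀ r := ball_subset_ball (min_le_left _ _) hz
  have hz4 : ‖z - z₀‖ < r * ε / 4 := by
    rw [← dist_eq_norm]; exact lt_of_lt_of_le hz (min_le_right _ _)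
  have hz5 : 1 / r * ‖z - z₀‖ < ε / 4 := by
    rw [one_div, inv_mul_lt_iff₀ hr0]; linarith
  have a1 := hlip n z hzr
  have a2 := hlipf z hzr
  rw [dist_eq_norm] at hn ⊢
  calc ‖f z - F n z‖ = ‖(f z - f z₀) - (F n z₀ - f z₀) - (F n z - F n z₀)‖ := by congr 1; ring
    _ ≤ ‖f z - f z₀‖ + ‖F n z₀ - f z₀‖ + ‖F n z - F n z₀‖ :=
      (norm_sub_le _ _).trans (add_le_add_left (norm_sub_le _ _) _)
    _ < ε := by linarith

/-- Hurwitz's theorem: zeros of a locally uniform limit of holomorphic functions are limits of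
zeros. -/
theorem eventually_exists_eq_zero_of_tendstoLocallyUniformlyOn {ι : Type*} {l : Filter ι}
    {G : ι → ℂ → ℂ} {g : ℂ → ℂ} {U V : Set ℂ} (hU : IsOpen U)
    (hd : ∀ n, DifferentiableOn ℂ (G n) U) (hg : DifferentiableOn ℂ g U)
    (hlim : TendstoLocallyUniformlyOn G g l U) {a : ℂ} (haU : a ∈ U) (ha : g a = 0)
    (hne : ¬ ∀ᶠ z in 𝓝 a, g z = 0) (hV : V ∈ 𝓝 a) : ∀ᶠ n in l, ∃ z ∈ V, G n z = 0 := by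
  have h1 := ((hg.analyticOnNhd hU a haU).eventually_eq_zero_or_eventually_ne_zero).resolve_left hne
  obtain ⟨s, hs, hsub⟩ := Metric.mem_nhds_iff.1
    (inter_mem (inter_mem hV (hU.mem_nhds haU)) (eventually_nhdsWithin_iff.1 h1))
  set r := s / 2
  have hr : 0 < r := by positivity
  have hcb : closedBall a r ⊆ ball a s := closedBall_subset_ball (by simp only [r]; linarith)
  have hcU : closedBall a r ⊆ U := fun z hz ↦ (hsub (hcb hz)).1.2
  obtain ⟨w, hw, hmin⟩ := (isCompact_sphere a r).exists_isMinOn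
    (NormedSpace.sphere_nonempty.2 hr.le)
    ((hg.continuousOn.mono (sphere_subset_closedBall.trans hcU)).norm)
  have hδ : 0 < ‖g w‖ := by
    rw [norm_pos_iff]
    refine (hsub (hcb (sphere_subset_closedBall hw))).2 ?_
    rintro rfl
    rw [mem_sphere, dist_self] at hw
    exact hr.ne hw
  have hunif := (tendstoLocallyUniformlyOn_iff_forall_isCompact hU).1 hlim _ hcU
    (isCompact_closedBall a r)
  filter_upwards [Metric.tendstoUniformlyOn_iff.1 hunif (‖g w‖ / 3) (by positivity)] with n hn
  by_contra! hcon
  have hnz : ∀ z ∈ closedBall a r, G n z ≠ 0 := fun z hz ↦ hcon z (hsub (hcb hz)).1.1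
  -- Without zeros the maximum principle applies to `1 / G n`. But its norm is at most `3 / (2 * ‖g
  -- w‖)` on the circle and more than `3 / ‖g w‖` at the centre.
  have hdiff : DiffContOnCl ℂ (fun z ↦ (G n z)⁻¹) (ball a r) :=
    (((hd n).mono hcU).inv hnz).diffContOnCl_ball subset_rfl
  have := Complex.norm_le_of_forall_mem_frontier_norm_le isBounded_ball hdiff
    (C := 3 / (2 * ‖g w‖)) (z := a) (fun z hz ↦ ?_) (subset_closure (mem_ball_self hr))
  · have h2 := hn a (mem_closedBall_self hr.le)
    rw [ha, dist_zero_left] at h2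
    rw [norm_inv, inv_eq_one_div, div_le_div_iff₀ (norm_pos_iff.2 (hnz a (mem_closedBall_self hr.le)))
      (by positivity)] at this
    linarith
  · rw [frontier_ball _ hr.ne'] at hz
    have h2 := hn z (sphere_subset_closedBall hz)
    have h3 : ‖g w‖ ≤ ‖g z‖ := hmin hz
    have h4 : ‖g z‖ - ‖G n z‖ ≤ dist (g z) (G n z) := by
      rw [dist_eq_norm]; exact norm_sub_norm_le _ _
    rw [norm_inv, inv_eq_one_div, div_le_div_iff₀ (norm_pos_iff.2
      (hnz z (sphere_subset_closedBall hz))) (by positivity)]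
    linarith


/-! ### The Riemann mapping theorem. -/

/-- The disk automorphism `w ↦ (w - c) / (1 - c̄ w)`. -/
noncomputable def diskAut (c w : ℂ) : ℂ := (w - c) / (1 - starRingEnd ℂ c * w)

theorem one_sub_conj_mul_ne_zero {c w : ℂ} (hc : ‖c‖ < 1) (hw : ‖w‖ < 1) :
    1 - starRingEnd ℂ c * w ≠ 0 := by
  intro h
  have : ‖starRingEnd ℂ c * w‖ = 1 := by rw [← sub_eq_zero.1 h, norm_one]
  rw [norm_mul, RCLike.norm_conj] at this
  nlinarith [norm_nonneg c, norm_nonneg w]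

theorem norm_diskAut_lt_one {c w : ℂ} (hc : ‖c‖ < 1) (hw : ‖w‖ < 1) : ‖diskAut c w‖ < 1 := by
  have h0 := one_sub_conj_mul_ne_zero hc hw
  rw [diskAut, norm_div, div_lt_one (norm_pos_iff.2 h0)]
  rw [← abs_norm, ← abs_norm (1 - _), ← sq_lt_sq, Complex.sq_norm, Complex.sq_norm]
  have hc' : Complex.normSq c < 1 := by
    rw [← Complex.sq_norm]; nlinarith [norm_nonneg c]
  have hw' : Complex.normSq w < 1 := by
    rw [← Complex.sq_norm]; nlinarith [norm_nonneg w]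
  rw [Complex.normSq_apply] at hc' hw' ⊢
  rw [Complex.normSq_apply]
  simp only [Complex.sub_re, Complex.sub_im, Complex.one_re, Complex.one_im, Complex.mul_re,
    Complex.mul_im, Complex.conj_re, Complex.conj_im]
  nlinarith

theorem hasDerivAt_diskAut {c w : ℂ} (hc : ‖c‖ < 1) (hw : ‖w‖ < 1) :
    HasDerivAt (diskAut c) ((1 - starRingEnd ℂ c * c) / (1 - starRingEnd ℂ c * w) ^ 2) w := by
  have h := ((hasDerivAt_id w).sub_const c).div
    (((hasDerivAt_id w).const_mul (starRingEnd ℂ c)).const_sub 1) (one_sub_conj_mul_ne_zero hc hw)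
  refine (h.congr_deriv ?_)
  simp only [id]
  congr 1; ring

theorem injOn_diskAut {c : ℂ} (hc : ‖c‖ < 1) : InjOn (diskAut c) (ball 0 1) := by
  intro w hw z hz h
  rw [mem_ball_zero_iff] at hw hz
  rw [diskAut, diskAut, div_eq_div_iff (one_sub_conj_mul_ne_zero hc hw)
    (one_sub_conj_mul_ne_zero hc hz)] at h
  have h2 : (w - z) * (1 - starRingEnd ℂ c * c) = 0 := by linear_combination h
  rcases mul_eq_zero.1 h2 with h3 | h3
  · exact sub_eq_zero.1 h3
  · exact absurd h3 (one_sub_conj_mul_ne_zero hc hc)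

theorem one_sub_conj_mul_self_ne_zero {c : ℂ} (hc : ‖c‖ < 1) : 1 - starRingEnd ℂ c * c ≠ 0 :=
  one_sub_conj_mul_ne_zero hc hc

/-- Normalized injective holomorphic maps of `U` into the unit disk. -/
structure IsSchlicht (U : Set ℂ) (z₀ : ℂ) (f : ℂ → ℂ) : Prop where
  diff : DifferentiableOn ℂ f U
  inj : InjOn f U
  maps : MapsTo f U (ball 0 1)
  zero : f z₀ = 0
  deriv_ne : ∀ z ∈ U, deriv f z ≠ 0

/-- The automorphism restores the normalization at `z₀` and multiplies the derivative there by `1 /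
(1 - ‖f z₀‖ ^ 2)`. -/
theorem IsSchlicht.diskAut_comp {U : Set ℂ} (hU : IsOpen U) {z₀ : ℂ} (hz₀ : z₀ ∈ U) {f : ℂ → ℂ}
    (hd : DifferentiableOn ℂ f U) (hinj : InjOn f U) (hmaps : MapsTo f U (ball 0 1))
    (hder : ∀ z ∈ U, deriv f z ≠ 0) : IsSchlicht U z₀ (diskAut (f z₀) ∘ f) ∧
      deriv (diskAut (f z₀) ∘ f) z₀ =
        deriv f z₀ / (1 - starRingEnd ℂ (f z₀) * f z₀) := by
  have hb : ∀ z ∈ U, ‖f z‖ < 1 := fun z hz ↦ mem_ball_zero_iff.1 (hmaps hz)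
  have hD : ∀ z ∈ U, HasDerivAt (diskAut (f z₀) ∘ f) _ z := fun z hz ↦
    (hasDerivAt_diskAut (hb z₀ hz₀) (hb z hz)).comp z
      (hd.differentiableAt (hU.mem_nhds hz)).hasDerivAt
  refine ⟨⟨fun z hz ↦ (hD z hz).differentiableAt.differentiableWithinAt,
    (injOn_diskAut (hb z₀ hz₀)).comp hinj hmaps, fun z hz ↦ mem_ball_zero_iff.2
      (norm_diskAut_lt_one (hb z₀ hz₀) (hb z hz)), by simp [diskAut], fun z hz ↦ ?_⟩, ?_⟩
  · rw [(hD z hz).deriv]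
    exact mul_ne_zero (div_ne_zero (one_sub_conj_mul_self_ne_zero (hb z₀ hz₀))
      (pow_ne_zero 2 (one_sub_conj_mul_ne_zero (hb z₀ hz₀) (hb z hz)))) (hder z hz)
  · rw [(hD z₀ hz₀).deriv]
    have := one_sub_conj_mul_self_ne_zero (hb z₀ hz₀)
    field_simp

/-- Koebe's square root trick. Move the omitted value `c` to `0`, take a square root, which exists
by simple connectedness, and normalize again. Undoing these operations is a non-injective self-map
of the disk fixing `0`, hence a strict contraction there, so the derivative grows. -/
theorem IsSchlicht.exists_norm_deriv_lt {U : Set ℂ} (hU : IsOpen U) (hUc : IsSimplyConnected U)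
    {z₀ : ℂ} (hz₀ : z₀ ∈ U) {f : ℂ → ℂ} (hf : IsSchlicht U z₀ f) {c : ℂ} (hc : ‖c‖ < 1)
    (hcf : c ∉ f '' U) : ∃ F, IsSchlicht U z₀ F ∧ ‖deriv f z₀‖ < ‖deriv F z₀‖ := by
  have hb : ∀ z ∈ U, ‖f z‖ < 1 := fun z hz ↦ mem_ball_zero_iff.1 (hf.maps hz)
  have hD : ∀ z ∈ U, HasDerivAt (diskAut c ∘ f) _ z := fun z hz ↦
    (hasDerivAt_diskAut hc (hb z hz)).comp z
      (hf.diff.differentiableAt (hU.mem_nhds hz)).hasDerivAt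
  have hgc : ContinuousOn (diskAut c ∘ f) U := fun z hz ↦
    (hD z hz).continuousAt.continuousWithinAt
  have hg0 : (0 : ℂ) ∉ (diskAut c ∘ f) '' U := by
    rintro ⟨z, hz, h⟩
    rw [Function.comp, diskAut, div_eq_zero_iff, sub_eq_zero] at h
    rcases h with h | h
    · exact hcf ⟨z, hz, h⟩
    · exact one_sub_conj_mul_ne_zero hc (hb z hz) h
  obtain ⟨h, hhc, hh⟩ := Complex.exists_continuousOn_pow_eq hUc hU hgc hg0 two_ne_zero
  have hh0 : ∀ z ∈ U, h z ≠ 0 := fun z hz h0 ↦ hg0 ⟨z, hz, by rw [← hh, h0]; simp⟩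
  have hhD : ∀ z ∈ U, ∃ h', HasDerivAt h h' z ∧
      2 * h z * h' = (1 - starRingEnd ℂ c * c) / (1 - starRingEnd ℂ c * f z) ^ 2 * deriv f z := by
    intro z hz
    have hsq : HasStrictDerivAt (fun w : ℂ ↦ w ^ 2) (2 * h z) (h z) := by
      simpa using hasStrictDerivAt_pow 2 (h z)
    have hne : 2 * h z ≠ 0 := mul_ne_zero two_ne_zero (hh0 z hz)
    have hcont : ContinuousAt h z := hhc.continuousAt (hU.mem_nhds hz)
    -- The continuous root is locally a branch of the inverse of squaring, hence differentiable.
    have e1 : h =ᶠ[𝓝 z] fun w ↦ hsq.localInverse _ _ _ hne ((diskAut c ∘ f) w) := by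
      filter_upwards [hcont.eventually (hsq.eventually_left_inverse hne)] with w hw
      rw [← hh w, hw]
    have e3 : HasDerivAt (hsq.localInverse _ _ _ hne) (2 * h z)⁻¹ ((diskAut c ∘ f) z) := by
      rw [← hh z]
      exact (hsq.to_localInverse hne).hasDerivAt
    have e2 := (e3.comp z (hD z hz)).congr_of_eventuallyEq e1
    exact ⟨_, e2, mul_inv_cancel_left₀ hne _⟩
  have hhder : ∀ z ∈ U, deriv h z ≠ 0 := by
    intro z hz h0
    obtain ⟨h', h1, h2⟩ := hhD z hz
    rw [h1.deriv] at h0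
    rw [h0, mul_zero] at h2
    exact mul_ne_zero (div_ne_zero (one_sub_conj_mul_self_ne_zero hc)
      (pow_ne_zero 2 (one_sub_conj_mul_ne_zero hc (hb z hz)))) (hf.deriv_ne z hz) h2.symm
  have hhmaps : MapsTo h U (ball 0 1) := by
    intro z hz
    rw [mem_ball_zero_iff]
    have : ‖h z‖ ^ 2 < 1 := by
      rw [← norm_pow, hh z]; exact norm_diskAut_lt_one hc (hb z hz)
    nlinarith [norm_nonneg (h z)]
  have hhinj : InjOn h U := by
    intro z hz w hw hzw
    have : (diskAut c ∘ f) z = (diskAut c ∘ f) w := by rw [← hh, ← hh, hzw]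
    exact hf.inj hz hw (injOn_diskAut hc (hf.maps hz) (hf.maps hw) this)
  obtain ⟨k1, k2⟩ := IsSchlicht.diskAut_comp hU hz₀ (fun z hz ↦ by
    obtain ⟨h', h1, -⟩ := hhD z hz
    exact h1.differentiableAt.differentiableWithinAt) hhinj hhmaps hhder
  refine ⟨_, k1, ?_⟩
  obtain ⟨h', h1, h2⟩ := hhD z₀ hz₀
  rw [k2, h1.deriv]
  have hb2 : h z₀ ^ 2 = - c := by
    rw [hh]; simp [diskAut, hf.zero]
  have hnb : ‖h z₀‖ ^ 2 = ‖c‖ := by rw [← norm_pow, hb2, norm_neg]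
  set b := h z₀
  rw [hf.zero, mul_zero, sub_zero, one_pow, div_one] at h2
  have hcc : ∀ w : ℂ, starRingEnd ℂ w * w = ((‖w‖ ^ 2 : ℝ) : ℂ) := fun w ↦ by
    rw [Complex.sq_norm, mul_comm, Complex.mul_conj]
  have hn : ∀ w : ℂ, ‖w‖ < 1 → ‖1 - starRingEnd ℂ w * w‖ = 1 - ‖w‖ ^ 2 := fun w hw ↦ by
    rw [hcc, ← Complex.ofReal_one, ← Complex.ofReal_sub, Complex.norm_real, Real.norm_eq_abs,
      abs_of_nonneg]
    nlinarith [norm_nonneg w]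
  have hb1 : ‖b‖ < 1 := mem_ball_zero_iff.1 (hhmaps hz₀)
  have hb0 : 0 < ‖b‖ := norm_pos_iff.2 (hh0 z₀ hz₀)
  have h3 : 2 * ‖b‖ * ‖h'‖ = (1 - ‖c‖ ^ 2) * ‖deriv f z₀‖ := by
    have := congrArg norm h2
    rwa [norm_mul, norm_mul, norm_mul, hn c hc, RCLike.norm_ofNat] at this
  have hfd : 0 < ‖deriv f z₀‖ := norm_pos_iff.2 (hf.deriv_ne z₀ hz₀)
  rw [norm_div, hn b hb1, hnb, lt_div_iff₀ (by linarith)]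
  have hc0 : 0 < 1 - ‖c‖ := by linarith
  -- the gain is `(1 + ‖b‖²) / (2 ‖b‖)`
  have h4 : 2 * ‖b‖ < 1 + ‖c‖ := by rw [← hnb]; nlinarith [sq_nonneg (1 - ‖b‖)]
  have h5 : 2 * ‖b‖ * (‖deriv f z₀‖ * (1 - ‖c‖)) < 2 * ‖b‖ * ‖h'‖ := by
    rw [h3]
    have := mul_lt_mul_of_pos_right h4 (mul_pos hfd hc0)
    nlinarith
  exact lt_of_mul_lt_mul_left h5 (by positivity)

/-- The Riemann mapping theorem. -/
theorem exists_riemannMap {U : Set ℂ} (hU : IsOpen U) (hUc : IsSimplyConnected U)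
    (hbd : Bornology.IsBounded U) {z₀ : ℂ} (hz₀ : z₀ ∈ U) :
    ∃ f, IsSchlicht U z₀ f ∧ f '' U = ball 0 1 := by
  have hpre : IsPreconnected U := by
    have := hUc.simplyConnectedSpace
    exact isPreconnected_iff_preconnectedSpace.2 inferInstance
  obtain ⟨f₀, hf₀m, hf₀i, hf₀d⟩ :
      ∃ f : ℂ → ℂ, MapsTo f U (ball 0 1) ∧ InjOn f U ∧ ∀ z ∈ U, deriv f z ≠ 0 := by
    obtain ⟨C, hC0, hC⟩ := hbd.exists_pos_norm_lt
    have hC' : ((C : ℝ) : ℂ) ≠ 0 := Complex.ofReal_ne_zero.2 hC0.ne'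
    refine ⟨fun z ↦ z / C, fun z hz ↦ ?_, fun z _ w _ h ↦ ?_, fun z _ ↦ ?_⟩
    · rw [mem_ball_zero_iff, norm_div, Complex.norm_real, Real.norm_of_nonneg hC0.le,
        div_lt_one hC0]
      exact hC z hz
    · exact (div_left_inj' hC').1 h
    · rw [((hasDerivAt_id' z).div_const _).deriv]
      exact div_ne_zero one_ne_zero hC'
  have hf₀ := (IsSchlicht.diskAut_comp hU hz₀ (fun z hz ↦ (differentiableAt_of_deriv_ne_zero
    (hf₀d z hz)).differentiableWithinAt) hf₀i hf₀m hf₀d).1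
  set A : Set ℝ := (fun f ↦ ‖deriv f z₀‖) '' {f | IsSchlicht U z₀ f} with hA
  have hAne : A.Nonempty := ⟨_, _, hf₀, rfl⟩
  have hAb : BddAbove A := by
    obtain ⟨s, hs, hsU⟩ := Metric.isOpen_iff.1 hU z₀ hz₀
    refine ⟨1 / (s / 2), ?_⟩
    rintro _ ⟨f, hf, rfl⟩
    have hsub : closedBall z₀ (s / 2) ⊆ U :=
      (closedBall_subset_ball (by linarith)).trans hsU
    exact Complex.norm_deriv_le_of_forall_mem_sphere_norm_le (by positivity)
      ((hf.diff.mono hsub).diffContOnCl_ball subset_rfl)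
      (fun w hw ↦ (mem_ball_zero_iff.1 (hf.maps (hsub (sphere_subset_closedBall hw)))).le)
  obtain ⟨u, -, hulim, huA⟩ := exists_seq_tendsto_sSup hAne hAb
  choose F hF hFu using huA
  -- Along an ultrafilter every sequence in a compact set converges, so the limit exists at all
  -- points at once and no subsequences have to be extracted.
  set l : Filter ℕ := (hyperfilter ℕ : Filter ℕ)
  have hl : l ≤ atTop := by
    rw [← Nat.cofinite_eq_atTop]; exact hyperfilter_le_cofinite
  have hFb : ∀ n, ∀ z ∈ U, ‖F n z‖ ≤ 1 := fun n z hz ↦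
    (mem_ball_zero_iff.1 ((hF n).maps hz)).le
  have hex : ∀ z, ∃ w, z ∈ U → Tendsto (fun n ↦ F n z) l (𝓝 w) := by
    intro z
    by_cases hz : z ∈ U
    · obtain ⟨w, -, hw⟩ := (isCompact_closedBall (0 : ℂ) 1).ultrafilter_le_nhds
        ((hyperfilter ℕ).map (fun n ↦ F n z)) (by
          rw [le_principal_iff, Ultrafilter.mem_coe, Ultrafilter.mem_map]
          exact univ_mem' fun n ↦ mem_closedBall_zero_iff.2 (hFb n z hz))
      exact ⟨w, fun _ ↦ hw⟩
    · exact ⟨0, fun h ↦ absurd h hz⟩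
  choose f hf using hex
  have hlu := tendstoLocallyUniformlyOn_of_forall_tendsto_of_norm_le_one hU
    (fun n ↦ (hF n).diff) hFb hf
  have hfd : DifferentiableOn ℂ f U :=
    hlu.differentiableOn (Eventually.of_forall fun n ↦ (hF n).diff) hU
  have hlu' := hlu.deriv (Eventually.of_forall fun n ↦ (hF n).diff) hU
  have hdz : ‖deriv f z₀‖ = sSup A := by
    refine tendsto_nhds_unique ((hlu'.tendsto_at hz₀).norm) ?_
    simp only [Function.comp, hFu]
    exact hulim.mono_left hl
  have hpos : 0 < ‖deriv f z₀‖ := by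
    rw [hdz]
    exact lt_of_lt_of_le (norm_pos_iff.2 (hf₀.deriv_ne z₀ hz₀)) (le_csSup hAb ⟨_, hf₀, rfl⟩)
  -- The derivative of the limit at `z₀` is the supremum, which is positive. By the identity theorem
  -- the limit is nowhere locally constant, as Hurwitz's theorem requires.
  have hnc : ∀ a ∈ U, ∀ w, ¬ ∀ᶠ z in 𝓝 a, f z = w := by
    intro a ha w hw
    have := (hfd.analyticOnNhd hU).eqOn_of_preconnected_of_eventuallyEq analyticOnNhd_const hpre ha
      (g := fun _ ↦ w) hw
    have h2 : f =ᶠ[𝓝 z₀] fun _ ↦ w := this.eventuallyEq_of_mem (hU.mem_nhds hz₀)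
    rw [h2.deriv_eq] at hpos
    simp at hpos
  have hfinj : InjOn f U := by
    intro a ha b hb hab
    by_contra hne
    have hlim2 : TendstoLocallyUniformlyOn (fun n z ↦ F n z - F n b) (fun z ↦ f z - f b) l U := by
      rw [tendstoLocallyUniformlyOn_iff_forall_isCompact hU] at hlu ⊢
      intro K hK hKc
      have h1 := hlu K hK hKc
      have h2 := hf b hb
      rw [Metric.tendstoUniformlyOn_iff] at h1 ⊢
      intro ε hε
      filter_upwards [h1 (ε / 2) (by positivity), Metric.tendsto_nhds.1 h2 (ε / 2) (by positivity)]
        with n h3 h4 z hz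
      have h5 := h3 z hz
      rw [dist_eq_norm] at h4 h5 ⊢
      calc ‖f z - f b - (F n z - F n b)‖ = ‖(f z - F n z) + (F n b - f b)‖ := by congr 1; ring
        _ ≤ _ := norm_add_le _ _
        _ < ε := by linarith
    have := eventually_exists_eq_zero_of_tendstoLocallyUniformlyOn hU
      (fun n ↦ (hF n).diff.sub_const _) (hfd.sub_const _) hlim2 ha (by simp [hab])
      (fun h ↦ hnc a ha (f b) (h.mono fun z hz ↦ sub_eq_zero.1 hz))
      (inter_mem (hU.mem_nhds ha) (isOpen_ne.mem_nhds hne))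
    obtain ⟨n, z, ⟨hzU, hzb⟩, hz⟩ := this.exists
    exact hzb ((hF n).inj hzU hb (sub_eq_zero.1 hz))
  have hfder : ∀ z ∈ U, deriv f z ≠ 0 := by
    intro a ha h0
    have := eventually_exists_eq_zero_of_tendstoLocallyUniformlyOn hU
      (fun n ↦ (hF n).diff.deriv hU) (hfd.deriv hU) hlu' ha h0 (fun h ↦ ?_) (hU.mem_nhds ha)
    · obtain ⟨n, z, hzU, hz⟩ := this.exists
      exact (hF n).deriv_ne z hzU hz
    · have h1 : EqOn (deriv f) 0 U :=
        ((hfd.deriv hU).analyticOnNhd hU).eqOn_of_preconnected_of_eventuallyEq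
          analyticOnNhd_const hpre ha (g := fun _ ↦ 0) h
      rw [h1 hz₀] at hpos
      simp at hpos
  have hfle : ∀ z ∈ U, ‖f z‖ ≤ 1 := fun z hz ↦
    le_of_tendsto (hf z hz).norm (Eventually.of_forall fun n ↦ hFb n z hz)
  have hfopen : IsOpen (f '' U) := by
    rcases (hfd.analyticOnNhd hU).is_constant_or_isOpen hpre with ⟨w, hw⟩ | h
    · exact absurd (eventually_of_mem (hU.mem_nhds hz₀) hw) (hnc z₀ hz₀ w)
    · exact h U subset_rfl hU
  -- The limit only satisfies `‖f z‖ ≤ 1`; openness of the image excludes equality.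
  have hfmaps : MapsTo f U (ball 0 1) := by
    intro z hz
    have : f '' U ⊆ interior (closedBall 0 1) := by
      refine hfopen.subset_interior_iff.2 ?_
      rintro _ ⟨w, hw, rfl⟩
      exact mem_closedBall_zero_iff.2 (hfle w hw)
    rw [interior_closedBall _ one_ne_zero] at this
    exact this ⟨z, hz, rfl⟩
  have hf0 : f z₀ = 0 := tendsto_nhds_unique (hf z₀ hz₀) (by simp [(hF _).zero])
  have hfS : IsSchlicht U z₀ f := ⟨hfd, hfinj, hfmaps, hf0, hfder⟩
  refine ⟨f, hfS, hfmaps.image_subset.antisymm fun c hc ↦ ?_⟩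
  by_contra hcf
  obtain ⟨G, hG, hlt⟩ := hfS.exists_norm_deriv_lt hU hUc hz₀ (mem_ball_zero_iff.1 hc) hcf
  rw [hdz] at hlt
  exact absurd (le_csSup hAb ⟨G, hG, rfl⟩) (not_le.2 hlt)

/-! ### Embedded balls with relatively open interior. -/

/-- `χ` parametrizes a closed ball of radius `ρ` in `S` whose interior is relatively open in `S`. -/
structure IsDisk {E Y : Type*} [NormedAddCommGroup E] [TopologicalSpace Y] (S : Set Y) (χ : E → Y)
    (ρ : ℝ) : Prop where
  cont : ContinuousOn χ (closedBall 0 ρ)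
  inj : InjOn χ (closedBall 0 ρ)
  maps : MapsTo χ (closedBall 0 ρ) S
  isOpen : ∃ O, IsOpen O ∧ χ '' ball 0 ρ = O ∩ S

theorem continuousOn_invFunOn_of_isCompact {X Y : Type*} [TopologicalSpace X] [TopologicalSpace Y]
    [T2Space Y] [Nonempty X] {f : X → Y} {K : Set X} (hK : IsCompact K) (hf : ContinuousOn f K)
    (hi : InjOn f K) : ContinuousOn (Function.invFunOn f K) (f '' K) := by
  rw [continuousOn_iff_isClosed]
  intro t ht
  refine ⟨f '' (K ∩ t), ((hK.inter_right ht).image_of_continuousOn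
    (hf.mono inter_subset_left)).isClosed, ?_⟩
  ext y
  constructor
  · rintro ⟨hy, x, hx, rfl⟩
    rw [mem_preimage, hi.leftInvOn_invFunOn hx] at hy
    exact ⟨⟨x, ⟨hx, hy⟩, rfl⟩, x, hx, rfl⟩
  · rintro ⟨⟨x, hx, rfl⟩, -⟩
    refine ⟨?_, x, hx.1, rfl⟩
    rw [mem_preimage, hi.leftInvOn_invFunOn hx.1]
    exact hx.2

namespace IsDisk

variable {E Y : Type*} [NormedAddCommGroup E] [TopologicalSpace Y] {S : Set Y}
  {χ : E → Y} {ρ : ℝ}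

/-- The inverse of a disk parametrization. -/
noncomputable def inv (_ : IsDisk S χ ρ) : Y → E := Function.invFunOn χ (closedBall 0 ρ)

theorem inv_apply (h : IsDisk S χ ρ) {z : E} (hz : z ∈ closedBall 0 ρ) : h.inv (χ z) = z :=
  h.inj.leftInvOn_invFunOn hz

theorem inv_mem (h : IsDisk S χ ρ) {y : Y} (hy : y ∈ χ '' closedBall 0 ρ) :
    h.inv y ∈ closedBall 0 ρ := by
  obtain ⟨z, hz, rfl⟩ := hy
  rwa [h.inv_apply hz]

theorem apply_inv (h : IsDisk S χ ρ) {y : Y} (hy : y ∈ χ '' closedBall 0 ρ) : χ (h.inv y) = y := by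
  obtain ⟨z, hz, rfl⟩ := hy
  rw [h.inv_apply hz]

theorem continuousOn_inv [ProperSpace E] [T2Space Y] (h : IsDisk S χ ρ) :
    ContinuousOn h.inv (χ '' closedBall 0 ρ) :=
  continuousOn_invFunOn_of_isCompact (isCompact_closedBall 0 ρ) h.cont h.inj

theorem isOpen_image [ProperSpace E] [T2Space Y] (h : IsDisk S χ ρ) {V : Set E} (hV : IsOpen V)
    (hVb : V ⊆ ball 0 ρ) : ∃ O, IsOpen O ∧ χ '' V = O ∩ S := by
  obtain ⟨O₁, hO₁, h1⟩ := h.isOpen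
  obtain ⟨O₂, hO₂, h2⟩ := continuousOn_iff'.1 h.continuousOn_inv V hV
  refine ⟨O₁ ∩ O₂, hO₁.inter hO₂, ?_⟩
  ext y
  constructor
  · rintro ⟨z, hz, rfl⟩
    have hzc := ball_subset_closedBall (hVb hz)
    have : χ z ∈ O₂ ∩ χ '' closedBall 0 ρ := by
      rw [← h2]; exact ⟨by rw [mem_preimage, h.inv_apply hzc]; exact hz, z, hzc, rfl⟩
    exact ⟨⟨(h1.subset ⟨z, hVb hz, rfl⟩).1, this.1⟩, h.maps hzc⟩
  · rintro ⟨⟨hy1, hy2⟩, hyS⟩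
    obtain ⟨z, hz, rfl⟩ := h1.symm.subset ⟨hy1, hyS⟩
    have hzc := ball_subset_closedBall hz
    have := (h2.symm.subset ⟨hy2, z, hzc, rfl⟩).1
    rw [mem_preimage, h.inv_apply hzc] at this
    exact ⟨z, this, rfl⟩

theorem mono [ProperSpace E] [T2Space Y] (h : IsDisk S χ ρ) {r : ℝ} (hr : r ≤ ρ) :
    IsDisk S χ r :=
  have hs := closedBall_subset_closedBall (x := (0 : E)) hr
  ⟨h.cont.mono hs, h.inj.mono hs, h.maps.mono_left hs,
    h.isOpen_image isOpen_ball (ball_subset_ball hr)⟩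

end IsDisk

/-! ### The length-area principle. -/

section LengthArea

open MeasureTheory

/-- The real Jacobian of a holomorphic map is `‖deriv f w‖ ^ 2`, so the integral is the area of the
bounded image. -/
theorem lintegral_sq_norm_deriv_lt_top {U : Set ℂ} (hU : IsOpen U) {f : ℂ → ℂ}
    (hd : DifferentiableOn ℂ f U) (hi : InjOn f U) (hb : Bornology.IsBounded (f '' U)) :
    ∫⁻ w, U.indicator (fun w ↦ ENNReal.ofReal (‖deriv f w‖ ^ 2)) w < ⊤ := by
  have h := lintegral_image_eq_lintegral_abs_det_fderiv_mul volume hU.measurableSet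
    (f := f) (f' := fun w ↦ deriv f w • (1 : ℂ →L[ℝ] ℂ)) (fun w hw ↦
      ((hd.differentiableAt (hU.mem_nhds hw)).hasDerivAt.complexToReal_fderiv).hasFDerivWithinAt)
      hi (fun _ ↦ 1)
  rw [lintegral_indicator hU.measurableSet]
  have hdet : ∀ c : ℂ, |(c • (1 : ℂ →L[ℝ] ℂ)).det| = ‖c‖ ^ 2 := by
    intro c
    have h1 : (c • (1 : ℂ →L[ℝ] ℂ)).det =
        LinearMap.det ((LinearMap.mulLeft ℂ c).restrictScalars ℝ) := by
      rw [ContinuousLinearMap.det]; congr 1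
    rw [h1, LinearMap.det_restrictScalars, Algebra.norm_complex_apply]
    have : LinearMap.det (LinearMap.mulLeft ℂ c) = c := by
      simp
    rw [this, abs_of_nonneg (Complex.normSq_nonneg _), Complex.sq_norm]
  simp only [mul_one, hdet, setLIntegral_one] at h
  rw [← h]
  exact hb.measure_lt_top

/-- In polar coordinates the finite integral is that of `r` times the angular integral. If the
latter were at least `η / r ^ 2` for all `r < r₀`, then `η / r` would be integrable at `0`. -/
theorem exists_radius_lintegral_lt {G : ℂ → ENNReal} (hG : Measurable G)
    (hfin : ∫⁻ w, G w < ⊤) (p : ℂ) {η r₀ : ℝ} (hη : 0 < η) (hr₀ : 0 < r₀) :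
    ∃ ρ, 0 < ρ ∧ ρ < r₀ ∧ ENNReal.ofReal (ρ ^ 2) *
      ∫⁻ θ in Ioo (-Real.pi) Real.pi, G (p + Complex.polarCoord.symm (ρ, θ)) <
        ENNReal.ofReal η := by
  by_contra! hcon
  have hmeas : Measurable fun q : ℝ × ℝ ↦ Complex.polarCoord.symm q := by
    simp only [Complex.polarCoord_symm_apply]
    fun_prop
  have h1 : ∫⁻ q in Ioi (0 : ℝ) ×ˢ Ioo (-Real.pi) Real.pi,
      ENNReal.ofReal q.1 * G (p + Complex.polarCoord.symm q) < ⊤ := by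
    have := Complex.lintegral_comp_polarCoord_symm (fun w ↦ G (p + w))
    rw [lintegral_add_left_eq_self, polarCoord_target] at this
    simp only [smul_eq_mul] at this
    rwa [this]
  have hm2 : Measurable fun q : ℝ × ℝ ↦ G (p + Complex.polarCoord.symm q) :=
    hG.comp (hmeas.const_add p)
  rw [Measure.volume_eq_prod, setLIntegral_prod _ (by
    exact ((ENNReal.measurable_ofReal.comp measurable_fst).mul hm2).aemeasurable)] at h1
  have h2 : ∫⁻ r in Ioo 0 r₀, ENNReal.ofReal (η * r⁻¹) < ⊤ := by
    refine lt_of_le_of_lt ?_ h1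
    refine LE.le.trans ?_ (lintegral_mono_set (s := Ioo 0 r₀) Ioo_subset_Ioi_self)
    · refine setLIntegral_mono' measurableSet_Ioo fun r hr ↦ ?_
      have hm3 : Measurable fun θ : ℝ ↦ G (p + Complex.polarCoord.symm (r, θ)) :=
        hm2.comp (measurable_const.prodMk measurable_id)
      change _ ≤ ∫⁻ y in Ioo (-Real.pi) Real.pi,
        ENNReal.ofReal r * G (p + Complex.polarCoord.symm (r, y))
      rw [lintegral_const_mul _ hm3]
      have := hcon r hr.1 hr.2
      rw [pow_two, ENNReal.ofReal_mul hr.1.le, mul_assoc] at this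
      rw [ENNReal.ofReal_mul hη.le, ENNReal.ofReal_inv_of_pos hr.1, ← div_eq_mul_inv]
      exact ENNReal.div_le_of_le_mul' this
  have h3 : IntegrableOn (fun r : ℝ ↦ η * r⁻¹) (Ioo 0 r₀) := by
    refine ⟨(measurable_inv.const_mul η).aestronglyMeasurable, ?_⟩
    rw [hasFiniteIntegral_iff_enorm]
    refine lt_of_le_of_lt (setLIntegral_mono' measurableSet_Ioo fun r hr ↦ ?_) h2
    rw [Real.enorm_eq_ofReal (mul_nonneg hη.le (inv_nonneg.2 hr.1.le))]
  have h4 : IntegrableOn (fun r : ℝ ↦ r⁻¹) (Ioo 0 r₀) := by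
    have := h3.const_mul η⁻¹
    simpa [← mul_assoc, hη.ne', IntegrableOn] using this
  have h5 : IntervalIntegrable (fun r : ℝ ↦ r⁻¹) volume 0 r₀ := by
    rw [intervalIntegrable_iff_integrableOn_Ioo_of_le hr₀.le]; exact h4
  rw [intervalIntegrable_inv_iff] at h5
  rcases h5 with h5 | h5
  · exact hr₀.ne h5
  · exact h5 (by simp)

/-- The measure of the projected image is at most the length of the image arcs, the integral of `A =
ρ * ‖deriv f‖` over the angle. The area bound controls the integral of `A ^ 2`, and the two are
compared by `A ≤ s / 2 + A ^ 2 / (2 * s)`. -/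
theorem volume_image_circle_le {U : Set ℂ} (hU : IsOpen U) {f : ℂ → ℂ}
    (hd : DifferentiableOn ℂ f U) (p : ℂ) {ρ ε : ℝ} (hρ : 0 < ρ) (hε : 0 < ε)
    (hle : ENNReal.ofReal (ρ ^ 2) * ∫⁻ θ in Ioo (-Real.pi) Real.pi,
      U.indicator (fun w ↦ ENNReal.ofReal (‖deriv f w‖ ^ 2)) (p + Complex.polarCoord.symm (ρ, θ)) <
        ENNReal.ofReal (ε ^ 2 / (2 * Real.pi))) (ℓ : ℂ →L[ℝ] ℝ) (hℓ : ‖ℓ‖ ≤ 1) :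
    volume ((fun w ↦ ℓ (f w)) '' {w | w ∈ U ∧ dist w p = ρ}) ≤ ENNReal.ofReal ε := by
  set c : ℝ → ℂ := fun θ ↦ p + Complex.polarCoord.symm (ρ, θ) with hc
  have hcd : ∀ θ, HasDerivAt c (ρ * (-Real.sin θ + Real.cos θ * Complex.I)) θ := by
    intro θ
    have h1 : HasDerivAt (fun θ : ℝ ↦ ((Real.cos θ : ℝ) : ℂ)) (-Real.sin θ : ℝ) θ :=
      (Real.hasDerivAt_cos θ).ofReal_comp
    have h2 : HasDerivAt (fun θ : ℝ ↦ ((Real.sin θ : ℝ) : ℂ)) (Real.cos θ : ℝ) θ :=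
      (Real.hasDerivAt_sin θ).ofReal_comp
    have := ((h1.add (h2.mul_const Complex.I)).const_mul (ρ : ℂ)).const_add p
    refine HasDerivAt.congr_of_eventuallyEq (this.congr_deriv (by push_cast; ring)) ?_
    refine Eventually.of_forall fun θ ↦ ?_
    simp [hc, Complex.polarCoord_symm_apply]
  have hcn : ∀ θ : ℝ, ‖(ρ * (-Real.sin θ + Real.cos θ * Complex.I) : ℂ)‖ = ρ := by
    intro θ
    have : (-Real.sin θ + Real.cos θ * Complex.I : ℂ) =
        Complex.I * (Real.cos θ + Real.sin θ * Complex.I) := by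
      linear_combination -(Real.sin θ : ℂ) * Complex.I_mul_I
    rw [this, Complex.ofReal_cos, Complex.ofReal_sin, ← Complex.exp_mul_I, norm_mul, norm_mul,
      Complex.norm_exp_ofReal_mul_I, Complex.norm_I, Complex.norm_real, Real.norm_of_nonneg hρ.le]
    ring
  have hcc : Continuous c := continuous_iff_continuousAt.2 fun θ ↦ (hcd θ).continuousAt
  set E : Set ℝ := Ioo (-Real.pi) Real.pi ∩ c ⁻¹' U with hE
  have hEm : MeasurableSet E := measurableSet_Ioo.inter (hU.preimage hcc).measurableSet
  have hsub : (fun w ↦ ℓ (f w)) '' {w | w ∈ U ∧ dist w p = ρ} ⊆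
      (fun θ ↦ ℓ (f (c θ))) '' E ∪ {ℓ (f (p - ρ))} := by
    rintro _ ⟨w, ⟨hwU, hw⟩, rfl⟩
    have hwp : w = p + ρ * Complex.exp (Complex.arg (w - p) * Complex.I) := by
      rw [dist_eq_norm] at hw
      rw [← hw, Complex.norm_mul_exp_arg_mul_I]; ring
    -- The open interval of angles misses argument `π`, which contributes only the point `p - ρ`.
    rcases (Complex.arg_le_pi (w - p)).eq_or_lt with hπ | hπ
    · right
      rw [hπ, Complex.exp_pi_mul_I] at hwp
      have : w = p - ρ := by rw [hwp]; ring
      simp [this]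
    · left
      have hcw : c (Complex.arg (w - p)) = w := by
        conv_rhs => rw [hwp, Complex.exp_mul_I]
        simp [hc, Complex.polarCoord_symm_apply]
      exact ⟨_, ⟨⟨Complex.neg_pi_lt_arg _, hπ⟩, by rw [mem_preimage, hcw]; exact hwU⟩,
        by simp only [hcw]⟩
  refine (measure_mono hsub).trans ((measure_union_le _ _).trans ?_)
  rw [measure_singleton, add_zero]
  have hder : ∀ θ ∈ E, HasFDerivWithinAt (fun θ ↦ ℓ (f (c θ)))
      (ContinuousLinearMap.toSpanSingleton ℝ (ℓ (deriv f (c θ) *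
        (ρ * (-Real.sin θ + Real.cos θ * Complex.I))))) E θ := by
    intro θ hθ
    have h1 := (hd.differentiableAt (hU.mem_nhds hθ.2)).hasDerivAt.scomp θ (hcd θ)
    have h2 := (ℓ.hasFDerivAt (x := f (c θ))).comp_hasDerivAt θ h1
    refine (h2.hasFDerivAt.hasFDerivWithinAt).congr_fderiv ?_
    ext
    simp [mul_comm]
  refine (addHaar_image_le_lintegral_abs_det_fderiv volume hEm hder).trans ?_
  -- With this `s` each of the two terms of the pointwise estimate integrates to at most `ε / 2`.
  set s : ℝ := ε / (2 * Real.pi) with hs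
  have hpi := Real.pi_pos
  have hs0 : 0 < s := by positivity
  have hdm : Measurable fun θ ↦ U.indicator (fun w ↦ ENNReal.ofReal (‖deriv f w‖ ^ 2)) (c θ) := by
    refine Measurable.comp (g := U.indicator _) ?_ hcc.measurable
    exact (ENNReal.measurable_ofReal.comp ((measurable_deriv f).norm.pow_const 2)).indicator
      hU.measurableSet
  have hpt : ∀ θ ∈ E, ENNReal.ofReal |(ContinuousLinearMap.toSpanSingleton ℝ (ℓ (deriv f (c θ) *
        (ρ * (-Real.sin θ + Real.cos θ * Complex.I))))).det| ≤ ENNReal.ofReal (s / 2) +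
        ENNReal.ofReal (1 / (2 * s)) * (ENNReal.ofReal (ρ ^ 2) *
          U.indicator (fun w ↦ ENNReal.ofReal (‖deriv f w‖ ^ 2)) (c θ)) := by
    intro θ hθ
    rw [indicator_of_mem (show c θ ∈ U from hθ.2), ← ENNReal.ofReal_mul (by positivity),
      ← ENNReal.ofReal_mul (by positivity), ← ENNReal.ofReal_add (by positivity) (by positivity)]
    refine ENNReal.ofReal_le_ofReal ?_
    have hdet : (ContinuousLinearMap.toSpanSingleton ℝ (ℓ (deriv f (c θ) *
        (ρ * (-Real.sin θ + Real.cos θ * Complex.I))))).det = ℓ (deriv f (c θ) *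
        (ρ * (-Real.sin θ + Real.cos θ * Complex.I))) := by
      simp
    rw [hdet]
    have h1 : |ℓ (deriv f (c θ) * (ρ * (-Real.sin θ + Real.cos θ * Complex.I)))| ≤
        ‖deriv f (c θ)‖ * ρ := by
      refine (ℓ.le_of_opNorm_le hℓ _).trans ?_
      rw [one_mul, norm_mul, hcn]
    refine h1.trans ?_
    set A := ‖deriv f (c θ)‖ * ρ
    have h2 : s / 2 + 1 / (2 * s) * (ρ ^ 2 * ‖deriv f (c θ)‖ ^ 2) - A = (A - s) ^ 2 / (2 * s) := by
      simp only [A]; field_simp; ring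
    have : 0 ≤ (A - s) ^ 2 / (2 * s) := by positivity
    linarith
  refine (setLIntegral_mono' hEm hpt).trans ((lintegral_mono_set inter_subset_left).trans ?_)
  rw [lintegral_add_left measurable_const, lintegral_const_mul _ (hdm.const_mul _),
    lintegral_const_mul _ hdm, setLIntegral_const, Real.volume_Ioo]
  have h6 : ENNReal.ofReal (1 / (2 * s)) * (ENNReal.ofReal (ρ ^ 2) *
      ∫⁻ θ in Ioo (-Real.pi) Real.pi,
        U.indicator (fun w ↦ ENNReal.ofReal (‖deriv f w‖ ^ 2)) (c θ)) ≤
      ENNReal.ofReal (1 / (2 * s)) * ENNReal.ofReal (ε ^ 2 / (2 * Real.pi)) := by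
    gcongr
  refine (add_le_add_right h6 _).trans ?_
  rw [← ENNReal.ofReal_mul (by positivity), ← ENNReal.ofReal_mul (by positivity),
    ← ENNReal.ofReal_add (mul_nonneg (by positivity) (by linarith)) (by positivity)]
  refine ENNReal.ofReal_le_ofReal (le_of_eq ?_)
  rw [hs]; field_simp; ring

/-- The length-area principle: arbitrarily small circles have images with small projections. -/
theorem exists_radius_volume_image_le {U : Set ℂ} (hU : IsOpen U) {f : ℂ → ℂ}
    (hd : DifferentiableOn ℂ f U) (hi : InjOn f U) (hb : Bornology.IsBounded (f '' U))
    (p : ℂ) {ε r₀ : ℝ} (hε : 0 < ε) (hr₀ : 0 < r₀) :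
    ∃ ρ, 0 < ρ ∧ ρ < r₀ ∧
      volume ((fun w ↦ (f w).re) '' {w | w ∈ U ∧ dist w p = ρ}) ≤ ENNReal.ofReal ε ∧
      volume ((fun w ↦ (f w).im) '' {w | w ∈ U ∧ dist w p = ρ}) ≤ ENNReal.ofReal ε := by
  have hpi := Real.pi_pos
  obtain ⟨ρ, h1, h2, h3⟩ := exists_radius_lintegral_lt
    ((ENNReal.measurable_ofReal.comp ((measurable_deriv f).norm.pow_const 2)).indicator
      hU.measurableSet) (lintegral_sq_norm_deriv_lt_top hU hd hi hb) p
    (η := ε ^ 2 / (2 * Real.pi)) (by positivity) hr₀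
  refine ⟨ρ, h1, h2, volume_image_circle_le hU hd p h1 hε h3 Complex.reCLM ?_,
    volume_image_circle_le hU hd p h1 hε h3 Complex.imCLM ?_⟩ <;> simp

theorem exists_mem_Ioo_notMem_of_volume_le {a b ε : ℝ} (hε : 0 < ε) (hab : ε < b - a) {s : Set ℝ}
    (hs : volume s ≤ ENNReal.ofReal ε) : ∃ x ∈ Ioo a b, x ∉ s := by
  by_contra! h
  have := (measure_mono h).trans hs
  rw [Real.volume_Ioo, ENNReal.ofReal_le_ofReal_iff hε.le] at this
  linarith

end LengthArea

/-! ### Boundary behaviour of the Riemann map: Carathéodory's theorem. -/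

theorem IsSchlicht.isOpen_image {U : Set ℂ} {z₀ : ℂ} {f : ℂ → ℂ} (hf : IsSchlicht U z₀ f)
    (hU : IsOpen U) {V : Set ℂ} (hV : IsOpen V) (hVU : V ⊆ U) : IsOpen (f '' V) := by
  rw [isOpen_iff_mem_nhds]
  rintro _ ⟨z, hz, rfl⟩
  have h1 : HasStrictDerivAt f (deriv f z) z :=
    ((hf.diff.analyticOnNhd hU) z (hVU hz)).hasStrictDerivAt
  rw [← h1.map_nhds_eq (hf.deriv_ne z (hVU hz))]
  exact image_mem_map (hV.mem_nhds hz)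

theorem IsSchlicht.exists_inverse {U : Set ℂ} {z₀ : ℂ} {f : ℂ → ℂ} (hf : IsSchlicht U z₀ f)
    (hU : IsOpen U) (him : f '' U = ball 0 1) : ∃ γ : ℂ → ℂ, DifferentiableOn ℂ γ (ball 0 1) ∧
      (∀ z ∈ U, γ (f z) = z) ∧ (∀ w ∈ ball (0 : ℂ) 1, γ w ∈ U ∧ f (γ w) = w) := by
  have hl : ∀ z ∈ U, Function.invFunOn f U (f z) = z := fun z hz ↦ hf.inj.leftInvOn_invFunOn hz
  have hr : ∀ w ∈ ball (0 : ℂ) 1, Function.invFunOn f U w ∈ U ∧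
      f (Function.invFunOn f U w) = w := by
    intro w hw
    rw [← him] at hw
    exact ⟨Function.invFunOn_mem hw, Function.invFunOn_eq hw⟩
  refine ⟨Function.invFunOn f U, fun w hw ↦ ?_, hl, hr⟩
  refine DifferentiableAt.differentiableWithinAt (HasDerivAt.differentiableAt
    (f' := (deriv f (Function.invFunOn f U w))⁻¹) (HasDerivAt.of_local_left_inverse ?_
      ((hf.diff.differentiableAt (hU.mem_nhds (hr w hw).1)).hasDerivAt)
      (hf.deriv_ne _ (hr w hw).1) ?_))
  · intro V hV
    obtain ⟨O, hOV, hO, hwO⟩ := _root_.mem_nhds_iff.1 hV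
    refine mem_map.2 (mem_of_superset ((hf.isOpen_image hU (hO.inter hU) inter_subset_right).mem_nhds
      ⟨_, ⟨hwO, (hr w hw).1⟩, (hr w hw).2⟩) ?_)
    rintro _ ⟨z, ⟨hz, hzU⟩, rfl⟩
    rw [mem_preimage, hl z hzU]; exact hOV hz
  · filter_upwards [isOpen_ball.mem_nhds hw] with y hy using (hr y hy).2

/-- The crosscut is an arc: its points `η * (1 - ρ * exp (φ * I))` are those with `cos φ > ρ / 2`,
and these angles form an interval because the cosine is concave on `[-π/2, π/2]`. -/
theorem isPreconnected_ball_inter_sphere {η : ℂ} (hη : ‖η‖ = 1) {ρ : ℝ} (h0 : 0 < ρ) :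
    IsPreconnected {w : ℂ | w ∈ ball (0 : ℂ) 1 ∧ dist w η = ρ} := by
  have hpi := Real.pi_pos
  have hconv : Convex ℝ {φ ∈ Icc (-(Real.pi / 2)) (Real.pi / 2) | ρ / 2 < Real.cos φ} :=
    strictConcaveOn_cos_Icc.concaveOn.convex_gt _
  have hη0 : η ≠ 0 := by rintro rfl; simp at hη
  have key : ∀ φ : ℝ, ‖η * (1 - ρ * Complex.exp (φ * Complex.I))‖ < 1 ↔
      ρ / 2 < Real.cos φ := by
    intro φ
    rw [norm_mul, hη, one_mul, ← sq_lt_one_iff₀ (norm_nonneg _), Complex.sq_norm,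
      Complex.normSq_apply]
    simp only [Complex.sub_re, Complex.one_re, Complex.sub_im, Complex.one_im,
      Complex.re_ofReal_mul, Complex.im_ofReal_mul, Complex.exp_ofReal_mul_I_re,
      Complex.exp_ofReal_mul_I_im]
    have := Real.sin_sq_add_cos_sq φ
    have h2 : (1 - ρ * Real.cos φ) * (1 - ρ * Real.cos φ) + (0 - ρ * Real.sin φ) *
        (0 - ρ * Real.sin φ) = 1 + ρ * (ρ - 2 * Real.cos φ) := by
      linear_combination ρ ^ 2 * this
    rw [h2]
    constructor
    · intro h; by_contra! hc; nlinarith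
    · intro h; nlinarith
  have : {w : ℂ | w ∈ ball (0 : ℂ) 1 ∧ dist w η = ρ} =
      (fun φ : ℝ ↦ η * (1 - ρ * Complex.exp (φ * Complex.I))) ''
        {φ ∈ Icc (-(Real.pi / 2)) (Real.pi / 2) | ρ / 2 < Real.cos φ} := by
    ext w
    constructor
    · rintro ⟨hw, hd⟩
      rw [mem_ball_zero_iff] at hw
      have e1 : ‖1 - w / η‖ = ρ := by
        rw [← hd, dist_eq_norm, ← norm_neg (w - η)]
        have : -(w - η) = η * (1 - w / η) := by field_simp; ring
        rw [this, norm_mul, hη, one_mul]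
      have e2 : η * (1 - ρ * Complex.exp (Complex.arg (1 - w / η) * Complex.I)) = w := by
        rw [← e1, Complex.norm_mul_exp_arg_mul_I]; field_simp; ring
      have e3 : |Complex.arg (1 - w / η)| < Real.pi / 2 := by
        rw [Complex.abs_arg_lt_pi_div_two_iff]
        left
        have : (w / η).re ≤ ‖w / η‖ := Complex.re_le_norm _
        rw [norm_div, hη, div_one] at this
        simp only [Complex.sub_re, Complex.one_re]; linarith
      refine ⟨_, ⟨⟨(abs_lt.1 e3).1.le, (abs_lt.1 e3).2.le⟩, ?_⟩, e2⟩
      rw [← key, e2]; exact hw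
    · rintro ⟨φ, ⟨-, hφ⟩, rfl⟩
      refine ⟨mem_ball_zero_iff.2 ((key φ).2 hφ), ?_⟩
      rw [dist_eq_norm]
      have : η * (1 - ρ * Complex.exp (φ * Complex.I)) - η =
        -(η * (ρ * Complex.exp (φ * Complex.I))) := by ring
      simp only [this, norm_neg, norm_mul, hη, one_mul, Complex.norm_exp_ofReal_mul_I, mul_one,
        Complex.norm_real, Real.norm_of_nonneg h0.le]
  rw [this]
  refine hconv.isPreconnected.image _ (Continuous.continuousOn ?_)
  fun_prop

theorem abs_sub_le_of_volume_le {s : Set ℝ} (hs : IsPreconnected s) {ε : ℝ} (hε : 0 < ε)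
    (hv : MeasureTheory.volume s ≤ ENNReal.ofReal ε) {x y : ℝ} (hx : x ∈ s) (hy : y ∈ s) :
    |x - y| ≤ ε := by
  wlog h : y ≤ x generalizing x y
  · rw [abs_sub_comm]; exact this hy hx (not_le.1 h).le
  rw [abs_of_nonneg (sub_nonneg.2 h)]
  by_contra! hc
  obtain ⟨t, ht, hts⟩ := exists_mem_Ioo_notMem_of_volume_le hε hc hv
  exact hts (hs.ordConnected.out hy hx (Ioo_subset_Icc_self ht))

theorem IsDisk.isOpen_image_univ {E : Type*} [NormedAddCommGroup E] [ProperSpace E] {Y : Type*}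
    [TopologicalSpace Y] [T2Space Y] {χ : E → Y} {ρ : ℝ} (h : IsDisk univ χ ρ) {V : Set E}
    (hV : IsOpen V) (hVb : V ⊆ ball 0 ρ) : IsOpen (χ '' V) := by
  obtain ⟨O, hO, h1⟩ := h.isOpen_image hV hVb
  rwa [h1, inter_univ]

/-- By the length-area principle the image under `f` of a small circle about `τ ζ` has small
projections to both axes. If the real part of `f ∘ τ` varied by more than `ε` near `ζ`, some
vertical chord of the unit disk would miss this image and contain a value taken inside the circle.
Some horizontal chord close to `0` also misses it and contains a value taken outside. Each chord is
connected, so it stays on its side, although the two chords cross. -/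
theorem abs_re_sub_le_of_isDisk {τ f : ℂ → ℂ} (hτ : IsDisk univ τ 1)
    (hf : IsSchlicht (τ '' ball 0 1) (τ 0) f) (him : f '' (τ '' ball 0 1) = ball 0 1)
    {ζ : ℂ} (hζ : ‖ζ‖ = 1) {ε : ℝ} (hε : 0 < ε) :
    ∃ δ > 0, ∀ z ∈ ball (0 : ℂ) 1 ∩ ball ζ δ, ∀ z' ∈ ball (0 : ℂ) 1 ∩ ball ζ δ,
      (f (τ z)).re - (f (τ z')).re ≤ ε := by
  have hU : IsOpen (τ '' ball 0 1) := hτ.isOpen_image_univ isOpen_ball subset_rfl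
  have hb2 : ball (0 : ℂ) (1 / 2) ⊆ ball 0 1 := ball_subset_ball (by norm_num)
  have hcb2 : closedBall (0 : ℂ) (1 / 2) ⊆ closedBall 0 1 := closedBall_subset_closedBall (by norm_num)
  have hO : IsOpen (f '' (τ '' ball 0 (1 / 2))) :=
    hf.isOpen_image hU (hτ.isOpen_image_univ isOpen_ball hb2) (image_mono hb2)
  obtain ⟨c, hc, hcO⟩ := Metric.isOpen_iff.1 hO 0
    ⟨τ 0, ⟨0, by simp, rfl⟩, hf.zero⟩
  have hK : IsClosed (τ '' closedBall 0 (1 / 2)) :=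
    ((isCompact_closedBall 0 _).image_of_continuousOn (hτ.cont.mono hcb2)).isClosed
  have hζm : ζ ∈ closedBall (0 : ℂ) 1 := by rw [mem_closedBall_zero_iff, hζ]
  obtain ⟨r₀, hr₀, hr₀K⟩ := Metric.isOpen_iff.1 hK.isOpen_compl (τ ζ) (by
    rintro ⟨z, hz, hzζ⟩
    have := hτ.inj (hcb2 hz) hζm hzζ
    subst this
    rw [mem_closedBall_zero_iff, hζ] at hz; norm_num at hz)
  -- `3 * e ≤ ε` leaves more than `e` for the abscissa `x` after a margin `e` at both ends; the
  -- margins keep the crossing point inside the unit disk. `e < c` puts a point of the horizontal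
  -- chord into the image of the half-size disk, far from `τ ζ`.
  set e := min (ε / 3) (c / 2)
  have he : 0 < e := by positivity
  have he1 : 3 * e ≤ ε := by have := min_le_left (ε / 3) (c / 2); simp only [e]; linarith
  have he2 : e < c := (min_le_right _ _).trans_lt (by linarith)
  obtain ⟨ρ, hρ, hρr, hvr, hvi⟩ := exists_radius_volume_image_le hU hf.diff hf.inj
    (by rw [him]; exact isBounded_ball) (τ ζ) he hr₀
  obtain ⟨δ, hδ, hδs⟩ := Metric.continuousWithinAt_iff.1 (hτ.cont ζ hζm) ρ hρ
  refine ⟨δ, hδ, ?_⟩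
  by_contra! hcon
  obtain ⟨u, hu, u', hu', huu⟩ := hcon
  set A := f '' (τ '' ball 0 1 ∩ ball (τ ζ) ρ)
  set B := f '' (τ '' ball 0 1 ∩ {w | ρ < dist w (τ ζ)})
  have hA : IsOpen A := hf.isOpen_image hU (hU.inter isOpen_ball) inter_subset_left
  have hB : IsOpen B := hf.isOpen_image hU (hU.inter
    (isOpen_lt continuous_const (continuous_id.dist continuous_const))) inter_subset_left
  have hAB : Disjoint A B := by
    rw [Set.disjoint_left]
    rintro _ ⟨w, ⟨hw, hw1⟩, rfl⟩ ⟨w', ⟨hw', hw2⟩, h⟩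
    have := hf.inj hw' hw h
    subst this
    exact lt_asymm hw2 (mem_ball.1 hw1)
  have hcov : ∀ w ∈ ball (0 : ℂ) 1, w ∉ f '' {w | w ∈ τ '' ball 0 1 ∧ dist w (τ ζ) = ρ} →
      w ∈ A ∪ B := by
    intro w hw hw2
    rw [← him] at hw
    obtain ⟨v, hv, rfl⟩ := hw
    rcases lt_trichotomy (dist v (τ ζ)) ρ with h | h | h
    · exact Or.inl ⟨v, ⟨hv, h⟩, rfl⟩
    · exact absurd ⟨v, ⟨hv, h⟩, rfl⟩ hw2
    · exact Or.inr ⟨v, ⟨hv, h⟩, rfl⟩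
  obtain ⟨x, hx, hxn⟩ := exists_mem_Ioo_notMem_of_volume_le
    (a := (f (τ u')).re + e) (b := (f (τ u)).re - e) he (by linarith) hvr
  obtain ⟨s, hs, hsn⟩ := exists_mem_Ioo_notMem_of_volume_le (a := -e) (b := e) he (by linarith) hvi
  have hb : ∀ z ∈ ball (0 : ℂ) 1, ‖f (τ z)‖ < 1 := fun z hz ↦
    mem_ball_zero_iff.1 (hf.maps ⟨z, hz, rfl⟩)
  have hL : IsPreconnected (ball (0 : ℂ) 1 ∩ {w | w.re = x}) :=
    ((convex_ball 0 1).inter ((convex_singleton x).linear_preimage Complex.reLm)).isPreconnected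
  have hH : IsPreconnected (ball (0 : ℂ) 1 ∩ {w | w.im = s}) :=
    ((convex_ball 0 1).inter ((convex_singleton s).linear_preimage Complex.imLm)).isPreconnected
  have hLA : ball (0 : ℂ) 1 ∩ {w | w.re = x} ⊆ A := by
    refine hL.subset_left_of_subset_union hA hB hAB ?_ ?_
    · rintro w ⟨hw, hwx⟩
      refine hcov w hw fun ⟨v, hv, hvw⟩ ↦ hxn ⟨v, hv, ?_⟩
      simp only [hvw]; exact hwx
    · have hN : IsPreconnected ((fun z ↦ (f (τ z)).re) '' (ball (0 : ℂ) 1 ∩ ball ζ δ)) := by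
        refine ((convex_ball 0 1).inter (convex_ball ζ δ)).isPreconnected.image _ ?_
        refine Complex.continuous_re.comp_continuousOn (hf.diff.continuousOn.comp
          (hτ.cont.mono (inter_subset_left.trans ball_subset_closedBall)) fun z hz ↦ ⟨z, hz.1, rfl⟩)
      obtain ⟨v, hv, hvx⟩ := hN.ordConnected.out ⟨u', hu', rfl⟩ ⟨u, hu, rfl⟩
        (show x ∈ Icc _ _ from ⟨by linarith [hx.1], by linarith [hx.2]⟩)
      refine ⟨f (τ v), ⟨mem_ball_zero_iff.2 (hb v hv.1), hvx⟩, τ v, ⟨⟨v, hv.1, rfl⟩, ?_⟩, rfl⟩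
      exact hδs (ball_subset_closedBall hv.1) hv.2
  have hHB : ball (0 : ℂ) 1 ∩ {w | w.im = s} ⊆ B := by
    refine hH.subset_left_of_subset_union hB hA hAB.symm ?_ ?_
    · rintro w ⟨hw, hwx⟩
      rw [union_comm]
      refine hcov w hw fun ⟨v, hv, hvw⟩ ↦ hsn ⟨v, hv, ?_⟩
      simp only [hvw]; exact hwx
    · have hsc : (s * Complex.I : ℂ) ∈ ball (0 : ℂ) c := by
        simp only [mem_ball_zero_iff, norm_mul, Complex.norm_I, mul_one, Complex.norm_real,
          Real.norm_eq_abs]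
        exact (abs_lt.2 hs).trans he2
      obtain ⟨_, ⟨z, hz, rfl⟩, hzs⟩ := hcO hsc
      refine ⟨s * Complex.I, ⟨?_, by simp⟩, τ z, ⟨⟨z, hb2 hz, rfl⟩, ?_⟩, hzs⟩
      · rw [← hzs]; exact mem_ball_zero_iff.2 (hb z (hb2 hz))
      · by_contra hcon
        exact hr₀K (lt_of_le_of_lt (not_lt.1 hcon) hρr) ⟨z, ball_subset_closedBall hz, rfl⟩
  have hxs : (⟨x, s⟩ : ℂ) ∈ ball (0 : ℂ) 1 := by
    rw [mem_ball_zero_iff]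
    refine (Complex.norm_le_abs_re_add_abs_im _).trans_lt ?_
    have h1 := Complex.abs_re_le_norm (f (τ u))
    have h2 := Complex.abs_re_le_norm (f (τ u'))
    have h3 := hb u hu.1
    have h4 := hb u' hu'.1
    have h5 : |s| < e := abs_lt.2 hs
    have h6 : |x| < 1 - e := by
      rw [abs_lt]
      constructor
      · linarith [hx.1, (abs_le.1 h2).1]
      · linarith [hx.2, (abs_le.1 h1).2]
    simp only; linarith
  exact Set.disjoint_left.1 hAB (hLA ⟨hxs, rfl⟩) (hHB ⟨hxs, rfl⟩)

theorem IsSchlicht.const_mul {U : Set ℂ} {z₀ : ℂ} {f : ℂ → ℂ} (hf : IsSchlicht U z₀ f)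
    (hU : IsOpen U) {a : ℂ} (ha : ‖a‖ = 1) : IsSchlicht U z₀ (fun z ↦ a * f z) := by
  have ha0 : a ≠ 0 := by rintro rfl; simp at ha
  refine ⟨hf.diff.const_mul a, fun x hx y hy h ↦ hf.inj hx hy (mul_left_cancel₀ ha0 h),
    fun z hz ↦ ?_, by simp [hf.zero], fun z hz ↦ ?_⟩
  · rw [mem_ball_zero_iff, norm_mul, ha, one_mul]; exact mem_ball_zero_iff.1 (hf.maps hz)
  · rw [deriv_const_mul a (hf.diff.differentiableAt (hU.mem_nhds hz))]
    exact mul_ne_zero ha0 (hf.deriv_ne z hz)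

/-- The imaginary part of `f` is the real part of `-I * f`, which is again a normalized map onto the
disk. -/
theorem dist_le_of_isDisk {τ f : ℂ → ℂ} (hτ : IsDisk univ τ 1)
    (hf : IsSchlicht (τ '' ball 0 1) (τ 0) f) (him : f '' (τ '' ball 0 1) = ball 0 1)
    {ζ : ℂ} (hζ : ‖ζ‖ = 1) {ε : ℝ} (hε : 0 < ε) :
    ∃ δ > 0, ∀ z ∈ ball (0 : ℂ) 1 ∩ ball ζ δ, ∀ z' ∈ ball (0 : ℂ) 1 ∩ ball ζ δ,
      dist (f (τ z)) (f (τ z')) ≤ ε := by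
  have hU : IsOpen (τ '' ball 0 1) := hτ.isOpen_image_univ isOpen_ball subset_rfl
  have hI : ‖-Complex.I‖ = 1 := by simp
  obtain ⟨δ₁, hδ₁, h1⟩ := abs_re_sub_le_of_isDisk hτ hf him hζ (half_pos hε)
  obtain ⟨δ₂, hδ₂, h2⟩ := abs_re_sub_le_of_isDisk hτ (hf.const_mul hU hI) (by
    have : (fun z ↦ -Complex.I * f z) '' (τ '' ball 0 1) =
        (fun z ↦ -Complex.I * z) '' ball 0 1 := by
      have := image_image (fun z ↦ -Complex.I * z) f (τ '' ball 0 1)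
      rw [him] at this; exact this.symm
    rw [this]
    ext w
    simp only [mem_image, mem_ball_zero_iff]
    constructor
    · rintro ⟨z, hz, rfl⟩; simpa using hz
    · intro hw
      exact ⟨Complex.I * w, by simpa using hw, by
        rw [← mul_assoc, neg_mul, Complex.I_mul_I]; ring⟩) hζ (half_pos hε)
  refine ⟨min δ₁ δ₂, lt_min hδ₁ hδ₂, fun z hz z' hz' ↦ ?_⟩
  have s1 : ball ζ (min δ₁ δ₂) ⊆ ball ζ δ₁ := ball_subset_ball (min_le_left _ _)
  have s2 : ball ζ (min δ₁ δ₂) ⊆ ball ζ δ₂ := ball_subset_ball (min_le_right _ _)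
  rw [dist_eq_norm]
  refine (Complex.norm_le_abs_re_add_abs_im _).trans ?_
  have a1 := h1 z ⟨hz.1, s1 hz.2⟩ z' ⟨hz'.1, s1 hz'.2⟩
  have a2 := h1 z' ⟨hz'.1, s1 hz'.2⟩ z ⟨hz.1, s1 hz.2⟩
  have a3 := h2 z ⟨hz.1, s2 hz.2⟩ z' ⟨hz'.1, s2 hz'.2⟩
  have a4 := h2 z' ⟨hz'.1, s2 hz'.2⟩ z ⟨hz.1, s2 hz.2⟩
  simp only [Complex.mul_re, Complex.neg_re, Complex.I_re, Complex.I_im,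
    zero_mul, neg_mul, one_mul, sub_neg_eq_add, zero_sub] at a3 a4
  have b1 : |(f (τ z) - f (τ z')).re| ≤ ε / 2 := by
    rw [Complex.sub_re, abs_le]; constructor <;> linarith
  have b2 : |(f (τ z) - f (τ z')).im| ≤ ε / 2 := by
    rw [Complex.sub_im, abs_le]; constructor <;> linarith
  linarith

/-- A short crosscut around `η` is connected, so its image under `γ` has small diameter, and so has
the further image under `hτ.inv`, by uniform continuity. That image lies near the unit circle, since
compact parts of the open disk stay away from `η`. If `z` lies behind the crosscut, the segment from
`0` to `q = hτ.inv (γ z)` has to cross this image. The crossing is close to `q`, because both lie on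
one ray with norms in `(1 - e, 1)`. -/
theorem dist_inv_le_of_isDisk {τ f γ : ℂ → ℂ} (hτ : IsDisk univ τ 1)
    (hf : IsSchlicht (τ '' ball 0 1) (τ 0) f)
    (hγ : DifferentiableOn ℂ γ (ball 0 1)) (hγl : ∀ z ∈ τ '' ball 0 1, γ (f z) = z)
    (hγr : ∀ w ∈ ball (0 : ℂ) 1, γ w ∈ τ '' ball 0 1 ∧ f (γ w) = w)
    {η : ℂ} (hη : ‖η‖ = 1) {ε : ℝ} (hε : 0 < ε) :
    ∃ δ > 0, ∀ z ∈ ball (0 : ℂ) 1 ∩ ball η δ, ∀ z' ∈ ball (0 : ℂ) 1 ∩ ball η δ,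
      dist (hτ.inv (γ z)) (hτ.inv (γ z')) ≤ ε := by
  have hU : IsOpen (τ '' ball 0 1) := hτ.isOpen_image_univ isOpen_ball subset_rfl
  have hsub : τ '' ball 0 1 ⊆ τ '' closedBall 0 1 := image_mono ball_subset_closedBall
  have hgσ : ∀ w ∈ ball (0 : ℂ) 1, hτ.inv (γ w) ∈ ball (0 : ℂ) 1 ∧ f (τ (hτ.inv (γ w))) = w := by
    intro w hw
    obtain ⟨h1, h2⟩ := hγr w hw
    rw [hτ.apply_inv (hsub h1)]
    obtain ⟨z, hz, hzw⟩ := h1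
    rw [← hzw, hτ.inv_apply (ball_subset_closedBall hz), hzw]
    exact ⟨hz, h2⟩
  have hσg : ∀ z ∈ ball (0 : ℂ) 1, hτ.inv (γ (f (τ z))) = z := by
    intro z hz
    rw [hγl _ ⟨z, hz, rfl⟩, hτ.inv_apply (ball_subset_closedBall hz)]
  have hgc : ContinuousOn (fun z ↦ f (τ z)) (ball 0 1) :=
    hf.diff.continuousOn.comp (hτ.cont.mono ball_subset_closedBall) fun z hz ↦ ⟨z, hz, rfl⟩
  set e := min (ε / 4) (1 / 2)
  have he : 0 < e := by positivity
  have he1 : 4 * e ≤ ε := by have := min_le_left (ε / 4) (1 / 2); simp only [e]; linarith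
  have he2 : e ≤ 1 / 2 := min_le_right _ _
  obtain ⟨d, hd, hdu⟩ := Metric.uniformContinuousOn_iff_le.1
    (((isCompact_closedBall (0 : ℂ) 1).image_of_continuousOn hτ.cont).uniformContinuousOn_of_continuous
      hτ.continuousOn_inv) e he
  have hbb : closedBall (0 : ℂ) (1 - e) ⊆ ball 0 1 := closedBall_subset_ball (by linarith)
  have hK : IsClosed ((fun z ↦ f (τ z)) '' closedBall 0 (1 - e)) :=
    ((isCompact_closedBall 0 _).image_of_continuousOn (hgc.mono hbb)).isClosed
  obtain ⟨r₀, hr₀, hr₀K⟩ := Metric.isOpen_iff.1 hK.isOpen_compl η (by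
    rintro ⟨z, hz, hzη⟩
    have := mem_ball_zero_iff.1 (hf.maps ⟨z, hbb hz, rfl⟩)
    simp only at hzη
    rw [hzη, hη] at this; exact lt_irrefl _ this)
  have hγi : InjOn γ (ball 0 1) := fun x hx y hy h ↦ by
    rw [← (hγr x hx).2, h, (hγr y hy).2]
  have hγb : Bornology.IsBounded (γ '' ball 0 1) := by
    refine (((isCompact_closedBall (0 : ℂ) 1).image_of_continuousOn hτ.cont).isBounded).subset ?_
    rintro _ ⟨w, hw, rfl⟩
    exact hsub (hγr w hw).1
  obtain ⟨ρ, hρ, hρr, hvr, hvi⟩ := exists_radius_volume_image_le isOpen_ball hγ hγi hγb η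
    (half_pos hd) (r₀ := min r₀ 1) (by positivity)
  have hρ1 : ρ < 1 := hρr.trans_le (min_le_right _ _)
  have hρr0 : ρ < r₀ := hρr.trans_le (min_le_left _ _)
  have hκ := isPreconnected_ball_inter_sphere hη hρ
  set κ := {w : ℂ | w ∈ ball (0 : ℂ) 1 ∧ dist w η = ρ} with hκd
  have hγc : ContinuousOn γ κ := hγ.continuousOn.mono fun w hw ↦ hw.1
  have hdiam : ∀ x ∈ κ, ∀ y ∈ κ, dist (hτ.inv (γ x)) (hτ.inv (γ y)) ≤ e := by
    intro x hx y hy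
    refine hdu _ (hsub (hγr x hx.1).1) _ (hsub (hγr y hy.1).1) ?_
    rw [dist_eq_norm]
    refine (Complex.norm_le_abs_re_add_abs_im _).trans ?_
    have h1 := abs_sub_le_of_volume_le (hκ.image _ (Complex.continuous_re.comp_continuousOn hγc))
      (half_pos hd) hvr ⟨x, hx, rfl⟩ ⟨y, hy, rfl⟩
    have h2 := abs_sub_le_of_volume_le (hκ.image _ (Complex.continuous_im.comp_continuousOn hγc))
      (half_pos hd) hvi ⟨x, hx, rfl⟩ ⟨y, hy, rfl⟩
    simp only [Complex.sub_re, Complex.sub_im, Function.comp_apply] at h1 h2 ⊢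
    linarith
  have hbig : ∀ x ∈ κ, 1 - e < ‖hτ.inv (γ x)‖ := by
    intro x hx
    by_contra! hcon
    refine hr₀K (show x ∈ ball η r₀ from ?_) ⟨hτ.inv (γ x), mem_closedBall_zero_iff.2 hcon,
      (hgσ x hx.1).2⟩
    rw [mem_ball, hx.2]; exact hρr0
  have hk : ((1 - ρ : ℝ) : ℂ) * η ∈ κ := by
    constructor
    · rw [mem_ball_zero_iff, norm_mul, hη, Complex.norm_real, Real.norm_of_nonneg (by linarith)]
      linarith
    · rw [dist_eq_norm]
      have : ((1 - ρ : ℝ) : ℂ) * η - η = -((ρ : ℂ) * η) := by push_cast; ring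
      rw [this, norm_neg, norm_mul, hη, Complex.norm_real, Real.norm_of_nonneg hρ.le, mul_one]
  set k := hτ.inv (γ (((1 - ρ : ℝ) : ℂ) * η))
  have hmain : ∀ z ∈ ball (0 : ℂ) 1 ∩ ball η ρ, dist (hτ.inv (γ z)) k ≤ 2 * e := by
    rintro z ⟨hz1, hzη⟩
    by_contra! hcon
    set q := hτ.inv (γ z)
    have hq : q ∈ ball (0 : ℂ) 1 := (hgσ z hz1).1
    have hseg : segment ℝ 0 q ⊆ ball (0 : ℂ) 1 :=
      (convex_ball (0 : ℂ) 1).segment_subset (by simp) hq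
    have hpre : IsPreconnected ((fun z ↦ f (τ z)) '' segment ℝ 0 q) :=
      (convex_segment 0 q).isPreconnected.image _ (hgc.mono hseg)
    have hsub2 := hpre.subset_left_of_subset_union (u := ball η ρ) (v := {w | ρ < dist w η})
      isOpen_ball (isOpen_lt continuous_const (continuous_id.dist continuous_const))
      (by rw [Set.disjoint_left]; intro x hx hx2; exact lt_asymm hx2 (mem_ball.1 hx)) (by
        rintro _ ⟨x, hx, rfl⟩
        rcases lt_trichotomy (dist (f (τ x)) η) ρ with h | h | h
        · exact Or.inl h
        · exfalso
          have hxκ : f (τ x) ∈ κ := ⟨hf.maps ⟨x, hseg hx, rfl⟩, h⟩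
          have h1 := hbig _ hxκ
          have h2 := hdiam _ hxκ _ hk
          rw [hσg x (hseg hx)] at h1 h2
          rw [segment_eq_image_lineMap] at hx
          obtain ⟨t, ht, rfl⟩ := hx
          have h3 : dist q (AffineMap.lineMap (0 : ℂ) q t) = (1 - t) * ‖q‖ := by
            rw [AffineMap.lineMap_apply, dist_eq_norm]
            simp only [vsub_eq_sub, sub_zero, vadd_eq_add, add_zero]
            have : q - t • q = (1 - t) • q := by module
            rw [this, norm_smul, Real.norm_of_nonneg (by linarith [ht.2])]
          have h4 : ‖(AffineMap.lineMap (0 : ℂ) q t : ℂ)‖ = t * ‖q‖ := by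
            simp [AffineMap.lineMap_apply, abs_of_nonneg ht.1]
          have h5 := dist_triangle q (AffineMap.lineMap (0 : ℂ) q t) k
          have h6 := mem_ball_zero_iff.1 hq
          rw [h4] at h1; rw [h3] at h5
          linarith
        · exact Or.inr h) ⟨z, (⟨q, right_mem_segment ℝ 0 q,
          (hgσ z hz1).2⟩ : z ∈ (fun z ↦ f (τ z)) '' segment ℝ 0 q), hzη⟩
    have := hsub2 (show (0 : ℂ) ∈ _ from ⟨0, left_mem_segment ℝ 0 q, hf.zero⟩)
    rw [mem_ball, dist_zero_left, hη] at this
    linarith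
  refine ⟨ρ, hρ, fun z hz z' hz' ↦ ?_⟩
  have h1 := hmain z hz
  have h2 := hmain z' hz'
  have := dist_triangle_right (hτ.inv (γ z)) (hτ.inv (γ z')) k
  linarith

theorem exists_continuousOn_closedBall {g : ℂ → ℂ} (hg : ContinuousOn g (ball 0 1))
    (hm : MapsTo g (ball 0 1) (ball 0 1))
    (hosc : ∀ ζ : ℂ, ‖ζ‖ = 1 → ∀ ε > 0, ∃ δ > 0, ∀ z ∈ ball (0 : ℂ) 1 ∩ ball ζ δ,
      ∀ z' ∈ ball (0 : ℂ) 1 ∩ ball ζ δ, dist (g z) (g z') ≤ ε) :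
    ∃ Φ : ℂ → ℂ, ContinuousOn Φ (closedBall 0 1) ∧ MapsTo Φ (closedBall 0 1) (closedBall 0 1) ∧
      EqOn Φ g (ball 0 1) := by
  have hcl : closure (ball (0 : ℂ) 1) = closedBall 0 1 := closure_ball 0 one_ne_zero
  have hlim : ∀ x ∈ closedBall (0 : ℂ) 1, ∃ y, Tendsto g (𝓝[ball 0 1] x) (𝓝 y) := by
    intro x hx
    rw [mem_closedBall_zero_iff] at hx
    rcases hx.lt_or_eq with hx | hx
    · exact ⟨g x, hg x (mem_ball_zero_iff.2 hx)⟩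
    · have : (𝓝[ball (0 : ℂ) 1] x).NeBot := by
        rw [← mem_closure_iff_nhdsWithin_neBot, hcl, mem_closedBall_zero_iff, hx]
      refine cauchy_map_iff_exists_tendsto.1 ?_
      rw [Metric.cauchy_iff]
      refine ⟨inferInstance, fun ε hε ↦ ?_⟩
      obtain ⟨δ, hδ, h⟩ := hosc x hx (ε / 2) (half_pos hε)
      refine ⟨g '' (ball 0 1 ∩ ball x δ), image_mem_map
        (inter_mem_nhdsWithin _ (ball_mem_nhds x hδ)), ?_⟩
      rintro _ ⟨z, hz, rfl⟩ _ ⟨z', hz', rfl⟩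
      exact (h z hz z' hz').trans_lt (half_lt_self hε)
  have hc := continuousOn_extendFrom hcl.ge hlim
  have he : EqOn (extendFrom (ball 0 1) g) g (ball 0 1) := fun x hx ↦
    extendFrom_eq (subset_closure hx) (hg x hx)
  refine ⟨_, hc, fun x hx ↦ ?_, he⟩
  rw [← hcl] at hc hx ⊢
  have := hc.image_closure.trans (closure_mono (he.image_eq.trans_subset hm.image_subset))
  exact this ⟨x, hx, rfl⟩

/-- Carathéodory's theorem for a Jordan domain presented as the interior of an embedded disk. -/
theorem exists_caratheodory {τ f : ℂ → ℂ} (hτ : IsDisk univ τ 1)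
    (hf : IsSchlicht (τ '' ball 0 1) (τ 0) f) (him : f '' (τ '' ball 0 1) = ball 0 1) :
    ∃ Φ Ψ : ℂ → ℂ, ContinuousOn Φ (closedBall 0 1) ∧ ContinuousOn Ψ (closedBall 0 1) ∧
      MapsTo Φ (closedBall 0 1) (closedBall 0 1) ∧ MapsTo Ψ (closedBall 0 1) (closedBall 0 1) ∧
      (∀ z ∈ closedBall (0 : ℂ) 1, Ψ (Φ z) = z) ∧ (∀ z ∈ closedBall (0 : ℂ) 1, Φ (Ψ z) = z) ∧
      EqOn Φ (fun z ↦ f (τ z)) (ball 0 1) ∧ MapsTo Ψ (ball 0 1) (ball 0 1) := by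
  have hU : IsOpen (τ '' ball 0 1) := hτ.isOpen_image_univ isOpen_ball subset_rfl
  have hsub : τ '' ball 0 1 ⊆ τ '' closedBall 0 1 := image_mono ball_subset_closedBall
  obtain ⟨γ, hγ, hγl, hγr⟩ := hf.exists_inverse hU him
  have hgσ : ∀ w ∈ ball (0 : ℂ) 1, hτ.inv (γ w) ∈ ball (0 : ℂ) 1 ∧ f (τ (hτ.inv (γ w))) = w := by
    intro w hw
    obtain ⟨h1, h2⟩ := hγr w hw
    rw [hτ.apply_inv (hsub h1)]
    obtain ⟨z, hz, hzw⟩ := h1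
    rw [← hzw, hτ.inv_apply (ball_subset_closedBall hz), hzw]
    exact ⟨hz, h2⟩
  have hσg : ∀ z ∈ ball (0 : ℂ) 1, hτ.inv (γ (f (τ z))) = z := by
    intro z hz
    rw [hγl _ ⟨z, hz, rfl⟩, hτ.inv_apply (ball_subset_closedBall hz)]
  have hgm : ∀ z ∈ ball (0 : ℂ) 1, f (τ z) ∈ ball (0 : ℂ) 1 := fun z hz ↦ hf.maps ⟨z, hz, rfl⟩
  obtain ⟨Φ, hΦc, hΦm, hΦe⟩ := exists_continuousOn_closedBall
    (g := fun z ↦ f (τ z)) (hf.diff.continuousOn.comp (hτ.cont.mono ball_subset_closedBall)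
      fun z hz ↦ ⟨z, hz, rfl⟩) hgm (fun ζ hζ ε hε ↦ dist_le_of_isDisk hτ hf him hζ hε)
  obtain ⟨Ψ, hΨc, hΨm, hΨe⟩ := exists_continuousOn_closedBall
    (g := fun z ↦ hτ.inv (γ z)) (hτ.continuousOn_inv.comp hγ.continuousOn
      fun z hz ↦ hsub (hγr z hz).1) (fun w hw ↦ (hgσ w hw).1)
      (fun ζ hζ ε hε ↦ dist_inv_le_of_isDisk hτ hf hγ hγl hγr hζ hε)
  have hcl : closure (ball (0 : ℂ) 1) = closedBall 0 1 := closure_ball 0 one_ne_zero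
  refine ⟨Φ, Ψ, hΦc, hΨc, hΦm, hΨm, ?_, ?_, hΦe, fun z hz ↦ ?_⟩
  · refine EqOn.of_subset_closure (f := fun z ↦ Ψ (Φ z)) (g := fun z ↦ z) (s := ball 0 1) ?_
      (hΨc.comp hΦc hΦm) continuousOn_id ball_subset_closedBall hcl.ge
    intro z hz
    simp only
    rw [hΦe hz, hΨe (hgm z hz)]
    exact hσg z hz
  · refine EqOn.of_subset_closure (f := fun z ↦ Φ (Ψ z)) (g := fun z ↦ z) (s := ball 0 1) ?_
      (hΦc.comp hΨc hΨm) continuousOn_id ball_subset_closedBall hcl.ge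
    intro z hz
    simp only
    rw [hΨe hz, hΦe (hgσ z hz).1]
    exact (hgσ z hz).2
  · rw [hΨe hz]; exact (hgσ z hz).1

/-! ### Homeomorphisms of disks: extension by the identity, circle homeomorphisms, local
straightening. -/

theorem exists_homeomorph_of_isCompact {Y : Type*} [TopologicalSpace Y] [T2Space Y] {K L : Set Y}
    (hK : IsCompact K) (hL : IsClosed L) (hKL : K ∪ L = univ) {θ : Y → Y} (hc : ContinuousOn θ K)
    (hi : InjOn θ K) (him : θ '' K = K) (hid : ∀ y ∈ K, y ∈ L → θ y = y) :
    ∃ e : Y ≃ₜ Y, EqOn e θ K ∧ ∀ y ∈ L, e y = y := by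
  classical
  set g : Y → Y := K.piecewise θ id with hg
  have hgK : EqOn g θ K := fun y hy ↦ by simp [hg, hy]
  have hgL : ∀ y ∈ L, g y = y := fun y hy ↦ by
    by_cases h : y ∈ K
    · rw [hgK h, hid y h hy]
    · simp [hg, h]
  have hgc : Continuous g := by
    rw [← continuousOn_univ, ← hKL]
    exact (hc.congr hgK).union_of_isClosed (continuousOn_id.congr hgL) hK.isClosed hL
  have hnK : ∀ y, y ∉ K → g y = y := fun y hy ↦ by simp [hg, hy]
  have hmK : ∀ y ∈ K, g y ∈ K := fun y hy ↦ by
    rw [hgK hy, ← him]; exact ⟨y, hy, rfl⟩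
  have hinj : Function.Injective g := by
    intro x y h
    by_cases hx : x ∈ K <;> by_cases hy : y ∈ K
    · rw [hgK hx, hgK hy] at h; exact hi hx hy h
    · rw [hnK y hy] at h; exact absurd (h ▸ hmK x hx) hy
    · rw [hnK x hx] at h; exact absurd (h ▸ hmK y hy) hx
    · rwa [hnK x hx, hnK y hy] at h
  have hsurj : Function.Surjective g := by
    intro y
    by_cases hy : y ∈ K
    · obtain ⟨x, hx, rfl⟩ := him.symm.subset hy
      exact ⟨x, hgK hx⟩
    · exact ⟨y, hnK y hy⟩
  have hcl : IsClosedMap g := by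
    intro C hC
    have : g '' C = θ '' (K ∩ C) ∪ (L ∩ C) := by
      have hC' : C = (K ∩ C) ∪ (L ∩ C) := by rw [← union_inter_distrib_right, hKL, univ_inter]
      conv_lhs => rw [hC', image_union]
      congr 1
      · exact image_congr fun y hy ↦ hgK hy.1
      · rw [image_congr fun y hy ↦ hgL y hy.1, image_id']
    rw [this]
    exact (((hK.inter_right hC).image_of_continuousOn (hc.mono inter_subset_left)).isClosed).union
      (hL.inter hC)
  exact ⟨(Equiv.ofBijective g ⟨hinj, hsurj⟩).toHomeomorphOfContinuousClosed hgc hcl, hgK, hgL⟩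

theorem exists_homeomorph_closedBall {E : Type*} [NormedAddCommGroup E] [ProperSpace E] {ρ : ℝ}
    {θ : E → E} (hc : ContinuousOn θ (closedBall 0 ρ)) (hi : InjOn θ (closedBall 0 ρ))
    (him : θ '' closedBall 0 ρ = closedBall 0 ρ) (hid : ∀ y, ‖y‖ = ρ → θ y = y) :
    ∃ e : E ≃ₜ E, EqOn e θ (closedBall 0 ρ) ∧ ∀ y, ρ ≤ ‖y‖ → e y = y := by
  refine exists_homeomorph_of_isCompact (isCompact_closedBall 0 ρ) (L := {y | ρ ≤ ‖y‖})
    (isClosed_le continuous_const continuous_norm) ?_ hc hi him fun y hy hy' ↦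
      hid y (le_antisymm (mem_closedBall_zero_iff.1 hy) hy')
  ext y
  simp only [mem_union, mem_closedBall_zero_iff, mem_ofPred_eq, mem_univ, iff_true]
  exact le_total _ _

/-- The identity plus a contraction is invertible, by the inverse function theorem in its global
Lipschitz form. -/
theorem exists_homeomorph_add_of_lipschitzWith {E : Type*} [NormedAddCommGroup E]
    [NormedSpace ℝ E] [CompleteSpace E] {u : E → E} {K : NNReal} (hu : LipschitzWith K u)
    (hK : K < 1) : ∃ e : E ≃ₜ E, ∀ z, e z = z + u z := by
  have h : ApproximatesLinearOn (fun z ↦ z + u z)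
      ((ContinuousLinearEquiv.refl ℝ E : E ≃L[ℝ] E) : E →L[ℝ] E) univ K := by
    intro x _ y _
    have : x + u x - (y + u y) - ((ContinuousLinearEquiv.refl ℝ E : E ≃L[ℝ] E) : E →L[ℝ] E) (x - y)
        = u x - u y := by
      simp only [ContinuousLinearEquiv.coe_refl, ContinuousLinearMap.coe_id', id_eq]
      abel
    rw [this, ← dist_eq_norm, ← dist_eq_norm]
    exact hu.dist_le_mul x y
  refine ⟨h.toHomeomorph _ ?_, fun z ↦ rfl⟩
  rcases subsingleton_or_nontrivial E with hE | hE
  · exact Or.inl hE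
  · right
    refine hK.trans_le ?_
    rw [one_le_inv₀]
    · refine ContinuousLinearMap.opNNNorm_le_bound _ _ fun x ↦ ?_
      simp
    · exact ContinuousLinearEquiv.nnnorm_symm_pos _

theorem exists_int_of_continuous {f : ℝ → ℝ} (hf : Continuous f)
    (hn : ∀ t, ∃ n : ℤ, f t = n * (2 * Real.pi)) : ∃ n : ℤ, ∀ t, f t = n * (2 * Real.pi) := by
  have hpi := Real.pi_pos
  choose n hn using hn
  have hc : Continuous n := by
    rw [Int.isClosedEmbedding_coe_real.isEmbedding.continuous_iff]
    have : ((↑) : ℤ → ℝ) ∘ n = fun t ↦ f t / (2 * Real.pi) := by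
      ext t; simp only [Function.comp_apply]; rw [hn t]; field_simp
    rw [this]; fun_prop
  exact ⟨n 0, fun t ↦ by rw [hn t, PreconnectedSpace.constant inferInstance hc (x := t) (y := 0)]⟩

/-- A lift changes by an integral multiple `m` of `2π` over a period. A lift of the inverse has such
a degree `n`, and `m * n = 1` leaves only `m = 1` and `m = -1`. An injective continuous real
function is monotone, in the direction given by this sign. -/
theorem exists_lift_circle_homeomorph (b : Circle ≃ₜ Circle) : ∃ h : ℝ → ℝ, Continuous h ∧
    (∀ t, Circle.exp (h t) = b (Circle.exp t)) ∧
    ((StrictMono h ∧ ∀ t, h (t + 2 * Real.pi) = h t + 2 * Real.pi) ∨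
      (StrictAnti h ∧ ∀ t, h (t + 2 * Real.pi) = h t - 2 * Real.pi)) := by
  have hpi := Real.pi_pos
  have lift : ∀ b : Circle ≃ₜ Circle, ∃ h : ℝ → ℝ, Continuous h ∧
      (∀ t, Circle.exp (h t) = b (Circle.exp t)) ∧
      ∃ m : ℤ, ∀ t, h (t + 2 * Real.pi) = h t + m * (2 * Real.pi) := by
    intro b
    obtain ⟨e₀, he₀⟩ := Circle.exp_surjective (b (Circle.exp 0))
    obtain ⟨F, ⟨-, hF⟩, -⟩ := Circle.isCoveringMap_exp.existsUnique_continuousMap_lifts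
      (⟨fun t : ℝ ↦ b (Circle.exp t), by fun_prop⟩ : C(ℝ, Circle)) 0 e₀ he₀
    have hF' : ∀ t, Circle.exp (F t) = b (Circle.exp t) := fun t ↦ congrFun hF t
    obtain ⟨m, hm⟩ := exists_int_of_continuous (f := fun t ↦ F (t + 2 * Real.pi) - F t)
      (by fun_prop) fun t ↦ by
        obtain ⟨m, hm⟩ := Circle.exp_eq_exp.1
          (show Circle.exp (F (t + 2 * Real.pi)) = Circle.exp (F t) by
            rw [hF', hF', Circle.exp_add_two_pi])
        exact ⟨m, by rw [hm]; ring⟩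
    exact ⟨F, F.continuous, hF', m, fun t ↦ by linarith [hm t]⟩
  obtain ⟨h, hc, hb, m, hm⟩ := lift b
  obtain ⟨k, kc, kb, n, hn⟩ := lift b.symm
  have hmz : ∀ (j : ℤ) t, k (t + j * (2 * Real.pi)) = k t + j * n * (2 * Real.pi) := by
    intro j t
    induction j using Int.induction_on with
    | zero => simp
    | succ i ih =>
      have := hn (t + i * (2 * Real.pi))
      push_cast at ih ⊢
      rw [show t + (i + 1) * (2 * Real.pi) = t + i * (2 * Real.pi) + 2 * Real.pi by ring, this, ih]
      ring
    | pred i ih =>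
      have := hn (t + (-i - 1) * (2 * Real.pi))
      push_cast at ih ⊢
      rw [show t + (-i - 1) * (2 * Real.pi) + 2 * Real.pi = t + -i * (2 * Real.pi) by ring, ih] at this
      linarith
  obtain ⟨c, hkc⟩ := exists_int_of_continuous (f := fun t ↦ k (h t) - t) (by fun_prop) fun t ↦ by
    obtain ⟨j, hj⟩ := Circle.exp_eq_exp.1 (show Circle.exp (k (h t)) = Circle.exp t by
      rw [kb, hb, b.symm_apply_apply])
    exact ⟨j, by rw [hj]; ring⟩
  have hinj : Function.Injective h := by
    intro s t hst
    have h1 := hkc s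
    have h2 := hkc t
    rw [hst] at h1
    linarith
  have hmn : m * n = 1 := by
    have h1 := hkc (2 * Real.pi)
    have h2 := hkc 0
    have h3 := hm 0
    rw [zero_add] at h3
    rw [h3, hmz] at h1
    have : ((m * n : ℤ) : ℝ) * (2 * Real.pi) = 1 * (2 * Real.pi) := by push_cast; linarith
    exact_mod_cast mul_right_cancel₀ (by positivity) this
  refine ⟨h, hc, hb, ?_⟩
  rcases Int.eq_one_or_neg_one_of_mul_eq_one hmn with rfl | rfl
  · have hm' : ∀ t, h (t + 2 * Real.pi) = h t + 2 * Real.pi := fun t ↦ by rw [hm t]; push_cast; ring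
    refine Or.inl ⟨(hc.strictMono_of_inj hinj).resolve_right fun ha ↦ ?_, hm'⟩
    have := ha (show (0 : ℝ) < 0 + 2 * Real.pi by positivity)
    rw [hm'] at this; linarith
  · have hm' : ∀ t, h (t + 2 * Real.pi) = h t - 2 * Real.pi := fun t ↦ by rw [hm t]; push_cast; ring
    refine Or.inr ⟨(hc.strictMono_of_inj hinj).resolve_left fun ha ↦ ?_, hm'⟩
    have := ha (show (0 : ℝ) < 0 + 2 * Real.pi by positivity)
    rw [hm'] at this; linarith

/-- The jump of the argument on the negative axis is a period of `d`. There the continuous branch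
`arg (-z) + π` is used instead. -/
theorem continuousOn_periodic_arg {d : ℝ → ℝ} (hd : Continuous d)
    (hp : Function.Periodic d (2 * Real.pi)) : ContinuousOn (fun z : ℂ ↦ d z.arg) {0}ᶜ := by
  intro z hz
  refine ContinuousAt.continuousWithinAt ?_
  by_cases hs : z ∈ Complex.slitPlane
  · exact hd.continuousAt.comp (Complex.continuousAt_arg hs)
  · have hs' : -z ∈ Complex.slitPlane := by
      rw [Complex.mem_slitPlane_iff] at hs ⊢
      push Not at hs
      left
      rw [Complex.neg_re, neg_pos]
      refine lt_of_le_of_ne hs.1 fun h ↦ hz (Complex.ext h hs.2)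
    have h1 : ContinuousAt (fun z : ℂ ↦ d ((-z).arg + Real.pi)) z :=
      hd.continuousAt.comp ((ContinuousAt.comp (f := fun z : ℂ ↦ -z)
        (Complex.continuousAt_arg hs') continuousAt_neg).add_const _)
    refine h1.congr ?_
    filter_upwards [isOpen_compl_singleton.mem_nhds hz] with w hw
    have hw0 : w ≠ 0 := hw
    have h2 : Circle.exp ((-w).arg + Real.pi) = Circle.exp w.arg := by
      ext
      rw [Circle.coe_exp, Circle.coe_exp]
      push_cast
      rw [add_mul, Complex.exp_add, Complex.exp_pi_mul_I]
      have e1 := Complex.norm_mul_exp_arg_mul_I w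
      have e2 := Complex.norm_mul_exp_arg_mul_I (-w)
      rw [norm_neg] at e2
      have e3 : (‖w‖ : ℂ) ≠ 0 := by simpa using hw0
      refine mul_left_cancel₀ e3 ?_
      linear_combination -e1 - e2
    obtain ⟨n, hn⟩ := Circle.exp_eq_exp.1 h2
    rw [hn]; exact hp.int_mul n _

/-- Radial extension of the circle homeomorphism with lift `h`, the identity near the centre. -/
theorem exists_homeomorph_of_lift {h : ℝ → ℝ} (hc : Continuous h) (hm : StrictMono h)
    (hp : ∀ t, h (t + 2 * Real.pi) = h t + 2 * Real.pi) : ∃ B : ℂ → ℂ,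
      ContinuousOn B (closedBall 0 1) ∧ InjOn B (closedBall 0 1) ∧
      B '' closedBall 0 1 = closedBall 0 1 ∧ (∀ z, ‖z‖ ≤ 1 / 2 → B z = z) ∧
      ∀ t : ℝ, B (Complex.exp (t * Complex.I)) = Complex.exp (h t * Complex.I) := by
  have hpi := Real.pi_pos
  -- `l` is `0` up to radius `1 / 2` and `1` at radius `1`. On the circle of radius `r` the map
  -- below has the lift `(1 - l r) * t + l r * h t`, a convex combination of increasing lifts.
  set l : ℝ → ℝ := fun r ↦ max 0 (min 1 (2 * r - 1)) with hl
  have hl0 : ∀ r, 0 ≤ l r := fun r ↦ le_max_left _ _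
  have hl1 : ∀ r, l r ≤ 1 := fun r ↦ max_le zero_le_one (min_le_left _ _)
  have hlc : Continuous l := by fun_prop
  set d : ℝ → ℝ := fun t ↦ h t - t with hd
  have hdp : Function.Periodic d (2 * Real.pi) := fun t ↦ by simp only [hd, hp t]; ring
  have hdc : Continuous d := by fun_prop
  set B : ℂ → ℂ := fun z ↦ z * Complex.exp ((l ‖z‖ * d z.arg : ℝ) * Complex.I) with hB
  have hn : ∀ z, ‖B z‖ = ‖z‖ := fun z ↦ by
    simp only [hB, norm_mul, Complex.norm_exp_ofReal_mul_I, mul_one]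
  have hpol : ∀ (r : ℝ) (t : ℝ), 0 < r → B (r * Complex.exp (t * Complex.I)) =
      r * Complex.exp (((1 - l r) * t + l r * h t : ℝ) * Complex.I) := by
    intro r t hr
    have h1 : ‖(r * Complex.exp (t * Complex.I) : ℂ)‖ = r := by
      rw [norm_mul, Complex.norm_exp_ofReal_mul_I, mul_one, Complex.norm_real,
        Real.norm_of_nonneg hr.le]
    have h2 : d (Complex.arg (r * Complex.exp (t * Complex.I))) = d t := by
      have : Circle.exp (Complex.arg (r * Complex.exp (t * Complex.I))) = Circle.exp t := by
        ext
        rw [Circle.coe_exp, Circle.coe_exp]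
        have e1 := Complex.norm_mul_exp_arg_mul_I (r * Complex.exp (t * Complex.I))
        rw [h1] at e1
        exact mul_left_cancel₀ (by simpa using hr.ne') e1
      obtain ⟨n, hn⟩ := Circle.exp_eq_exp.1 this
      rw [hn]; exact hdp.int_mul n _
    simp only [hB, h1, h2, mul_assoc]
    rw [← Complex.exp_add]
    congr 2
    simp only [hd]; push_cast; ring
  have hH : ∀ r, StrictMono fun t ↦ (1 - l r) * t + l r * h t := by
    intro r s t hst
    have h1 := hm hst
    have := hl0 r; have := hl1 r
    simp only
    rcases (hl0 r).eq_or_lt with h0 | h0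
    · rw [← h0]; simpa using hst
    · nlinarith
  have hHp : ∀ r (n : ℤ) t, (1 - l r) * (t + n * (2 * Real.pi)) + l r * h (t + n * (2 * Real.pi)) =
      (1 - l r) * t + l r * h t + n * (2 * Real.pi) := by
    intro r n t
    have := hdp.int_mul n t
    simp only [hd] at this
    have e : h (t + n * (2 * Real.pi)) = h t + n * (2 * Real.pi) := by linarith
    rw [e]; ring
  refine ⟨B, ?_, ?_, ?_, ?_, ?_⟩
  · refine Continuous.continuousOn (continuous_iff_continuousAt.2 fun z ↦ ?_)
    by_cases hz : z = 0
    · subst hz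
      have hB0 : B 0 = 0 := by simp [hB]
      rw [ContinuousAt, hB0, tendsto_zero_iff_norm_tendsto_zero]
      simp only [hn]
      exact continuous_norm.tendsto' 0 0 norm_zero
    · have : ContinuousAt (fun z : ℂ ↦ d z.arg) z :=
        (continuousOn_periodic_arg hdc hdp).continuousAt (isOpen_compl_singleton.mem_nhds hz)
      have h3 := ((hlc.comp continuous_norm).continuousAt (x := z)).mul this
      exact continuousAt_id.mul (Complex.continuous_exp.continuousAt.comp
        ((Complex.continuous_ofReal.continuousAt.comp h3).mul continuousAt_const))
  · intro z _ w _ hzw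
    have hnzw : ‖z‖ = ‖w‖ := by rw [← hn z, ← hn w, hzw]
    by_cases hz : z = 0
    · subst hz; rw [norm_zero] at hnzw; exact (norm_eq_zero.1 hnzw.symm).symm
    have hr : 0 < ‖z‖ := norm_pos_iff.2 hz
    have ez := Complex.norm_mul_exp_arg_mul_I z
    have ew := Complex.norm_mul_exp_arg_mul_I w
    rw [← hnzw] at ew
    rw [← ez, ← ew, hpol _ _ hr, hpol _ _ hr] at hzw
    have h1 := mul_left_cancel₀ (by simpa using hr.ne') hzw
    have h2 : Circle.exp ((1 - l ‖z‖) * z.arg + l ‖z‖ * h z.arg) =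
        Circle.exp ((1 - l ‖z‖) * w.arg + l ‖z‖ * h w.arg) := by
      ext; rw [Circle.coe_exp, Circle.coe_exp]; exact h1
    obtain ⟨n, hn'⟩ := Circle.exp_eq_exp.1 h2
    rw [← hHp] at hn'
    have h3 := (hH ‖z‖).injective hn'
    rw [← ez, ← ew, h3]
    congr 1
    rw [Complex.exp_eq_exp_iff_exists_int]
    exact ⟨n, by push_cast; ring⟩
  · refine Subset.antisymm ?_ ?_
    · rintro _ ⟨z, hz, rfl⟩
      rw [mem_closedBall_zero_iff] at hz ⊢
      rwa [hn]
    · intro w hw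
      rw [mem_closedBall_zero_iff] at hw
      by_cases hw0 : w = 0
      · exact ⟨0, by simp, by simp [hB, hw0]⟩
      have hr : 0 < ‖w‖ := norm_pos_iff.2 hw0
      have hcont : Continuous fun t ↦ (1 - l ‖w‖) * t + l ‖w‖ * h t := by fun_prop
      obtain ⟨n, hn1⟩ := exists_int_gt
        ((w.arg - ((1 - l ‖w‖) * 0 + l ‖w‖ * h 0)) / (2 * Real.pi))
      obtain ⟨m, hm1⟩ := exists_int_lt
        ((w.arg - ((1 - l ‖w‖) * 0 + l ‖w‖ * h 0)) / (2 * Real.pi))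
      rw [div_lt_iff₀ (by positivity)] at hn1
      rw [lt_div_iff₀ (by positivity)] at hm1
      have a1 := hHp ‖w‖ n 0
      have a2 := hHp ‖w‖ m 0
      obtain ⟨t, -, ht⟩ := intermediate_value_uIcc (a := 0 + m * (2 * Real.pi))
        (b := 0 + n * (2 * Real.pi)) hcont.continuousOn
        (show w.arg ∈ _ from mem_uIcc_of_le (by linarith) (by linarith))
      refine ⟨‖w‖ * Complex.exp (t * Complex.I), ?_, ?_⟩
      · rwa [mem_closedBall_zero_iff, norm_mul, Complex.norm_exp_ofReal_mul_I, mul_one,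
          Complex.norm_real, norm_norm]
      · rw [hpol _ _ hr]
        simp only at ht
        rw [ht, Complex.norm_mul_exp_arg_mul_I]
  · intro z hz
    have : l ‖z‖ = 0 := max_eq_left ((min_le_right _ _).trans (by linarith))
    simp [hB, this]
  · intro t
    have := hpol 1 t one_pos
    have h1 : l 1 = 1 := by norm_num [hl]
    simpa [h1] using this

/-- Cut off `G - id`: as `G` is strictly differentiable with derivative `1`, this difference has a
small Lipschitz constant near `0`, and its cut-off stays a contraction. -/
theorem exists_homeomorph_eq_near_zero {E : Type*} [NormedAddCommGroup E] [NormedSpace ℝ E]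
    [CompleteSpace E] {G : E → E} (hG : HasStrictFDerivAt G (1 : E →L[ℝ] E) 0)
    (hG0 : G 0 = 0) {r₀ : ℝ} (hr₀ : 0 < r₀) :
    ∃ e : E ≃ₜ E, (∀ z, r₀ ≤ ‖z‖ → e z = z) ∧ ∃ r > 0, ∀ z ∈ ball (0 : E) r, e z = G z := by
  -- The cutoff has slope `2 / r` and multiplies values of size at most `r / 6`. So `1 / 6` gives
  -- the Lipschitz constant `1 / 3 + 1 / 6 = 1 / 2` for the product.
  obtain ⟨s, hs, hsG⟩ := hG.approximates_deriv_on_nhds (c := 1 / 6) (Or.inr (by norm_num))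
  obtain ⟨r₁, hr₁, hr₁s⟩ := Metric.mem_nhds_iff.1 hs
  set r := min r₀ r₁
  have hr : 0 < r := lt_min hr₀ hr₁
  set g : E → E := fun z ↦ G z - z with hg
  have hgl : ∀ x y : E, ‖x‖ < r → ‖y‖ < r → ‖g x - g y‖ ≤ 1 / 6 * ‖x - y‖ := by
    intro x y hx hy
    have := hsG x (hr₁s (mem_ball_zero_iff.2 (hx.trans_le (min_le_right _ _)))) y
      (hr₁s (mem_ball_zero_iff.2 (hy.trans_le (min_le_right _ _))))
    simp only [hg]
    rw [show G x - x - (G y - y) = G x - G y - (x - y) by abel]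
    simpa using this
  have hg0 : g 0 = 0 := by simp [hg, hG0]
  have hgn : ∀ x : E, ‖x‖ < r → ‖g x‖ ≤ 1 / 6 * r := by
    intro x hx
    have := hgl x 0 hx (by simpa using hr)
    rw [hg0, sub_zero, sub_zero] at this
    linarith
  set χ : ℝ → ℝ := fun t ↦ max 0 (min 1 (2 - 2 / r * t)) with hχ
  have hχ0 : ∀ t, 0 ≤ χ t := fun t ↦ le_max_left _ _
  have hχ1 : ∀ t, χ t ≤ 1 := fun t ↦ max_le zero_le_one (min_le_left _ _)
  have hχr : ∀ t, r ≤ t → χ t = 0 := fun t ht ↦ max_eq_left ((min_le_right _ _).trans (by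
    have : 2 ≤ 2 / r * t := by rw [div_mul_eq_mul_div, le_div_iff₀ hr]; linarith
    linarith))
  have hχl : ∀ x y : E, |χ ‖x‖ - χ ‖y‖| ≤ 2 / r * ‖x - y‖ := by
    intro x y
    have h1 : |χ ‖x‖ - χ ‖y‖| ≤ |(2 - 2 / r * ‖x‖) - (2 - 2 / r * ‖y‖)| := by
      refine (abs_max_sub_max_le_max _ _ _ _).trans ?_
      rw [sub_self, abs_zero, max_eq_right (abs_nonneg _)]
      refine (abs_min_sub_min_le_max _ _ _ _).trans ?_
      rw [sub_self, abs_zero, max_eq_right (abs_nonneg _)]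
    refine h1.trans ?_
    rw [show 2 - 2 / r * ‖x‖ - (2 - 2 / r * ‖y‖) = -(2 / r * (‖x‖ - ‖y‖)) by ring, abs_neg, abs_mul,
      abs_of_nonneg (by positivity)]
    exact mul_le_mul_of_nonneg_left (abs_norm_sub_norm_le x y) (by positivity)
  set u : E → E := fun z ↦ χ ‖z‖ • g z with hu
  have hu0 : ∀ z, r ≤ ‖z‖ → u z = 0 := fun z hz ↦ by simp [hu, hχr _ hz]
  have key : ∀ x y : E, ‖x‖ < r → ‖u x - u y‖ ≤ 1 / 2 * ‖x - y‖ := by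
    intro x y hx
    by_cases hy : ‖y‖ < r
    · have e : u x - u y = (χ ‖x‖ - χ ‖y‖) • g x + χ ‖y‖ • (g x - g y) := by
        simp only [hu]; module
      rw [e]
      refine (norm_add_le _ _).trans ?_
      rw [norm_smul, norm_smul, Real.norm_eq_abs, Real.norm_of_nonneg (hχ0 _)]
      have h1 : |χ ‖x‖ - χ ‖y‖| * ‖g x‖ ≤ (2 / r * ‖x - y‖) * (1 / 6 * r) :=
        mul_le_mul (hχl x y) (hgn x hx) (norm_nonneg _) (by positivity)
      have h2 : χ ‖y‖ * ‖g x - g y‖ ≤ 1 * (1 / 6 * ‖x - y‖) :=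
        mul_le_mul (hχ1 _) (hgl x y hx hy) (norm_nonneg _) zero_le_one
      have h3 : (2 / r * ‖x - y‖) * (1 / 6 * r) = 1 / 3 * ‖x - y‖ := by field_simp; ring
      linarith
    · rw [hu0 y (not_lt.1 hy), sub_zero]
      have h0 := hχl x y
      rw [hχr _ (not_lt.1 hy), sub_zero, abs_of_nonneg (hχ0 _)] at h0
      simp only [hu, norm_smul, Real.norm_of_nonneg (hχ0 _)]
      have h1 : χ ‖x‖ * ‖g x‖ ≤ (2 / r * ‖x - y‖) * (1 / 6 * r) :=
        mul_le_mul h0 (hgn x hx) (norm_nonneg _) (by positivity)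
      have h3 : (2 / r * ‖x - y‖) * (1 / 6 * r) = 1 / 3 * ‖x - y‖ := by field_simp; ring
      have := norm_nonneg (x - y)
      linarith
  have hul : LipschitzWith (1 / 2) u := by
    refine LipschitzWith.of_dist_le_mul fun x y ↦ ?_
    rw [dist_eq_norm, dist_eq_norm]
    push_cast
    by_cases hx : ‖x‖ < r
    · simpa using key x y hx
    by_cases hy : ‖y‖ < r
    · have := key y x hy
      rw [norm_sub_rev, norm_sub_rev x]; simpa using this
    · rw [hu0 x (not_lt.1 hx), hu0 y (not_lt.1 hy)]; simp
  obtain ⟨e, he⟩ := exists_homeomorph_add_of_lipschitzWith hul (by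
    rw [← NNReal.coe_lt_coe]; norm_num)
  refine ⟨e, fun z hz ↦ ?_, r / 2, half_pos hr, fun z hz ↦ ?_⟩
  · rw [he, hu0 z ((min_le_left _ _).trans hz), add_zero]
  · rw [he]
    rw [mem_ball_zero_iff] at hz
    have : χ ‖z‖ = 1 := by
      simp only [hχ]
      have : 2 / r * ‖z‖ ≤ 1 := by rw [div_mul_eq_mul_div, div_le_one hr]; linarith
      rw [min_eq_left (by linarith), max_eq_right zero_le_one]
    simp [hu, hg, this]

/-! ### Straightening a planar disk at its centre. -/

theorem IsDisk.isSimplyConnected {τ : ℂ → ℂ} (hτ : IsDisk univ τ 1) :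
    IsSimplyConnected (τ '' ball 0 1) := by
  have hsub : τ '' ball 0 1 ⊆ τ '' closedBall 0 1 := image_mono ball_subset_closedBall
  have h1 : ∀ w : τ '' ball 0 1, hτ.inv w ∈ ball (0 : ℂ) 1 := by
    rintro ⟨_, z, hz, rfl⟩
    rw [hτ.inv_apply (ball_subset_closedBall hz)]; exact hz
  have h2 : Continuous fun z : ball (0 : ℂ) 1 ↦ τ z :=
    hτ.cont.comp_continuous continuous_subtype_val fun z ↦ ball_subset_closedBall z.2
  have h3 : Continuous fun w : τ '' ball 0 1 ↦ hτ.inv w :=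
    hτ.continuousOn_inv.comp_continuous continuous_subtype_val fun w ↦ hsub w.2
  let e : ball (0 : ℂ) 1 ≃ₜ τ '' ball 0 1 :=
    { toFun := fun z ↦ ⟨τ z, z, z.2, rfl⟩
      invFun := fun w ↦ ⟨hτ.inv w, h1 w⟩
      left_inv := fun z ↦ Subtype.ext (hτ.inv_apply (ball_subset_closedBall z.2))
      right_inv := fun w ↦ Subtype.ext (hτ.apply_inv (hsub w.2))
      continuous_toFun := h2.subtype_mk _
      continuous_invFun := h3.subtype_mk _ }
  have : ContractibleSpace (ball (0 : ℂ) 1) := contractibleSpace_ball one_pos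
  have : ContractibleSpace (τ '' ball 0 1) := e.symm.contractibleSpace
  exact (inferInstance : SimplyConnectedSpace (τ '' ball 0 1))

/-- A complex number operation which is the identity or the complex conjugation. -/
def IsReflection (κ : ℂ → ℂ) : Prop := κ = id ∨ κ = starRingEnd ℂ

theorem IsReflection.involutive {κ : ℂ → ℂ} (h : IsReflection κ) (z : ℂ) : κ (κ z) = z := by
  rcases h with rfl | rfl <;> simp

theorem IsReflection.norm {κ : ℂ → ℂ} (h : IsReflection κ) (z : ℂ) : ‖κ z‖ = ‖z‖ := by
  rcases h with rfl | rfl <;> simp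

theorem IsReflection.continuous {κ : ℂ → ℂ} (h : IsReflection κ) : Continuous κ := by
  rcases h with rfl | rfl
  · exact continuous_id
  · exact Complex.continuous_conj

theorem IsReflection.mul {κ : ℂ → ℂ} (h : IsReflection κ) (z w : ℂ) : κ (z * w) = κ z * κ w := by
  rcases h with rfl | rfl <;> simp

theorem IsReflection.ofReal {κ : ℂ → ℂ} (h : IsReflection κ) (x : ℝ) : κ x = x := by
  rcases h with rfl | rfl <;> simp

/-- Only an increasing lift can be interpolated with the identity, so an orientation-reversing `b`
is first composed with the conjugation. -/
theorem exists_extension_of_circle_homeomorph (b : Circle ≃ₜ Circle) : ∃ κ B : ℂ → ℂ,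
    IsReflection κ ∧ ContinuousOn B (closedBall 0 1) ∧ InjOn B (closedBall 0 1) ∧
      B '' closedBall 0 1 = closedBall 0 1 ∧ (∀ z, ‖z‖ ≤ 1 / 2 → B z = z) ∧
      ∀ u : Circle, B u = κ (b u) := by
  obtain ⟨h, hc, hb, ⟨hm, hp⟩ | ⟨hm, hp⟩⟩ := exists_lift_circle_homeomorph b
  · obtain ⟨B, h1, h2, h3, h4, h5⟩ := exists_homeomorph_of_lift hc hm hp
    refine ⟨id, B, Or.inl rfl, h1, h2, h3, h4, fun u ↦ ?_⟩
    obtain ⟨t, rfl⟩ := Circle.exp_surjective u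
    rw [← hb, Circle.coe_exp, Circle.coe_exp, h5, id]
  · obtain ⟨B, h1, h2, h3, h4, h5⟩ := exists_homeomorph_of_lift (h := fun t ↦ -h t) hc.neg
      (fun s t hst ↦ neg_lt_neg (hm hst)) fun t ↦ by rw [hp]; ring
    refine ⟨_, B, Or.inr rfl, h1, h2, h3, h4, fun u ↦ ?_⟩
    obtain ⟨t, rfl⟩ := Circle.exp_surjective u
    rw [← hb, Circle.coe_exp, Circle.coe_exp, h5, ← Complex.exp_conj]
    simp

/-- A disk in the plane can be straightened near its centre, keeping its parametrization fixed near
the boundary. -/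
theorem exists_flatten {τ : ℂ → ℂ} (hτ : IsDisk univ τ 1) : ∃ Θ : ℂ ≃ₜ ℂ,
    (∀ z, 1 ≤ ‖z‖ → Θ z = z) ∧ ∃ κ, IsReflection κ ∧ ∃ c ≠ 0, ∃ r > 0,
      ∀ z ∈ ball (0 : ℂ) r, Θ z = c * κ (τ z - τ 0) := by
  have hU : IsOpen (τ '' ball 0 1) := hτ.isOpen_image_univ isOpen_ball subset_rfl
  have hw₀ : τ 0 ∈ τ '' ball 0 1 := ⟨0, by simp, rfl⟩
  have hbd : Bornology.IsBounded (τ '' ball 0 1) :=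
    (((isCompact_closedBall (0 : ℂ) 1).image_of_continuousOn hτ.cont).isBounded).subset
      (image_mono ball_subset_closedBall)
  obtain ⟨f, hf, him⟩ := exists_riemannMap hU hτ.isSimplyConnected hbd hw₀
  obtain ⟨Φ, Ψ, hΦc, hΨc, hΦm, hΨm, hΨΦ, hΦΨ, hΦe, hΨb⟩ := exists_caratheodory hτ hf him
  obtain ⟨γ, hγ, hγl, hγr⟩ := hf.exists_inverse hU him
  have hΦs : ∀ z : ℂ, ‖z‖ = 1 → ‖Φ z‖ = 1 := by
    intro z hz
    have hz1 : z ∈ closedBall (0 : ℂ) 1 := by rw [mem_closedBall_zero_iff, hz]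
    by_contra hne
    have h1 := hΨb (mem_ball_zero_iff.2
      (lt_of_le_of_ne (mem_closedBall_zero_iff.1 (hΦm hz1)) hne))
    rw [hΨΦ z hz1, mem_ball_zero_iff, hz] at h1
    exact lt_irrefl _ h1
  have hΨs : ∀ z : ℂ, ‖z‖ = 1 → ‖Ψ z‖ = 1 := by
    intro z hz
    have hz1 : z ∈ closedBall (0 : ℂ) 1 := by rw [mem_closedBall_zero_iff, hz]
    by_contra hne
    have h0 := mem_ball_zero_iff.2 (lt_of_le_of_ne (mem_closedBall_zero_iff.1 (hΨm hz1)) hne)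
    have h1 := hf.maps ⟨Ψ z, h0, rfl⟩
    have h2 := hΦe h0
    simp only at h2
    rw [← h2, hΦΨ z hz1, mem_ball_zero_iff, hz] at h1
    exact lt_irrefl _ h1
  have hcm : ∀ u : Circle, (u : ℂ) ∈ closedBall (0 : ℂ) 1 := fun u ↦ by
    rw [mem_closedBall_zero_iff, Circle.norm_coe]
  let b : Circle ≃ₜ Circle :=
    { toFun := fun u ↦ ⟨Φ u, mem_sphere_zero_iff_norm.2 (hΦs u (Circle.norm_coe u))⟩
      invFun := fun u ↦ ⟨Ψ u, mem_sphere_zero_iff_norm.2 (hΨs u (Circle.norm_coe u))⟩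
      left_inv := fun u ↦ Subtype.ext (hΨΦ u (hcm u))
      right_inv := fun u ↦ Subtype.ext (hΦΨ u (hcm u))
      continuous_toFun := (hΦc.comp_continuous continuous_subtype_val hcm).subtype_mk _
      continuous_invFun := (hΨc.comp_continuous continuous_subtype_val hcm).subtype_mk _ }
  obtain ⟨κ, B, hκ, hBc, hBi, hBim, hB0, hBb⟩ := exists_extension_of_circle_homeomorph b
  set c := deriv f (τ 0)
  have hc0 : c ≠ 0 := hf.deriv_ne _ hw₀
  have hγ0 : γ 0 = τ 0 := by
    have := hγl _ hw₀
    rwa [hf.zero] at this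
  have hγd : HasStrictDerivAt γ (deriv γ 0) 0 :=
    ((hγ.analyticOnNhd isOpen_ball) 0 (by simp)).hasStrictDerivAt
  have hcγ : c * deriv γ 0 = 1 := by
    have h1 : HasDerivAt (γ ∘ f) (deriv γ 0 * c) (τ 0) := by
      refine HasDerivAt.comp (τ 0) ?_ (hf.diff.differentiableAt (hU.mem_nhds hw₀)).hasDerivAt
      rw [hf.zero]; exact hγd.hasDerivAt
    have h2 : HasDerivAt (γ ∘ f) 1 (τ 0) := by
      refine (hasDerivAt_id (τ 0)).congr_of_eventuallyEq ?_
      filter_upwards [hU.mem_nhds hw₀] with z hz using hγl z hz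
    rw [mul_comm]; exact h1.unique h2
  -- `c * (γ w - τ 0)` has derivative `1` at `0`. Its local modification `E` turns the conformal
  -- coordinate `Φ` into `c * (τ z - τ 0)` near the centre and is the identity on the unit circle.
  obtain ⟨E, hE1, r₁, hr₁, hEr⟩ := exists_homeomorph_eq_near_zero
    (G := fun w ↦ c * (γ w - τ 0)) (by
      have := (HasStrictDerivAt.const_mul c (show HasStrictDerivAt (fun w ↦ γ w - τ 0)
        (deriv γ 0) 0 from hγd.sub_const _)).complexToReal_fderiv
      rw [hcγ, one_smul] at this
      exact this) (by simp [hγ0]) (one_pos)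
  have hE0 : E 0 = 0 := by rw [hEr 0 (by simpa using hr₁)]; simp [hγ0]
  have hEm : ∀ z, ‖E z‖ ≤ 1 ↔ ‖z‖ ≤ 1 := by
    intro z
    constructor
    · intro h; by_contra! hcon; rw [hE1 z hcon.le] at h; linarith
    · intro h; by_contra! hcon
      have := E.injective (hE1 (E z) hcon.le)
      rw [this] at hcon; linarith
  have hBl : ∀ z ∈ closedBall (0 : ℂ) 1, Function.invFunOn B (closedBall 0 1) (B z) = z :=
    fun z hz ↦ hBi.leftInvOn_invFunOn hz
  have hBr : ∀ z ∈ closedBall (0 : ℂ) 1, Function.invFunOn B (closedBall 0 1) z ∈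
      closedBall (0 : ℂ) 1 ∧ B (Function.invFunOn B (closedBall 0 1) z) = z := by
    intro z hz
    rw [← hBim] at hz
    exact ⟨Function.invFunOn_mem hz, Function.invFunOn_eq hz⟩
  have hBic : ContinuousOn (Function.invFunOn B (closedBall 0 1)) (closedBall 0 1) := by
    have := continuousOn_invFunOn_of_isCompact (isCompact_closedBall (0 : ℂ) 1) hBc hBi
    rwa [hBim] at this
  -- On the unit circle `E` is the identity and `B = κ ∘ Φ`, so `θ` fixes the circle. Near the
  -- centre `B` is the identity, so `θ = κ ∘ E ∘ Φ` there.
  set θ : ℂ → ℂ := fun z ↦ Function.invFunOn B (closedBall 0 1) (κ (E (Φ z))) with hθ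
  have hm : MapsTo (fun z ↦ κ (E (Φ z))) (closedBall 0 1) (closedBall 0 1) := by
    intro z hz
    rw [mem_closedBall_zero_iff, hκ.norm, hEm, ← mem_closedBall_zero_iff]
    exact hΦm hz
  obtain ⟨Θ, hΘ, hΘ1⟩ := exists_homeomorph_closedBall (θ := θ) (ρ := 1)
    (hBic.comp (hκ.continuous.comp_continuousOn (E.continuous.comp_continuousOn hΦc)) hm) (by
      intro x hx y hy hxy
      have h1 := congrArg B hxy
      simp only [hθ] at h1
      rw [(hBr _ (hm hx)).2, (hBr _ (hm hy)).2] at h1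
      have h2 := congrArg κ h1
      rw [hκ.involutive, hκ.involutive] at h2
      rw [← hΨΦ x hx, ← hΨΦ y hy, E.injective h2]) (by
      refine Subset.antisymm ?_ fun w hw ↦ ?_
      · rintro _ ⟨z, hz, rfl⟩
        exact (hBr _ (hm hz)).1
      · have h1 : κ (B w) ∈ closedBall (0 : ℂ) 1 := by
          rw [mem_closedBall_zero_iff, hκ.norm, ← mem_closedBall_zero_iff, ← hBim]; exact ⟨w, hw, rfl⟩
        have h2 : E.symm (κ (B w)) ∈ closedBall (0 : ℂ) 1 := by
          rw [mem_closedBall_zero_iff, ← hEm, E.apply_symm_apply, ← mem_closedBall_zero_iff]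
          exact h1
        refine ⟨Ψ (E.symm (κ (B w))), hΨm h2, ?_⟩
        simp only [hθ]
        rw [hΦΨ _ h2, E.apply_symm_apply, hκ.involutive, hBl w hw]) (by
      intro y hy
      have hy1 : y ∈ closedBall (0 : ℂ) 1 := by rw [mem_closedBall_zero_iff, hy]
      simp only [hθ]
      rw [hE1 _ (hΦs y hy).ge]
      have := hBb ⟨y, mem_sphere_zero_iff_norm.2 hy⟩
      change B y = κ (Φ y) at this
      rw [← this, hBl y hy1])
  have hΦ0 : Φ 0 = 0 := by
    have := hΦe (show (0 : ℂ) ∈ ball (0 : ℂ) 1 by simp)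
    simp only at this
    rw [this, hf.zero]
  have hΦca : ContinuousAt Φ 0 := hΦc.continuousAt (closedBall_mem_nhds 0 one_pos)
  have hev : ∀ᶠ z in 𝓝 (0 : ℂ), ‖Φ z‖ < r₁ ∧ ‖E (Φ z)‖ < 1 / 2 ∧ ‖z‖ < 1 := by
    have h1 : ContinuousAt (fun z ↦ ‖Φ z‖) 0 := hΦca.norm
    have h2 : ContinuousAt (fun z ↦ ‖E (Φ z)‖) 0 := (E.continuous.continuousAt.comp hΦca).norm
    refine (h1.eventually_lt continuousAt_const (by simpa [hΦ0] using hr₁)).and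
      ((h2.eventually_lt continuousAt_const (by simp [hΦ0, hE0])).and
        (continuous_norm.continuousAt.eventually_lt continuousAt_const (by simp)))
  obtain ⟨r, hr, hrs⟩ := Metric.eventually_nhds_iff_ball.1 hev
  refine ⟨Θ, hΘ1, κ, hκ, κ c, ?_, r, hr, fun z hz ↦ ?_⟩
  · rw [← norm_ne_zero_iff, hκ.norm]; exact norm_ne_zero_iff.2 hc0
  · obtain ⟨h1, h2, h3⟩ := hrs z hz
    have hzb : z ∈ ball (0 : ℂ) 1 := mem_ball_zero_iff.2 h3
    rw [hΘ (ball_subset_closedBall hzb), ← hκ.mul]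
    have h4 : c * (τ z - τ 0) = E (Φ z) := by
      rw [hEr _ (mem_ball_zero_iff.2 h1), hΦe hzb]
      simp only
      rw [hγl _ ⟨z, hzb, rfl⟩]
    have h5 : B (κ (E (Φ z))) = κ (E (Φ z)) := hB0 _ (by rw [hκ.norm]; exact h2.le)
    rw [h4]
    simp only [hθ]
    conv_lhs => rw [← h5]
    refine hBl _ ?_
    rw [mem_closedBall_zero_iff, hκ.norm]; linarith

/-! ### Alexander's trick and ambient isotopies supported in a ball. -/

theorem exists_homeomorph_of_param {Z Y : Type*} [TopologicalSpace Z] [TopologicalSpace Y]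
    [T2Space Y] {P U : Set Z} (hP : IsCompact P) (hUP : U ⊆ P) {κ : Z → Y} (hκ : ContinuousOn κ P)
    (hκi : InjOn κ P) (hU : IsOpen (κ '' U)) {T : Z → Z} (hT : ContinuousOn T P) (hTi : InjOn T P)
    (hTim : T '' P = P) (hTU : ∀ p ∈ P, p ∉ U → T p = p) :
    ∃ e : Y ≃ₜ Y, (∀ p ∈ P, e (κ p) = κ (T p)) ∧ ∀ y, y ∉ κ '' U → e y = y := by
  rcases P.eq_empty_or_nonempty with rfl | ⟨p₀, -⟩
  · exact ⟨Homeomorph.refl Y, by simp, fun _ _ ↦ rfl⟩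
  have : Nonempty Z := ⟨p₀⟩
  have hl : ∀ p ∈ P, Function.invFunOn κ P (κ p) = p := fun p hp ↦ hκi.leftInvOn_invFunOn hp
  have hTm : MapsTo T P P := fun p hp ↦ hTim.subset ⟨p, hp, rfl⟩
  have hinv := continuousOn_invFunOn_of_isCompact hP hκ hκi
  have hmi : MapsTo (Function.invFunOn κ P) (κ '' P) P := by
    rintro _ ⟨p, hp, rfl⟩; rw [hl p hp]; exact hp
  obtain ⟨e, he, he'⟩ := exists_homeomorph_of_isCompact (hP.image_of_continuousOn hκ)
    hU.isClosed_compl (by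
      rw [eq_univ_iff_forall]; intro y
      by_cases hy : y ∈ κ '' U
      · exact Or.inl (image_mono hUP hy)
      · exact Or.inr hy)
    (θ := fun y ↦ κ (T (Function.invFunOn κ P y)))
    (hκ.comp (hT.comp hinv hmi) (hTm.comp hmi)) (by
      rintro _ ⟨p, hp, rfl⟩ _ ⟨q, hq, rfl⟩ h
      simp only at h
      rw [hl p hp, hl q hq] at h
      rw [hTi hp hq (hκi (hTm hp) (hTm hq) h)]) (by
      ext y
      constructor
      · rintro ⟨_, ⟨p, hp, rfl⟩, rfl⟩
        simp only
        rw [hl p hp]; exact ⟨_, hTm hp, rfl⟩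
      · rintro ⟨p, hp, rfl⟩
        obtain ⟨q, hq, rfl⟩ := hTim.symm.subset hp
        exact ⟨κ q, ⟨q, hq, rfl⟩, by simp only; rw [hl q hq]⟩) (by
      rintro _ ⟨p, hp, rfl⟩ hy
      rw [hl p hp, hTU p hp fun h ↦ hy ⟨p, h, rfl⟩])
  refine ⟨e, fun p hp ↦ ?_, fun y hy ↦ he' y hy⟩
  rw [he ⟨p, hp, rfl⟩]
  simp only
  rw [hl p hp]

section Alexander

variable {E : Type*} [NormedAddCommGroup E] [NormedSpace ℝ E]

/-- The Alexander isotopy from the identity (at `a = 0`) to `Θ` (at `a = 1`). -/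
noncomputable def alexander (Θ : E → E) (a : ℝ) (z : E) : E := z + a • (Θ (a⁻¹ • z) - a⁻¹ • z)

theorem alexander_zero (Θ : E → E) (z : E) : alexander Θ 0 z = z := by simp [alexander]

theorem alexander_one (Θ : E → E) (z : E) : alexander Θ 1 z = Θ z := by simp [alexander]

theorem alexander_of_ne_zero (Θ : E → E) {a : ℝ} (ha : a ≠ 0) (z : E) :
    alexander Θ a z = a • Θ (a⁻¹ • z) := by
  rw [alexander, smul_sub, smul_inv_smul₀ ha]; abel

theorem alexander_eq_self {Θ : E → E} {ρ : ℝ} (h : ∀ z, ρ ≤ ‖z‖ → Θ z = z) {a : ℝ} (ha0 : 0 ≤ a)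
    (ha : a ≤ 1) {z : E} (hz : ρ ≤ ‖z‖) : alexander Θ a z = z := by
  rcases ha0.eq_or_lt with rfl | h0
  · exact alexander_zero Θ z
  · rw [alexander_of_ne_zero Θ h0.ne', h, smul_inv_smul₀ h0.ne']
    rw [norm_smul, norm_inv, Real.norm_of_nonneg ha0]
    refine hz.trans (le_mul_of_one_le_left (norm_nonneg z) ?_)
    exact (one_le_inv₀ h0).2 ha

theorem alexander_symm (Θ : E ≃ₜ E) (a : ℝ) (z : E) :
    alexander Θ.symm a (alexander Θ a z) = z := by
  by_cases ha : a = 0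
  · subst ha; rw [alexander_zero, alexander_zero]
  · rw [alexander_of_ne_zero _ ha, alexander_of_ne_zero _ ha, inv_smul_smul₀ ha,
      Θ.symm_apply_apply, smul_inv_smul₀ ha]

/-- The displacement of `Θ` is bounded because `Θ` is the identity far out. Scaled by `a` it tends
to `0`, which gives continuity at `a = 0`. -/
theorem continuous_alexander [ProperSpace E] {Θ : E → E} (hΘ : Continuous Θ) {ρ : ℝ}
    (h : ∀ z, ρ ≤ ‖z‖ → Θ z = z) : Continuous fun p : ℝ × E ↦ alexander Θ p.1 p.2 := by
  obtain ⟨C, hC⟩ : ∃ C, ∀ z, ‖Θ z - z‖ ≤ C := by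
    obtain ⟨C, hC⟩ := (isCompact_closedBall (0 : E) ρ).exists_bound_of_continuousOn
      (f := fun z ↦ Θ z - z) (by fun_prop)
    refine ⟨max C 0, fun z ↦ ?_⟩
    by_cases hz : ‖z‖ ≤ ρ
    · exact (hC z (mem_closedBall_zero_iff.2 hz)).trans (le_max_left _ _)
    · rw [h z (not_le.1 hz).le, sub_self, norm_zero]; exact le_max_right _ _
  refine continuous_snd.add (continuous_iff_continuousAt.2 fun p ↦ ?_)
  by_cases hp : p.1 = 0
  · rw [ContinuousAt, hp, zero_smul, tendsto_zero_iff_norm_tendsto_zero]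
    have : Tendsto (fun q : ℝ × E ↦ |q.1| * C) (𝓝 p) (𝓝 0) := by
      have : Continuous fun q : ℝ × E ↦ |q.1| * C := by fun_prop
      exact this.tendsto' _ _ (by simp [hp])
    refine squeeze_zero (fun _ ↦ norm_nonneg _) (fun q ↦ ?_) this
    rw [norm_smul, Real.norm_eq_abs]
    exact mul_le_mul_of_nonneg_left (hC _) (abs_nonneg _)
  · have h1 : ContinuousAt (fun q : ℝ × E ↦ q.1⁻¹ • q.2) p :=
      (continuousAt_fst.inv₀ hp).smul continuousAt_snd
    exact continuousAt_fst.smul ((hΘ.continuousAt.comp h1).sub h1)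

theorem alexander_image [ProperSpace E] (Θ : E ≃ₜ E) {ρ : ℝ}
    (h : ∀ z, ρ ≤ ‖z‖ → Θ z = z) {a : ℝ} (ha0 : 0 ≤ a) (ha : a ≤ 1) :
    alexander Θ a '' closedBall 0 ρ = closedBall 0 ρ := by
  have key : ∀ Θ : E ≃ₜ E, (∀ z, ρ ≤ ‖z‖ → Θ z = z) →
      MapsTo (alexander Θ a) (closedBall 0 ρ) (closedBall 0 ρ) := by
    intro Θ h z hz
    rw [mem_closedBall_zero_iff] at hz ⊢
    by_contra! hcon
    have h1 := alexander_symm Θ a (alexander Θ a z)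
    rw [alexander_eq_self h ha0 ha hcon.le] at h1
    have h2 := alexander_symm Θ a z
    rw [h1] at h2
    rw [h2] at hcon
    linarith
  have h' : ∀ z, ρ ≤ ‖z‖ → Θ.symm z = z := fun z hz ↦ by
    rw [Homeomorph.symm_apply_eq, h z hz]
  refine Subset.antisymm (key Θ h).image_subset fun z hz ↦ ?_
  exact ⟨_, key Θ.symm h' hz, alexander_symm Θ.symm a z⟩

theorem alexander_injective (Θ : E ≃ₜ E) (a : ℝ) : Function.Injective (alexander Θ a) :=
  (show Function.LeftInverse (alexander Θ.symm a) (alexander Θ a) from alexander_symm Θ a).injective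

end Alexander

namespace IsDisk

variable {E : Type*} [NormedAddCommGroup E] {Y Y' : Type*} [TopologicalSpace Y]
  [TopologicalSpace Y'] {S : Set Y} {χ : E → Y} {ρ : ℝ}

theorem image (h : IsDisk S χ ρ) (e : Y ≃ₜ Y') : IsDisk (e '' S) (fun z ↦ e (χ z)) ρ := by
  refine ⟨e.continuous.comp_continuousOn h.cont, e.injective.comp_injOn h.inj,
    fun z hz ↦ ⟨_, h.maps hz, rfl⟩, ?_⟩
  obtain ⟨O, hO, h1⟩ := h.isOpen
  refine ⟨e '' O, e.isOpenMap O hO, ?_⟩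
  rw [← image_inter e.injective, ← h1, image_image]

theorem image_of_eq {e : Y ≃ₜ Y} (h : IsDisk S χ ρ) (he : e '' S = S) :
    IsDisk S (fun z ↦ e (χ z)) ρ := by
  have := h.image e
  rwa [he] at this

/-- The Alexander isotopy in a ball, as an ambient isotopy. -/
theorem exists_isotopy [NormedSpace ℝ E] [ProperSpace E] [T2Space Y] (h : IsDisk univ χ ρ)
    (Θ : E ≃ₜ E) (hΘ : ∀ z, ρ ≤ ‖z‖ → Θ z = z) :
    ∃ F : unitInterval → Y ≃ₜ Y, Continuous (fun p : unitInterval × Y ↦ F p.1 p.2) ∧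
      (∀ y, F 0 y = y) ∧ (∀ z ∈ closedBall 0 ρ, F 1 (χ z) = χ (Θ z)) ∧
      ∀ y, y ∉ χ '' ball 0 ρ → F 1 y = y := by
  have hcont := continuous_alexander Θ.continuous hΘ
  have hA : ∀ a : unitInterval, ∃ e : Y ≃ₜ Y, (∀ z ∈ closedBall 0 ρ,
      e (χ z) = χ (alexander Θ a z)) ∧ ∀ y, y ∉ χ '' ball 0 ρ → e y = y := fun a ↦
    exists_homeomorph_of_param (isCompact_closedBall 0 ρ) ball_subset_closedBall h.cont h.inj
      (h.isOpen_image_univ isOpen_ball subset_rfl)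
      (hcont.comp (continuous_const.prodMk continuous_id)).continuousOn
      (alexander_injective Θ a).injOn (alexander_image Θ hΘ a.2.1 a.2.2) fun p _ hp' ↦
        alexander_eq_self hΘ a.2.1 a.2.2 (not_lt.1 fun hlt ↦ hp' (mem_ball_zero_iff.2 hlt))
  choose F hF hF' using hA
  refine ⟨F, ?_, fun y ↦ ?_, fun z hz ↦ ?_, hF' 1⟩
  · rw [← continuousOn_univ]
    have hcov : (univ : Set (unitInterval × Y)) =
        univ ×ˢ (χ '' closedBall 0 ρ) ∪ univ ×ˢ (χ '' ball 0 ρ)ᶜ := by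
      rw [← prod_union, eq_comm, eq_univ_iff_forall]
      rintro ⟨a, y⟩
      refine ⟨mem_univ _, ?_⟩
      by_cases hy : y ∈ χ '' ball 0 ρ
      · exact Or.inl (image_mono ball_subset_closedBall hy)
      · exact Or.inr hy
    rw [hcov]
    have hK : IsClosed (χ '' closedBall 0 ρ) :=
      ((isCompact_closedBall 0 ρ).image_of_continuousOn h.cont).isClosed
    refine ContinuousOn.union_of_isClosed ?_ ?_ (isClosed_univ.prod hK)
      (isClosed_univ.prod (h.isOpen_image_univ isOpen_ball subset_rfl).isClosed_compl)
    · have h1 : ContinuousOn (fun p : unitInterval × Y ↦ χ (alexander Θ p.1 (h.inv p.2)))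
          (univ ×ˢ (χ '' closedBall 0 ρ)) := by
        refine h.cont.comp (hcont.comp_continuousOn (ContinuousOn.prodMk
          (continuous_subtype_val.comp continuous_fst).continuousOn
          (h.continuousOn_inv.comp continuousOn_snd fun p hp ↦ hp.2))) fun p hp ↦ ?_
        exact (alexander_image Θ hΘ p.1.2.1 p.1.2.2).subset ⟨_, h.inv_mem hp.2, rfl⟩
      refine h1.congr ?_
      rintro ⟨a, _⟩ ⟨-, z, hz, rfl⟩
      simp only
      rw [hF a z hz, h.inv_apply hz]
    · exact continuousOn_snd.congr fun p hp ↦ hF' p.1 p.2 hp.2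
  · by_cases hy : y ∈ χ '' ball 0 ρ
    · obtain ⟨z, hz, rfl⟩ := hy
      rw [hF 0 z (ball_subset_closedBall hz)]
      simp [alexander_zero]
    · exact hF' 0 y hy
  · rw [hF 1 z hz]; simp [alexander_one]

end IsDisk

/-! ### Matching disks in a surface with a collar. -/

/-- Every homeomorphism of a disk in `B` that is the identity near the boundary extends to a
homeomorphism of the ambient space preserving `B`. -/
def Transportable {Y : Type*} [TopologicalSpace Y] (B : Set Y) : Prop :=
  ∀ (χ : ℂ → Y) (ρ : ℝ), IsDisk B χ ρ → ∀ Θ : ℂ ≃ₜ ℂ, (∀ z, ρ ≤ ‖z‖ → Θ z = z) →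
    ∃ e : Y ≃ₜ Y, e '' B = B ∧ ∀ z ∈ closedBall 0 ρ, e (χ z) = χ (Θ z)

/-- The Alexander isotopy is run along the collar: it is `Θ` on the surface itself and has faded to
the identity at the inner end, so it extends by the identity. -/
theorem transportable_of_collar {Y : Type*} [TopologicalSpace Y] [T2Space Y] {B : Set Y}
    (hBc : IsCompact B) {c : Y × ℝ → Y} (hc : ContinuousOn c (B ×ˢ Icc 0 1))
    (hci : InjOn c (B ×ˢ Icc 0 1)) (hc0 : ∀ y ∈ B, c (y, 0) = y)
    (ho : IsOpen (c '' (B ×ˢ Ico 0 1))) : Transportable B := by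
  intro χ ρ h Θ hΘ
  have hcont := continuous_alexander Θ.continuous hΘ
  have hmaps : MapsTo (fun p : ℂ × ℝ ↦ (χ p.1, p.2)) (closedBall 0 ρ ×ˢ Icc 0 1) (B ×ˢ Icc 0 1) :=
    fun p hp ↦ ⟨h.maps hp.1, hp.2⟩
  have hχc : ContinuousOn (fun p : ℂ × ℝ ↦ (χ p.1, p.2)) (closedBall 0 ρ ×ˢ Icc 0 1) :=
    (h.cont.comp continuousOn_fst fun p hp ↦ hp.1).prodMk continuousOn_snd
  have hχi : InjOn (fun p : ℂ × ℝ ↦ (χ p.1, p.2)) (closedBall 0 ρ ×ˢ Icc 0 1) := by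
    rintro ⟨z, s⟩ hz ⟨w, t⟩ hw h'
    simp only [Prod.mk.injEq] at h'
    exact Prod.ext (h.inj hz.1 hw.1 h'.1) h'.2
  have hopen : IsOpen ((fun p : ℂ × ℝ ↦ c (χ p.1, p.2)) '' (ball 0 ρ ×ˢ Ico 0 1)) := by
    obtain ⟨O, hO, h1⟩ := h.isOpen
    have hne : (fun p : ℂ × ℝ ↦ c (χ p.1, p.2)) '' (ball 0 ρ ×ˢ Ico 0 1) =
        c '' (B ×ˢ Ico 0 1) ∩ (c '' ((B \ O) ×ˢ Icc 0 1))ᶜ := by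
      ext y
      constructor
      · rintro ⟨⟨z, s⟩, ⟨hz, hs⟩, rfl⟩
        have hzO : χ z ∈ O ∩ B := h1.subset ⟨z, hz, rfl⟩
        refine ⟨⟨(χ z, s), ⟨hzO.2, hs⟩, rfl⟩, ?_⟩
        rintro ⟨⟨y', s'⟩, ⟨hy', hs'⟩, he⟩
        have := hci ⟨hy'.1, hs'⟩ ⟨hzO.2, Ico_subset_Icc_self hs⟩ he
        rw [Prod.mk.injEq] at this
        exact hy'.2 (this.1 ▸ hzO.1)
      · rintro ⟨⟨⟨y', s⟩, ⟨hy', hs⟩, rfl⟩, hn⟩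
        have hyO : y' ∈ O := by
          by_contra hcon
          exact hn ⟨(y', s), ⟨⟨hy', hcon⟩, Ico_subset_Icc_self hs⟩, rfl⟩
        obtain ⟨z, hz, rfl⟩ := h1.symm.subset ⟨hyO, hy'⟩
        exact ⟨(z, s), ⟨hz, hs⟩, rfl⟩
    rw [hne]
    refine ho.inter (IsClosed.isOpen_compl (self := ?_))
    refine (IsCompact.image_of_continuousOn ((hBc.diff hO).prod isCompact_Icc)
      (hc.mono (prod_mono_left sdiff_subset))).isClosed
  have hT : ∀ s : ℝ, s ∈ Icc (0 : ℝ) 1 → 0 ≤ 1 - s ∧ 1 - s ≤ 1 := fun s hs ↦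
    ⟨by linarith [hs.2], by linarith [hs.1]⟩
  obtain ⟨e, he, he'⟩ := exists_homeomorph_of_param (P := closedBall (0 : ℂ) ρ ×ˢ Icc (0 : ℝ) 1)
    (U := ball (0 : ℂ) ρ ×ˢ Ico (0 : ℝ) 1) ((isCompact_closedBall 0 ρ).prod isCompact_Icc)
    (prod_mono ball_subset_closedBall Ico_subset_Icc_self)
    (hc.comp hχc hmaps) (hci.comp hχi hmaps) hopen
    (T := fun p ↦ (alexander Θ (1 - p.2) p.1, p.2))
    (Continuous.continuousOn ((hcont.comp ((continuous_const.sub continuous_snd).prodMk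
      continuous_fst)).prodMk continuous_snd)) (by
      rintro ⟨z, s⟩ - ⟨w, t⟩ - h'
      simp only [Prod.mk.injEq] at h'
      obtain ⟨h1, rfl⟩ := h'
      rw [alexander_injective Θ _ h1]) (by
      ext ⟨z, s⟩
      constructor
      · rintro ⟨⟨w, t⟩, ⟨hw, ht⟩, h'⟩
        simp only [Prod.mk.injEq] at h'
        obtain ⟨rfl, rfl⟩ := h'
        exact ⟨(alexander_image Θ hΘ (hT t ht).1 (hT t ht).2).subset ⟨_, hw, rfl⟩, ht⟩
      · rintro ⟨hz, hs⟩
        obtain ⟨w, hw, hwz⟩ := (alexander_image Θ hΘ (hT s hs).1 (hT s hs).2).symm.subset hz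
        exact ⟨(w, s), ⟨hw, hs⟩, by simp only; rw [hwz]⟩) (by
      rintro ⟨z, s⟩ ⟨hz, hs⟩ hn
      simp only [Prod.mk.injEq, and_true]
      rcases hs.2.lt_or_eq with h1 | rfl
      · exact alexander_eq_self hΘ (hT s hs).1 (hT s hs).2
          (not_lt.1 fun hlt ↦ hn ⟨mem_ball_zero_iff.2 hlt, hs.1, h1⟩)
      · rw [sub_self, alexander_zero])
  have he0 : ∀ z ∈ closedBall (0 : ℂ) ρ, e (χ z) = χ (Θ z) := by
    intro z hz
    have h0 : (0 : ℝ) ∈ Icc (0 : ℝ) 1 := ⟨le_rfl, zero_le_one⟩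
    have := he (z, 0) ⟨hz, h0⟩
    simp only [Function.comp_apply] at this
    rw [hc0 _ (h.maps hz), sub_zero, alexander_one] at this
    rw [this, hc0]
    refine h.maps ?_
    rw [← alexander_one Θ z]
    exact (alexander_image Θ hΘ zero_le_one le_rfl).subset ⟨_, hz, rfl⟩
  have hmap : ∀ y ∈ B, y ∈ χ '' closedBall 0 ρ ∨ e y = y := by
    intro y hy
    by_cases hn : y ∈ (fun p : ℂ × ℝ ↦ c (χ p.1, p.2)) '' (ball 0 ρ ×ˢ Ico 0 1)
    · obtain ⟨⟨z, s⟩, ⟨hz, hs⟩, rfl⟩ := hn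
      have hz' := ball_subset_closedBall hz
      have h0 : (0 : ℝ) ∈ Icc (0 : ℝ) 1 := ⟨le_rfl, zero_le_one⟩
      have := hci ⟨hy, h0⟩ ⟨h.maps hz', Ico_subset_Icc_self hs⟩ (hc0 _ hy)
      rw [Prod.mk.injEq] at this
      exact Or.inl ⟨z, hz', this.1.symm⟩
    · exact Or.inr (he' y hn)
  refine ⟨e, Subset.antisymm ?_ ?_, he0⟩
  · rintro _ ⟨y, hy, rfl⟩
    rcases hmap y hy with ⟨z, hz, rfl⟩ | h1
    · rw [he0 z hz]
      refine h.maps ?_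
      rw [← alexander_one Θ z]
      exact (alexander_image Θ hΘ zero_le_one le_rfl).subset ⟨_, hz, rfl⟩
    · rwa [h1]
  · intro y hy
    rcases hmap y hy with ⟨z, hz, rfl⟩ | h1
    · obtain ⟨w, hw, hwz⟩ := (alexander_image Θ hΘ zero_le_one le_rfl).symm.subset hz
      rw [alexander_one] at hwz
      exact ⟨χ w, h.maps hw, by rw [he0 w hw, hwz]⟩
    · exact ⟨y, hy, h1⟩

/-- A translation by `z₁`, faded out linearly in the radius; the condition `‖z₁‖ < ρ` makes the
displacement a contraction. -/
theorem exists_homeomorph_apply_zero {E : Type*} [NormedAddCommGroup E] [NormedSpace ℝ E]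
    [CompleteSpace E] {ρ : ℝ} {z₁ : E} (hz₁ : ‖z₁‖ < ρ) :
    ∃ Θ : E ≃ₜ E, (∀ z, ρ ≤ ‖z‖ → Θ z = z) ∧ Θ 0 = z₁ := by
  have hρ : 0 < ρ := (norm_nonneg z₁).trans_lt hz₁
  set u : E → E := fun x ↦ max 0 (1 - ‖x‖ / ρ) • z₁ with hu
  have hul : LipschitzWith (‖z₁‖ / ρ).toNNReal u := by
    refine LipschitzWith.of_dist_le_mul fun x y ↦ ?_
    rw [dist_eq_norm, dist_eq_norm, Real.coe_toNNReal _ (by positivity)]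
    simp only [hu]
    rw [← sub_smul, norm_smul]
    have h1 : ‖max 0 (1 - ‖x‖ / ρ) - max 0 (1 - ‖y‖ / ρ)‖ ≤ ‖x - y‖ / ρ := by
      refine (abs_max_sub_max_le_max _ _ _ _).trans ?_
      rw [sub_self, abs_zero, max_eq_right (abs_nonneg _)]
      rw [show 1 - ‖x‖ / ρ - (1 - ‖y‖ / ρ) = -((‖x‖ - ‖y‖) / ρ) by ring, abs_neg, abs_div,
        abs_of_pos hρ]
      gcongr
      exact abs_norm_sub_norm_le x y
    calc _ ≤ ‖x - y‖ / ρ * ‖z₁‖ := by gcongr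
      _ = _ := by ring
  obtain ⟨e, he⟩ := exists_homeomorph_add_of_lipschitzWith hul (by
    rw [Real.toNNReal_lt_one, div_lt_one hρ]; exact hz₁)
  refine ⟨e, fun z hz ↦ ?_, ?_⟩
  · have : 1 ≤ ‖z‖ / ρ := by rwa [one_le_div hρ]
    rw [he]; simp only [hu]; rw [max_eq_left (by linarith)]; simp
  · rw [he]; simp [hu]

/-- Multiply by `exp (q * log μ)`, where `q` falls from `1` to `0` between the radii `R` and `ρ`. As
`‖μ‖ ≤ 1`, the modulus of this factor does not decrease with the radius, so circles go to circles of
strictly increasing radius. -/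
theorem exists_homeomorph_eq_mul {R ρ : ℝ} (hR : 0 < R) (hRρ : R < ρ) {μ : ℂ} (hμ : μ ≠ 0)
    (hμ1 : ‖μ‖ ≤ 1) : ∃ Θ : ℂ ≃ₜ ℂ, (∀ z, ρ ≤ ‖z‖ → Θ z = z) ∧
      ∀ z, ‖z‖ ≤ R → Θ z = μ * z := by
  set q : ℝ → ℝ := fun t ↦ max 0 (min 1 ((ρ - t) / (ρ - R))) with hq
  have hρR : 0 < ρ - R := sub_pos.2 hRρ
  have hqR : ∀ t, t ≤ R → q t = 1 := fun t ht ↦ by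
    have : 1 ≤ (ρ - t) / (ρ - R) := by rw [one_le_div hρR]; linarith
    simp [hq, this]
  have hqρ : ∀ t, ρ ≤ t → q t = 0 := fun t ht ↦
    max_eq_left ((min_le_right _ _).trans (div_nonpos_of_nonpos_of_nonneg (by linarith) hρR.le))
  have hqa : Antitone q := fun s t hst ↦ by
    simp only [hq]; gcongr
  have hqc : Continuous q := by fun_prop
  set lam : ℝ := -Real.log ‖μ‖ with hlam
  have hlam0 : 0 ≤ lam := by
    rw [hlam, Left.nonneg_neg_iff]; exact Real.log_nonpos (norm_nonneg _) hμ1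
  set θ : ℂ → ℂ := fun z ↦ z * Complex.exp (q ‖z‖ * Complex.log μ) with hθ
  have hexpn : ∀ t : ℝ, ‖Complex.exp (t * Complex.log μ)‖ = Real.exp (-(lam * t)) := by
    intro t
    rw [Complex.norm_exp]
    simp [Complex.log_re, hlam, mul_comm]
  have hn : ∀ z, ‖θ z‖ = ‖z‖ * Real.exp (-(lam * q ‖z‖)) := fun z ↦ by
    simp only [hθ]; rw [norm_mul, hexpn]
  have hmono : StrictMonoOn (fun t ↦ t * Real.exp (-(lam * q t))) (Ici 0) := by
    intro s hs t ht hst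
    have h1 : Real.exp (-(lam * q s)) ≤ Real.exp (-(lam * q t)) :=
      Real.exp_le_exp.2 (neg_le_neg (mul_le_mul_of_nonneg_left (hqa hst.le) hlam0))
    calc s * Real.exp (-(lam * q s)) < t * Real.exp (-(lam * q s)) :=
          mul_lt_mul_of_pos_right hst (Real.exp_pos _)
      _ ≤ t * Real.exp (-(lam * q t)) := mul_le_mul_of_nonneg_left h1 ht
  have hfix : ∀ z, ρ ≤ ‖z‖ → θ z = z := fun z hz ↦ by simp [hθ, hqρ _ hz]
  obtain ⟨Θ, hΘ, hΘ'⟩ := exists_homeomorph_closedBall (θ := θ) (ρ := ρ)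
    (Continuous.continuousOn (by fun_prop)) (by
      intro z _ w _ hzw
      have h1 : ‖z‖ = ‖w‖ := hmono.injOn (norm_nonneg z) (norm_nonneg w) (by
        rw [← hn, ← hn, hzw])
      simp only [hθ, h1] at hzw
      exact mul_right_cancel₀ (Complex.exp_ne_zero _) hzw) (by
      refine Subset.antisymm ?_ fun w hw ↦ ?_
      · rintro _ ⟨z, hz, rfl⟩
        rw [mem_closedBall_zero_iff] at hz ⊢
        rw [hn]
        refine (mul_le_of_le_one_right (norm_nonneg z) ?_).trans hz
        rw [Real.exp_le_one_iff, neg_nonpos]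
        exact mul_nonneg hlam0 (le_max_left _ _)
      · rw [mem_closedBall_zero_iff] at hw
        have hcont : ContinuousOn (fun t ↦ t * Real.exp (-(lam * q t))) (Icc 0 ρ) := by fun_prop
        obtain ⟨t, ht, htw⟩ := intermediate_value_Icc (hR.trans hRρ).le hcont
          (show ‖w‖ ∈ Icc _ _ from ⟨by simp, by simpa [hqρ ρ le_rfl] using hw⟩)
        simp only at htw
        have hnorm : ‖w * Complex.exp (-(q t * Complex.log μ))‖ = t := by
          rw [norm_mul, Complex.exp_neg, norm_inv, hexpn, ← htw, mul_assoc,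
            mul_inv_cancel₀ (Real.exp_ne_zero _), mul_one]
        refine ⟨w * Complex.exp (-(q t * Complex.log μ)), ?_, ?_⟩
        · rw [mem_closedBall_zero_iff, hnorm]; exact ht.2
        · simp only [hθ]
          rw [hnorm, mul_assoc, ← Complex.exp_add, neg_add_cancel, Complex.exp_zero, mul_one])
    fun y hy ↦ hfix y hy.ge
  refine ⟨Θ, hΘ', fun z hz ↦ ?_⟩
  rw [hΘ (mem_closedBall_zero_iff.2 (hz.trans hRρ.le))]
  simp only [hθ]
  rw [hqR _ hz, Complex.ofReal_one, one_mul, Complex.exp_log hμ, mul_comm]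

theorem Homeomorph.image_trans_eq {Y : Type*} [TopologicalSpace Y] {B : Set Y} {e e' : Y ≃ₜ Y}
    (h : e '' B = B) (h' : e' '' B = B) : (e.trans e') '' B = B := by
  have : ⇑(e.trans e') = e' ∘ e := rfl
  rw [this, image_comp, h, h']

theorem Homeomorph.image_symm_eq {Y : Type*} [TopologicalSpace Y] {B : Set Y} {e : Y ≃ₜ Y}
    (h : e '' B = B) : e.symm '' B = B := by
  conv_lhs => rw [← h]
  rw [← image_comp]; simp

/-- Disks in a transportable set whose images share a point up to a homeomorphism are matched by a
homeomorphism, up to a reflection. -/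
theorem Transportable.exists_match {Y : Type*} [TopologicalSpace Y] [T2Space Y] {B : Set Y}
    (hB : Transportable B) {χ χ' : ℂ → Y} {ρ R : ℝ} (hR : 0 < R) (hRρ : R < ρ)
    (h : IsDisk B χ ρ) (h' : IsDisk B χ' ρ) {e₀ : Y ≃ₜ Y} (he₀ : e₀ '' B = B) {z₁ z₂ : ℂ}
    (hz₁ : ‖z₁‖ < ρ) (hz₂ : ‖z₂‖ < ρ) (heq : e₀ (χ z₁) = χ' z₂) :
    ∃ (e : Y ≃ₜ Y) (κ : ℂ → ℂ), IsReflection κ ∧ e '' B = B ∧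
      ∀ z ∈ closedBall (0 : ℂ) R, e (χ z) = χ' (κ z) := by
  have hρ : 0 < ρ := hR.trans hRρ
  have h0ρ : (0 : ℂ) ∈ closedBall (0 : ℂ) ρ := mem_closedBall_self hρ.le
  obtain ⟨Θ₁, hΘ₁, hΘ₁0⟩ := exists_homeomorph_apply_zero hz₁
  obtain ⟨Θ₂, hΘ₂, hΘ₂0⟩ := exists_homeomorph_apply_zero hz₂
  obtain ⟨e₁, he₁, he₁'⟩ := hB χ ρ h Θ₁ hΘ₁
  obtain ⟨e₂, he₂, he₂'⟩ := hB χ' ρ h' Θ₂ hΘ₂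
  obtain ⟨eA, heA, heA0⟩ : ∃ eA : Y ≃ₜ Y, eA '' B = B ∧ eA (χ 0) = χ' 0 := by
    refine ⟨(e₁.trans e₀).trans e₂.symm, Homeomorph.image_trans_eq
      (Homeomorph.image_trans_eq he₁ he₀) (Homeomorph.image_symm_eq he₂), ?_⟩
    simp only [Homeomorph.trans_apply]
    rw [he₁' 0 h0ρ, hΘ₁0, heq, Homeomorph.symm_apply_eq, he₂' 0 h0ρ, hΘ₂0]
  set χ₂ : ℂ → Y := fun z ↦ eA (χ z) with hχ₂
  have h2 : IsDisk B χ₂ ρ := h.image_of_eq heA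
  obtain ⟨O, hO, hOB⟩ := h'.isOpen
  have hO0 : χ₂ 0 ∈ O := by
    have : χ₂ 0 = χ' 0 := heA0
    rw [this]; exact (hOB.subset ⟨0, by simpa using hρ, rfl⟩).1
  obtain ⟨r₀, hr₀, hr₀O⟩ := Metric.eventually_nhds_iff_ball.1
    ((h2.cont.continuousAt (closedBall_mem_nhds 0 hρ)).eventually (hO.mem_nhds hO0))
  obtain ⟨r, hr, hrr, hrρ⟩ : ∃ r, 0 < r ∧ r < r₀ ∧ r < ρ :=
    ⟨min r₀ ρ / 2, by positivity, by have := min_le_left r₀ ρ; linarith,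
      by have := min_le_right r₀ ρ; linarith⟩
  have hsub : ∀ z ∈ closedBall (0 : ℂ) r, χ₂ z ∈ χ' '' ball 0 ρ := fun z hz ↦ by
    rw [hOB]
    exact ⟨hr₀O z (closedBall_subset_ball hrr hz),
      h2.maps (closedBall_subset_closedBall hrρ.le hz)⟩
  have hsub' : ∀ z ∈ closedBall (0 : ℂ) r, χ₂ z ∈ χ' '' closedBall 0 ρ := fun z hz ↦
    image_mono ball_subset_closedBall (hsub z hz)
  have hscale : ∀ z ∈ closedBall (0 : ℂ) 1, (r : ℂ) * z ∈ closedBall (0 : ℂ) r := fun z hz ↦ by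
    rw [mem_closedBall_zero_iff] at hz ⊢
    rw [norm_mul, Complex.norm_real, Real.norm_of_nonneg hr.le]
    exact mul_le_of_le_one_right hr.le hz
  have hrc : (r : ℂ) ≠ 0 := by simpa using hr.ne'
  have h2r : IsDisk B χ₂ r := h2.mono hrρ.le
  -- With the centres aligned, a small part of the first disk is seen in the coordinates of the
  -- second one as a planar disk, to which the straightening applies.
  set τ : ℂ → ℂ := fun z ↦ h'.inv (χ₂ (r * z)) with hτdef
  have hτ' : ∀ z ∈ closedBall (0 : ℂ) 1, χ' (τ z) = χ₂ (r * z) := fun z hz ↦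
    h'.apply_inv (hsub' _ (hscale z hz))
  have hτ : IsDisk univ τ 1 := by
    refine ⟨?_, fun z hz w hw hzw ↦ ?_, mapsTo_univ _ _, ?_⟩
    · refine h'.continuousOn_inv.comp (h2r.cont.comp (by fun_prop) hscale) fun z hz ↦
        hsub' _ (hscale z hz)
    · have := congrArg χ' hzw
      rw [hτ' z hz, hτ' w hw] at this
      exact mul_left_cancel₀ hrc (h2r.inj (hscale z hz) (hscale w hw) this)
    · obtain ⟨O₂, hO₂, hO₂B⟩ := h2r.isOpen
      refine ⟨ball 0 ρ ∩ χ' ⁻¹' O₂, (h'.cont.mono ball_subset_closedBall).isOpen_inter_preimage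
        isOpen_ball hO₂, ?_⟩
      rw [inter_univ]
      ext z
      constructor
      · rintro ⟨w, hw, rfl⟩
        have hw1 := ball_subset_closedBall hw
        refine ⟨?_, ?_⟩
        · obtain ⟨v, hv, hv'⟩ := hsub _ (hscale w hw1)
          simp only [hτdef]
          rw [← hv', h'.inv_apply (ball_subset_closedBall hv)]; exact hv
        · rw [mem_preimage, hτ' w hw1]
          refine (hO₂B.subset ⟨_, ?_, rfl⟩).1
          rw [mem_ball_zero_iff] at hw ⊢
          rw [norm_mul, Complex.norm_real, Real.norm_of_nonneg hr.le]
          exact mul_lt_of_lt_one_right hr hw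
      · rintro ⟨hz, hzO⟩
        obtain ⟨w, hw, hwz⟩ := hO₂B.symm.subset ⟨hzO, h'.maps (ball_subset_closedBall hz)⟩
        refine ⟨w / r, ?_, ?_⟩
        · rw [mem_ball_zero_iff] at hw ⊢
          rwa [norm_div, Complex.norm_real, Real.norm_of_nonneg hr.le, div_lt_one hr]
        · simp only [hτdef]
          rw [mul_div_cancel₀ _ hrc, hwz, h'.inv_apply (ball_subset_closedBall hz)]
  have hτ0 : τ 0 = 0 := by
    have : χ₂ 0 = χ' 0 := heA0
    simp only [hτdef]
    rw [mul_zero, this, h'.inv_apply h0ρ]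
  obtain ⟨Θ, hΘ, κ, hκ, c, hc, r', hr', hΘr⟩ := exists_flatten hτ
  have hκ0 : κ 0 = 0 := by simpa using hκ.ofReal 0
  have hΘ0 : Θ 0 = 0 := by
    rw [hΘr 0 (by simpa using hr'), sub_self, hκ0, mul_zero]
  let sc : ℂ ≃ₜ ℂ := Homeomorph.mulLeft₀ (r : ℂ) hrc
  -- Reparametrizing by the inverse of the straightening makes the first disk, read in the second,
  -- equal to `μ * κ z` near the centre.
  obtain ⟨e₃, he₃, he₃'⟩ := hB χ₂ r h2r ((sc.symm.trans Θ.symm).trans sc) (by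
    intro z hz
    simp only [Homeomorph.trans_apply]
    have : sc.symm z = z / r := by
      rw [Homeomorph.symm_apply_eq]; exact (mul_div_cancel₀ z hrc).symm
    have h1 : Θ.symm (z / r) = z / r := by
      rw [Homeomorph.symm_apply_eq, hΘ]
      rwa [norm_div, Complex.norm_real, Real.norm_of_nonneg hr.le, one_le_div hr]
    rw [this, h1]; exact mul_div_cancel₀ z hrc)
  have he₃w : ∀ w ∈ closedBall (0 : ℂ) 1, e₃ (χ₂ (r * w)) = χ₂ (r * Θ.symm w) := by
    intro w hw
    rw [he₃' _ (hscale w hw)]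
    simp only [Homeomorph.trans_apply]
    have : sc.symm (r * w) = w := by rw [Homeomorph.symm_apply_eq]; rfl
    rw [this]; rfl
  obtain ⟨s, hs, hss⟩ := Metric.eventually_nhds_iff_ball.1
    ((Θ.symm.continuous.continuousAt (x := 0)).eventually (ball_mem_nhds _
      (lt_min hr' one_pos)))
  have hΘs0 : Θ.symm 0 = 0 := by rw [Homeomorph.symm_apply_eq, hΘ0]
  rw [hΘs0] at hss
  set μ : ℂ := κ c⁻¹ * κ (r : ℂ)⁻¹ with hμ
  have hκne : ∀ z, z ≠ 0 → κ z ≠ 0 := fun z hz ↦ by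
    rw [← norm_ne_zero_iff, hκ.norm]; exact norm_ne_zero_iff.2 hz
  have hμ0 : μ ≠ 0 := mul_ne_zero (hκne _ (inv_ne_zero hc)) (hκne _ (inv_ne_zero hrc))
  have key : ∀ z : ℂ, ‖z‖ < r * min s 1 → e₃ (χ₂ z) = χ' (μ * κ z) := by
    intro z hz
    have hz1 : ‖z / r‖ < min s 1 := by
      rw [norm_div, Complex.norm_real, Real.norm_of_nonneg hr.le, div_lt_iff₀ hr, mul_comm]
      exact hz
    have hw1 : z / r ∈ closedBall (0 : ℂ) 1 :=
      mem_closedBall_zero_iff.2 (hz1.le.trans (min_le_right _ _))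
    have hx := hss _ (mem_ball_zero_iff.2 (hz1.trans_le (min_le_left _ _)))
    rw [dist_zero_right] at hx
    have e1 := he₃w _ hw1
    rw [mul_div_cancel₀ z hrc] at e1
    have e2 := hΘr _ (mem_ball_zero_iff.2 (hx.trans_le (min_le_left _ _)))
    rw [Θ.apply_symm_apply, hτ0, sub_zero] at e2
    have e3 : τ (Θ.symm (z / r)) = μ * κ z := by
      have h4 : c⁻¹ * (r : ℂ)⁻¹ * z = κ (τ (Θ.symm (z / r))) := by
        rw [← inv_mul_cancel_left₀ hc (κ _), ← e2]; field_simp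
      rw [hμ, ← hκ.mul, ← hκ.mul, h4, hκ.involutive]
    rw [e1, ← e3, hτ' _ (mem_closedBall_zero_iff.2 (hx.le.trans (min_le_right _ _)))]
  set χ₃ : ℂ → Y := fun z ↦ e₃ (χ₂ z) with hχ₃
  have h3 : IsDisk B χ₃ ρ := h2.image_of_eq he₃
  -- The two disks agree only near the centre. Shrinking the ball of radius `R` by `a` in the first
  -- and by `μ * a` in the second moves it into this range; `e₅.symm` then undoes the second
  -- shrinking.
  obtain ⟨a, ha, ha1, haR, haμ⟩ : ∃ a : ℝ, 0 < a ∧ a ≤ 1 ∧ a * R < r * min s 1 ∧ ‖μ‖ * a ≤ 1 := by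
    have hμn : 0 < ‖μ‖ := norm_pos_iff.2 hμ0
    have hm : 0 < r * min s 1 := by positivity
    refine ⟨min 1 (min (r * min s 1 / (2 * R)) ‖μ‖⁻¹), by positivity, min_le_left _ _, ?_, ?_⟩
    · have : min 1 (min (r * min s 1 / (2 * R)) ‖μ‖⁻¹) ≤ r * min s 1 / (2 * R) :=
        (min_le_right _ _).trans (min_le_left _ _)
      have h4 : r * min s 1 / (2 * R) * R = r * min s 1 / 2 := by field_simp
      nlinarith
    · have : min 1 (min (r * min s 1 / (2 * R)) ‖μ‖⁻¹) ≤ ‖μ‖⁻¹ :=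
        (min_le_right _ _).trans (min_le_right _ _)
      calc _ ≤ ‖μ‖ * ‖μ‖⁻¹ := by gcongr
        _ = 1 := mul_inv_cancel₀ hμn.ne'
  have hac : (a : ℂ) ≠ 0 := by simpa using ha.ne'
  have han : ‖(a : ℂ)‖ = a := by rw [Complex.norm_real, Real.norm_of_nonneg ha.le]
  obtain ⟨Θ₄, hΘ₄, hΘ₄'⟩ := exists_homeomorph_eq_mul hR hRρ hac (by rw [han]; exact ha1)
  obtain ⟨Θ₅, hΘ₅, hΘ₅'⟩ := exists_homeomorph_eq_mul hR hRρ (mul_ne_zero hμ0 hac)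
    (by rw [norm_mul, han]; exact haμ)
  obtain ⟨e₄, he₄, he₄'⟩ := hB χ₃ ρ h3 Θ₄ hΘ₄
  obtain ⟨e₅, he₅, he₅'⟩ := hB χ' ρ h' Θ₅ hΘ₅
  refine ⟨((eA.trans e₃).trans e₄).trans e₅.symm, κ, hκ, Homeomorph.image_trans_eq
    (Homeomorph.image_trans_eq (Homeomorph.image_trans_eq heA he₃) he₄)
    (Homeomorph.image_symm_eq he₅), fun z hz ↦ ?_⟩
  rw [mem_closedBall_zero_iff] at hz
  simp only [Homeomorph.trans_apply]
  rw [Homeomorph.symm_apply_eq]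
  have e1 := he₄' z (mem_closedBall_zero_iff.2 (hz.trans hRρ.le))
  have e2 := he₅' (κ z) (mem_closedBall_zero_iff.2 (by rw [hκ.norm]; exact hz.trans hRρ.le))
  rw [hΘ₄' z hz] at e1
  rw [hΘ₅' _ (by rwa [hκ.norm])] at e2
  have e3 := key (a * z) (by
    rw [norm_mul, han]; exact (mul_le_mul_of_nonneg_left hz ha.le).trans_lt haR)
  have e4 : χ₃ (a * z) = χ' (μ * a * κ z) := by
    simp only [hχ₃]
    rw [e3, hκ.mul (a : ℂ) z, hκ.ofReal, ← mul_assoc]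
  rw [e2, ← e4, ← e1]

/-! ### The model handlebody: walls, depth and collar. -/

/-- A punctured disk of radius `R` with `g` unit holes, times the unit interval. -/
def solid (g : ℕ) (R : ℝ) : Set (ℂ × ℝ) :=
  {p | ‖p.1‖ ≤ R ∧ (∀ j : ℕ, 1 ≤ j → j ≤ g → 1 ≤ ‖p.1 - 3 * j‖) ∧ 0 ≤ p.2 ∧ p.2 ≤ 1}

/-- The radius is kept variable because attaching a handle compares genus `g` with genus `g + 1`
inside one disk of radius `3 * g + 5`. -/
theorem stdHandlebody_eq_solid (g : ℕ) : stdHandlebody g = solid g (3 * g + 2) := rfl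

/-- The boundary of `solid g R`. -/
def solidBdry (g : ℕ) (R : ℝ) : Set (ℂ × ℝ) :=
  {p | p ∈ solid g R ∧
    (‖p.1‖ = R ∨ (∃ j : ℕ, 1 ≤ j ∧ j ≤ g ∧ ‖p.1 - 3 * j‖ = 1) ∨ p.2 = 0 ∨ p.2 = 1)}

/-- Sign of the `i`-th wall; the wall with index `0` is the outer one. -/
def wallSign (i : ℕ) : ℝ := if i = 0 then -1 else 1

/-- Radius of the `i`-th wall. -/
def wallRadius (R : ℝ) (i : ℕ) : ℝ := if i = 0 then R else 1

/-- Depth below the `i`-th wall. -/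
noncomputable def wallDepth (R : ℝ) (i : ℕ) (x : ℂ) : ℝ :=
  wallSign i * (‖x - 3 * i‖ - wallRadius R i)

/-- The inward direction at the `i`-th wall. -/
noncomputable def wallDir (i : ℕ) (x : ℂ) : ℂ :=
  (wallSign i / max ‖x - 3 * i‖ 1 : ℝ) * (x - 3 * i)

theorem wallSign_mul_self (i : ℕ) : wallSign i * wallSign i = 1 := by
  unfold wallSign; split_ifs <;> norm_num

theorem mem_solid_iff {g : ℕ} {R : ℝ} {p : ℂ × ℝ} :
    p ∈ solid g R ↔ (∀ i ≤ g, 0 ≤ wallDepth R i p.1) ∧ 0 ≤ p.2 ∧ p.2 ≤ 1 := by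
  constructor
  · rintro ⟨h1, h2, h3, h4⟩
    refine ⟨fun i hi ↦ ?_, h3, h4⟩
    rcases Nat.eq_zero_or_pos i with rfl | hi0
    · simp only [wallDepth, wallSign, wallRadius, if_pos, Nat.cast_zero, mul_zero, sub_zero]
      linarith
    · have := h2 i hi0 hi
      simp only [wallDepth, wallSign, wallRadius, if_neg hi0.ne', one_mul]
      linarith
  · rintro ⟨h1, h3, h4⟩
    refine ⟨?_, fun j hj hjg ↦ ?_, h3, h4⟩
    · have := h1 0 (Nat.zero_le g)
      simp only [wallDepth, wallSign, wallRadius, if_pos, Nat.cast_zero, mul_zero, sub_zero] at this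
      linarith
    · have := h1 j hjg
      simp only [wallDepth, wallSign, wallRadius, if_neg (Nat.one_le_iff_ne_zero.1 hj), one_mul]
        at this
      linarith

theorem mem_solidBdry_iff {g : ℕ} {R : ℝ} {p : ℂ × ℝ} :
    p ∈ solidBdry g R ↔ p ∈ solid g R ∧ ((∃ i ≤ g, wallDepth R i p.1 = 0) ∨ p.2 = 0 ∨ p.2 = 1) := by
  refine and_congr_right fun _ ↦ ?_
  rw [← or_assoc]
  refine or_congr_left ⟨?_, ?_⟩
  · rintro (h | ⟨j, hj, hjg, h⟩)
    · exact ⟨0, Nat.zero_le g, by simp [wallDepth, wallRadius, h]⟩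
    · exact ⟨j, hjg, by simp [wallDepth, wallRadius, Nat.one_le_iff_ne_zero.1 hj, h]⟩
  · rintro ⟨i, hi, h⟩
    rcases Nat.eq_zero_or_pos i with rfl | hi0
    · left
      simp only [wallDepth, wallSign, wallRadius, if_pos, Nat.cast_zero, mul_zero, sub_zero] at h
      linarith
    · right
      refine ⟨i, hi0, hi, ?_⟩
      simp only [wallDepth, wallSign, wallRadius, if_neg hi0.ne', one_mul] at h
      linarith

theorem continuous_wallDepth (R : ℝ) (i : ℕ) : Continuous (wallDepth R i) := by
  unfold wallDepth; fun_prop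

theorem continuous_wallDir (i : ℕ) : Continuous (wallDir i) := by
  unfold wallDir
  have : Continuous fun x : ℂ ↦ wallSign i / max ‖x - 3 * i‖ 1 :=
    continuous_const.div (by fun_prop) fun x ↦ (zero_lt_one.trans_le (le_max_right _ _)).ne'
  exact (Complex.continuous_ofReal.comp this).mul (by fun_prop)

/-- Any two walls are at distance at least `1`. Hence a point has depth less than `1 / 2` below at
most one wall, and pushes away from different walls never interfere. -/
theorem one_le_wallDepth_add {g : ℕ} {R : ℝ} (hR : 3 * (g : ℝ) + 2 ≤ R) {i k : ℕ} (hi : i ≤ g)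
    (hk : k ≤ g) (hik : i ≠ k) (x : ℂ) : 1 ≤ wallDepth R i x + wallDepth R k x := by
  wlog h : i < k generalizing i k
  · rw [add_comm]; exact this hk hi hik.symm (lt_of_le_of_ne (not_lt.1 h) hik.symm)
  have hk0 : k ≠ 0 := (Nat.zero_le i).trans_lt h |>.ne'
  have hik1 : (i : ℝ) + 1 ≤ k := by exact_mod_cast h
  have hn : ‖((3 * k : ℂ) - 3 * i)‖ = 3 * k - 3 * i := by
    rw [show ((3 * k : ℂ) - 3 * i) = ((3 * k - 3 * i : ℝ) : ℂ) by push_cast; ring,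
      Complex.norm_real, Real.norm_of_nonneg (by linarith)]
  rcases Nat.eq_zero_or_pos i with rfl | hi0
  · simp only [wallDepth, wallSign, wallRadius, if_pos, if_neg hk0, Nat.cast_zero, mul_zero,
      sub_zero, one_mul] at hn ⊢
    have h1 := norm_sub_norm_le x (3 * k : ℂ)
    rw [hn] at h1
    have : (k : ℝ) ≤ g := by exact_mod_cast hk
    linarith
  · simp only [wallDepth, wallSign, wallRadius, if_neg hi0.ne', if_neg hk0, one_mul]
    have h1 : ‖((3 * k : ℂ) - 3 * i)‖ ≤ ‖x - 3 * i‖ + ‖x - 3 * k‖ := by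
      rw [show ((3 * k : ℂ) - 3 * i) = (x - 3 * i) - (x - 3 * k) by ring]
      exact norm_sub_le _ _
    rw [hn] at h1
    linarith

/-- In the strip next to a wall the maximum in `wallDir` is the norm, so `wallDir` is the radial
unit vector there. -/
theorem one_le_norm_of_wallDepth {R : ℝ} (hR : 2 ≤ R) {i : ℕ} {x : ℂ} (h0 : 0 ≤ wallDepth R i x)
    (h1 : wallDepth R i x < 1 / 2) : 1 ≤ ‖x - 3 * i‖ := by
  unfold wallDepth wallSign wallRadius at h0 h1
  split_ifs at h0 h1 <;> linarith

theorem norm_add_smul_wallDir {i : ℕ} {x : ℂ} {τ : ℝ} (h0 : 1 ≤ ‖x - 3 * i‖)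
    (h1 : 1 ≤ ‖x - 3 * i‖ + wallSign i * τ) :
    ‖x + τ • wallDir i x - 3 * i‖ = ‖x - 3 * i‖ + wallSign i * τ ∧
      wallDir i (x + τ • wallDir i x) = wallDir i x := by
  have hn : 0 < ‖x - 3 * i‖ := by linarith
  have e1 : x + τ • wallDir i x - 3 * i =
      (((‖x - 3 * i‖ + wallSign i * τ) / ‖x - 3 * i‖ : ℝ) : ℂ) * (x - 3 * i) := by
    rw [wallDir, max_eq_left h0, Complex.real_smul]
    have : ((‖x - 3 * i‖ : ℝ) : ℂ) ≠ 0 := by exact_mod_cast hn.ne'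
    push_cast
    field_simp
    ring
  have e2 : ‖x + τ • wallDir i x - 3 * i‖ = ‖x - 3 * i‖ + wallSign i * τ := by
    rw [e1, norm_mul, Complex.norm_real, Real.norm_of_nonneg (by positivity)]
    field_simp
  refine ⟨e2, ?_⟩
  have e3 : wallDir i (x + τ • wallDir i x) = (wallSign i / (‖x - 3 * i‖ + wallSign i * τ) : ℝ) *
      ((((‖x - 3 * i‖ + wallSign i * τ) / ‖x - 3 * i‖ : ℝ) : ℂ) * (x - 3 * i)) := by
    conv_lhs => rw [wallDir, e2, max_eq_left h1, e1]
  rw [e3, wallDir, max_eq_left h0, ← mul_assoc, ← Complex.ofReal_mul]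
  congr 2
  have : ‖x - 3 * i‖ + wallSign i * τ ≠ 0 := by linarith
  field_simp

theorem wallDepth_add_smul_wallDir {R : ℝ} (hR : 2 ≤ R) {i : ℕ} {x : ℂ} {τ : ℝ}
    (h0 : 0 ≤ wallDepth R i x) (h1 : wallDepth R i x < 1 / 2) (h2 : 0 ≤ wallDepth R i x + τ)
    (h3 : wallDepth R i x + τ < 1 / 2) : wallDepth R i (x + τ • wallDir i x) = wallDepth R i x + τ ∧
      wallDir i (x + τ • wallDir i x) = wallDir i x := by
  have hn := one_le_norm_of_wallDepth hR h0 h1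
  have hn' : 1 ≤ ‖x - 3 * i‖ + wallSign i * τ := by
    unfold wallDepth wallSign wallRadius at *
    split_ifs at * <;> linarith
  obtain ⟨e1, e2⟩ := norm_add_smul_wallDir hn hn'
  refine ⟨?_, e2⟩
  rw [wallDepth, e1, wallDepth]
  linear_combination τ * wallSign_mul_self i

/-- Displacement along the inward directions by amounts depending on the depths. -/
noncomputable def wallPush (g : ℕ) (R : ℝ) (a : ℝ → ℝ) (x : ℂ) : ℂ :=
  x + ∑ i ∈ Finset.range (g + 1), a (wallDepth R i x) • wallDir i x

section Push

variable {g : ℕ} {R : ℝ} {a b : ℝ → ℝ} {x : ℂ}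

theorem wallPush_of_lt (hR : 3 * (g : ℝ) + 2 ≤ R) (ha : ∀ d, 1 / 2 ≤ d → a d = 0) {i : ℕ}
    (hi : i ≤ g) (h1 : wallDepth R i x < 1 / 2) :
    wallPush g R a x = x + a (wallDepth R i x) • wallDir i x := by
  rw [wallPush, Finset.sum_eq_single_of_mem i (Finset.mem_range.2 (Nat.lt_succ_of_le hi))]
  intro k hk hki
  rw [ha, zero_smul]
  have := one_le_wallDepth_add hR hi (Nat.le_of_lt_succ (Finset.mem_range.1 hk)) hki.symm x
  linarith

theorem wallPush_of_le (ha : ∀ d, 1 / 2 ≤ d → a d = 0) (h : ∀ i ≤ g, 1 / 2 ≤ wallDepth R i x) :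
    wallPush g R a x = x := by
  rw [wallPush, Finset.sum_eq_zero, add_zero]
  intro i hi
  rw [ha _ (h i (Nat.le_of_lt_succ (Finset.mem_range.1 hi))), zero_smul]

theorem wallDepth_wallPush (hR : 3 * (g : ℝ) + 2 ≤ R) (ha : ∀ d, 1 / 2 ≤ d → a d = 0)
    (hx : ∀ i ≤ g, 0 ≤ wallDepth R i x)
    (hxa : ∀ i ≤ g, wallDepth R i x < 1 / 2 → 0 ≤ wallDepth R i x + a (wallDepth R i x) ∧
      wallDepth R i x + a (wallDepth R i x) < 1 / 2) {i : ℕ} (hi : i ≤ g) :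
    (wallDepth R i x < 1 / 2 →
      wallDepth R i (wallPush g R a x) = wallDepth R i x + a (wallDepth R i x)) ∧
    (1 / 2 ≤ wallDepth R i x → 1 / 2 ≤ wallDepth R i (wallPush g R a x)) := by
  have hR2 : 2 ≤ R := by have : (0 : ℝ) ≤ g := Nat.cast_nonneg g; linarith
  constructor
  · intro h
    rw [wallPush_of_lt hR ha hi h]
    exact (wallDepth_add_smul_wallDir hR2 (hx i hi) h (hxa i hi h).1 (hxa i hi h).2).1
  · intro h
    by_cases hk : ∃ k ≤ g, wallDepth R k x < 1 / 2
    · obtain ⟨k, hk, hkx⟩ := hk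
      have hki : k ≠ i := by rintro rfl; linarith
      have h1 := one_le_wallDepth_add hR hk hi hki (wallPush g R a x)
      have h2 := wallPush_of_lt hR ha hk hkx
      have h3 := (wallDepth_add_smul_wallDir hR2 (hx k hk) hkx (hxa k hk hkx).1 (hxa k hk hkx).2).1
      rw [← h2] at h3
      linarith [(hxa k hk hkx).2]
    · push Not at hk
      rwa [wallPush_of_le ha hk]

theorem wallPush_wallPush (hR : 3 * (g : ℝ) + 2 ≤ R) (ha : ∀ d, 1 / 2 ≤ d → a d = 0)
    (hb : ∀ d, 1 / 2 ≤ d → b d = 0) (hx : ∀ i ≤ g, 0 ≤ wallDepth R i x)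
    (hxa : ∀ i ≤ g, wallDepth R i x < 1 / 2 → 0 ≤ wallDepth R i x + a (wallDepth R i x) ∧
      wallDepth R i x + a (wallDepth R i x) < 1 / 2)
    (hab : ∀ i ≤ g, wallDepth R i x < 1 / 2 →
      b (wallDepth R i x + a (wallDepth R i x)) = -a (wallDepth R i x)) :
    wallPush g R b (wallPush g R a x) = x := by
  have hR2 : 2 ≤ R := by have : (0 : ℝ) ≤ g := Nat.cast_nonneg g; linarith
  by_cases hk : ∃ k ≤ g, wallDepth R k x < 1 / 2
  · obtain ⟨k, hk, hkx⟩ := hk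
    have h1 := (wallDepth_wallPush hR ha hx hxa hk).1 hkx
    rw [wallPush_of_lt hR hb hk (by rw [h1]; exact (hxa k hk hkx).2), h1, hab k hk hkx,
      wallPush_of_lt hR ha hk hkx, (wallDepth_add_smul_wallDir hR2 (hx k hk) hkx (hxa k hk hkx).1
      (hxa k hk hkx).2).2]
    module
  · push Not at hk
    rw [wallPush_of_le ha hk, wallPush_of_le hb hk]

end Push

theorem continuous_wallPush (g : ℕ) (R : ℝ) {a : ℝ → ℝ → ℝ}
    (ha : Continuous fun p : ℝ × ℝ ↦ a p.1 p.2) :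
    Continuous fun p : ℝ × ℂ ↦ wallPush g R (a p.1) p.2 := by
  unfold wallPush
  refine continuous_snd.add (continuous_finsetSum _ fun i _ ↦ ?_)
  exact (ha.comp (continuous_fst.prodMk ((continuous_wallDepth R i).comp continuous_snd))).smul
    ((continuous_wallDir i).comp continuous_snd)

/-- The collar coordinate of the walls. -/
noncomputable def collarAmount (s d : ℝ) : ℝ := s / 4 * max 0 (1 - 2 * d)

/-- The collar of the boundary of `solid g R`. -/
noncomputable def solidCollar (g : ℕ) (R : ℝ) (q : (ℂ × ℝ) × ℝ) : ℂ × ℝ :=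
  (wallPush g R (collarAmount q.2) q.1.1, 1 / 2 + (q.1.2 - 1 / 2) * (1 - q.2 / 2))

theorem continuous_solidCollar (g : ℕ) (R : ℝ) : Continuous (solidCollar g R) := by
  refine Continuous.prodMk ?_ (by fun_prop)
  refine (continuous_wallPush g R (a := collarAmount) ?_).comp
    (continuous_snd.prodMk (continuous_fst.comp continuous_fst))
  unfold collarAmount; fun_prop

theorem collarAmount_of_le (s : ℝ) {d : ℝ} (hd : 1 / 2 ≤ d) : collarAmount s d = 0 := by
  rw [collarAmount, max_eq_left (by linarith), mul_zero]

/-- The new depth is affine in the old one, fixing `1 / 2` and sending `0` to `s / 4`. This makes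
the collar explicitly invertible at each level. -/
theorem collarAmount_of_lt (s : ℝ) {d : ℝ} (hd : d < 1 / 2) :
    d + collarAmount s d = s / 4 + (1 - s / 2) * d := by
  rw [collarAmount, max_eq_right (by linarith)]; ring

section Collar

variable {g : ℕ} {R : ℝ}

theorem collarAmount_bounds {s : ℝ} (hs : s ∈ Icc (0 : ℝ) 1) {d : ℝ} (hd0 : 0 ≤ d)
    (hd : d < 1 / 2) : 0 ≤ d + collarAmount s d ∧ d + collarAmount s d < 1 / 2 := by
  rw [collarAmount_of_lt s hd]
  constructor <;> nlinarith [hs.1, hs.2]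

/-- The point `p` lies in the level set of depth `η`. -/
def HasDepth (g : ℕ) (R : ℝ) (η : ℝ) (p : ℂ × ℝ) : Prop :=
  (∀ i ≤ g, η ≤ wallDepth R i p.1) ∧ η ≤ p.2 ∧ p.2 ≤ 1 - η ∧
    ((∃ i ≤ g, wallDepth R i p.1 = η) ∨ p.2 = η ∨ p.2 = 1 - η)

theorem HasDepth.unique {η η' : ℝ} {p : ℂ × ℝ} (h : HasDepth g R η p) (h' : HasDepth g R η' p) :
    η = η' := by
  have key : ∀ {η η' : ℝ}, HasDepth g R η p → HasDepth g R η' p → η ≤ η' := by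
    intro η η' h h'
    rcases h'.2.2.2 with ⟨i, hi, h1⟩ | h1 | h1
    · rw [← h1]; exact h.1 i hi
    · rw [← h1]; exact h.2.1
    · linarith [h.2.2.1]
  exact le_antisymm (key h h') (key h' h)

theorem exists_hasDepth (g : ℕ) (R : ℝ) (p : ℂ × ℝ) : ∃ η, HasDepth g R η p := by
  obtain ⟨i, hi, him⟩ := Finset.exists_min_image (Finset.range (g + 1))
    (fun i ↦ wallDepth R i p.1) ⟨0, by simp⟩
  have hig := Nat.le_of_lt_succ (Finset.mem_range.1 hi)
  have him' : ∀ k ≤ g, wallDepth R i p.1 ≤ wallDepth R k p.1 := fun k hk ↦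
    him k (Finset.mem_range.2 (Nat.lt_succ_of_le hk))
  have m1 := min_le_left (wallDepth R i p.1) (min p.2 (1 - p.2))
  have m2 := (min_le_right (wallDepth R i p.1) (min p.2 (1 - p.2))).trans (min_le_left _ _)
  have m3 := (min_le_right (wallDepth R i p.1) (min p.2 (1 - p.2))).trans (min_le_right _ _)
  refine ⟨min (wallDepth R i p.1) (min p.2 (1 - p.2)), fun k hk ↦ m1.trans (him' k hk), m2,
    by linarith, ?_⟩
  rcases min_choice (wallDepth R i p.1) (min p.2 (1 - p.2)) with h | h
  · exact Or.inl ⟨i, hig, h.symm⟩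
  · rcases min_choice p.2 (1 - p.2) with h' | h'
    · right; left; rw [h, h']
    · right; right; rw [h, h']; ring

/-- Level `s` of the collar is the boundary of the parallel solid of depth `s / 4`: the pushes move
the walls to that depth, and contraction towards height `1 / 2` moves the ends. Since a point has a
unique depth, its level can be read off, corners included. -/
theorem hasDepth_solidCollar (hR : 3 * (g : ℝ) + 2 ≤ R) {p : ℂ × ℝ} (hp : p ∈ solidBdry g R)
    {s : ℝ} (hs : s ∈ Icc (0 : ℝ) 1) : HasDepth g R (s / 4) (solidCollar g R (p, s)) := by
  obtain ⟨hp1, hp2⟩ := mem_solidBdry_iff.1 hp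
  obtain ⟨hx, ht0, ht1⟩ := mem_solid_iff.1 hp1
  have hw := fun {i} (hi : i ≤ g) ↦ wallDepth_wallPush hR (fun d hd ↦ collarAmount_of_le s hd) hx
    (fun i hi h ↦ collarAmount_bounds hs (hx i hi) h) hi
  have hs0 := hs.1
  have hs1 := hs.2
  refine ⟨fun i hi ↦ ?_, ?_, ?_, ?_⟩
  · simp only [solidCollar]
    by_cases h : wallDepth R i p.1 < 1 / 2
    · rw [(hw hi).1 h, collarAmount_of_lt s h]
      have := hx i hi
      nlinarith
    · have := (hw hi).2 (not_lt.1 h)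
      linarith
  · simp only [solidCollar]; nlinarith
  · simp only [solidCollar]; nlinarith
  · simp only [solidCollar]
    rcases hp2 with ⟨i, hi, h⟩ | h | h
    · refine Or.inl ⟨i, hi, ?_⟩
      have h' : wallDepth R i p.1 < 1 / 2 := by rw [h]; norm_num
      rw [(hw hi).1 h', collarAmount_of_lt s h', h]; ring
    · right; left; rw [h]; ring
    · right; right; rw [h]; ring

theorem solidCollar_injOn (hR : 3 * (g : ℝ) + 2 ≤ R) :
    InjOn (solidCollar g R) (solidBdry g R ×ˢ Icc 0 1) := by
  rintro ⟨p, s⟩ ⟨hp, hs⟩ ⟨q, s'⟩ ⟨hq, hs'⟩ h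
  have h1 := hasDepth_solidCollar hR hp hs
  rw [h] at h1
  have h2 : s = s' := by linarith [h1.unique (hasDepth_solidCollar hR hq hs')]
  subst h2
  have hs0 : (0 : ℝ) ≤ s := hs.1
  have hs1 : s ≤ 1 := hs.2
  have hs2 : 0 < 1 - s / 2 := by linarith
  have hs3 : 2 - s ≠ 0 := (by linarith : 0 < 2 - s).ne'
  have inv : ∀ p ∈ solidBdry g R, wallPush g R (fun d ↦ -(collarAmount s d / (1 - s / 2)))
      (wallPush g R (collarAmount s) p.1) = p.1 := by
    intro p hp
    obtain ⟨hx, -, -⟩ := mem_solid_iff.1 (mem_solidBdry_iff.1 hp).1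
    refine wallPush_wallPush hR (fun d hd ↦ collarAmount_of_le s hd)
      (fun d hd ↦ by rw [collarAmount_of_le s hd]; simp) hx
      (fun i hi h ↦ collarAmount_bounds hs (hx i hi) h) fun i hi h ↦ ?_
    have h3 := collarAmount_bounds hs (hx i hi) h
    rw [collarAmount_of_lt s h] at h3 ⊢
    rw [collarAmount, max_eq_right (by linarith), collarAmount, max_eq_right (by linarith)]
    field_simp
    ring
  simp only [solidCollar, Prod.mk.injEq] at h
  refine Prod.ext (Prod.ext ?_ ?_) rfl
  · rw [← inv p hp, h.1, inv q hq]
  · have h4 : (p.2 - 1 / 2) * (1 - s / 2) = (q.2 - 1 / 2) * (1 - s / 2) := by linarith [h.2]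
    have := mul_right_cancel₀ hs2.ne' h4
    simp only
    linarith

theorem solidCollar_zero (g : ℕ) (R : ℝ) (p : ℂ × ℝ) : solidCollar g R (p, 0) = p := by
  refine Prod.ext ?_ ?_
  · simp [solidCollar, wallPush, collarAmount]
  · simp [solidCollar]

theorem mem_solid_of_hasDepth {η : ℝ} (hη : 0 ≤ η) {p : ℂ × ℝ} (h : HasDepth g R η p) :
    p ∈ solid g R :=
  mem_solid_iff.2 ⟨fun i hi ↦ hη.trans (h.1 i hi), hη.trans h.2.1, by linarith [h.2.2.1]⟩

theorem exists_solidCollar_eq (hR : 3 * (g : ℝ) + 2 ≤ R) {p : ℂ × ℝ} {s : ℝ}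
    (hs : s ∈ Icc (0 : ℝ) 1) (hp : HasDepth g R (s / 4) p) :
    ∃ q ∈ solidBdry g R, solidCollar g R (q, s) = p := by
  have hs0 := hs.1
  have hs1 := hs.2
  have hs2 : 0 < 1 - s / 2 := by linarith
  have hs3 : 2 - s ≠ 0 := (by linarith : 0 < 2 - s).ne'
  have hx : ∀ i ≤ g, 0 ≤ wallDepth R i p.1 := fun i hi ↦ by
    have := hp.1 i hi; linarith
  set b : ℝ → ℝ := fun d ↦ -(collarAmount s d / (1 - s / 2)) with hb
  have hb0 : ∀ d, 1 / 2 ≤ d → b d = 0 := fun d hd ↦ by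
    simp only [hb]; rw [collarAmount_of_le s hd]; simp
  have hbd : ∀ d, d < 1 / 2 → d + b d = (d - s / 4) / (1 - s / 2) := fun d hd ↦ by
    simp only [hb]; rw [collarAmount, max_eq_right (by linarith)]; field_simp; ring
  have hxa : ∀ i ≤ g, wallDepth R i p.1 < 1 / 2 → 0 ≤ wallDepth R i p.1 + b (wallDepth R i p.1) ∧
      wallDepth R i p.1 + b (wallDepth R i p.1) < 1 / 2 := by
    intro i hi h
    rw [hbd _ h]
    constructor
    · exact div_nonneg (by linarith [hp.1 i hi]) hs2.le
    · rw [div_lt_iff₀ hs2]; linarith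
  have hw := fun {i} (hi : i ≤ g) ↦ wallDepth_wallPush hR hb0 hx hxa hi
  refine ⟨(wallPush g R b p.1, 1 / 2 + (p.2 - 1 / 2) / (1 - s / 2)), ?_, ?_⟩
  · have ht : ∀ c : ℝ, c + (p.2 - 1 / 2) / (1 - s / 2) = (c * (1 - s / 2) + (p.2 - 1 / 2)) / (1 - s / 2) :=
      fun c ↦ by field_simp
    have h2 := hp.2.1
    have h3 := hp.2.2.1
    rw [mem_solidBdry_iff, mem_solid_iff]
    refine ⟨⟨fun i hi ↦ ?_, ?_, ?_⟩, ?_⟩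
    · by_cases h : wallDepth R i p.1 < 1 / 2
      · rw [(hw hi).1 h]; exact (hxa i hi h).1
      · have := (hw hi).2 (not_lt.1 h); linarith
    · simp only; rw [ht]; exact div_nonneg (by linarith) hs2.le
    · simp only; rw [ht, div_le_one hs2]; linarith
    · rcases hp.2.2.2 with ⟨i, hi, h⟩ | h | h
      · left
        refine ⟨i, hi, ?_⟩
        have h' : wallDepth R i p.1 < 1 / 2 := by rw [h]; linarith
        rw [(hw hi).1 h', hbd _ h', h]; simp
      · right; left; simp only; rw [ht, h]; field_simp; ring
      · right; right; simp only; rw [ht, h]; field_simp; ring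
  · refine Prod.ext ?_ ?_
    · simp only [solidCollar]
      refine wallPush_wallPush hR hb0 (fun d hd ↦ collarAmount_of_le s hd) hx hxa fun i hi h ↦ ?_
      have h3 := (hxa i hi h).2
      rw [collarAmount, max_eq_right (by linarith), hbd _ h]
      simp only [hb]
      rw [collarAmount, max_eq_right (by linarith)]
      field_simp
      ring
    · simp only [solidCollar]; field_simp; ring

end Collar

/-! ### The model as a compact space with transportable boundary. -/

theorem isClosed_solid (g : ℕ) (R : ℝ) : IsClosed (solid g R) := by
  have : solid g R = (⋂ i ≤ g, {p : ℂ × ℝ | 0 ≤ wallDepth R i p.1}) ∩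
      ({p | 0 ≤ p.2} ∩ {p | p.2 ≤ 1}) := by
    ext p; rw [mem_solid_iff]; simp
  rw [this]
  refine IsClosed.inter (isClosed_iInter fun i ↦ isClosed_iInter fun _ ↦ ?_) (IsClosed.inter ?_ ?_)
  · exact isClosed_le continuous_const ((continuous_wallDepth R i).comp continuous_fst)
  · exact isClosed_le continuous_const continuous_snd
  · exact isClosed_le continuous_snd continuous_const

theorem isCompact_solid (g : ℕ) (R : ℝ) : IsCompact (solid g R) := by
  refine ((isCompact_closedBall (0 : ℂ) R).prod (isCompact_Icc (a := (0 : ℝ)) (b := 1))).of_isClosed_subset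
    (isClosed_solid g R) fun p hp ↦ ⟨mem_closedBall_zero_iff.2 hp.1, hp.2.2.1, hp.2.2.2⟩

theorem solidBdry_subset (g : ℕ) (R : ℝ) : solidBdry g R ⊆ solid g R := fun _ h ↦ h.1

theorem frontier_solid (g : ℕ) {R : ℝ} (hR : 0 < R) : frontier (solid g R) = solidBdry g R := by
  rw [(isClosed_solid g R).frontier_eq]
  ext p
  constructor
  · rintro ⟨hp, hn⟩
    rw [mem_solidBdry_iff]
    refine ⟨hp, ?_⟩
    by_contra hcon
    push Not at hcon
    refine hn (mem_interior.2 ⟨{p : ℂ × ℝ | (∀ i ∈ Finset.range (g + 1), 0 < wallDepth R i p.1) ∧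
      0 < p.2 ∧ p.2 < 1}, ?_, ?_, ?_⟩)
    · rintro q ⟨h1, h2, h3⟩
      exact mem_solid_iff.2 ⟨fun i hi ↦ (h1 i (Finset.mem_range.2 (Nat.lt_succ_of_le hi))).le, h2.le,
        h3.le⟩
    · have : {p : ℂ × ℝ | (∀ i ∈ Finset.range (g + 1), 0 < wallDepth R i p.1) ∧ 0 < p.2 ∧ p.2 < 1} =
        (⋂ i ∈ Finset.range (g + 1), {p : ℂ × ℝ | 0 < wallDepth R i p.1}) ∩
          ({p | 0 < p.2} ∩ {p | p.2 < 1}) := by ext p; simp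
      rw [this]
      refine IsOpen.inter (isOpen_biInter_finset fun i _ ↦ ?_) (IsOpen.inter ?_ ?_)
      · exact isOpen_lt continuous_const ((continuous_wallDepth R i).comp continuous_fst)
      · exact isOpen_lt continuous_const continuous_snd
      · exact isOpen_lt continuous_snd continuous_const
    · obtain ⟨h1, h2, h3⟩ := mem_solid_iff.1 hp
      refine ⟨fun i hi ↦ ?_, h2.lt_of_ne' hcon.2.1, h3.lt_of_ne hcon.2.2⟩
      have hi' := Nat.le_of_lt_succ (Finset.mem_range.1 hi)
      exact (h1 i hi').lt_of_ne' (hcon.1 i hi')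
  · rintro ⟨hp, hb⟩
    refine ⟨hp, fun hint ↦ ?_⟩
    -- A point of a wall leaves the solid radially with respect to the centre of the wall, and a
    -- point of an end leaves it vertically.
    have move : ∀ γ : ℝ → ℂ × ℝ, Continuous γ → γ 0 = p → ∃ δ > 0, ∀ ε, |ε| < δ → γ ε ∈ solid g R := by
      intro γ hγ h0
      have h1 : ∀ᶠ ε in 𝓝 (0 : ℝ), γ ε ∈ solid g R :=
        hγ.continuousAt.eventually (by rw [h0]; exact mem_interior_iff_mem_nhds.1 hint)
      obtain ⟨δ, hδ, h2⟩ := Metric.eventually_nhds_iff.1 h1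
      exact ⟨δ, hδ, fun ε hε ↦ h2 (by rwa [Real.dist_eq, sub_zero])⟩
    rcases hb with h | ⟨j, hj, hjg, h⟩ | h | h
    · obtain ⟨δ, hδ, h2⟩ := move (fun ε ↦ ((1 + ε : ℝ) * p.1, p.2)) (by fun_prop) (by simp)
      have h3 := (h2 (δ / 2) (by rw [abs_of_pos (half_pos hδ)]; linarith)).1
      simp only [norm_mul, Complex.norm_real, h] at h3
      rw [Real.norm_of_nonneg (by positivity)] at h3
      nlinarith
    · obtain ⟨δ, hδ, h2⟩ := move (fun ε ↦ (3 * j + (1 + ε : ℝ) * (p.1 - 3 * j), p.2)) (by fun_prop)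
        (by simp)
      have hm : 0 < min (δ / 2) (1 / 2) := by positivity
      have h3 := (h2 (-min (δ / 2) (1 / 2)) (by
        rw [abs_neg, abs_of_pos hm]; exact (min_le_left _ _).trans_lt (by linarith))).2.1 j hj hjg
      simp only [add_sub_cancel_left, norm_mul, Complex.norm_real, h] at h3
      have := min_le_right (δ / 2) (1 / 2)
      rw [Real.norm_of_nonneg (by linarith)] at h3
      linarith
    · obtain ⟨δ, hδ, h2⟩ := move (fun ε ↦ (p.1, p.2 + ε)) (by fun_prop) (by simp)
      have h3 := (h2 (-(δ / 2)) (by rw [abs_neg, abs_of_pos (half_pos hδ)]; linarith)).2.2.1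
      simp only [h] at h3
      linarith
    · obtain ⟨δ, hδ, h2⟩ := move (fun ε ↦ (p.1, p.2 + ε)) (by fun_prop) (by simp)
      have h3 := (h2 (δ / 2) (by rw [abs_of_pos (half_pos hδ)]; linarith)).2.2.2
      simp only [h] at h3
      linarith

section Lift

variable {Y : Type*} [TopologicalSpace Y] {A : Set Y}

open Classical in
/-- A retraction of sets from `Y` to `A`. -/
noncomputable def liftTo (A : Set Y) (a : A) (y : Y) : A := if h : y ∈ A then ⟨y, h⟩ else a


theorem coe_liftTo {a : A} {y : Y} (h : y ∈ A) : (liftTo A a y : Y) = y := by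
  rw [liftTo, dif_pos h]


theorem liftTo_coe {a : A} (y : A) : liftTo A a y = y := Subtype.ext (coe_liftTo y.2)

theorem ContinuousOn.liftTo {X : Type*} [TopologicalSpace X] {f : X → Y} {s : Set X}
    (hf : ContinuousOn f s) (hm : MapsTo f s A) (a : A) : ContinuousOn (fun x ↦ liftTo A a (f x)) s := by
  rw [IsInducing.subtypeVal.continuousOn_iff]
  exact hf.congr fun x hx ↦ coe_liftTo (hm hx)

theorem IsDisk.liftTo {E : Type*} [NormedAddCommGroup E] {S : Set Y} {χ : E → Y} {ρ : ℝ}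
    (h : IsDisk S χ ρ) (hS : S ⊆ A) (a : A) :
    IsDisk (Subtype.val ⁻¹' S : Set A) (fun z ↦ liftTo A a (χ z)) ρ := by
  have hc : ∀ z ∈ closedBall (0 : E) ρ, (_root_.liftTo A a (χ z) : Y) = χ z := fun z hz ↦
    coe_liftTo (hS (h.maps hz))
  refine ⟨h.cont.liftTo (fun z hz ↦ hS (h.maps hz)) a, fun z hz w hw hzw ↦ ?_, fun z hz ↦ ?_, ?_⟩
  · have := congrArg Subtype.val hzw
    rw [hc z hz, hc w hw] at this
    exact h.inj hz hw this
  · rw [mem_preimage, hc z hz]; exact h.maps hz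
  · obtain ⟨O, hO, h1⟩ := h.isOpen
    refine ⟨Subtype.val ⁻¹' O, hO.preimage continuous_subtype_val, ?_⟩
    ext y
    constructor
    · rintro ⟨z, hz, rfl⟩
      have := h1.subset ⟨z, hz, rfl⟩
      rw [mem_inter_iff, mem_preimage, mem_preimage, hc z (ball_subset_closedBall hz)]
      exact this
    · intro hy
      obtain ⟨z, hz, hzy⟩ := h1.symm.subset hy
      exact ⟨z, hz, Subtype.ext (by rw [hc z (ball_subset_closedBall hz), hzy])⟩

theorem IsDisk.of_inverse {E : Type*} [NormedAddCommGroup E] {S O : Set Y} {χ : E → Y} {W : Y → E}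
    {ρ : ℝ} (hχ : ContinuousOn χ (closedBall 0 ρ)) (hO : IsOpen O) (hW : ContinuousOn W O)
    (h : ∀ z ∈ closedBall 0 ρ, χ z ∈ S ∧ χ z ∈ O ∧ W (χ z) = z)
    (h' : ∀ p ∈ S, p ∈ O → χ (W p) = p) : IsDisk S χ ρ := by
  refine ⟨hχ, fun z hz w hw hzw ↦ ?_, fun z hz ↦ (h z hz).1, O ∩ W ⁻¹' ball 0 ρ,
    hW.isOpen_inter_preimage hO isOpen_ball, ?_⟩
  · rw [← (h z hz).2.2, hzw, (h w hw).2.2]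
  · ext p
    constructor
    · rintro ⟨z, hz, rfl⟩
      have := h z (ball_subset_closedBall hz)
      exact ⟨⟨this.2.1, by rw [mem_preimage, this.2.2]; exact hz⟩, this.1⟩
    · rintro ⟨⟨hpO, hpW⟩, hpS⟩
      exact ⟨W p, hpW, h' p hpS hpO⟩

theorem IsDisk.comp_homeomorph {E E' : Type*} [NormedAddCommGroup E] [ProperSpace E]
    [NormedAddCommGroup E'] [T2Space Y] {S : Set Y} {χ : E → Y} {ρ ρ' : ℝ} (h : IsDisk S χ ρ)
    (L : E' ≃ₜ E) (hL : MapsTo L (closedBall 0 ρ') (ball 0 ρ)) :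
    IsDisk S (fun z ↦ χ (L z)) ρ' := by
  have hm : MapsTo L (closedBall 0 ρ') (closedBall 0 ρ) := fun z hz ↦ ball_subset_closedBall (hL hz)
  refine ⟨h.cont.comp L.continuous.continuousOn hm, h.inj.comp L.injective.injOn hm,
    h.maps.comp hm, ?_⟩
  obtain ⟨O, hO, h1⟩ := h.isOpen_image (L.isOpenMap _ (isOpen_ball (x := 0) (ε := ρ')))
    (fun z ⟨w, hw, hwz⟩ ↦ hwz ▸ hL (ball_subset_closedBall hw))
  exact ⟨O, hO, by rw [← h1, image_image]⟩

end Lift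

section Equivalence

variable {g : ℕ} {R : ℝ}

/-- The boundary of the solid as a subset of the solid. -/
def solidBdry' (g : ℕ) (R : ℝ) : Set (solid g R) := Subtype.val ⁻¹' solidBdry g R

theorem isClosed_solidBdry (g : ℕ) {R : ℝ} (hR : 0 < R) : IsClosed (solidBdry g R) := by
  rw [← frontier_solid g hR]; exact isClosed_frontier

theorem radius_pos (hR : 3 * (g : ℝ) + 2 ≤ R) : 2 ≤ R := by
  have : (0 : ℝ) ≤ g := Nat.cast_nonneg g
  linarith

theorem solidCollar_image (hR : 3 * (g : ℝ) + 2 ≤ R) :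
    solidCollar g R '' (solidBdry g R ×ˢ Ico 0 1) = {p : ℂ × ℝ | p ∈ solid g R ∧
      ((∃ i ∈ Finset.range (g + 1), wallDepth R i p.1 < 1 / 4) ∨ p.2 < 1 / 4 ∨ 3 / 4 < p.2)} := by
  ext p
  constructor
  · rintro ⟨⟨q, s⟩, ⟨hq, hs⟩, rfl⟩
    have h := hasDepth_solidCollar hR hq (Ico_subset_Icc_self hs)
    have hs0 : (0 : ℝ) ≤ s := hs.1
    have hs1 : s < 1 := hs.2
    refine ⟨mem_solid_of_hasDepth (by positivity) h, ?_⟩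
    rcases h.2.2.2 with ⟨i, hi, h1⟩ | h1 | h1
    · exact Or.inl ⟨i, Finset.mem_range.2 (Nat.lt_succ_of_le hi), by rw [h1]; linarith⟩
    · right; left; rw [h1]; linarith
    · right; right; rw [h1]; linarith
  · rintro ⟨hp, hp'⟩
    obtain ⟨η, hη⟩ := exists_hasDepth g R p
    obtain ⟨h1, h2, h3⟩ := mem_solid_iff.1 hp
    have hη0 : 0 ≤ η := by
      rcases hη.2.2.2 with ⟨i, hi, h⟩ | h | h
      · rw [← h]; exact h1 i hi
      · rw [← h]; exact h2
      · linarith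
    have hη1 : η < 1 / 4 := by
      rcases hp' with ⟨i, hi, h⟩ | h | h
      · exact (hη.1 i (Nat.le_of_lt_succ (Finset.mem_range.1 hi))).trans_lt h
      · exact hη.2.1.trans_lt h
      · linarith [hη.2.2.1]
    obtain ⟨q, hq, hqp⟩ := exists_solidCollar_eq hR (s := 4 * η) ⟨by linarith, by linarith⟩
      (by rwa [mul_div_cancel_left₀ _ (by norm_num : (4 : ℝ) ≠ 0)])
    exact ⟨(q, 4 * η), ⟨hq, by linarith, by linarith⟩, hqp⟩

theorem isOpen_solidCollar_aux (g : ℕ) (R : ℝ) : IsOpen {p : ℂ × ℝ |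
    (∃ i ∈ Finset.range (g + 1), wallDepth R i p.1 < 1 / 4) ∨ p.2 < 1 / 4 ∨ 3 / 4 < p.2} := by
  have : {p : ℂ × ℝ | (∃ i ∈ Finset.range (g + 1), wallDepth R i p.1 < 1 / 4) ∨ p.2 < 1 / 4 ∨
      3 / 4 < p.2} = (⋃ i ∈ Finset.range (g + 1), {p : ℂ × ℝ | wallDepth R i p.1 < 1 / 4}) ∪
        ({p | p.2 < 1 / 4} ∪ {p | 3 / 4 < p.2}) := by ext p; simp
  rw [this]
  refine IsOpen.union (isOpen_biUnion fun i _ ↦ ?_) (IsOpen.union ?_ ?_)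
  · exact isOpen_lt ((continuous_wallDepth R i).comp continuous_fst) continuous_const
  · exact isOpen_lt continuous_snd continuous_const
  · exact isOpen_lt continuous_const continuous_snd

theorem solidCollar_mem (hR : 3 * (g : ℝ) + 2 ≤ R) {q : (ℂ × ℝ) × ℝ}
    (hq : q ∈ solidBdry g R ×ˢ Icc (0 : ℝ) 1) : solidCollar g R q ∈ solid g R :=
  mem_solid_of_hasDepth (by have := hq.2.1; positivity) (hasDepth_solidCollar hR hq.1 hq.2)

theorem transportable_solidBdry (hR : 3 * (g : ℝ) + 2 ≤ R) :
    Transportable (solidBdry' g R) := by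
  have hR2 := radius_pos hR
  by_cases hne : Nonempty (solid g R)
  swap
  · rw [not_nonempty_iff] at hne
    intro χ
    exact hne.elim (χ 0)
  obtain ⟨a⟩ := hne
  have hY : CompactSpace (solid g R) := isCompact_iff_compactSpace.1 (isCompact_solid g R)
  have hB : IsCompact (solidBdry' g R) :=
    ((isClosed_solidBdry g (by linarith)).preimage continuous_subtype_val).isCompact
  have hmem : ∀ q ∈ solidBdry' g R ×ˢ Icc (0 : ℝ) 1, solidCollar g R (q.1, q.2) ∈ solid g R :=
    fun q hq ↦ solidCollar_mem hR ⟨hq.1, hq.2⟩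
  have hval : ∀ q ∈ solidBdry' g R ×ˢ Icc (0 : ℝ) 1,
      (liftTo (solid g R) a (solidCollar g R (q.1, q.2)) : ℂ × ℝ) = solidCollar g R (q.1, q.2) :=
    fun q hq ↦ coe_liftTo (hmem q hq)
  refine transportable_of_collar hB
    (c := fun q ↦ liftTo (solid g R) a (solidCollar g R (q.1, q.2))) ?_ ?_ ?_ ?_
  · refine ContinuousOn.liftTo (Continuous.continuousOn ?_) hmem a
    exact (continuous_solidCollar g R).comp
      ((continuous_subtype_val.comp continuous_fst).prodMk continuous_snd)
  · intro q hq q' hq' h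
    have := congrArg Subtype.val h
    rw [hval q hq, hval q' hq'] at this
    have := solidCollar_injOn hR
      (show ((q.1 : ℂ × ℝ), q.2) ∈ solidBdry g R ×ˢ Icc 0 1 from ⟨hq.1, hq.2⟩)
      (show ((q'.1 : ℂ × ℝ), q'.2) ∈ solidBdry g R ×ˢ Icc 0 1 from ⟨hq'.1, hq'.2⟩) this
    rw [Prod.mk.injEq] at this
    exact Prod.ext (Subtype.ext this.1) this.2
  · intro y hy
    simp only
    rw [solidCollar_zero, liftTo_coe]
  · have h := (isOpen_solidCollar_aux g R).preimage (continuous_subtype_val (p := (· ∈ solid g R)))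
    convert h using 1
    ext y
    constructor
    · rintro ⟨q, hq, rfl⟩
      rw [mem_preimage, hval q ⟨hq.1, Ico_subset_Icc_self hq.2⟩]
      exact ((solidCollar_image hR).subset ⟨(q.1, q.2), ⟨hq.1, hq.2⟩, rfl⟩).2
    · intro hy
      obtain ⟨⟨q, s⟩, hq, hqy⟩ := (solidCollar_image hR).symm.subset ⟨y.2, hy⟩
      refine ⟨(⟨q, solidBdry_subset g R hq.1⟩, s), ⟨hq.1, hq.2⟩, ?_⟩
      simp only
      rw [hqy, liftTo_coe]

/-- Two points are related by a homeomorphism preserving `B`. -/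
def Homog {Y : Type*} [TopologicalSpace Y] (B : Set Y) (p q : Y) : Prop :=
  ∃ e : Y ≃ₜ Y, e '' B = B ∧ e p = q

theorem Homog.symm {Y : Type*} [TopologicalSpace Y] {B : Set Y} {p q : Y} (h : Homog B p q) :
    Homog B q p := by
  obtain ⟨e, he, rfl⟩ := h
  exact ⟨e.symm, Homeomorph.image_symm_eq he, e.symm_apply_apply p⟩

theorem Homog.trans {Y : Type*} [TopologicalSpace Y] {B : Set Y} {p q r : Y} (h : Homog B p q)
    (h' : Homog B q r) : Homog B p r := by
  obtain ⟨e, he, rfl⟩ := h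
  obtain ⟨e', he', rfl⟩ := h'
  exact ⟨e.trans e', Homeomorph.image_trans_eq he he', rfl⟩

theorem Transportable.homog {Y : Type*} [TopologicalSpace Y] {B : Set Y} (hB : Transportable B)
    {χ : ℂ → Y} {ρ : ℝ} (h : IsDisk B χ ρ) {z w : ℂ} (hz : ‖z‖ < ρ) (hw : ‖w‖ < ρ) :
    Homog B (χ z) (χ w) := by
  have key : ∀ z : ℂ, ‖z‖ < ρ → Homog B (χ 0) (χ z) := by
    intro z hz
    obtain ⟨Θ, hΘ, hΘ0⟩ := exists_homeomorph_apply_zero hz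
    obtain ⟨e, he, he'⟩ := hB χ ρ h Θ hΘ
    exact ⟨e, he, by rw [he' 0 (mem_closedBall_self ((norm_nonneg z).trans hz.le)), hΘ0]⟩
  exact (key z hz).symm.trans (key w hw)

end Equivalence

/-! ### Charts of the boundary of the model and its homogeneity. -/

section Charts

variable {g : ℕ} {R : ℝ}

theorem IsDisk.homog_solid (hR : 3 * (g : ℝ) + 2 ≤ R) {χ : ℂ → ℂ × ℝ} {ρ : ℝ}
    (h : IsDisk (solidBdry g R) χ ρ) {z w : ℂ} (hz : ‖z‖ < ρ) (hw : ‖w‖ < ρ) {p q : solid g R}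
    (hp : (p : ℂ × ℝ) = χ z) (hq : (q : ℂ × ℝ) = χ w) : Homog (solidBdry' g R) p q := by
  have h1 := (transportable_solidBdry hR).homog (h.liftTo (solidBdry_subset g R) p) hz hw
  rwa [← hp, ← hq, liftTo_coe, liftTo_coe] at h1

/-- A chart of the boundary of `solid g R` around a wall, folded over the two edges of the wall. -/
noncomputable def foldChart (R : ℝ) (i : ℕ) (θ : ℝ) (w : ℂ) : ℂ × ℝ :=
  (3 * i + ((wallRadius R i + wallSign i * (max 0 (|w.im| - 1) / 30) : ℝ) : ℂ) *
    Complex.exp ((θ + w.re / 5 : ℝ) * Complex.I), max 0 (min 1 ((1 + w.im) / 2)))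

theorem continuous_foldChart (R : ℝ) (i : ℕ) (θ : ℝ) : Continuous (foldChart R i θ) := by
  unfold foldChart; fun_prop

theorem foldChart_depth (hR : 2 ≤ R) (i : ℕ) (θ : ℝ) {w : ℂ} (hw : ‖w‖ ≤ 15) :
    0 < wallRadius R i + wallSign i * (max 0 (|w.im| - 1) / 30) ∧
    wallDepth R i (foldChart R i θ w).1 = max 0 (|w.im| - 1) / 30 ∧
    max 0 (|w.im| - 1) / 30 < 1 / 2 := by
  have h1 := (Complex.abs_im_le_norm w).trans hw
  have h2 : max 0 (|w.im| - 1) ≤ 14 := max_le (by norm_num) (by linarith)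
  have h3 : 0 ≤ max 0 (|w.im| - 1) := le_max_left _ _
  have h4 : 0 < wallRadius R i + wallSign i * (max 0 (|w.im| - 1) / 30) := by
    unfold wallRadius wallSign; split_ifs <;> linarith
  refine ⟨h4, ?_, by linarith⟩
  rw [wallDepth, foldChart]
  simp only
  rw [add_sub_cancel_left, norm_mul, Complex.norm_exp_ofReal_mul_I, mul_one, Complex.norm_real,
    Real.norm_of_nonneg h4.le]
  linear_combination (max 0 (|w.im| - 1) / 30) * wallSign_mul_self i

/-- On the ball of radius `15` the angle differs from `θ` by at most `3 < π`, and the depth reached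
on the ends is at most `14 / 30 < 1 / 2`, clear of all other walls. The inverse recovers the angle
by `arg` and the imaginary part as `(2 * t - 1) * (1 + 30 * depth)`. -/
theorem isDisk_foldChart (hR : 3 * (g : ℝ) + 2 ≤ R) {i : ℕ} (hi : i ≤ g) (θ : ℝ) :
    IsDisk (solidBdry g R) (foldChart R i θ) 15 := by
  have hR2 := radius_pos hR
  have hπ := Real.pi_gt_three
  refine IsDisk.of_inverse (O := {p | (p.1 - 3 * i) * Complex.exp (-(θ * Complex.I)) ∈
      Complex.slitPlane ∧ wallDepth R i p.1 < 1 / 2})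
    (W := fun p ↦ ((5 * Complex.arg ((p.1 - 3 * i) * Complex.exp (-(θ * Complex.I))) : ℝ) : ℂ) +
      (((2 * p.2 - 1) * (1 + 30 * wallDepth R i p.1) : ℝ) : ℂ) * Complex.I)
    (continuous_foldChart R i θ).continuousOn ?_ ?_ ?_ ?_
  · refine IsOpen.inter (Complex.isOpen_slitPlane.preimage (by fun_prop)) ?_
    exact isOpen_lt ((continuous_wallDepth R i).comp continuous_fst) continuous_const
  · have h1 : ContinuousOn (fun p : ℂ × ℝ ↦ Complex.arg ((p.1 - 3 * i) *
        Complex.exp (-(θ * Complex.I)))) {p | (p.1 - 3 * i) * Complex.exp (-(θ * Complex.I)) ∈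
        Complex.slitPlane ∧ wallDepth R i p.1 < 1 / 2} :=
      fun p hp ↦ (ContinuousAt.comp (g := Complex.arg)
        (f := fun p : ℂ × ℝ ↦ (p.1 - 3 * i) * Complex.exp (-(θ * Complex.I)))
        (Complex.continuousAt_arg hp.1) (by fun_prop)).continuousWithinAt
    have h2 : Continuous fun p : ℂ × ℝ ↦ wallDepth R i p.1 :=
      (continuous_wallDepth R i).comp continuous_fst
    have h3 : Continuous fun p : ℂ × ℝ ↦
      (((2 * p.2 - 1) * (1 + 30 * wallDepth R i p.1) : ℝ) : ℂ) * Complex.I := by fun_prop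
    exact (Complex.continuous_ofReal.comp_continuousOn (continuousOn_const.mul h1)).add
      h3.continuousOn
  · intro w hw
    rw [mem_closedBall_zero_iff] at hw
    obtain ⟨hr, hd, hd'⟩ := foldChart_depth hR2 i θ hw
    have hre := (Complex.abs_re_le_norm w).trans hw
    have hre' := abs_le.1 hre
    have him := abs_le.1 ((Complex.abs_im_le_norm w).trans hw)
    have harg : ((foldChart R i θ w).1 - 3 * i) * Complex.exp (-(θ * Complex.I)) =
        ((wallRadius R i + wallSign i * (max 0 (|w.im| - 1) / 30) : ℝ) : ℂ) *
        (Complex.cos (w.re / 5 : ℝ) + Complex.sin (w.re / 5 : ℝ) * Complex.I) := by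
      rw [← Complex.exp_mul_I, foldChart]
      simp only
      rw [add_sub_cancel_left, mul_assoc, ← Complex.exp_add]
      congr 2
      push_cast; ring
    have harg' := Complex.arg_mul_cos_add_sin_mul_I hr (θ := w.re / 5) ⟨by linarith, by linarith⟩
    have ht : (2 * (foldChart R i θ w).2 - 1) * (1 + max 0 (|w.im| - 1)) = w.im := by
      simp only [foldChart]
      rcases le_total |w.im| 1 with h | h
      · have := abs_le.1 h
        rw [max_eq_left (a := (0 : ℝ)) (b := |w.im| - 1) (by linarith), min_eq_right (by linarith),
          max_eq_right (by linarith)]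
        ring
      · rw [max_eq_right (a := (0 : ℝ)) (b := |w.im| - 1) (by linarith)]
        rcases abs_cases w.im with ⟨h1, h2⟩ | ⟨h1, h2⟩ <;> rw [h1] at h ⊢
        · rw [min_eq_left (by linarith)]; norm_num
        · rw [min_eq_right (by linarith), max_eq_left (by linarith)]; ring
    refine ⟨?_, ⟨?_, by rw [hd]; exact hd'⟩, ?_⟩
    · rw [mem_solidBdry_iff, mem_solid_iff]
      refine ⟨⟨fun k hk ↦ ?_, le_max_left _ _, max_le zero_le_one (min_le_left _ _)⟩, ?_⟩
      · rcases eq_or_ne i k with rfl | hik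
        · rw [hd]; positivity
        · have := one_le_wallDepth_add hR hi hk hik (foldChart R i θ w).1
          linarith
      · rcases le_total |w.im| 1 with h | h
        · left
          refine ⟨i, hi, ?_⟩
          rw [hd, max_eq_left (by linarith)]; simp
        · right
          simp only [foldChart]
          rcases abs_cases w.im with ⟨h1, h2⟩ | ⟨h1, h2⟩
          · right
            rw [min_eq_left (by linarith), max_eq_right (by norm_num)]
          · left
            rw [min_eq_right (by linarith), max_eq_left (by linarith)]
    · rw [harg, Complex.mem_slitPlane_iff_arg, harg']
      refine ⟨by linarith, mul_ne_zero (by exact_mod_cast hr.ne') ?_⟩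
      rw [← Complex.exp_mul_I]; exact Complex.exp_ne_zero _
    · rw [harg, harg', hd, mul_div_cancel₀ _ (by norm_num : (30 : ℝ) ≠ 0), ht,
        mul_div_cancel₀ _ (by norm_num : (5 : ℝ) ≠ 0), Complex.re_add_im]
  · rintro p hp ⟨hp1, hp2⟩
    obtain ⟨hp0, hp3⟩ := mem_solidBdry_iff.1 hp
    obtain ⟨h1, h2, h3⟩ := mem_solid_iff.1 hp0
    have hd0 := h1 i hi
    have key : max 0 (|(2 * p.2 - 1) * (1 + 30 * wallDepth R i p.1)| - 1) / 30 = wallDepth R i p.1 ∧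
        max 0 (min 1 ((1 + (2 * p.2 - 1) * (1 + 30 * wallDepth R i p.1)) / 2)) = p.2 := by
      rcases eq_or_ne (wallDepth R i p.1) 0 with h0 | h0
      · rw [h0, mul_zero, add_zero, mul_one]
        have : |2 * p.2 - 1| ≤ 1 := abs_le.2 ⟨by linarith, by linarith⟩
        rw [max_eq_left (by linarith), min_eq_right (by linarith), max_eq_right (by linarith)]
        constructor <;> ring
      · have hlt := hd0.lt_of_ne' h0
        rcases hp3 with ⟨k, hk, hk0⟩ | h | h
        · exfalso
          rcases eq_or_ne i k with rfl | hik
          · exact h0 hk0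
          · have := one_le_wallDepth_add hR hi hk hik p.1
            linarith
        · rw [h, abs_of_nonpos (by linarith), max_eq_right (a := (0 : ℝ)) (by linarith),
            min_eq_right (by linarith), max_eq_left (by linarith)]
          constructor <;> ring
        · rw [h, abs_of_nonneg (by linarith), max_eq_right (a := (0 : ℝ)) (by linarith),
            min_eq_left (by linarith), max_eq_right (by linarith)]
          constructor <;> ring
    have hr : wallRadius R i + wallSign i * wallDepth R i p.1 = ‖p.1 - 3 * i‖ := by
      rw [wallDepth]; linear_combination (‖p.1 - 3 * i‖ - wallRadius R i) * wallSign_mul_self i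
    have hW : ∀ a b : ℝ, ((a : ℂ) + b * Complex.I).re = a ∧ ((a : ℂ) + b * Complex.I).im = b :=
      fun a b ↦ by simp
    refine Prod.ext ?_ ?_
    · simp only [foldChart]
      rw [(hW _ _).1, (hW _ _).2, key.1, hr, mul_div_cancel_left₀ _ (by norm_num : (5 : ℝ) ≠ 0)]
      have h5 := Complex.norm_mul_exp_arg_mul_I ((p.1 - 3 * i) * Complex.exp (-(θ * Complex.I)))
      rw [norm_mul, show -((θ : ℂ) * Complex.I) = ((-θ : ℝ) : ℂ) * Complex.I by push_cast; ring,
        Complex.norm_exp_ofReal_mul_I, mul_one] at h5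
      rw [show -((θ : ℂ) * Complex.I) = ((-θ : ℝ) : ℂ) * Complex.I by push_cast; ring,
        Complex.ofReal_add, add_mul, Complex.exp_add, mul_comm (Complex.exp _), ← mul_assoc, h5,
        mul_assoc, ← Complex.exp_add]
      push_cast
      rw [neg_mul, neg_add_cancel, Complex.exp_zero]
      ring
    · simp only [foldChart]
      rw [(hW _ _).2, key.2]

theorem isDisk_end {τ : ℝ} (hτ : τ = 0 ∨ τ = 1) {x : ℂ} {ε : ℝ}
    (hx : ∀ y ∈ closedBall x ε, ∀ i ≤ g, 0 < wallDepth R i y) :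
    IsDisk (solidBdry g R) (fun z ↦ (x + z, τ)) ε := by
  refine IsDisk.of_inverse (O := {p | (∀ i ∈ Finset.range (g + 1), 0 < wallDepth R i p.1) ∧
      p.2 ≠ 1 - τ}) (W := fun p ↦ p.1 - x) (by fun_prop) ?_ (by fun_prop) ?_ ?_
  · have : {p : ℂ × ℝ | (∀ i ∈ Finset.range (g + 1), 0 < wallDepth R i p.1) ∧ p.2 ≠ 1 - τ} =
        (⋂ i ∈ Finset.range (g + 1), {p : ℂ × ℝ | 0 < wallDepth R i p.1}) ∩
          {p | p.2 ≠ 1 - τ} := by ext p; simp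
    rw [this]
    refine IsOpen.inter (isOpen_biInter_finset fun i _ ↦ ?_) ?_
    · exact isOpen_lt continuous_const ((continuous_wallDepth R i).comp continuous_fst)
    · exact isOpen_ne_fun continuous_snd continuous_const
  · intro z hz
    have h := hx (x + z) (by rw [mem_closedBall, dist_eq_norm, add_sub_cancel_left]; simpa using hz)
    refine ⟨mem_solidBdry_iff.2 ⟨mem_solid_iff.2 ⟨fun i hi ↦ (h i hi).le, ?_, ?_⟩, Or.inr hτ⟩,
      ⟨fun i hi ↦ h i (Nat.le_of_lt_succ (Finset.mem_range.1 hi)), ?_⟩, add_sub_cancel_left x z⟩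
    · rcases hτ with rfl | rfl <;> norm_num
    · rcases hτ with rfl | rfl <;> norm_num
    · rcases hτ with rfl | rfl <;> norm_num
  · rintro p hp ⟨h1, h2⟩
    refine Prod.ext (add_sub_cancel x p.1) ?_
    rcases (mem_solidBdry_iff.1 hp).2 with ⟨i, hi, h⟩ | h | h
    · exact absurd h (h1 i (Finset.mem_range.2 (Nat.lt_succ_of_le hi))).ne'
    · rcases hτ with rfl | rfl
      · exact h.symm
      · rw [h] at h2; norm_num at h2
    · rcases hτ with rfl | rfl
      · rw [h] at h2; norm_num at h2
      · exact h.symm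

end Charts

section Connected

variable {g : ℕ} {R : ℝ}

/-- All holes are centred on the real axis, and moving vertically away from the axis increases the
distance to each real point. -/
theorem norm_add_vertical_le {y : ℂ} {σ : ℝ} (hσ : σ = 1 ∨ σ = -1) (hy : 0 ≤ σ * y.im) (c : ℝ)
    {s s' : ℝ} (hs : 0 ≤ s) (hss : s ≤ s') :
    ‖y + (σ * s : ℝ) * Complex.I - c‖ ≤ ‖y + (σ * s' : ℝ) * Complex.I - c‖ := by
  rw [Complex.norm_def, Complex.norm_def]
  refine Real.sqrt_le_sqrt ?_
  simp only [Complex.normSq_apply, Complex.sub_re, Complex.add_re, Complex.sub_im, Complex.add_im,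
    Complex.mul_re, Complex.mul_im, Complex.ofReal_re, Complex.ofReal_im, Complex.I_re,
    Complex.I_im]
  rcases hσ with rfl | rfl <;> nlinarith

/-- From any point one can travel vertically away from the real axis without entering a hole until
the outer annulus is reached. That annulus contains no holes and is connected. -/
theorem isPreconnected_wallDepth_pos (hR : 3 * (g : ℝ) + 2 ≤ R) :
    IsPreconnected {x : ℂ | ∀ i ≤ g, 0 < wallDepth R i x} := by
  have hR2 := radius_pos hR
  have h0 : ∀ x, wallDepth R 0 x = R - ‖x‖ := fun x ↦ by simp [wallDepth, wallSign, wallRadius]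
  have hi1 : ∀ i : ℕ, i ≠ 0 → ∀ x, wallDepth R i x = ‖x - 3 * i‖ - 1 := fun i hi x ↦ by
    simp [wallDepth, wallSign, wallRadius, hi]
  set A : Set ℂ := {x | R - 1 < ‖x‖ ∧ ‖x‖ < R} with hA
  have hAX : A ⊆ {x : ℂ | ∀ i ≤ g, 0 < wallDepth R i x} := by
    rintro x ⟨h1, h2⟩ i hi
    rcases Nat.eq_zero_or_pos i with rfl | hpos
    · rw [h0]; linarith
    · have := one_le_wallDepth_add hR (Nat.zero_le g) hi hpos.ne x
      rw [h0] at this; linarith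
  have hAc : IsPreconnected A := by
    have : A = (fun p : ℝ × ℝ ↦ (p.1 : ℂ) * Complex.exp (p.2 * Complex.I)) ''
        (Ioo (R - 1) R ×ˢ univ) := by
      ext x
      constructor
      · rintro ⟨h1, h2⟩
        exact ⟨(‖x‖, x.arg), ⟨⟨h1, h2⟩, mem_univ _⟩, Complex.norm_mul_exp_arg_mul_I x⟩
      · rintro ⟨p, ⟨⟨h1, h2⟩, -⟩, rfl⟩
        simp only [hA, mem_ofPred_eq, norm_mul, Complex.norm_exp_ofReal_mul_I, mul_one,
          Complex.norm_real]
        rw [Real.norm_of_nonneg (by linarith)]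
        exact ⟨h1, h2⟩
    rw [this]
    exact (isPreconnected_Ioo.prod isPreconnected_univ).image _ (by fun_prop)
  have hb : ((R - 1 / 2 : ℝ) : ℂ) ∈ A := by
    simp only [hA, mem_ofPred_eq, Complex.norm_real]
    rw [Real.norm_of_nonneg (by linarith)]
    constructor <;> linarith
  refine isPreconnected_of_forall ((R - 1 / 2 : ℝ) : ℂ) fun y hy ↦ ?_
  by_cases hyA : R - 1 < ‖y‖
  · refine ⟨A, hAX, hb, ⟨hyA, ?_⟩, hAc⟩
    have := hy 0 (Nat.zero_le g)
    rw [h0] at this; linarith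
  push Not at hyA
  obtain ⟨σ, hσ, hσy⟩ : ∃ σ : ℝ, (σ = 1 ∨ σ = -1) ∧ 0 ≤ σ * y.im := by
    rcases le_total 0 y.im with h | h
    · exact ⟨1, Or.inl rfl, by linarith⟩
    · exact ⟨-1, Or.inr rfl, by linarith⟩
  have hσ1 : |σ| = 1 := by rcases hσ with rfl | rfl <;> simp
  set γ : ℝ → ℂ := fun s ↦ y + (σ * s : ℝ) * Complex.I with hγ
  have hγc : Continuous γ := by fun_prop
  have hγ0 : γ 0 = y := by simp [hγ]
  have hmono : ∀ {s s' : ℝ}, 0 ≤ s → s ≤ s' → ‖γ s‖ ≤ ‖γ s'‖ := fun {s s'} h h' ↦ by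
    have := norm_add_vertical_le hσ hσy 0 h h'
    rwa [Complex.ofReal_zero, sub_zero, sub_zero] at this
  obtain ⟨s₁, hs₁, hs₁'⟩ : ∃ s ∈ Icc (0 : ℝ) (2 * R), ‖γ s‖ = R - 1 / 2 := by
    refine intermediate_value_Icc (by linarith) hγc.norm.continuousOn ⟨?_, ?_⟩
    · rw [hγ0]; linarith
    · have h1 := norm_sub_norm_le ((σ * (2 * R) : ℝ) * Complex.I : ℂ) (-y)
      rw [sub_neg_eq_add, add_comm _ y, norm_neg, norm_mul, Complex.norm_I, mul_one,
        Complex.norm_real, Real.norm_eq_abs, abs_mul, hσ1, one_mul, abs_of_pos (by linarith)] at h1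
      simp only [hγ]
      linarith
  refine ⟨A ∪ γ '' Icc 0 s₁, union_subset hAX ?_, Or.inl hb,
    Or.inr ⟨0, ⟨le_rfl, hs₁.1⟩, hγ0⟩, ?_⟩
  · rintro _ ⟨s, hs, rfl⟩ i hi
    rcases Nat.eq_zero_or_pos i with rfl | hpos
    · rw [h0]; linarith [hmono hs.1 hs.2]
    · have h1 := hy i hi
      rw [hi1 i hpos.ne'] at h1 ⊢
      have h2 := norm_add_vertical_le hσ hσy (3 * i) le_rfl hs.1
      simp only [mul_zero, Complex.ofReal_zero, zero_mul, add_zero] at h2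
      push_cast at h2
      simp only [hγ]
      push_cast
      linarith
  · refine IsPreconnected.union (γ s₁) ⟨?_, ?_⟩ ⟨s₁, ⟨hs₁.1, le_rfl⟩, rfl⟩ hAc
      (isPreconnected_Icc.image _ hγc.continuousOn)
    · rw [hs₁']; linarith
    · rw [hs₁']; linarith

theorem isOpen_wallDepth_pos (g : ℕ) (R : ℝ) :
    IsOpen {x : ℂ | ∀ i ≤ g, 0 < wallDepth R i x} := by
  have : {x : ℂ | ∀ i ≤ g, 0 < wallDepth R i x} =
      ⋂ i ∈ Finset.range (g + 1), {x : ℂ | 0 < wallDepth R i x} := by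
    ext x; simp
  rw [this]
  exact isOpen_biInter_finset fun i _ ↦ isOpen_lt continuous_const (continuous_wallDepth R i)

/-- A small round disk in the end shows that nearby points are equivalent; connectedness of the
punctured disk does the rest. -/
theorem homog_end (hR : 3 * (g : ℝ) + 2 ≤ R) {p q : solid g R}
    (hp : ∀ i ≤ g, 0 < wallDepth R i (p : ℂ × ℝ).1) (hq : ∀ i ≤ g, 0 < wallDepth R i (q : ℂ × ℝ).1)
    (hp2 : (p : ℂ × ℝ).2 = 0 ∨ (p : ℂ × ℝ).2 = 1) (hpq : (q : ℂ × ℝ).2 = (p : ℂ × ℝ).2) :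
    Homog (solidBdry' g R) p q := by
  set τ := (p : ℂ × ℝ).2 with hτ
  have key := (isPreconnected_wallDepth_pos hR).induction₂
    (fun x y : ℂ ↦ Homog (solidBdry' g R) (liftTo (solid g R) p (x, τ)) (liftTo (solid g R) p (y, τ)))
    (fun x hx ↦ ?_) (fun x y z _ _ _ ↦ Homog.trans) (fun x y _ _ ↦ Homog.symm) hp hq
  · rw [show ((p : ℂ × ℝ).1, τ) = (p : ℂ × ℝ) from rfl, ← hpq,
      show ((q : ℂ × ℝ).1, (q : ℂ × ℝ).2) = (q : ℂ × ℝ) from rfl, liftTo_coe, liftTo_coe] at key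
    exact key
  · obtain ⟨ε, hε, hεx⟩ := Metric.nhds_basis_closedBall.mem_iff.1
      ((isOpen_wallDepth_pos g R).mem_nhds hx)
    have hd : IsDisk (solidBdry g R) (fun z ↦ (x + z, τ)) ε := isDisk_end hp2 fun y hy ↦ hεx hy
    filter_upwards [mem_nhdsWithin_of_mem_nhds (ball_mem_nhds x hε)] with y hy
    rw [mem_ball, dist_eq_norm] at hy
    have hm : ∀ z ∈ closedBall (0 : ℂ) ε, (x + z, τ) ∈ solid g R := fun z hz ↦
      solidBdry_subset g R (hd.maps hz)
    refine hd.homog_solid hR (z := 0) (w := y - x) (by simpa using hε) hy ?_ ?_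
    · rw [coe_liftTo]
      · simp
      · simpa using hm 0 (mem_closedBall_self hε.le)
    · rw [coe_liftTo]
      · simp
      · simpa using hm (y - x) (mem_closedBall_zero_iff.2 hy.le)

/-- The points `±2 * I` of the chart lie just past the folds, on the flat ends. They allow a passage
from the wall to either end. -/
theorem foldChart_two (hR : 3 * (g : ℝ) + 2 ≤ R) {i : ℕ} (hi : i ≤ g) (θ : ℝ) {τ : ℝ}
    (hτ : τ = 0 ∨ τ = 1) : (∀ k ≤ g, 0 < wallDepth R k
      (foldChart R i θ ((4 * τ - 2 : ℝ) * Complex.I)).1) ∧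
      (foldChart R i θ ((4 * τ - 2 : ℝ) * Complex.I)).2 = τ ∧
      ‖((4 * τ - 2 : ℝ) * Complex.I : ℂ)‖ < 15 := by
  have hn : ‖((4 * τ - 2 : ℝ) * Complex.I : ℂ)‖ = 2 := by
    rw [norm_mul, Complex.norm_I, mul_one, Complex.norm_real, Real.norm_eq_abs]
    rcases hτ with rfl | rfl <;> norm_num
  have him : |((4 * τ - 2 : ℝ) * Complex.I : ℂ).im| = 2 := by
    simp only [Complex.mul_im, Complex.ofReal_re, Complex.I_im, Complex.ofReal_im, Complex.I_re]
    rcases hτ with rfl | rfl <;> norm_num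
  obtain ⟨-, hd, -⟩ := foldChart_depth (radius_pos hR) i θ (by rw [hn]; norm_num :
    ‖((4 * τ - 2 : ℝ) * Complex.I : ℂ)‖ ≤ 15)
  rw [him] at hd
  norm_num at hd
  refine ⟨fun k hk ↦ ?_, ?_, by rw [hn]; norm_num⟩
  · rcases eq_or_ne i k with rfl | hik
    · push_cast; rw [hd]; norm_num
    · have := one_le_wallDepth_add hR hi hk hik (foldChart R i θ ((4 * τ - 2 : ℝ) * Complex.I)).1
      push_cast at this ⊢
      rw [hd] at this; linarith
  · simp only [foldChart, Complex.mul_im, Complex.ofReal_re, Complex.I_im, Complex.ofReal_im,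
      Complex.I_re]
    rcases hτ with rfl | rfl <;> norm_num

/-- The homeomorphisms of the solid preserving its boundary act transitively on the boundary. -/
theorem homog_solidBdry (hR : 3 * (g : ℝ) + 2 ≤ R) {p q : solid g R} (hp : p ∈ solidBdry' g R)
    (hq : q ∈ solidBdry' g R) : Homog (solidBdry' g R) p q := by
  have hmem : ∀ {i : ℕ}, i ≤ g → ∀ θ w, ‖w‖ < 15 → foldChart R i θ w ∈ solid g R :=
    fun hi θ w hw ↦ solidBdry_subset g R
      ((isDisk_foldChart hR hi θ).maps (mem_closedBall_zero_iff.2 hw.le))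
  obtain ⟨b1, b2, b3⟩ := foldChart_two hR (Nat.zero_le g) 0 (Or.inr rfl : (1 : ℝ) = 0 ∨ (1 : ℝ) = 1)
  obtain ⟨c1, c2, c3⟩ := foldChart_two hR (Nat.zero_le g) 0 (Or.inl rfl : (0 : ℝ) = 0 ∨ (0 : ℝ) = 1)
  suffices key : ∀ p : solid g R, p ∈ solidBdry' g R →
      Homog (solidBdry' g R) p ⟨_, hmem (Nat.zero_le g) 0 _ b3⟩ from
    (key p hp).trans (key q hq).symm
  intro p hp
  by_cases hw : ∃ i ≤ g, wallDepth R i (p : ℂ × ℝ).1 = 0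
  · obtain ⟨i, hi, h0⟩ := hw
    set θ := Complex.arg ((p : ℂ × ℝ).1 - 3 * i) with hθ
    have hp2 : 0 ≤ (p : ℂ × ℝ).2 ∧ (p : ℂ × ℝ).2 ≤ 1 := (mem_solid_iff.1 p.2).2
    have ht : |2 * (p : ℂ × ℝ).2 - 1| ≤ 1 := abs_le.2 ⟨by linarith, by linarith⟩
    obtain ⟨d1, d2, d3⟩ := foldChart_two hR hi θ (Or.inr rfl : (1 : ℝ) = 0 ∨ (1 : ℝ) = 1)
    have hz : ‖((2 * (p : ℂ × ℝ).2 - 1 : ℝ) * Complex.I : ℂ)‖ < 15 := by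
      rw [norm_mul, Complex.norm_I, mul_one, Complex.norm_real, Real.norm_eq_abs]; linarith
    have hr : wallRadius R i = ‖(p : ℂ × ℝ).1 - 3 * i‖ := by
      rw [wallDepth] at h0
      rcases mul_eq_zero.1 h0 with h | h
      · unfold wallSign at h; split_ifs at h <;> norm_num at h
      · linarith
    have hpz : (p : ℂ × ℝ) = foldChart R i θ ((2 * (p : ℂ × ℝ).2 - 1 : ℝ) * Complex.I) := by
      have him : ((2 * (p : ℂ × ℝ).2 - 1 : ℝ) * Complex.I : ℂ).im = 2 * (p : ℂ × ℝ).2 - 1 := by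
        rw [Complex.mul_im]; simp
      have hre : ((2 * (p : ℂ × ℝ).2 - 1 : ℝ) * Complex.I : ℂ).re = 0 := by
        rw [Complex.mul_re]; simp
      refine Prod.ext ?_ ?_
      · simp only [foldChart]
        rw [him, hre, max_eq_left (by linarith), zero_div, mul_zero, add_zero, zero_div, add_zero, hr,
          hθ, Complex.norm_mul_exp_arg_mul_I]
        ring
      · simp only [foldChart]
        rw [him, min_eq_right (by linarith), max_eq_right (by linarith)]
        ring
    have s1 : Homog (solidBdry' g R) p ⟨_, hmem hi θ _ d3⟩ :=
      (isDisk_foldChart hR hi θ).homog_solid hR hz d3 hpz rfl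
    exact s1.trans (homog_end hR d1 b1 (Or.inr d2) (b2.trans d2.symm))
  · push Not at hw
    have hpos : ∀ i ≤ g, 0 < wallDepth R i (p : ℂ × ℝ).1 := fun i hi ↦
      ((mem_solid_iff.1 p.2).1 i hi).lt_of_ne' (hw i hi)
    rcases (mem_solidBdry_iff.1 hp).2 with ⟨i, hi, h⟩ | h | h
    · exact absurd h (hw i hi)
    · have s1 : Homog (solidBdry' g R) p ⟨_, hmem (Nat.zero_le g) 0 _ c3⟩ :=
        homog_end hR hpos c1 (Or.inl h) (c2.trans h.symm)
      exact s1.trans ((isDisk_foldChart hR (Nat.zero_le g) 0).homog_solid hR c3 b3 rfl rfl)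
    · exact homog_end hR hpos b1 (Or.inr h) (b2.trans h.symm)

end Connected

/-! ### Parametrizations of handlebodies with prescribed boundary disks, and collars. -/

theorem IsDisk.image_of_isCompact {E Y Y' : Type*} [NormedAddCommGroup E] [TopologicalSpace Y]
    [TopologicalSpace Y'] [T2Space Y'] {S K : Set Y} {χ : E → Y} {ρ : ℝ} (h : IsDisk S χ ρ)
    {f : Y → Y'} (hK : IsCompact K) (hf : ContinuousOn f K) (hi : InjOn f K) (hS : S ⊆ K) :
    IsDisk (f '' S) (fun z ↦ f (χ z)) ρ := by
  refine ⟨hf.comp h.cont fun z hz ↦ hS (h.maps hz), hi.comp h.inj fun z hz ↦ hS (h.maps hz),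
    fun z hz ↦ mem_image_of_mem f (h.maps hz), ?_⟩
  obtain ⟨O, hO, h1⟩ := h.isOpen
  refine ⟨(f '' (K \ O))ᶜ,
    ((hK.diff hO).image_of_continuousOn (hf.mono sdiff_subset)).isClosed.isOpen_compl, ?_⟩
  rw [← image_image f χ, h1]
  ext y
  constructor
  · rintro ⟨x, ⟨hxO, hxS⟩, rfl⟩
    refine ⟨?_, x, hxS, rfl⟩
    rintro ⟨x', ⟨hx'K, hx'O⟩, hx'⟩
    exact hx'O (hi (hS hxS) hx'K hx'.symm ▸ hxO)
  · rintro ⟨hy, x, hxS, rfl⟩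
    refine ⟨x, ⟨?_, hxS⟩, rfl⟩
    by_contra hxO
    exact hy ⟨x, ⟨hS hxS, hxO⟩, rfl⟩

/-- `f` parametrizes `H`, with boundary `S`, by the punctured disk of radius `R` times the interval. -/
structure IsParam {M : Type*} [TopologicalSpace M] (g : ℕ) (R : ℝ) (f : ℂ × ℝ → M) (H S : Set M) :
    Prop where
  cont : ContinuousOn f (solid g R)
  inj : InjOn f (solid g R)
  image : f '' solid g R = H
  image_bdry : f '' solidBdry g R = S

theorem exists_homeomorph_rescale {a l : ℝ} (ha : 1 ≤ a) (hl : 0 < l) :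
    ∃ Φ : ℂ ≃ₜ ℂ, (∀ x, ‖x‖ ≤ a → Φ x = x) ∧ ∀ x, a ≤ ‖x‖ → ‖Φ x‖ = a + l * (‖x‖ - a) := by
  set φ : ℝ → ℂ → ℂ := fun l x ↦
    (((min (max ‖x‖ 1) a + l * (max (max ‖x‖ 1) a - a)) / max ‖x‖ 1 : ℝ) : ℂ) * x with hφ
  have hpos : ∀ x : ℂ, 0 < max ‖x‖ 1 := fun x ↦ zero_lt_one.trans_le (le_max_right _ _)
  have h1 : ∀ l x, ‖x‖ ≤ a → φ l x = x := by
    intro l x hx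
    have : max ‖x‖ 1 ≤ a := max_le hx ha
    simp only [hφ]
    rw [min_eq_left this, max_eq_right this, sub_self, mul_zero, add_zero, div_self (hpos x).ne']
    simp
  have h2 : ∀ l x, a ≤ ‖x‖ → φ l x = (((a + l * (‖x‖ - a)) / ‖x‖ : ℝ) : ℂ) * x := by
    intro l x hx
    simp only [hφ]
    rw [max_eq_left (ha.trans hx), min_eq_right hx, max_eq_left hx]
  have h3 : ∀ l, 0 < l → ∀ x, a ≤ ‖x‖ → ‖φ l x‖ = a + l * (‖x‖ - a) := by
    intro l hl x hx
    have : 0 < ‖x‖ := by linarith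
    have h4 : 0 ≤ l * (‖x‖ - a) := mul_nonneg hl.le (by linarith)
    rw [h2 l x hx, norm_mul, Complex.norm_real, Real.norm_of_nonneg (by positivity)]
    field_simp
  have hc : ∀ l, Continuous (φ l) := by
    intro l
    have : Continuous fun x : ℂ ↦
        (min (max ‖x‖ 1) a + l * (max (max ‖x‖ 1) a - a)) / max ‖x‖ 1 :=
      Continuous.div (by fun_prop) (by fun_prop) fun x ↦ (hpos x).ne'
    exact (Complex.continuous_ofReal.comp this).mul continuous_id
  have hinv : ∀ l l', 0 < l → l' * l = 1 → ∀ x, φ l' (φ l x) = x := by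
    intro l l' hl hl' x
    rcases le_total ‖x‖ a with h | h
    · rw [h1 l x h, h1 l' x h]
    · have h4 : 0 ≤ l * (‖x‖ - a) := mul_nonneg hl.le (by linarith)
      have h5 : 0 < ‖x‖ := by linarith
      rw [h2 l' _ (by rw [h3 l hl x h]; linarith), h3 l hl x h, h2 l x h, ← mul_assoc,
        ← Complex.ofReal_mul]
      have : (a + l' * (a + l * (‖x‖ - a) - a)) / (a + l * (‖x‖ - a)) * ((a + l * (‖x‖ - a)) / ‖x‖)
          = 1 := by
        have : a + l * (‖x‖ - a) ≠ 0 := by linarith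
        field_simp
        linear_combination (‖x‖ - a) * hl'
      rw [this]; simp
  exact ⟨⟨⟨φ l, φ l⁻¹, hinv l l⁻¹ hl (inv_mul_cancel₀ hl.ne'),
    hinv l⁻¹ l (inv_pos.2 hl) (mul_inv_cancel₀ hl.ne')⟩, hc l, hc l⁻¹⟩, h1 l, h3 l hl⟩

/-- Only the ring outside radius `3 * g + 1` is stretched; all holes lie within that radius and are
not moved. -/
theorem exists_homeomorph_solid {g : ℕ} {R R' : ℝ} (hR : 3 * (g : ℝ) + 2 ≤ R)
    (hR' : 3 * (g : ℝ) + 2 ≤ R') : ∃ Φ : ℂ × ℝ ≃ₜ ℂ × ℝ,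
      Φ '' solid g R = solid g R' ∧ Φ '' solidBdry g R = solidBdry g R' := by
  set a : ℝ := 3 * g + 1 with ha
  have hg : (0 : ℝ) ≤ g := Nat.cast_nonneg g
  have h1a : 1 ≤ a := by rw [ha]; linarith
  have haR : 0 < R - a := by rw [ha]; linarith
  have haR' : 0 < R' - a := by rw [ha]; linarith
  have hl : 0 < (R' - a) / (R - a) := div_pos haR' haR
  obtain ⟨Φ, h1, h2⟩ := exists_homeomorph_rescale h1a hl
  have hR1 : R' = a + (R' - a) / (R - a) * (R - a) := by field_simp; ring
  set l := (R' - a) / (R - a) with hldef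
  clear_value l
  have hle : ∀ x, (‖Φ x‖ ≤ R' ↔ ‖x‖ ≤ R) ∧ (‖Φ x‖ = R' ↔ ‖x‖ = R) := by
    intro x
    rcases le_total ‖x‖ a with h | h
    · rw [h1 x h]
      constructor <;> constructor <;> intro <;> linarith
    · rw [h2 x h]
      constructor
      · rw [hR1, add_le_add_iff_left, mul_le_mul_iff_right₀ hl]
        constructor <;> intro <;> linarith
      · rw [hR1, add_right_inj, mul_right_inj' hl.ne']
        constructor <;> intro <;> linarith
  have hhole : ∀ x, ∀ j : ℕ, j ≤ g → (1 ≤ ‖Φ x - 3 * j‖ ↔ 1 ≤ ‖x - 3 * j‖) ∧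
      (‖Φ x - 3 * j‖ = 1 ↔ ‖x - 3 * j‖ = 1) := by
    intro x j hj
    rcases le_or_gt ‖x‖ a with h | h
    · rw [h1 x h]; exact ⟨Iff.rfl, Iff.rfl⟩
    · have key : ∀ y : ℂ, a < ‖y‖ → 1 < ‖y - 3 * j‖ := by
        intro y hy
        have h3 := norm_sub_norm_le y (3 * j : ℂ)
        have h4 : ‖(3 * j : ℂ)‖ = 3 * j := by simp
        have h5 : (j : ℝ) ≤ g := by exact_mod_cast hj
        rw [h4] at h3
        linarith
      have k1 := key x h
      have k2 := key (Φ x) (by rw [h2 x h.le]; have := mul_pos hl (sub_pos.2 h); linarith)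
      constructor <;> constructor <;> intro <;> linarith
  set Ψ : ℂ × ℝ ≃ₜ ℂ × ℝ := Φ.prodCongr (Homeomorph.refl ℝ) with hΨ
  have hsolid : ∀ p, Ψ p ∈ solid g R' ↔ p ∈ solid g R := by
    intro p
    refine and_congr (hle p.1).1 (and_congr ?_ Iff.rfl)
    exact forall_congr' fun j ↦ forall_congr' fun hj ↦ forall_congr' fun hjg ↦ (hhole p.1 j hjg).1
  have hbdry : ∀ p, Ψ p ∈ solidBdry g R' ↔ p ∈ solidBdry g R := by
    intro p
    refine and_congr (hsolid p) (or_congr (hle p.1).2 (or_congr ?_ Iff.rfl))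
    exact exists_congr fun j ↦ and_congr_right fun hj ↦ and_congr_right fun hjg ↦
      (hhole p.1 j hjg).2
  refine ⟨Ψ, ?_, ?_⟩
  · ext p
    rw [Ψ.image_eq_preimage_symm, mem_preimage, ← hsolid, Ψ.apply_symm_apply]
  · ext p
    rw [Ψ.image_eq_preimage_symm, mem_preimage, ← hbdry, Ψ.apply_symm_apply]

section Param

variable {M : Type*} [TopologicalSpace M] {g : ℕ} {R : ℝ} {H S : Set M} {f : ℂ × ℝ → M}

theorem IsParam.isHandlebody [T2Space M] (h : IsParam g (3 * g + 2) f H S) :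
    IsHandlebody g H S := by
  have hK : CompactSpace (stdHandlebody g) := isCompact_iff_compactSpace.1 (isCompact_solid g _)
  have hpos : (0 : ℝ) < 3 * g + 2 := by positivity
  refine ⟨fun p ↦ f p, ?_, ?_, ?_⟩
  · have hc : Continuous fun p : stdHandlebody g ↦ f p := continuousOn_iff_continuous_domRestrict.1 h.cont
    exact (hc.isClosedEmbedding fun p q hpq ↦ Subtype.ext (h.inj p.2 q.2 hpq)).isEmbedding
  · rw [← h.image, ← stdHandlebody_eq_solid]
    ext y; simp
  · rw [stdHandlebody_eq_solid, frontier_solid g hpos, ← h.image_bdry]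
    ext y
    constructor
    · rintro ⟨p, hp, rfl⟩
      exact ⟨p, hp, rfl⟩
    · rintro ⟨p, hp, rfl⟩
      exact ⟨⟨p, solidBdry_subset g _ hp⟩, hp, rfl⟩

theorem IsHandlebody.exists_isParam (h : IsHandlebody g H S) (hR : 3 * (g : ℝ) + 2 ≤ R) :
    ∃ f, IsParam g R f H S := by
  obtain ⟨f, hf, hr, hb⟩ := h
  have hpos : (0 : ℝ) < 3 * g + 2 := by positivity
  obtain ⟨Φ, hΦ, hΦb⟩ := exists_homeomorph_solid hR le_rfl
  have hmem : ((0 : ℂ), (0 : ℝ)) ∈ stdHandlebody g := by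
    refine ⟨by simpa using hpos.le, fun j hj _ ↦ ?_, le_rfl, zero_le_one⟩
    have : (1 : ℝ) ≤ j := by exact_mod_cast hj
    simp only [zero_sub, norm_neg]
    simp
    linarith
  have hm : MapsTo Φ (solid g R) (stdHandlebody g) := fun p hp ↦
    hΦ.subset (mem_image_of_mem Φ hp)
  have hF : ∀ p (hp : p ∈ solid g R), f (liftTo (stdHandlebody g) ⟨_, hmem⟩ (Φ p)) =
      f ⟨Φ p, hm hp⟩ := fun p hp ↦ congrArg f (Subtype.ext (coe_liftTo (hm hp)))
  refine ⟨fun p ↦ f (liftTo (stdHandlebody g) ⟨_, hmem⟩ (Φ p)), ?_, ?_, ?_, ?_⟩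
  · exact hf.continuous.comp_continuousOn (Φ.continuous.continuousOn.liftTo hm _)
  · intro p hp q hq hpq
    simp only at hpq
    rw [hF p hp, hF q hq] at hpq
    exact Φ.injective (congrArg Subtype.val (hf.injective hpq))
  · rw [← hr]
    ext y
    constructor
    · rintro ⟨p, hp, rfl⟩; exact mem_range_self _
    · rintro ⟨⟨q, hq⟩, rfl⟩
      obtain ⟨p, hp, rfl⟩ := hΦ.symm.subset hq
      exact ⟨p, hp, hF p hp⟩
  · have hfr : frontier (stdHandlebody g) = solidBdry g (3 * g + 2) := frontier_solid g hpos
    simp only [hfr] at hb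
    rw [← hb]
    ext y
    constructor
    · rintro ⟨p, hp, rfl⟩
      exact ⟨⟨Φ p, hm (solidBdry_subset g R hp)⟩, hΦb.subset (mem_image_of_mem Φ hp),
        (hF p (solidBdry_subset g R hp)).symm⟩
    · rintro ⟨⟨q, hq⟩, hqb, rfl⟩
      obtain ⟨p, hp, rfl⟩ := hΦb.symm.subset hqb
      exact ⟨p, hp, hF p (solidBdry_subset g R hp)⟩

theorem IsParam.isCompact (h : IsParam g R f H S) : IsCompact H :=
  h.image ▸ (isCompact_solid g R).image_of_continuousOn h.cont

theorem IsParam.subset (h : IsParam g R f H S) : S ⊆ H := by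
  rw [← h.image, ← h.image_bdry]; exact image_mono (solidBdry_subset g R)

theorem IsParam.isCompact_bdry [T2Space M] (h : IsParam g R f H S) (hR : 0 < R) : IsCompact S :=
  h.image_bdry ▸ ((isCompact_solid g R).of_isClosed_subset (isClosed_solidBdry g hR)
    (solidBdry_subset g R)).image_of_continuousOn (h.cont.mono (solidBdry_subset g R))

/-- A handlebody can be parametrized so that a given disk in its boundary corresponds, up to a
reflection, to a given disk in the boundary of the model. -/
theorem IsHandlebody.exists_isParam_match [T2Space M] (h : IsHandlebody g H S)
    (hR : 3 * (g : ℝ) + 2 ≤ R) {χ₀ : ℂ → ℂ × ℝ} {χ : ℂ → M} {r ρ : ℝ} (hr : 0 < r) (hrρ : r < ρ)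
    (h₀ : IsDisk (solidBdry g R) χ₀ ρ) (hχ : IsDisk S χ ρ) :
    ∃ (f : ℂ × ℝ → M) (κ : ℂ → ℂ), IsReflection κ ∧ IsParam g R f H S ∧
      ∀ z ∈ closedBall (0 : ℂ) r, f (χ₀ z) = χ (κ z) := by
  obtain ⟨f, hf⟩ := h.exists_isParam hR
  have hRpos : 0 < R := by have := radius_pos hR; linarith
  have hK := isCompact_solid g R
  have hsub := solidBdry_subset g R
  have h0 : (0 : ℂ) ∈ closedBall (0 : ℂ) ρ := mem_closedBall_self (hr.trans hrρ).le
  have hY : CompactSpace (solid g R) := isCompact_iff_compactSpace.1 hK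
  have hleft : ∀ p ∈ solid g R, Function.invFunOn f (solid g R) (f p) = p := fun p hp ↦
    hf.inj.leftInvOn_invFunOn hp
  have hχ' : IsDisk (solidBdry g R) (fun z ↦ Function.invFunOn f (solid g R) (χ z)) ρ := by
    have h1 := hχ.image_of_isCompact (f := Function.invFunOn f (solid g R)) hf.isCompact
      (hf.image ▸ continuousOn_invFunOn_of_isCompact hK hf.cont hf.inj)
      (hf.image ▸ Function.invFunOn_injOn_image f _) hf.subset
    rwa [← hf.image_bdry, image_image, image_congr fun p hp ↦ hleft p (hsub hp), image_id'] at h1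
  set a : solid g R := ⟨χ₀ 0, hsub (h₀.maps h0)⟩ with ha
  have d₀ := h₀.liftTo hsub a
  have d' := hχ'.liftTo hsub a
  -- Homogeneity brings the centre of one disk to the centre of the other, which is the starting
  -- point for matching them.
  obtain ⟨e₀, he₀, heq⟩ := homog_solidBdry hR (d₀.maps h0) (d'.maps h0)
  obtain ⟨e, κ, hκ, he, hmatch⟩ := (transportable_solidBdry hR).exists_match hr hrρ d₀ d' he₀
    (z₁ := 0) (z₂ := 0) (by simpa using hr.trans hrρ) (by simpa using hr.trans hrρ) heq
  refine ⟨fun p ↦ f (e (liftTo (solid g R) a p)), κ, hκ, ⟨?_, ?_, ?_, ?_⟩, ?_⟩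
  · exact hf.cont.comp ((continuous_subtype_val.comp e.continuous).comp_continuousOn
      (continuousOn_id.liftTo (fun p hp ↦ hp) a)) fun p _ ↦ (e _).2
  · intro p hp q hq hpq
    have h1 := e.injective (Subtype.ext (hf.inj (e _).2 (e _).2 hpq))
    rw [← coe_liftTo (a := a) hp, h1, coe_liftTo hq]
  · rw [← hf.image]
    ext y
    constructor
    · rintro ⟨p, -, rfl⟩; exact ⟨_, (e _).2, rfl⟩
    · rintro ⟨p, hp, rfl⟩
      exact ⟨e.symm ⟨p, hp⟩, (e.symm ⟨p, hp⟩).2, by simp only; rw [liftTo_coe, e.apply_symm_apply]⟩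
  · rw [← hf.image_bdry]
    ext y
    constructor
    · rintro ⟨p, hp, rfl⟩
      refine ⟨_, he.subset (mem_image_of_mem e ?_), rfl⟩
      rw [solidBdry', mem_preimage, coe_liftTo (hsub hp)]; exact hp
    · rintro ⟨p, hp, rfl⟩
      obtain ⟨q, hq, hqp⟩ := he.symm.subset (show (⟨p, hsub hp⟩ : solid g R) ∈ solidBdry' g R from hp)
      exact ⟨q, hq, by simp only; rw [liftTo_coe, hqp]⟩
  · intro z hz
    have hzρ := closedBall_subset_closedBall hrρ.le hz
    have hκρ : κ z ∈ closedBall (0 : ℂ) ρ := by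
      rw [mem_closedBall_zero_iff, hκ.norm]; exact mem_closedBall_zero_iff.1 hzρ
    simp only
    rw [hmatch z hz, coe_liftTo (hsub (hχ'.maps hκρ))]
    exact Function.invFunOn_eq (by rw [← mem_image, hf.image]; exact hf.subset (hχ.maps hκρ))

/-- A collar of the boundary of a handlebody. -/
theorem IsHandlebody.exists_collar [T2Space M] (h : IsHandlebody g H S) :
    ∃ c : M × ℝ → M, ContinuousOn c (S ×ˢ Icc 0 1) ∧ InjOn c (S ×ˢ Icc 0 1) ∧
      (∀ y ∈ S, c (y, 0) = y) ∧ MapsTo c (S ×ˢ Icc 0 1) H ∧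
      ∀ U, IsOpen U → ∃ O, IsOpen O ∧ c '' ((S ∩ U) ×ˢ Ico 0 1) = O ∩ H := by
  have hR : 3 * (g : ℝ) + 2 ≤ 3 * g + 2 := le_rfl
  set R : ℝ := 3 * g + 2 with hRdef
  have hRpos : 0 < R := by have := radius_pos hR; linarith
  obtain ⟨f, hf⟩ := h.exists_isParam hR
  have hK := isCompact_solid g R
  have hsub := solidBdry_subset g R
  set F := Function.invFunOn f (solid g R) with hFdef
  have hleft : ∀ p ∈ solid g R, F (f p) = p := fun p hp ↦ hf.inj.leftInvOn_invFunOn hp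
  have hFc : ContinuousOn F H := hf.image ▸ continuousOn_invFunOn_of_isCompact hK hf.cont hf.inj
  have hFS : ∀ y ∈ S, F y ∈ solidBdry g R ∧ f (F y) = y := by
    intro y hy
    obtain ⟨p, hp, rfl⟩ := hf.image_bdry.symm.subset hy
    rw [hleft p (hsub hp)]; exact ⟨hp, rfl⟩
  have hmem : ∀ q ∈ S ×ˢ Icc (0 : ℝ) 1, (F q.1, q.2) ∈ solidBdry g R ×ˢ Icc (0 : ℝ) 1 :=
    fun q hq ↦ ⟨(hFS q.1 hq.1).1, hq.2⟩
  have hcm : ∀ q ∈ S ×ˢ Icc (0 : ℝ) 1, solidCollar g R (F q.1, q.2) ∈ solid g R :=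
    fun q hq ↦ solidCollar_mem hR (hmem q hq)
  have hcont : ContinuousOn (fun q : M × ℝ ↦ f (solidCollar g R (F q.1, q.2))) (S ×ˢ Icc 0 1) :=
    hf.cont.comp ((continuous_solidCollar g R).comp_continuousOn
      ((hFc.comp continuousOn_fst fun q hq ↦ hf.subset hq.1).prodMk continuousOn_snd)) hcm
  have hinj : InjOn (fun q : M × ℝ ↦ f (solidCollar g R (F q.1, q.2))) (S ×ˢ Icc 0 1) := by
    intro q hq q' hq' hqq
    have h1 := solidCollar_injOn hR (hmem q hq) (hmem q' hq') (hf.inj (hcm q hq) (hcm q' hq') hqq)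
    rw [Prod.mk.injEq] at h1
    refine Prod.ext ?_ h1.2
    rw [← (hFS q.1 hq.1).2, h1.1, (hFS q'.1 hq'.1).2]
  refine ⟨_, hcont, hinj, fun y hy ↦ ?_, fun q hq ↦ hf.image ▸ mem_image_of_mem f (hcm q hq), ?_⟩
  · simp only
    rw [solidCollar_zero, (hFS y hy).2]
  · intro U hU
    have hSc := hf.isCompact_bdry hRpos
    set N := {p : ℂ × ℝ | (∃ i ∈ Finset.range (g + 1), wallDepth R i p.1 < 1 / 4) ∨ p.2 < 1 / 4 ∨
      3 / 4 < p.2} with hN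
    have hNo : IsOpen N := isOpen_solidCollar_aux g R
    have himN : ∀ p, p ∈ solid g R → p ∈ N → ∃ q ∈ solidBdry g R ×ˢ Ico (0 : ℝ) 1,
        solidCollar g R q = p := fun p hp hpN ↦ (solidCollar_image hR).symm.subset ⟨hp, hpN⟩
    have hNim : ∀ q ∈ solidBdry g R ×ˢ Ico (0 : ℝ) 1, solidCollar g R q ∈ N := fun q hq ↦
      ((solidCollar_image hR).subset (mem_image_of_mem _ hq)).2
    -- Relative openness is shown by removing two compact sets: the part of the handlebody below the
    -- open collar, and the collar over the rest of the surface.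
    refine ⟨(f '' (solid g R \ N))ᶜ ∩
      ((fun q : M × ℝ ↦ f (solidCollar g R (F q.1, q.2))) '' ((S \ U) ×ˢ Icc 0 1))ᶜ, ?_, ?_⟩
    · refine IsOpen.inter ?_ ?_
      · exact ((hK.diff hNo).image_of_continuousOn
          (hf.cont.mono sdiff_subset)).isClosed.isOpen_compl
      · exact (((hSc.diff hU).prod isCompact_Icc).image_of_continuousOn
          (hcont.mono (prod_mono sdiff_subset subset_rfl))).isClosed.isOpen_compl
    · ext y
      constructor
      · rintro ⟨q, ⟨⟨hqS, hqU⟩, hq⟩, rfl⟩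
        have hq' : q ∈ S ×ˢ Icc (0 : ℝ) 1 := ⟨hqS, Ico_subset_Icc_self hq⟩
        refine ⟨⟨?_, ?_⟩, hf.image ▸ mem_image_of_mem f (hcm q hq')⟩
        · rintro ⟨p, ⟨hp, hpN⟩, hpq⟩
          rw [hf.inj hp (hcm q hq') hpq] at hpN
          exact hpN (hNim (F q.1, q.2) ⟨(hmem q hq').1, hq⟩)
        · rintro ⟨q₁, ⟨⟨hq1S, hq1U⟩, hq1⟩, hqq⟩
          exact hq1U (hinj (show q₁ ∈ S ×ˢ Icc (0 : ℝ) 1 from ⟨hq1S, hq1⟩) hq' hqq ▸ hqU)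
      · rintro ⟨⟨h1, h2⟩, hyH⟩
        obtain ⟨p, hp, rfl⟩ := hf.image.symm.subset hyH
        have hpN : p ∈ N := by
          by_contra hpN
          exact h1 ⟨p, ⟨hp, hpN⟩, rfl⟩
        obtain ⟨⟨b, s⟩, ⟨hb, hs⟩, rfl⟩ := himN p hp hpN
        have hbS : f b ∈ S := hf.image_bdry ▸ mem_image_of_mem f hb
        have hval : f (solidCollar g R (F (f b), s)) = f (solidCollar g R (b, s)) := by
          rw [hleft b (hsub hb)]
        refine ⟨(f b, s), ⟨⟨hbS, ?_⟩, hs⟩, hval⟩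
        by_contra hbU
        exact h2 ⟨(f b, s), ⟨⟨hbS, hbU⟩, Ico_subset_Icc_self hs⟩, hval⟩

end Param

/-! ### Fibrewise homeomorphisms and gluing of parametrized pieces. -/

/-- On each fibre, staying at bounded distance from a line of positive slope gives surjectivity.
Strict monotonicity traps the inverse between two values, which gives its joint continuity. -/
theorem exists_homeomorph_fiber {Y : Type*} [TopologicalSpace Y] {f : ℝ × Y → ℝ}
    (hf : Continuous f) (hm : ∀ y, StrictMono fun x ↦ f (x, y)) {c C : ℝ} (hc : 0 < c)
    (hb : ∀ x y, |f (x, y) - c * x| ≤ C) :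
    ∃ e : ℝ × Y ≃ₜ ℝ × Y, ∀ p, e p = (f p, p.2) := by
  have hsurj : ∀ y, Function.Surjective fun x ↦ f (x, y) := by
    intro y
    refine Continuous.surjective (by fun_prop) ?_ ?_
    · refine tendsto_atTop_mono (f := fun x ↦ c * x + -C) (fun x ↦ ?_)
        (tendsto_atTop_add_const_right _ _ (tendsto_id.const_mul_atTop hc))
      linarith [(abs_le.1 (hb x y)).1]
    · have h1 : Tendsto (fun x ↦ c * x + C) atBot atBot :=
        tendsto_atBot_add_const_right _ _ (tendsto_id.const_mul_atBot hc)
      refine tendsto_atBot_mono (fun x ↦ ?_) h1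
      linarith [(abs_le.1 (hb x y)).2]
  choose i hi using hsurj
  refine ⟨⟨⟨fun p ↦ (f p, p.2), fun p ↦ (i p.2 p.1, p.2), fun p ↦ ?_, fun p ↦ ?_⟩,
    by fun_prop, ?_⟩, fun p ↦ rfl⟩
  · exact Prod.ext ((hm p.2).injective (hi p.2 (f p))) rfl
  · exact Prod.ext (hi p.2 p.1) rfl
  · refine Continuous.prodMk ?_ continuous_snd
    rw [continuous_iff_continuousAt]
    rintro ⟨z, y⟩
    rw [ContinuousAt, Metric.tendsto_nhds]
    intro ε hε
    have h1 : f (i y z - ε, y) < z := by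
      conv_rhs => rw [← hi y z]
      exact hm y (by linarith)
    have h2 : z < f (i y z + ε, y) := by
      conv_lhs => rw [← hi y z]
      exact hm y (by linarith)
    have o1 : IsOpen {p : ℝ × Y | f (i y z - ε, p.2) < p.1} := isOpen_lt (by fun_prop) (by fun_prop)
    have o2 : IsOpen {p : ℝ × Y | p.1 < f (i y z + ε, p.2)} := isOpen_lt (by fun_prop) (by fun_prop)
    filter_upwards [o1.mem_nhds h1, o2.mem_nhds h2] with p hp1 hp2
    rw [← hi p.2 p.1] at hp1 hp2
    have h3 := (hm p.2).lt_iff_lt.1 hp1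
    have h4 := (hm p.2).lt_iff_lt.1 hp2
    rw [Real.dist_eq, abs_lt]
    constructor
    · linarith
    · linarith

theorem exists_homeomorph_shear {f : ℝ × ℝ → ℝ} (hf : Continuous f)
    (hm : ∀ y, StrictMono fun x ↦ f (x, y)) {c C : ℝ} (hc : 0 < c)
    (hb : ∀ x y, |f (x, y) - c * x| ≤ C) :
    ∃ e : ℂ ≃ₜ ℂ, ∀ z : ℂ, (e z).re = f (z.re, z.im) ∧ (e z).im = z.im := by
  obtain ⟨e, he⟩ := exists_homeomorph_fiber hf hm hc hb
  set L := Complex.equivRealProdCLM.toHomeomorph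
  refine ⟨L.trans (e.trans L.symm), fun z ↦ ?_⟩
  have h1 : (L.trans (e.trans L.symm)) z = L.symm (e (z.re, z.im)) := rfl
  have h2 : ∀ p : ℝ × ℝ, (L.symm p).re = p.1 ∧ (L.symm p).im = p.2 := fun p ↦ by
    have : L.symm p = Complex.equivRealProd.symm p := rfl
    rw [this]; exact ⟨rfl, rfl⟩
  rw [h1, he]
  exact h2 _

/-- The hypothesis `h` says that the pieces overlap in `Y` exactly as they do in `M`; then `m ∘ n⁻¹`
is well defined and injective across the pieces. -/
theorem exists_glue {X₁ X₂ Y M : Type*} [TopologicalSpace X₁] [TopologicalSpace X₂]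
    [TopologicalSpace Y] [TopologicalSpace M] [T2Space Y] [Nonempty X₁] [Nonempty X₂]
    {K₁ : Set X₁} {K₂ : Set X₂} (hK₁ : IsCompact K₁) (hK₂ : IsCompact K₂) {n₁ : X₁ → Y}
    {n₂ : X₂ → Y} {m₁ : X₁ → M} {m₂ : X₂ → M} (hn₁ : ContinuousOn n₁ K₁) (hn₂ : ContinuousOn n₂ K₂)
    (hm₁ : ContinuousOn m₁ K₁) (hm₂ : ContinuousOn m₂ K₂) (in₁ : InjOn n₁ K₁) (in₂ : InjOn n₂ K₂)
    (im₁ : InjOn m₁ K₁) (im₂ : InjOn m₂ K₂)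
    (h : ∀ x ∈ K₁, ∀ y ∈ K₂, n₁ x = n₂ y ↔ m₁ x = m₂ y) :
    ∃ F : Y → M, ContinuousOn F (n₁ '' K₁ ∪ n₂ '' K₂) ∧ InjOn F (n₁ '' K₁ ∪ n₂ '' K₂) ∧
      (∀ x ∈ K₁, F (n₁ x) = m₁ x) ∧ ∀ y ∈ K₂, F (n₂ y) = m₂ y := by
  classical
  set F : Y → M := fun z ↦ if z ∈ n₁ '' K₁ then m₁ (Function.invFunOn n₁ K₁ z) else
    m₂ (Function.invFunOn n₂ K₂ z) with hF
  have l₁ : ∀ x ∈ K₁, Function.invFunOn n₁ K₁ (n₁ x) = x := fun x hx ↦ in₁.leftInvOn_invFunOn hx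
  have l₂ : ∀ x ∈ K₂, Function.invFunOn n₂ K₂ (n₂ x) = x := fun x hx ↦ in₂.leftInvOn_invFunOn hx
  have F₁ : ∀ x ∈ K₁, F (n₁ x) = m₁ x := fun x hx ↦ by
    simp only [hF]
    rw [if_pos (mem_image_of_mem n₁ hx), l₁ x hx]
  have F₂ : ∀ y ∈ K₂, F (n₂ y) = m₂ y := fun y hy ↦ by
    by_cases hyK : n₂ y ∈ n₁ '' K₁
    · obtain ⟨x, hx, hxy⟩ := hyK
      rw [← hxy, F₁ x hx]
      exact (h x hx y hy).1 hxy
    · simp only [hF]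
      rw [if_neg hyK, l₂ y hy]
  refine ⟨F, ?_, ?_, F₁, F₂⟩
  · refine ContinuousOn.union_of_isClosed ?_ ?_ (hK₁.image_of_continuousOn hn₁).isClosed
      (hK₂.image_of_continuousOn hn₂).isClosed
    · refine (hm₁.comp (continuousOn_invFunOn_of_isCompact hK₁ hn₁ in₁) ?_).congr ?_
      · rintro _ ⟨x, hx, rfl⟩; rwa [l₁ x hx]
      · rintro _ ⟨x, hx, rfl⟩
        simp only [Function.comp]
        rw [F₁ x hx, l₁ x hx]
    · refine (hm₂.comp (continuousOn_invFunOn_of_isCompact hK₂ hn₂ in₂) ?_).congr ?_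
      · rintro _ ⟨x, hx, rfl⟩; rwa [l₂ x hx]
      · rintro _ ⟨x, hx, rfl⟩
        simp only [Function.comp]
        rw [F₂ x hx, l₂ x hx]
  · rintro _ (⟨x, hx, rfl⟩ | ⟨x, hx, rfl⟩) _ (⟨y, hy, rfl⟩ | ⟨y, hy, rfl⟩) hxy
    · rw [F₁ x hx, F₁ y hy] at hxy
      rw [im₁ hx hy hxy]
    · rw [F₁ x hx, F₂ y hy] at hxy
      exact (h x hx y hy).2 hxy
    · rw [F₂ x hx, F₁ y hy] at hxy
      exact ((h y hy x hx).2 hxy.symm).symm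
    · rw [F₂ x hx, F₂ y hy] at hxy
      rw [im₂ hx hy hxy]

/-! ### The band that forms the last handle of the model. -/

section Model

/-- The cube `[-1, 1]³`. -/
def cube : Set (ℝ × ℝ × ℝ) := Icc (-1) 1 ×ˢ Icc (-1) 1 ×ˢ Icc (-1) 1

theorem isCompact_cube : IsCompact cube := isCompact_Icc.prod (isCompact_Icc.prod isCompact_Icc)

variable (g : ℕ)

/-- The distance, in the direction `θ`, from the centre of the last hole to the outer circle. -/
noncomputable def bandWidth (θ : ℝ) : ℝ :=
  √((3 * g + 5) ^ 2 - ((3 * g + 3) * Real.sin θ) ^ 2) - (3 * g + 3) * Real.cos θ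

/-- The half of the solid beyond the centre of the last hole, as the image of a cube. -/
noncomputable def modelBand (c : ℝ × ℝ × ℝ) : ℂ × ℝ :=
  (((3 * g + 3 : ℝ) : ℂ) + ((1 + (1 - c.2.2) / 2 * (bandWidth g (c.1 * (Real.pi / 2)) - 1) : ℝ) : ℂ) *
    Complex.exp ((c.1 * (Real.pi / 2) : ℝ) * Complex.I), (1 + c.2.1) / 2)

theorem continuous_modelBand : Continuous (modelBand g) := by
  unfold modelBand bandWidth; fun_prop

theorem bandWidth_sq (θ : ℝ) : (bandWidth g θ + (3 * g + 3) * Real.cos θ) ^ 2 =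
    (3 * g + 5) ^ 2 - ((3 * g + 3) * Real.sin θ) ^ 2 := by
  have hg : (0 : ℝ) ≤ g := Nat.cast_nonneg g
  rw [bandWidth, sub_add_cancel, Real.sq_sqrt]
  nlinarith [Real.sin_sq_le_one θ, mul_nonneg hg hg]

theorem bandWidth_add_nonneg (θ : ℝ) : 0 ≤ bandWidth g θ + (3 * g + 3) * Real.cos θ := by
  rw [bandWidth, sub_add_cancel]; exact Real.sqrt_nonneg _

theorem two_le_bandWidth (θ : ℝ) : 2 ≤ bandWidth g θ := by
  have hg : (0 : ℝ) ≤ g := Nat.cast_nonneg g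
  rw [bandWidth, le_sub_iff_add_le]
  refine Real.le_sqrt_of_sq_le ?_
  nlinarith [Real.sin_sq_add_cos_sq θ, Real.cos_le_one θ]

theorem norm_add_polar_sq (o r θ : ℝ) :
    ‖((o : ℂ) + (r : ℂ) * Complex.exp ((θ : ℝ) * Complex.I))‖ ^ 2 =
      (r + o * Real.cos θ) ^ 2 + (o * Real.sin θ) ^ 2 := by
  rw [← Complex.normSq_eq_norm_sq, Complex.exp_mul_I, ← Complex.ofReal_cos, ← Complex.ofReal_sin,
    Complex.normSq_apply]
  simp only [Complex.add_re, Complex.mul_re, Complex.add_im, Complex.mul_im, Complex.ofReal_re,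
    Complex.ofReal_im, Complex.I_re, Complex.I_im]
  linear_combination (r ^ 2 - o ^ 2) * Real.sin_sq_add_cos_sq θ


/-- The radial coordinate of a point of the band. -/
noncomputable def bandRadius (c : ℝ × ℝ × ℝ) : ℝ :=
  1 + (1 - c.2.2) / 2 * (bandWidth g (c.1 * (Real.pi / 2)) - 1)

theorem modelBand_fst_sub (c : ℝ × ℝ × ℝ) : (modelBand g c).1 - ((3 * g + 3 : ℝ) : ℂ) =
    (bandRadius g c : ℂ) * Complex.exp ((c.1 * (Real.pi / 2) : ℝ) * Complex.I) := by
  rw [modelBand, bandRadius]; simp only; rw [add_sub_cancel_left]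

variable {g}

theorem bandRadius_bounds {c : ℝ × ℝ × ℝ} (hc : c ∈ cube) : 1 ≤ bandRadius g c ∧
    bandRadius g c ≤ bandWidth g (c.1 * (Real.pi / 2)) ∧ (bandRadius g c = 1 ↔ c.2.2 = 1) ∧
    (bandRadius g c = bandWidth g (c.1 * (Real.pi / 2)) ↔ c.2.2 = -1) := by
  have h := two_le_bandWidth g (c.1 * (Real.pi / 2))
  obtain ⟨-, -, h1, h2⟩ := hc
  unfold bandRadius
  refine ⟨by nlinarith, by nlinarith, ⟨fun h' ↦ ?_, fun h' ↦ by rw [h']; ring⟩,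
    ⟨fun h' ↦ ?_, fun h' ↦ by rw [h']; ring⟩⟩ <;> nlinarith

theorem cube_angle {c : ℝ × ℝ × ℝ} (hc : c ∈ cube) : 0 ≤ Real.cos (c.1 * (Real.pi / 2)) ∧
    (Real.cos (c.1 * (Real.pi / 2)) = 0 ↔ |c.1| = 1) := by
  have hπ := Real.pi_pos
  obtain ⟨⟨h1, h2⟩, -⟩ := hc
  refine ⟨Real.cos_nonneg_of_mem_Icc ⟨by nlinarith, by nlinarith⟩, fun h ↦ ?_, fun h ↦ ?_⟩
  · by_contra hne
    have h3 : |c.1| < 1 := lt_of_le_of_ne (abs_le.2 ⟨h1, h2⟩) hne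
    obtain ⟨h4, h5⟩ := abs_lt.1 h3
    exact (Real.cos_pos_of_mem_Ioo ⟨by nlinarith, by nlinarith⟩).ne' h
  · rcases eq_or_eq_neg_of_abs_eq h with h | h <;> rw [h] <;> simp

theorem norm_modelBand {c : ℝ × ℝ × ℝ} (hc : c ∈ cube) : ‖(modelBand g c).1‖ ≤ 3 * g + 5 ∧
    (‖(modelBand g c).1‖ = 3 * g + 5 ↔ c.2.2 = -1) := by
  obtain ⟨h1, h2, h3, h4⟩ := bandRadius_bounds (g := g) hc
  have hcos := (cube_angle hc).1
  have hw := bandWidth_sq g (c.1 * (Real.pi / 2))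
  have hn := norm_add_polar_sq (3 * g + 3) (bandRadius g c) (c.1 * (Real.pi / 2))
  rw [← modelBand_fst_sub, add_sub_cancel] at hn
  have hg : (0 : ℝ) ≤ g := Nat.cast_nonneg g
  have ho : 0 ≤ (3 * (g : ℝ) + 3) * Real.cos (c.1 * (Real.pi / 2)) := by positivity
  have hn0 := norm_nonneg (modelBand g c).1
  constructor
  · refine abs_le_of_sq_le_sq' ?_ (by positivity) |>.2
    rw [hn]
    nlinarith
  · rw [← h4, ← sq_eq_sq₀ hn0 (by positivity), hn]
    constructor
    · intro h
      have : (bandRadius g c + (3 * g + 3) * Real.cos (c.1 * (Real.pi / 2))) ^ 2 =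
        (bandWidth g (c.1 * (Real.pi / 2)) + (3 * g + 3) * Real.cos (c.1 * (Real.pi / 2))) ^ 2 := by
        linarith
      rw [sq_eq_sq₀ (by linarith) (by linarith)] at this
      linarith
    · intro h
      rw [h]; linarith

theorem modelBand_re (c : ℝ × ℝ × ℝ) : (modelBand g c).1.re =
    3 * g + 3 + bandRadius g c * Real.cos (c.1 * (Real.pi / 2)) := by
  have h := congrArg Complex.re (modelBand_fst_sub g c)
  rw [Complex.exp_mul_I, ← Complex.ofReal_cos, ← Complex.ofReal_sin] at h
  simp only [Complex.sub_re, Complex.mul_re, Complex.ofReal_re, Complex.add_re, Complex.ofReal_im,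
    Complex.I_re, Complex.I_im, Complex.add_im, Complex.mul_im] at h
  linarith

theorem le_modelBand_re {c : ℝ × ℝ × ℝ} (hc : c ∈ cube) : 3 * (g : ℝ) + 3 ≤ (modelBand g c).1.re ∧
    ((modelBand g c).1.re = 3 * g + 3 ↔ |c.1| = 1) := by
  obtain ⟨h1, -⟩ := bandRadius_bounds (g := g) hc
  obtain ⟨h2, h3⟩ := cube_angle hc
  rw [modelBand_re]
  refine ⟨by nlinarith, ?_⟩
  rw [← h3]
  constructor
  · intro h
    have : bandRadius g c * Real.cos (c.1 * (Real.pi / 2)) = 0 := by linarith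
    rcases mul_eq_zero.1 this with h | h
    · linarith
    · exact h
  · intro h; rw [h]; ring

theorem norm_modelBand_sub {c : ℝ × ℝ × ℝ} (hc : c ∈ cube) :
    ‖(modelBand g c).1 - ((3 * g + 3 : ℝ) : ℂ)‖ = bandRadius g c := by
  rw [modelBand_fst_sub, norm_mul, Complex.norm_exp_ofReal_mul_I, mul_one, Complex.norm_real,
    Real.norm_of_nonneg (by linarith [(bandRadius_bounds (g := g) hc).1])]

/-- The band lies to the right of the centre of the last hole, so all earlier holes are far from it.
-/
theorem three_le_norm_sub {x : ℂ} (hx : 3 * (g : ℝ) + 3 ≤ x.re) {j : ℕ} (hj : j ≤ g) :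
    3 ≤ ‖x - 3 * j‖ := by
  have h1 := Complex.re_le_norm (x - 3 * j)
  have h2 : (x - 3 * j).re = x.re - 3 * j := by simp
  have h3 : (j : ℝ) ≤ g := by exact_mod_cast hj
  linarith

theorem modelBand_mem {c : ℝ × ℝ × ℝ} (hc : c ∈ cube) :
    modelBand g c ∈ solid (g + 1) (3 * g + 5) := by
  refine ⟨(norm_modelBand hc).1, fun j hj hjg ↦ ?_, ?_, ?_⟩
  · rcases Nat.lt_or_ge g j with h | h
    · obtain rfl : j = g + 1 := by omega
      have h1 := norm_modelBand_sub (g := g) hc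
      push_cast at h1 ⊢
      rw [show (3 * ((g : ℂ) + 1)) = 3 * g + 3 by ring, h1]
      exact (bandRadius_bounds hc).1
    · linarith [three_le_norm_sub (le_modelBand_re hc).1 h]
  · have := hc.2.1.1; simp only [modelBand]; linarith
  · have := hc.2.1.2; simp only [modelBand]; linarith

theorem modelBand_mem_bdry {c : ℝ × ℝ × ℝ} (hc : c ∈ cube) :
    modelBand g c ∈ solidBdry (g + 1) (3 * g + 5) ↔ |c.2.1| = 1 ∨ |c.2.2| = 1 := by
  have h1 := norm_modelBand_sub (g := g) hc
  have h2 := (bandRadius_bounds (g := g) hc).2.2.1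
  push_cast at h1
  have ht : (modelBand g c).2 = (1 + c.2.1) / 2 := rfl
  constructor
  · rintro ⟨-, h | ⟨j, hj, hjg, h⟩ | h | h⟩
    · right; rw [(norm_modelBand hc).2.1 h]; simp
    · rcases Nat.lt_or_ge g j with h' | h'
      · obtain rfl : j = g + 1 := by omega
        push_cast at h
        rw [show (3 * ((g : ℂ) + 1)) = 3 * g + 3 by ring, h1] at h
        right; rw [h2.1 h]; simp
      · linarith [three_le_norm_sub (le_modelBand_re hc).1 h']
    · left
      rw [ht] at h
      rw [show c.2.1 = -1 by linarith]; simp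
    · left
      rw [ht] at h
      rw [show c.2.1 = 1 by linarith]; simp
  · intro h
    refine ⟨modelBand_mem hc, ?_⟩
    rcases h with h | h
    · right; right
      rw [ht]
      rcases eq_or_eq_neg_of_abs_eq h with h | h <;> rw [h] <;> norm_num
    · rcases eq_or_eq_neg_of_abs_eq h with h | h
      · right; left
        refine ⟨g + 1, by omega, le_rfl, ?_⟩
        push_cast
        rw [show (3 * ((g : ℂ) + 1)) = 3 * g + 3 by ring, h1, h2.2 h]
      · left; exact (norm_modelBand hc).2.2 h

theorem modelBand_injOn : InjOn (modelBand g) cube := by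
  intro c hc c' hc' h
  have hr := norm_modelBand_sub (g := g) hc
  rw [h, norm_modelBand_sub hc'] at hr
  have h1 := (bandRadius_bounds (g := g) hc).1
  have hπ := Real.pi_pos
  have harg : ∀ c ∈ cube, Complex.arg ((modelBand g c).1 - ((3 * g + 3 : ℝ) : ℂ)) =
      c.1 * (Real.pi / 2) := by
    intro c hc
    have h1 := (bandRadius_bounds (g := g) hc).1
    obtain ⟨⟨h2, h3⟩, -⟩ := hc
    rw [modelBand_fst_sub, Complex.exp_mul_I]
    exact Complex.arg_mul_cos_add_sin_mul_I (by linarith) ⟨by nlinarith, by nlinarith⟩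
  have e1 : c.1 = c'.1 := by
    have := harg c hc
    rw [h, harg c' hc'] at this
    exact (mul_right_cancel₀ (by positivity) this).symm
  have e2 : c.2.1 = c'.2.1 := by
    have := congrArg Prod.snd h
    simp only [modelBand] at this
    linarith
  have e3 : c.2.2 = c'.2.2 := by
    rw [bandRadius, bandRadius, e1] at hr
    have h2 := two_le_bandWidth g (c'.1 * (Real.pi / 2))
    have h3 : (1 - c'.2.2) / 2 * (bandWidth g (c'.1 * (Real.pi / 2)) - 1) =
      (1 - c.2.2) / 2 * (bandWidth g (c'.1 * (Real.pi / 2)) - 1) := by linarith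
    have := mul_right_cancel₀ (by linarith) h3
    linarith
  exact Prod.ext e1 (Prod.ext e2 e3)

theorem exists_modelBand {p : ℂ × ℝ} (hp : p ∈ solid (g + 1) (3 * g + 5))
    (hre : 3 * (g : ℝ) + 3 ≤ p.1.re) : ∃ c ∈ cube, modelBand g c = p := by
  obtain ⟨h1, h2, h3, h4⟩ := hp
  have h2' := h2 (g + 1) (by omega) le_rfl
  push_cast at h2'
  rw [show (3 * ((g : ℂ) + 1)) = ((3 * g + 3 : ℝ) : ℂ) by push_cast; ring] at h2'
  have hπ := Real.pi_pos
  have hg : (0 : ℝ) ≤ g := Nat.cast_nonneg g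
  set x := p.1 - ((3 * g + 3 : ℝ) : ℂ) with hx
  have hxre : 0 ≤ x.re := by
    rw [hx, Complex.sub_re, Complex.ofReal_re]; linarith
  have harg := abs_le.1 (Complex.abs_arg_le_pi_div_two_iff.2 hxre)
  set σ := Complex.arg x / (Real.pi / 2) with hσ
  have hσθ : σ * (Real.pi / 2) = Complex.arg x := by rw [hσ]; field_simp
  have hσ1 : -1 ≤ σ ∧ σ ≤ 1 := by
    constructor
    · rw [hσ, le_div_iff₀ (by positivity)]; linarith
    · rw [hσ, div_le_iff₀ (by positivity)]; linarith
  have hpx : p.1 = ((3 * g + 3 : ℝ) : ℂ) + (‖x‖ : ℂ) * Complex.exp ((Complex.arg x : ℝ) * Complex.I) := by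
    rw [Complex.norm_mul_exp_arg_mul_I, hx, add_sub_cancel]
  have hw2 := two_le_bandWidth g (Complex.arg x)
  have hxw : ‖x‖ ≤ bandWidth g (Complex.arg x) := by
    have e1 := norm_add_polar_sq (3 * g + 3) ‖x‖ (Complex.arg x)
    rw [← hpx] at e1
    have e2 := bandWidth_sq g (Complex.arg x)
    have e3 : ‖p.1‖ ^ 2 ≤ (3 * (g : ℝ) + 5) ^ 2 := pow_le_pow_left₀ (norm_nonneg _) h1 2
    have e4 := bandWidth_add_nonneg g (Complex.arg x)
    have := abs_le_of_sq_le_sq' (show (‖x‖ + (3 * (g : ℝ) + 3) * Real.cos (Complex.arg x)) ^ 2 ≤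
      (bandWidth g (Complex.arg x) + (3 * (g : ℝ) + 3) * Real.cos (Complex.arg x)) ^ 2 by linarith) e4
    linarith [this.2]
  set ν := (‖x‖ - 1) / (bandWidth g (Complex.arg x) - 1) with hν
  have hwpos : 0 < bandWidth g (Complex.arg x) - 1 := by linarith
  have hν0 : 0 ≤ ν := div_nonneg (by linarith) hwpos.le
  have hν1 : ν ≤ 1 := by rw [hν, div_le_one hwpos]; linarith
  have hνx : ν * (bandWidth g (Complex.arg x) - 1) = ‖x‖ - 1 := by rw [hν]; field_simp
  refine ⟨(σ, 2 * p.2 - 1, 1 - 2 * ν), ⟨hσ1, ⟨?_, ?_⟩, ?_, ?_⟩, Prod.ext ?_ ?_⟩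
  · simp only; linarith
  · simp only; linarith
  · simp only; linarith
  · simp only; linarith
  · simp only [modelBand]
    rw [hσθ, show (1 - (1 - 2 * ν)) / 2 = ν by ring, hνx, add_sub_cancel]
    exact hpx.symm
  · simp only [modelBand]; ring

end Model

/-! ### Opening the last hole of the model. -/

section Shear

theorem norm_le_iff_re {z : ℂ} {R : ℝ} (hR : 0 ≤ R) (him : z.im ^ 2 ≤ R ^ 2) :
    (‖z‖ ≤ R ↔ |z.re| ≤ √(R ^ 2 - z.im ^ 2)) ∧ (‖z‖ = R ↔ |z.re| = √(R ^ 2 - z.im ^ 2)) := by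
  have h1 : ‖z‖ ^ 2 = |z.re| ^ 2 + z.im ^ 2 := by
    rw [← Complex.normSq_eq_norm_sq, Complex.normSq_apply, sq_abs]; ring
  have h2 : √(R ^ 2 - z.im ^ 2) ^ 2 = R ^ 2 - z.im ^ 2 := Real.sq_sqrt (by linarith)
  have h3 := Real.sqrt_nonneg (R ^ 2 - z.im ^ 2)
  have h4 := norm_nonneg z
  have h5 := abs_nonneg z.re
  constructor
  · rw [← sq_le_sq₀ h4 hR, ← sq_le_sq₀ h5 h3, h1, h2]; constructor <;> intro <;> linarith
  · rw [← sq_eq_sq₀ h4 hR, ← sq_eq_sq₀ h5 h3, h1, h2]; constructor <;> intro <;> linarith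

/-- Clamping to `[-k, k]`. -/
noncomputable def clamp (k x : ℝ) : ℝ := max (-k) (min k x)

theorem continuous_clamp (k : ℝ) : Continuous (clamp k) := by unfold clamp; fun_prop

theorem clamp_mono (k : ℝ) : Monotone (clamp k) := fun _ _ h ↦
  max_le_max le_rfl (min_le_min le_rfl h)

theorem clamp_of_abs_le {k x : ℝ} (h : |x| ≤ k) : clamp k x = x := by
  obtain ⟨h1, h2⟩ := abs_le.1 h
  rw [clamp, min_eq_right h2, max_eq_right h1]

theorem clamp_of_le {k x : ℝ} (hk : 0 ≤ k) (h : k ≤ x) : clamp k x = k := by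
  rw [clamp, min_eq_left h, max_eq_right (by linarith)]

theorem clamp_of_le_neg {k x : ℝ} (hk : 0 ≤ k) (h : x ≤ -k) : clamp k x = -k := by
  rw [clamp, min_eq_right (by linarith), max_eq_left h]

theorem abs_clamp_le {k : ℝ} (hk : 0 ≤ k) (x : ℝ) : |clamp k x| ≤ k :=
  abs_le.2 ⟨le_max_left _ _, max_le (by linarith) (min_le_left _ _)⟩

/-- A homeomorphism of the plane taking the part of the punctured disk to the left of the centre of the
last hole to the punctured disk without that hole. -/
theorem exists_modelShear (g : ℕ) : ∃ e : ℂ ≃ₜ ℂ,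
    (∀ z : ℂ, ‖e z‖ ≤ 3 * g + 5 ↔ ‖z‖ ≤ 3 * g + 5 ∧ 1 ≤ ‖z - ((3 * g + 3 : ℝ) : ℂ)‖ ∧ z.re ≤ 3 * g + 3) ∧
    (∀ z : ℂ, ‖z‖ ≤ 3 * g + 5 → 1 ≤ ‖z - ((3 * g + 3 : ℝ) : ℂ)‖ → z.re < 3 * g + 3 →
      (‖e z‖ = 3 * g + 5 ↔ ‖z‖ = 3 * g + 5 ∨ ‖z - ((3 * g + 3 : ℝ) : ℂ)‖ = 1)) ∧
    (∀ z : ℂ, ∀ j : ℕ, j ≤ g → (1 ≤ ‖e z - 3 * j‖ ↔ 1 ≤ ‖z - 3 * j‖) ∧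
      (‖e z - 3 * j‖ = 1 ↔ ‖z - 3 * j‖ = 1)) ∧
    ∀ y : ℝ, 1 ≤ |y| → y ^ 2 ≤ (3 * g + 5) ^ 2 - (3 * g + 3) ^ 2 →
      e ⟨3 * g + 3, y⟩ = ⟨√((3 * g + 5) ^ 2 - y ^ 2), y⟩ := by
  have hg : (0 : ℝ) ≤ g := Nat.cast_nonneg g
  set R : ℝ := 3 * g + 5 with hR
  set o : ℝ := 3 * g + 3 with ho
  have hR0 : 0 ≤ R := by linarith
  set w : ℝ → ℝ := fun y ↦ √(R ^ 2 - y ^ 2) with hw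
  set b : ℝ → ℝ := fun y ↦ o - √(max 0 (1 - y ^ 2)) with hb
  set V : ℝ → ℝ := fun y ↦ min (b y) (w y) with hV
  set q : ℝ → ℝ := fun x ↦ max 0 (min 1 (2 * x - (6 * g + 3))) with hq
  set f : ℝ × ℝ → ℝ := fun p ↦ p.1 + (w p.2 - V p.2) * q p.1 with hf
  have hw0 : ∀ y, 0 ≤ w y := fun y ↦ Real.sqrt_nonneg _
  have hVw : ∀ y, V y ≤ w y := fun y ↦ min_le_right _ _
  have hbo : ∀ y, o - 1 ≤ b y ∧ b y ≤ o := fun y ↦ by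
    have h1 := Real.sqrt_nonneg (max 0 (1 - y ^ 2))
    have h2 : √(max 0 (1 - y ^ 2)) ≤ 1 := by
      exact Real.sqrt_le_iff.2 ⟨zero_le_one, max_le (by norm_num) (by nlinarith [sq_nonneg y])⟩
    constructor <;> simp only [hb] <;> linarith
  have hV0 : ∀ y, 0 ≤ V y := fun y ↦ le_min (by linarith [(hbo y).1]) (hw0 y)
  have hwR : ∀ y, w y ≤ R := fun y ↦ Real.sqrt_le_iff.2 ⟨hR0, by nlinarith [sq_nonneg y]⟩
  have hq0 : ∀ x, 0 ≤ q x ∧ q x ≤ 1 := fun x ↦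
    ⟨le_max_left _ _, max_le zero_le_one (min_le_left _ _)⟩
  have hqz : ∀ x : ℝ, 2 * x ≤ 6 * g + 3 → q x = 0 := fun x hx ↦ by
    simp only [hq]
    rw [min_eq_right (by linarith), max_eq_left (by linarith)]
  have hq1 : ∀ x : ℝ, 3 * g + 2 ≤ x → q x = 1 := fun x hx ↦ by
    simp only [hq]
    rw [min_eq_left (by linarith), max_eq_right zero_le_one]
  have hqm : Monotone q := fun x y h ↦ max_le_max le_rfl (min_le_min le_rfl (by linarith))
  have hfm : ∀ y, StrictMono fun x ↦ f (x, y) := fun y x x' h ↦ by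
    have := mul_le_mul_of_nonneg_left (hqm h.le) (sub_nonneg.2 (hVw y))
    simp only [hf]; linarith
  have hfc : Continuous f := by fun_prop
  obtain ⟨e, he⟩ := exists_homeomorph_shear hfc hfm (c := 1) (C := R) one_pos fun x y ↦ by
    simp only [hf]
    have h1 := hVw y
    have h2 := hV0 y
    have h3 := hwR y
    obtain ⟨h4, h5⟩ := hq0 x
    rw [one_mul, add_sub_cancel_left, abs_of_nonneg (by nlinarith)]
    nlinarith
  have hfw : ∀ y, f (-w y, y) = -w y := fun y ↦ by
    simp only [hf]
    rw [hqz _ (by linarith [hw0 y]), mul_zero, add_zero]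
  have hfV : ∀ y, f (V y, y) = w y := fun y ↦ by
    simp only [hf]
    rcases min_choice (b y) (w y) with h | h
    · rw [hq1 (V y) (by simp only [hV]; rw [h]; linarith [(hbo y).1])]; ring
    · have : V y = w y := h
      rw [this, sub_self, zero_mul, add_zero]
  have hsq : ∀ z : ℂ, ‖z - (o : ℂ)‖ ^ 2 = (o - z.re) ^ 2 + z.im ^ 2 := fun z ↦ by
    rw [← Complex.normSq_eq_norm_sq, Complex.normSq_apply]; simp; ring
  have hb1 : ∀ z : ℂ, (1 ≤ ‖z - (o : ℂ)‖ ∧ z.re ≤ o) ↔ z.re ≤ b z.im := fun z ↦ by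
    have h1 : z.re ≤ b z.im ↔ √(max 0 (1 - z.im ^ 2)) ≤ o - z.re := by
      simp only [hb]; constructor <;> intro <;> linarith
    rw [h1, Real.sqrt_le_iff, max_le_iff, ← one_le_sq_iff₀ (norm_nonneg _), hsq]
    constructor
    · rintro ⟨h2, h3⟩
      exact ⟨by linarith, sq_nonneg _, by linarith⟩
    · rintro ⟨h2, -, h3⟩
      exact ⟨by linarith, by linarith⟩
  have him : ∀ z : ℂ, ‖z‖ ≤ R → z.im ^ 2 ≤ R ^ 2 := fun z hz ↦ by
    rw [← sq_abs]
    exact pow_le_pow_left₀ (abs_nonneg _) ((Complex.abs_im_le_norm z).trans hz) 2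
  have hnorm : ∀ z : ℂ, z.im ^ 2 ≤ R ^ 2 → ((‖e z‖ ≤ R ↔ -w z.im ≤ z.re ∧ z.re ≤ V z.im) ∧
      (‖e z‖ = R ↔ z.re = -w z.im ∨ z.re = V z.im)) := fun z hz ↦ by
    obtain ⟨h1, h2⟩ := norm_le_iff_re (z := e z) hR0 (by rwa [(he z).2])
    rw [(he z).1, (he z).2] at h1 h2
    have k1 : -w z.im ≤ z.re ↔ -w z.im ≤ f (z.re, z.im) := by
      conv_rhs => rw [← hfw z.im]
      exact (hfm z.im).le_iff_le.symm
    have k2 : z.re ≤ V z.im ↔ f (z.re, z.im) ≤ w z.im := by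
      conv_rhs => rw [← hfV z.im]
      exact (hfm z.im).le_iff_le.symm
    have k3 : z.re = -w z.im ↔ f (z.re, z.im) = -w z.im := by
      conv_rhs => rw [← hfw z.im]
      exact (hfm z.im).injective.eq_iff.symm
    have k4 : z.re = V z.im ↔ f (z.re, z.im) = w z.im := by
      conv_rhs => rw [← hfV z.im]
      exact (hfm z.im).injective.eq_iff.symm
    constructor
    · rw [h1, k1, k2, abs_le]
    · rw [h2, k3, k4, or_comm]
      exact abs_eq (hw0 _)
  refine ⟨e, fun z ↦ ?_, fun z hz hz1 hzo ↦ ?_, fun z j hj ↦ ?_, fun y hy hyR ↦ ?_⟩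
  · rw [hb1 z]
    by_cases hz : z.im ^ 2 ≤ R ^ 2
    · rw [(hnorm z hz).1, (norm_le_iff_re hR0 hz).1, abs_le]
      change _ ↔ (-w z.im ≤ z.re ∧ z.re ≤ w z.im) ∧ _
      rw [and_assoc, and_congr_right_iff]
      intro _
      exact le_min_iff.trans and_comm
    · refine iff_of_false (fun h ↦ hz ?_) (fun h ↦ hz (him z h.1))
      have := him _ h
      rwa [(he z).2] at this
  · have hzi := him z hz
    have hzb := (hb1 z).1 ⟨hz1, hzo.le⟩
    have hzw := (abs_le.1 ((norm_le_iff_re hR0 hzi).1.1 hz)).2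
    have h1 : ‖z - (o : ℂ)‖ = 1 ↔ z.re = b z.im := by
      have h2 : z.re = b z.im ↔ √(max 0 (1 - z.im ^ 2)) = o - z.re := by
        simp only [hb]; constructor <;> intro <;> linarith
      rw [h2, ← sq_eq_sq₀ (norm_nonneg _) zero_le_one, hsq, Real.sqrt_eq_iff_eq_sq (le_max_left _ _)
        (by linarith)]
      have h3 : 0 < (o - z.re) ^ 2 := pow_pos (by linarith) 2
      constructor
      · intro h
        rw [max_eq_right (by linarith)]; linarith
      · intro h
        rcases max_choice 0 (1 - z.im ^ 2) with h4 | h4 <;> rw [h4] at h <;> linarith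
    rw [(hnorm z hzi).2, (norm_le_iff_re hR0 hzi).2, h1, abs_eq (Real.sqrt_nonneg _)]
    change _ ↔ (z.re = w z.im ∨ z.re = -w z.im) ∨ _
    constructor
    · rintro (h | h)
      · exact Or.inl (Or.inr h)
      · rcases min_choice (b z.im) (w z.im) with h2 | h2
        · exact Or.inr (h.trans h2)
        · exact Or.inl (Or.inl (h.trans h2))
    · rintro ((h | h) | h)
      · exact Or.inr (le_antisymm (le_min hzb hzw) (by rw [h]; exact hVw _))
      · exact Or.inl h
      · exact Or.inr (le_antisymm (le_min hzb hzw) (by rw [h]; exact min_le_left _ _))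
  · have hj' : (j : ℝ) ≤ g := by exact_mod_cast hj
    rcases le_or_gt (2 * z.re) (6 * g + 3) with h | h
    · have : e z = z := by
        refine Complex.ext ?_ (he z).2
        rw [(he z).1]
        simp only [hf]
        rw [hqz _ h, mul_zero, add_zero]
      rw [this]; exact ⟨Iff.rfl, Iff.rfl⟩
    · have key : ∀ x : ℂ, 6 * (g : ℝ) + 3 < 2 * x.re → 1 < ‖x - 3 * j‖ := fun x hx ↦ by
        have h1 := Complex.re_le_norm (x - 3 * j)
        have h2 : (x - 3 * j).re = x.re - 3 * j := by simp
        linarith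
      have k1 := key z h
      have k2 := key (e z) (by
        rw [(he z).1]
        have := mul_nonneg (sub_nonneg.2 (hVw z.im)) (hq0 z.re).1
        simp only [hf]; linarith)
      constructor <;> constructor <;> intro <;> linarith
  · have h1 : b y = o := by
      have : 1 ≤ y ^ 2 := (one_le_sq_iff_one_le_abs y).2 hy
      simp only [hb]
      rw [max_eq_left (by linarith), Real.sqrt_zero, sub_zero]
    have h2 : V y = o := by
      refine (min_eq_left ?_).trans h1
      rw [h1]
      exact Real.le_sqrt_of_sq_le (by linarith)
    refine Complex.ext ?_ (he _).2
    rw [(he _).1]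
    simp only
    rw [← h2, hfV]

end Shear

/-! ### The feet of the band in standard position. -/

section AttachingChart

theorem clamp_clamp {k l : ℝ} (hk : 0 ≤ k) (hkl : k ≤ l) (x : ℝ) : clamp k (clamp l x) = clamp k x := by
  rcases le_total l x with h | h
  · rw [clamp_of_le (hk.trans hkl) h, clamp_of_le hk hkl, clamp_of_le hk (hkl.trans h)]
  · rcases le_total x (-l) with h' | h'
    · rw [clamp_of_le_neg (hk.trans hkl) h', clamp_of_le_neg hk (by linarith),
        clamp_of_le_neg hk (by linarith)]
    · rw [clamp_of_abs_le (abs_le.2 ⟨h', h⟩)]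

theorem clamp_sub_le (k : ℝ) {x y : ℝ} (h : x ≤ y) : clamp k y - clamp k x ≤ y - x := by
  have h1 : -k ≤ clamp k x := le_max_left _ _
  have h2 : min k x ≤ clamp k x := le_max_right _ _
  have : clamp k y ≤ clamp k x + (y - x) := by
    refine max_le (by linarith) ?_
    rcases min_choice k x with h3 | h3
    · exact (min_le_left k y).trans (by linarith)
    · exact (min_le_right k y).trans (by linarith)
  linarith

/-- The standard feet are the squares around `±6` of half-side `1`. The piecewise linear `Y` takes
`±5` to `±1` and `±7` to `±√((3 * g + 5) ^ 2 - (3 * g + 3) ^ 2)`, the heights where a foot of the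
band begins and ends. Then `5 * arcsin (Y / R)` is the coordinate in `foldChart` of the point of the
outer circle at that height. The small linear term outside `[-7, 7]` keeps the map strictly
increasing. -/
theorem exists_footShear (g : ℕ) : ∃ L : ℂ ≃ₜ ℂ, MapsTo L (closedBall 0 12) (ball 0 15) ∧
    ∀ σ v y : ℝ, |σ| = 1 → |v| ≤ 1 → L ⟨σ * (6 - v), y⟩ = ⟨5 * Real.arcsin
      (σ * (1 + (1 - v) / 2 * (√((3 * g + 5) ^ 2 - (3 * g + 3) ^ 2) - 1)) / (3 * g + 5)), y⟩ := by
  have hg : (0 : ℝ) ≤ g := Nat.cast_nonneg g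
  set R : ℝ := 3 * g + 5 with hR
  set h : ℝ := √(R ^ 2 - (3 * g + 3) ^ 2) with hh
  have hR0 : 0 < R := by linarith
  have hh1 : 4 ≤ h := Real.le_sqrt_of_sq_le (by nlinarith)
  have hhR : h ≤ R := Real.sqrt_le_iff.2 ⟨hR0.le, by nlinarith⟩
  set k := (h - 1) / 2 with hk
  set Y : ℝ → ℝ := fun u ↦ clamp 5 u / 5 + k * (clamp 7 u - clamp 5 u) with hY
  have hmono : ∀ {u u'}, u ≤ u' → clamp 5 u ≤ clamp 5 u' ∧
      clamp 7 u - clamp 5 u ≤ clamp 7 u' - clamp 5 u' := fun {u u'} huu ↦ by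
    refine ⟨clamp_mono 5 huu, ?_⟩
    have := clamp_sub_le 5 (clamp_mono 7 huu)
    rw [clamp_clamp (by norm_num) (by norm_num), clamp_clamp (by norm_num) (by norm_num)] at this
    linarith
  have hYm : Monotone Y := fun u u' huu ↦ by
    obtain ⟨h1, h2⟩ := hmono huu
    simp only [hY]
    nlinarith
  have hY7 : Y 7 = h ∧ Y (-7) = -h := by
    simp only [hY]
    constructor
    · rw [clamp_of_le (by norm_num) (by norm_num), clamp_of_le (by norm_num) (by norm_num)]; linarith
    · rw [clamp_of_le_neg (by norm_num) (by norm_num), clamp_of_le_neg (by norm_num) (by norm_num)]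
      linarith
  have hYc : ∀ u, Y (clamp 7 u) = Y u := fun u ↦ by
    simp only [hY]
    rw [clamp_clamp (by norm_num) (by norm_num), clamp_clamp (by norm_num) le_rfl]
  have hYh : ∀ u, -h ≤ Y u ∧ Y u ≤ h := fun u ↦ by
    have := abs_le.1 (abs_clamp_le (by norm_num : (0 : ℝ) ≤ 7) u)
    rw [← hYc, ← hY7.1]
    refine ⟨?_, hYm this.2⟩
    rw [hY7.1, ← hY7.2]
    exact hYm this.1
  have hYR : ∀ u, -1 ≤ Y u / R ∧ Y u / R ≤ 1 := fun u ↦ by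
    obtain ⟨h1, h2⟩ := hYh u
    constructor
    · rw [le_div_iff₀ hR0]; linarith
    · rw [div_le_one hR0]; linarith
  set f : ℝ × ℝ → ℝ := fun p ↦ 5 * Real.arcsin (Y p.1 / R) + (p.1 - clamp 7 p.1) / 10 with hf
  have hYcont : Continuous Y := by
    have := continuous_clamp 5
    have := continuous_clamp 7
    fun_prop
  have hfc : Continuous f := by
    have h1 := continuous_clamp 7
    have h2 : Continuous fun p : ℝ × ℝ ↦ Real.arcsin (Y p.1 / R) :=
      Real.continuous_arcsin.comp (by fun_prop)
    fun_prop
  have harc : ∀ x, |Real.arcsin x| ≤ 1.575 := fun x ↦ by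
    have h1 := Real.pi_lt_d2
    have h2 := Real.arcsin_le_pi_div_two x
    have h3 := Real.neg_pi_div_two_le_arcsin x
    exact abs_le.2 ⟨by linarith, by linarith⟩
  have hfm : ∀ y, StrictMono fun x ↦ f (x, y) := fun y u u' huu ↦ by
    simp only [hf]
    have h1 := hYm huu.le
    have h2 := clamp_sub_le 7 huu.le
    have h3 : Real.arcsin (Y u / R) ≤ Real.arcsin (Y u' / R) :=
      Real.monotone_arcsin (div_le_div_of_nonneg_right h1 hR0.le)
    rcases h2.lt_or_eq with h4 | h4
    · linarith
    · have h5 : Y u < Y u' := by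
        obtain ⟨k1, k2⟩ := hmono huu.le
        simp only [hY]
        rcases k1.lt_or_eq with k3 | k3 <;> nlinarith
      have h6 : Real.arcsin (Y u / R) < Real.arcsin (Y u' / R) :=
        Real.strictMonoOn_arcsin (hYR u) (hYR u') (div_lt_div_of_pos_right h5 hR0)
      linarith
  have hfb : ∀ x y, |f (x, y) - 1 / 10 * x| ≤ 10 := fun u y ↦ by
    simp only [hf]
    have h3 := abs_le.1 (harc (Y u / R))
    have h4 := abs_le.1 (abs_clamp_le (by norm_num : (0 : ℝ) ≤ 7) u)
    exact abs_le.2 ⟨by linarith, by linarith⟩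
  obtain ⟨L, hL⟩ := exists_homeomorph_shear hfc hfm (by norm_num) hfb
  refine ⟨L, fun z hz ↦ ?_, fun σ v y hσ hv ↦ ?_⟩
  · rw [mem_closedBall_zero_iff] at hz
    have h1 : |(L z).re| ≤ 8.5 := by
      rw [(hL z).1]
      have h2 : |z.re| ≤ 12 := (Complex.abs_re_le_norm z).trans hz
      have h3 := abs_le.1 (harc (Y z.re / R))
      have h4 := abs_le.1 h2
      have h5 := clamp_sub_le 7 h4.1
      have h6 := clamp_sub_le 7 h4.2
      rw [clamp_of_le (by norm_num) (by norm_num)] at h6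
      rw [clamp_of_le_neg (x := -12) (by norm_num) (by norm_num)] at h5
      simp only [hf]
      exact abs_le.2 ⟨by linarith, by linarith⟩
    have h2 : |(L z).im| ≤ 12 := by
      rw [(hL z).2]; exact (Complex.abs_im_le_norm z).trans hz
    rw [mem_ball_zero_iff]
    refine abs_lt_of_sq_lt_sq' ?_ (by norm_num) |>.2
    rw [← Complex.normSq_eq_norm_sq, Complex.normSq_apply]
    have h3 := sq_le_sq' (abs_le.1 h1).1 (abs_le.1 h1).2
    have h4 := sq_le_sq' (abs_le.1 h2).1 (abs_le.1 h2).2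
    nlinarith
  · obtain ⟨hv1, hv2⟩ := abs_le.1 hv
    have h1 : clamp 7 (σ * (6 - v)) = σ * (6 - v) := clamp_of_abs_le (by
      rw [abs_mul, hσ, one_mul, abs_of_pos (by linarith)]; linarith)
    have h2 : clamp 5 (σ * (6 - v)) = 5 * σ := by
      rcases eq_or_eq_neg_of_abs_eq hσ with rfl | rfl
      · rw [clamp_of_le (by norm_num) (by linarith)]; ring
      · rw [clamp_of_le_neg (by norm_num) (by linarith)]; ring
    refine Complex.ext ?_ (hL _).2
    rw [(hL _).1]
    simp only [hf, hY]
    rw [h1, h2, sub_self, zero_div, add_zero]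
    congr 3
    rw [hk]; ring

theorem modelBand_foot (g : ℕ) {σ : ℝ} (hσ : |σ| = 1) (y v : ℝ) : modelBand g (σ, y, v) =
    (⟨3 * g + 3, σ * (1 + (1 - v) / 2 * (√((3 * g + 5) ^ 2 - (3 * g + 3) ^ 2) - 1))⟩,
      (1 + y) / 2) := by
  have hw : bandWidth g (σ * (Real.pi / 2)) = √((3 * g + 5) ^ 2 - (3 * g + 3) ^ 2) := by
    rcases eq_or_eq_neg_of_abs_eq hσ with rfl | rfl
    · simp [bandWidth]
    · rw [bandWidth, neg_one_mul, Real.sin_neg, Real.cos_neg, Real.sin_pi_div_two,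
        Real.cos_pi_div_two]
      ring_nf
  have he : Complex.exp ((σ * (Real.pi / 2) : ℝ) * Complex.I) = σ * Complex.I := by
    rcases eq_or_eq_neg_of_abs_eq hσ with rfl | rfl
    · rw [one_mul, Complex.exp_mul_I, ← Complex.ofReal_cos, ← Complex.ofReal_sin]; simp
    · rw [Complex.exp_mul_I, ← Complex.ofReal_cos, ← Complex.ofReal_sin]; simp
  refine Prod.ext ?_ rfl
  simp only [modelBand]
  rw [hw, he]
  apply Complex.ext
  · simp
  · simp [mul_comm]

/-- The shear slides the feet horizontally from the cutting line to the outer circle, so the image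
of a foot is determined by its height in the plane. -/
theorem exists_attachingChart (g : ℕ) : ∃ χ : ℂ → ℂ × ℝ,
    IsDisk (solidBdry g (3 * g + 5)) χ 12 ∧
    ∀ c ∈ cube, |c.1| = 1 → χ ⟨c.1 * (6 - c.2.2), c.2.1⟩ =
      (⟨√((3 * g + 5) ^ 2 - (modelBand g c).1.im ^ 2), (modelBand g c).1.im⟩, (modelBand g c).2) := by
  have hg : (0 : ℝ) ≤ g := Nat.cast_nonneg g
  obtain ⟨L, hL, hLf⟩ := exists_footShear g
  have hd : IsDisk (solidBdry g (3 * g + 5)) (foldChart (3 * g + 5) 0 0) 15 :=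
    isDisk_foldChart (by linarith) (Nat.zero_le g) 0
  refine ⟨_, hd.comp_homeomorph L hL, ?_⟩
  rintro ⟨σ, y, v⟩ ⟨-, hy, hv⟩ hσ
  simp only at hσ hy hv ⊢
  rw [hLf σ v y hσ (abs_le.2 hv), modelBand_foot g hσ]
  set h : ℝ := √((3 * g + 5) ^ 2 - (3 * g + 3) ^ 2) with hh
  set Y := σ * (1 + (1 - v) / 2 * (h - 1)) with hY
  have hR0 : 0 < 3 * (g : ℝ) + 5 := by linarith
  have hh1 : 4 ≤ h := Real.le_sqrt_of_sq_le (by nlinarith)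
  have hhR : h ≤ 3 * g + 5 := Real.sqrt_le_iff.2 ⟨hR0.le, by nlinarith⟩
  have hYR : |Y| ≤ 3 * g + 5 := by
    have h1 : 0 ≤ 1 + (1 - v) / 2 * (h - 1) := by nlinarith [hv.1, hv.2]
    rw [hY, abs_mul, hσ, one_mul, abs_of_nonneg h1]
    nlinarith [hv.1, hv.2]
  obtain ⟨hY1, hY2⟩ := abs_le.1 hYR
  have ha : |y| - 1 ≤ 0 := by linarith [abs_le.2 hy]
  refine Prod.ext ?_ ?_
  · simp only [foldChart]
    rw [max_eq_left ha, zero_div, mul_zero, add_zero, mul_div_cancel_left₀ _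
      (by norm_num : (5 : ℝ) ≠ 0), zero_add, Complex.exp_mul_I, ← Complex.ofReal_cos,
      ← Complex.ofReal_sin, Real.cos_arcsin, Real.sin_arcsin
      (by rw [le_div_iff₀ hR0]; linarith) (by rw [div_le_one hR0]; linarith)]
    have hs : √((3 * (g : ℝ) + 5) ^ 2 - Y ^ 2) = (3 * g + 5) * √(1 - (Y / (3 * g + 5)) ^ 2) := by
      rw [show (3 * (g : ℝ) + 5) ^ 2 - Y ^ 2 = (3 * g + 5) ^ 2 * (1 - (Y / (3 * g + 5)) ^ 2) by
        field_simp, Real.sqrt_mul (sq_nonneg _), Real.sqrt_sq hR0.le]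
    have hY' : Y = (3 * g + 5) * (Y / (3 * g + 5)) := by field_simp
    rw [hs]
    generalize Y / (3 * g + 5) = a at hY' ⊢
    rw [hY']
    apply Complex.ext <;> simp [wallRadius]
  · simp only [foldChart]
    rw [min_eq_right (by linarith [hy.2]), max_eq_right (by linarith [hy.1])]

end AttachingChart

/-- The genus `g + 1` model is cut by the line through the centre of its last hole. Under `E` the
left part becomes the genus `g` model, and the cut becomes the pair of standard squares in the disk
`χ` on the outer wall; the right part is `modelBand`. -/
theorem exists_attachingModel (g : ℕ) : ∃ (E : ℂ × ℝ ≃ₜ ℂ × ℝ) (χ : ℂ → ℂ × ℝ),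
    IsDisk (solidBdry g (3 * g + 5)) χ 12 ∧
    (∀ p, E p ∈ solid g (3 * g + 5) ↔ p ∈ solid (g + 1) (3 * g + 5) ∧ p.1.re ≤ 3 * g + 3) ∧
    (∀ p ∈ solid (g + 1) (3 * g + 5), p.1.re < 3 * g + 3 →
      (E p ∈ solidBdry g (3 * g + 5) ↔ p ∈ solidBdry (g + 1) (3 * g + 5))) ∧
    ∀ c ∈ cube, |c.1| = 1 → E (modelBand g c) = χ ⟨c.1 * (6 - c.2.2), c.2.1⟩ := by
  have hg : (0 : ℝ) ≤ g := Nat.cast_nonneg g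
  obtain ⟨e, he, heb, hej, hef⟩ := exists_modelShear g
  obtain ⟨χ, hχ, hχf⟩ := exists_attachingChart g
  have hcast : ∀ x : ℂ, x - 3 * ((g + 1 : ℕ) : ℂ) = x - ((3 * g + 3 : ℝ) : ℂ) := fun x ↦ by
    push_cast; ring
  have hE : ∀ p : ℂ × ℝ, (e p.1, p.2) ∈ solid g (3 * g + 5) ↔
      p ∈ solid (g + 1) (3 * g + 5) ∧ p.1.re ≤ 3 * g + 3 := by
    intro p
    constructor
    · rintro ⟨h1, h2, h3⟩
      obtain ⟨k1, k2, k3⟩ := (he p.1).1 h1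
      refine ⟨⟨k1, fun j hj hjg ↦ ?_, h3⟩, k3⟩
      rcases Nat.lt_or_ge g j with h | h
      · obtain rfl : j = g + 1 := by omega
        rwa [hcast]
      · exact (hej p.1 j h).1.1 (h2 j hj h)
    · rintro ⟨⟨h1, h2, h3⟩, h4⟩
      refine ⟨(he p.1).2 ⟨h1, ?_, h4⟩, fun j hj hjg ↦ (hej p.1 j hjg).1.2 (h2 j hj (by omega)), h3⟩
      rw [← hcast]; exact h2 (g + 1) (by omega) le_rfl
  refine ⟨e.prodCongr (Homeomorph.refl ℝ), χ, hχ, hE, fun p hp hre ↦ ?_, ?_⟩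
  · have hp1 : 1 ≤ ‖p.1 - ((3 * g + 3 : ℝ) : ℂ)‖ := by
      rw [← hcast]; exact hp.2.1 (g + 1) (by omega) le_rfl
    have hb := heb p.1 hp.1 hp1 hre
    constructor
    · rintro ⟨-, h | ⟨j, hj, hjg, h⟩ | h⟩
      · rcases hb.1 h with h | h
        · exact ⟨hp, Or.inl h⟩
        · exact ⟨hp, Or.inr (Or.inl ⟨g + 1, by omega, le_rfl, by rwa [hcast]⟩)⟩
      · exact ⟨hp, Or.inr (Or.inl ⟨j, hj, by omega, (hej p.1 j hjg).2.1 h⟩)⟩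
      · exact ⟨hp, Or.inr (Or.inr h)⟩
    · rintro ⟨-, h | ⟨j, hj, hjg, h⟩ | h⟩
      · exact ⟨(hE p).2 ⟨hp, hre.le⟩, Or.inl (hb.2 (Or.inl h))⟩
      · refine ⟨(hE p).2 ⟨hp, hre.le⟩, ?_⟩
        rcases Nat.lt_or_ge g j with h' | h'
        · obtain rfl : j = g + 1 := by omega
          rw [hcast] at h
          exact Or.inl (hb.2 (Or.inr h))
        · exact Or.inr (Or.inl ⟨j, hj, h', (hej p.1 j h').2.2 h⟩)
      · exact ⟨(hE p).2 ⟨hp, hre.le⟩, Or.inr (Or.inr h)⟩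
  · rintro ⟨σ, y, v⟩ hc hσ
    rw [hχf _ hc hσ]
    obtain ⟨-, -, hv1, hv2⟩ := hc
    simp only at hσ hv1 hv2
    have hsq : (0 : ℝ) ≤ (3 * g + 5) ^ 2 - (3 * g + 3) ^ 2 := by nlinarith
    have hh1 : 4 ≤ √((3 * (g : ℝ) + 5) ^ 2 - (3 * g + 3) ^ 2) :=
      Real.le_sqrt_of_sq_le (by nlinarith)
    have hh2 := Real.sq_sqrt hsq
    rw [modelBand_foot g hσ]
    set h : ℝ := √((3 * g + 5) ^ 2 - (3 * g + 3) ^ 2) with hh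
    have h1 : 1 ≤ 1 + (1 - v) / 2 * (h - 1) := by nlinarith
    have h2 : 1 + (1 - v) / 2 * (h - 1) ≤ h := by nlinarith
    have habs : |σ * (1 + (1 - v) / 2 * (h - 1))| = 1 + (1 - v) / 2 * (h - 1) := by
      rw [abs_mul, hσ, one_mul, abs_of_nonneg (by linarith)]
    refine Prod.ext ?_ rfl
    refine hef _ (by rw [habs]; exact h1) ?_
    rw [← sq_abs, habs, ← hh2]
    exact pow_le_pow_left₀ (by linarith) h2 2

/-! ### Attaching a one-handle to an arbitrary handlebody. -/

section Attach

variable {M : Type*} [TopologicalSpace M] {g : ℕ} {H S : Set M}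

/-- Attaching a one-handle, parametrized by the cube, to a handlebody along two squares contained in a
disk in the boundary. -/
theorem IsHandlebody.attach [T2Space M] (hH : IsHandlebody g H S) {χ : ℂ → M} (hχ : IsDisk S χ 12)
    {κ : ℝ × ℝ × ℝ → M} (hκc : ContinuousOn κ cube) (hκi : InjOn κ cube)
    (hκχ : ∀ c ∈ cube, |c.1| = 1 → κ c = χ ⟨c.1 * (6 - c.2.2), c.2.1⟩)
    (hκH : ∀ c ∈ cube, κ c ∈ H → |c.1| = 1) :
    IsHandlebody (g + 1) (H ∪ κ '' cube)
      ((S \ κ '' {c ∈ cube | |c.1| = 1 ∧ |c.2.1| < 1 ∧ |c.2.2| < 1}) ∪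
        κ '' {c ∈ cube | |c.2.1| = 1 ∨ |c.2.2| = 1}) := by
  have hg : (0 : ℝ) ≤ g := Nat.cast_nonneg g
  have hR : 3 * (g : ℝ) + 2 ≤ 3 * g + 5 := by linarith
  obtain ⟨E, χ₀, hχ₀, hE, hEb, hEf⟩ := exists_attachingModel g
  -- Radius `8` contains the standard feet, since `7 ^ 2 + 1 ^ 2 ≤ 8 ^ 2`.
  obtain ⟨f, r, hr, hf, hfr⟩ := hH.exists_isParam_match hR (r := 8) (by norm_num) (by norm_num)
    hχ₀ hχ
  -- straighten a possible reflection
  obtain ⟨τ, hτ, hττ, hτr⟩ : ∃ τ : ℝ × ℝ × ℝ → ℝ × ℝ × ℝ, Continuous τ ∧ (∀ c, τ (τ c) = c) ∧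
      ∀ c : ℝ × ℝ × ℝ, (τ c).1 = c.1 ∧ (τ c).2.2 = c.2.2 ∧ |(τ c).2.1| = |c.2.1| ∧
        ∀ x : ℝ, (⟨x, (τ c).2.1⟩ : ℂ) = r ⟨x, c.2.1⟩ := by
    rcases hr with rfl | rfl
    · exact ⟨id, continuous_id, fun _ ↦ rfl, fun c ↦ ⟨rfl, rfl, rfl, fun x ↦ rfl⟩⟩
    · exact ⟨fun c ↦ (c.1, -c.2.1, c.2.2), by fun_prop, fun c ↦ by simp,
        fun c ↦ ⟨rfl, rfl, abs_neg _, fun x ↦ rfl⟩⟩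
  have hτc : ∀ c, τ c ∈ cube ↔ c ∈ cube := fun c ↦ by
    obtain ⟨h1, h2, h3, -⟩ := hτr c
    simp only [cube, mem_prod, mem_Icc, ← abs_le, h1, h2, h3]
  obtain ⟨K, hK⟩ : ∃ K : ℝ × ℝ × ℝ → M, ∀ c, K c = κ (τ c) := ⟨_, fun _ ↦ rfl⟩
  have hτim : ∀ P : ℝ × ℝ × ℝ → Prop, (∀ c, P (τ c) ↔ P c) →
      κ '' {c ∈ cube | P c} = K '' {c ∈ cube | P c} := by
    intro P hP
    ext y
    constructor
    · rintro ⟨c, ⟨hc, hPc⟩, rfl⟩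
      exact ⟨τ c, ⟨(hτc c).2 hc, (hP c).2 hPc⟩, by rw [hK, hττ]⟩
    · rintro ⟨c, ⟨hc, hPc⟩, rfl⟩
      exact ⟨τ c, ⟨(hτc c).2 hc, (hP c).2 hPc⟩, (hK c).symm⟩
  have hcube : κ '' cube = K '' cube := by
    simpa using hτim (fun _ ↦ True) fun _ ↦ Iff.rfl
  rw [hcube, hτim _ fun c ↦ by rw [(hτr c).1, (hτr c).2.1, (hτr c).2.2.1],
    hτim _ fun c ↦ by rw [(hτr c).2.1, (hτr c).2.2.1]]
  have hfoot : ∀ c ∈ cube, |c.1| = 1 → K c = f (E (modelBand g c)) := by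
    intro c hc hσ
    rw [hK, hEf c hc hσ, hfr, hκχ _ ((hτc c).2 hc) (by rwa [(hτr c).1]), (hτr c).1, (hτr c).2.1,
      (hτr c).2.2.2]
    obtain ⟨-, hy, hv1, hv2⟩ := hc
    rw [mem_closedBall_zero_iff]
    refine abs_le_of_sq_le_sq' ?_ (by norm_num) |>.2
    rw [← Complex.normSq_eq_norm_sq, Complex.normSq_apply]
    have h1 : c.1 * c.1 = 1 := by rw [← abs_mul_abs_self, hσ, one_mul]
    simp only
    have h2 : c.2.1 * c.2.1 ≤ 1 := by nlinarith [hy.1, hy.2]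
    have h3 : c.1 * (6 - c.2.2) * (c.1 * (6 - c.2.2)) = (6 - c.2.2) * (6 - c.2.2) := by
      linear_combination (6 - c.2.2) * (6 - c.2.2) * h1
    nlinarith
  have hfoot' : ∀ c ∈ cube, K c ∈ H → |c.1| = 1 := fun c hc h ↦ by
    have := hκH _ ((hτc c).2 hc) (hK c ▸ h)
    rwa [(hτr c).1] at this
  have hκ'c : ContinuousOn K cube :=
    (hκc.comp hτ.continuousOn fun c hc ↦ (hτc c).2 hc).congr fun c _ ↦ hK c
  have hκ'i : InjOn K cube := fun c hc c' hc' h ↦ by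
    rw [hK, hK] at h
    rw [← hττ c, hκi ((hτc c).2 hc) ((hτc c').2 hc') h, hττ]
  have hsymm : ∀ q ∈ solid g (3 * g + 5), E.symm q ∈ solid (g + 1) (3 * g + 5) ∧
      (E.symm q).1.re ≤ 3 * g + 3 := fun q hq ↦ (hE _).1 (by rwa [E.apply_symm_apply])
  -- In the model and in `M` alike, the handlebody and the handle meet exactly in the feet `|c.1| =
  -- 1`, and there the parametrizations agree.
  obtain ⟨F, hFc, hFi, hF₁, hF₂⟩ := exists_glue (isCompact_solid g (3 * g + 5)) isCompact_cube
    (n₁ := E.symm) (n₂ := modelBand g) (m₁ := f) (m₂ := K) E.symm.continuous.continuousOn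
    (continuous_modelBand g).continuousOn hf.cont hκ'c E.symm.injective.injOn modelBand_injOn hf.inj
    hκ'i (by
      intro q hq c hc
      constructor
      · intro h
        have h1 := (hsymm q hq).2
        rw [h] at h1
        have hσ := (le_modelBand_re hc).2.1 (le_antisymm h1 (le_modelBand_re hc).1)
        rw [hfoot c hc hσ, ← h, E.apply_symm_apply]
      · intro h
        have hσ := hfoot' c hc (by rw [← h, ← hf.image]; exact mem_image_of_mem f hq)
        rw [hfoot c hc hσ] at h
        have hm : E (modelBand g c) ∈ solid g (3 * g + 5) :=
          (hE _).2 ⟨modelBand_mem hc, ((le_modelBand_re hc).2.2 hσ).le⟩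
        rw [hf.inj hq hm h, E.symm_apply_apply])
  have hU : E.symm '' solid g (3 * g + 5) ∪ modelBand g '' cube = solid (g + 1) (3 * g + 5) := by
    ext p
    constructor
    · rintro (⟨q, hq, rfl⟩ | ⟨c, hc, rfl⟩)
      · exact (hsymm q hq).1
      · exact modelBand_mem hc
    · intro hp
      rcases le_total p.1.re (3 * g + 3) with h | h
      · exact Or.inl ⟨E p, (hE p).2 ⟨hp, h⟩, E.symm_apply_apply p⟩
      · exact Or.inr (exists_modelBand hp h)
  rw [hU] at hFc hFi
  have hR1 : (3 * ((g + 1 : ℕ) : ℝ) + 2) = 3 * g + 5 := by push_cast; ring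
  have hsub := solidBdry_subset (g + 1) (3 * (g : ℝ) + 5)
  refine IsParam.isHandlebody (f := F) ⟨by rwa [hR1], by rwa [hR1], ?_, ?_⟩
  · rw [hR1, ← hU, image_union, image_image, image_image, image_congr hF₁, image_congr hF₂, hf.image]
  · rw [hR1]
    ext y
    constructor
    · rintro ⟨p, hp, rfl⟩
      rcases lt_or_ge p.1.re (3 * g + 3) with h | h
      · left
        have hq : E p ∈ solidBdry g (3 * g + 5) := (hEb p (hsub hp) h).2 hp
        have hqs := solidBdry_subset _ _ hq
        have hFp : F p = f (E p) := by rw [← hF₁ _ hqs, E.symm_apply_apply]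
        refine ⟨by rw [hFp, ← hf.image_bdry]; exact mem_image_of_mem f hq, ?_⟩
        rintro ⟨c, ⟨hc, hσ, -⟩, hcp⟩
        rw [← hF₂ c hc] at hcp
        have := hFi (modelBand_mem hc) (hsub hp) hcp
        rw [← this, (le_modelBand_re hc).2.2 hσ] at h
        exact lt_irrefl _ h
      · right
        obtain ⟨c, hc, rfl⟩ := exists_modelBand (hsub hp) h
        exact ⟨c, ⟨hc, (modelBand_mem_bdry hc).1 hp⟩, (hF₂ c hc).symm⟩
    · rintro (⟨hyS, hyf⟩ | ⟨c, ⟨hc, hcb⟩, rfl⟩)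
      · rw [← hf.image_bdry] at hyS
        obtain ⟨q, hq, rfl⟩ := hyS
        have hqs := solidBdry_subset _ _ hq
        obtain ⟨h1, h2⟩ := hsymm q hqs
        rcases h2.lt_or_eq with h | h
        · exact ⟨E.symm q, (hEb _ h1 h).1 (by rwa [E.apply_symm_apply]), hF₁ q hqs⟩
        · obtain ⟨c, hc, hcq⟩ := exists_modelBand h1 h.ge
          have hσ : |c.1| = 1 := (le_modelBand_re hc).2.1 (by rw [hcq, h])
          have hKc : K c = f q := by rw [hfoot c hc hσ, hcq, E.apply_symm_apply]
          refine ⟨modelBand g c, (modelBand_mem_bdry hc).2 ?_, by rw [hF₂ c hc, hKc]⟩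
          -- A boundary point outside the open feet can only lie on the rim of a foot, which still
          -- belongs to the new boundary.
          by_contra hcon
          push Not at hcon
          exact hyf ⟨c, ⟨hc, hσ, (abs_le.2 hc.2.1).lt_of_ne hcon.1,
            (abs_le.2 hc.2.2).lt_of_ne hcon.2⟩, hKc⟩
      · exact ⟨modelBand g c, (modelBand_mem_bdry hc).2 hcb, hF₂ c hc⟩

end Attach

/-! ### Digging a trench into the wedge by a compactly supported homeomorphism. -/

section Trench

/-- The part of space occupied by the first handlebody in the local model. -/
def wedge : Set (ℝ × ℝ × ℝ) := {P | 0 ≤ P.1 ∧ 0 ≤ P.2.1 ∧ |P.2.2| ≤ 1}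

/-- The interior of the wedge. -/
def wedgeInt : Set (ℝ × ℝ × ℝ) := {P | 0 < P.1 ∧ 0 < P.2.1 ∧ |P.2.2| < 1}

/-- A cutoff function of the third coordinate. -/
noncomputable def cutoff (t : ℝ) : ℝ := max 0 (min 1 (2 - |t|))

theorem continuous_cutoff : Continuous cutoff := by unfold cutoff; fun_prop

theorem cutoff_of_le {t : ℝ} (h : |t| ≤ 1) : cutoff t = 1 := by
  rw [cutoff, min_eq_left (by linarith), max_eq_right zero_le_one]

theorem cutoff_of_ge {t : ℝ} (h : 2 ≤ |t|) : cutoff t = 0 := by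
  rw [cutoff, min_eq_right (by linarith), max_eq_left (by linarith)]

theorem cutoff_bounds (t : ℝ) : 0 ≤ cutoff t ∧ cutoff t ≤ 1 :=
  ⟨le_max_left _ _, max_le zero_le_one (min_le_left _ _)⟩

/-- The depth profile of the trench before its walls are straightened. -/
noncomputable def profile (q : ℝ) : ℝ := max 0 (min 3 (7 - 8 * |q - 5 / 2|))

theorem continuous_profile : Continuous profile := by unfold profile; fun_prop

theorem profile_bounds (q : ℝ) : 0 ≤ profile q ∧ profile q ≤ 3 :=
  ⟨le_max_left _ _, max_le (by norm_num) (min_le_left _ _)⟩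

theorem profile_le_iff {q p : ℝ} : profile q ≤ p ↔ 0 ≤ p ∧ (3 ≤ p ∨ (7 - p) / 8 ≤ |q - 5 / 2|) := by
  rw [profile, max_le_iff, min_le_iff]
  refine and_congr_right fun _ ↦ or_congr_right ?_
  constructor <;> intro <;> linarith

theorem profile_lt_iff {q p : ℝ} : profile q < p ↔ 0 < p ∧ (3 < p ∨ (7 - p) / 8 < |q - 5 / 2|) := by
  rw [profile, max_lt_iff, min_lt_iff]
  refine and_congr_right fun _ ↦ or_congr_right ?_
  constructor <;> intro <;> linarith

/-- The face `p = 0` is pushed onto the graph of `profile`. The push is damped linearly until `|p| =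
4`, with slope at most `3 / 4`, so it is increasing in `p`. Such a push cannot create walls parallel
to the `p`-axis, so the walls are left sloping. -/
theorem exists_digHomeomorph : ∃ E : ℝ × ℝ × ℝ ≃ₜ ℝ × ℝ × ℝ, (∀ P, (E P).2 = P.2) ∧
    (∀ P : ℝ × ℝ × ℝ, 4 ≤ |P.1| ∨ 1 ≤ |P.2.1 - 5 / 2| ∨ 2 ≤ |P.2.2| → E P = P) ∧
    ∀ P : ℝ × ℝ × ℝ, |P.2.2| ≤ 1 → (0 ≤ P.1 ↔ profile P.2.1 ≤ (E P).1) ∧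
      (0 < P.1 ↔ profile P.2.1 < (E P).1) ∧ (P.1 = 0 → (E P).1 = profile P.2.1) := by
  set f : ℝ × ℝ × ℝ → ℝ := fun P ↦ P.1 + profile P.2.1 * cutoff P.2.2 * max 0 (1 - |P.1| / 4) with hf
  have hfc : Continuous f := by
    have h1 := continuous_profile
    have h2 := continuous_cutoff
    fun_prop
  have hm : ∀ y : ℝ × ℝ, 0 ≤ profile y.1 * cutoff y.2 ∧ profile y.1 * cutoff y.2 ≤ 3 := fun y ↦ by
    obtain ⟨h1, h2⟩ := profile_bounds y.1
    obtain ⟨h3, h4⟩ := cutoff_bounds y.2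
    exact ⟨mul_nonneg h1 h3, by nlinarith⟩
  have hfm : ∀ y, StrictMono fun x ↦ f (x, y) := by
    intro y x x' hx
    obtain ⟨h1, h2⟩ := hm y
    have h3 : max 0 (1 - |x| / 4) ≤ max 0 (1 - |x'| / 4) + (x' - x) / 4 := by
      have h4 : |x'| ≤ |x| + (x' - x) := by
        have := abs_add_le x (x' - x)
        rwa [add_sub_cancel, abs_of_pos (sub_pos.2 hx)] at this
      have h5 := le_max_left 0 (1 - |x'| / 4)
      have h6 := le_max_right 0 (1 - |x'| / 4)
      exact max_le (by linarith) (by linarith)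
    simp only [hf]
    nlinarith
  obtain ⟨E, hE⟩ := exists_homeomorph_fiber hfc hfm (c := 1) (C := 3) one_pos (fun x y ↦ by
    obtain ⟨h1, h2⟩ := hm y
    have h3 : max 0 (1 - |x| / 4) ≤ 1 := max_le zero_le_one (by linarith [abs_nonneg x])
    have h4 := le_max_left 0 (1 - |x| / 4)
    simp only [hf]
    rw [one_mul, add_sub_cancel_left, abs_of_nonneg (mul_nonneg h1 h4)]
    nlinarith)
  refine ⟨E, fun P ↦ by rw [hE], fun P hP ↦ ?_, fun P ht ↦ ?_⟩
  · rw [hE]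
    refine Prod.ext ?_ rfl
    simp only [hf]
    rcases hP with h | h | h
    · rw [max_eq_left (by linarith), mul_zero, add_zero]
    · have : profile P.2.1 = 0 := le_antisymm (profile_le_iff.2 ⟨le_rfl, Or.inr (by linarith)⟩)
        (profile_bounds _).1
      rw [this]; ring
    · rw [cutoff_of_ge h]; ring
  · have h0 : f (0, P.2) = profile P.2.1 := by simp [hf, cutoff_of_le ht]
    rw [hE, ← h0]
    refine ⟨(hfm P.2).le_iff_le.symm, (hfm P.2).lt_iff_lt.symm, fun h ↦ ?_⟩
    simp only
    rw [← h]

/-- The displacement used to straighten the walls of the trench. -/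
noncomputable def wallShift (s : ℝ) : ℝ := clamp 1 (2 * s) - (clamp 2 s - clamp 1 s)

/-- Its amplitude as a function of the first coordinate. -/
noncomputable def wallAmplitude (p : ℝ) : ℝ := max 0 (min ((3 - p) / 8) (3 * (p + 1) / 8))

theorem continuous_wallShift : Continuous wallShift := by
  have h1 := continuous_clamp 1
  have h2 := continuous_clamp 2
  unfold wallShift
  fun_prop

theorem continuous_wallAmplitude : Continuous wallAmplitude := by unfold wallAmplitude; fun_prop

theorem wallAmplitude_bounds (p : ℝ) : 0 ≤ wallAmplitude p ∧ wallAmplitude p ≤ 3 / 8 := by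
  refine ⟨le_max_left _ _, max_le (by norm_num) ?_⟩
  rcases le_total p 0 with h | h
  · exact (min_le_right _ _).trans (by linarith)
  · exact (min_le_left _ _).trans (by linarith)

theorem wallAmplitude_of_mem {p : ℝ} (h0 : 0 ≤ p) (h3 : p ≤ 3) : wallAmplitude p = (3 - p) / 8 := by
  rw [wallAmplitude, min_eq_left (by linarith), max_eq_right (by linarith)]

theorem wallAmplitude_of_ge {p : ℝ} (h : 1 ≤ |p - 1| / 2) : wallAmplitude p = 0 := by
  rw [wallAmplitude]
  rcases abs_cases (p - 1) with ⟨h1, h2⟩ | ⟨h1, h2⟩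
  · exact max_eq_left ((min_le_left _ _).trans (by linarith))
  · exact max_eq_left ((min_le_right _ _).trans (by linarith))

theorem wallShift_sub_le {s s' : ℝ} (h : s ≤ s') : wallShift s' - wallShift s ≤ 2 * (s' - s) := by
  have h1 := clamp_sub_le 1 (show 2 * s ≤ 2 * s' by linarith)
  have h2 := clamp_sub_le 1 (clamp_mono 2 h)
  rw [clamp_clamp (by norm_num) (by norm_num), clamp_clamp (by norm_num) (by norm_num)] at h2
  unfold wallShift
  linarith

theorem wallShift_of_two_le {s : ℝ} (h : 2 ≤ |s|) : wallShift s = 0 := by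
  unfold wallShift
  rcases abs_cases s with ⟨h1, h2⟩ | ⟨h1, h2⟩
  · rw [clamp_of_le (by norm_num) (by linarith), clamp_of_le (by norm_num) (by linarith),
      clamp_of_le (by norm_num) (by linarith)]; norm_num
  · rw [clamp_of_le_neg (by norm_num) (by linarith), clamp_of_le_neg (by norm_num) (by linarith),
      clamp_of_le_neg (by norm_num) (by linarith)]; norm_num

theorem wallShift_mul {σ a : ℝ} (hσ : |σ| = 1) (h1 : 1 / 2 ≤ a) (h2 : a ≤ 1) :
    wallShift (σ * a) = σ := by
  have h3 : |σ * a| ≤ 1 := by rw [abs_mul, hσ, one_mul, abs_of_nonneg (by linarith)]; exact h2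
  rw [wallShift, clamp_of_abs_le h3, clamp_of_abs_le (h3.trans (by norm_num)), sub_self, sub_zero]
  rcases eq_or_eq_neg_of_abs_eq hσ with rfl | rfl
  · rw [clamp_of_le (by norm_num) (by linarith)]
  · rw [clamp_of_le_neg (by norm_num) (by linarith)]

/-- The sloping walls `|q - 5/2| = (7 - p) / 8` are at distance `(3 - p) / 8` from the planes `|q -
5/2| = 1/2`, which is the amplitude used. `wallShift` equals `±1` where the walls lie and vanishes
from distance `2` on; slope at most `2` times amplitude at most `3 / 8` keeps the map increasing in
`q`. -/
theorem exists_straightenHomeomorph : ∃ F : ℝ × ℝ × ℝ ≃ₜ ℝ × ℝ × ℝ,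
    (∀ P, (F P).1 = P.1 ∧ (F P).2.2 = P.2.2) ∧
    (∀ P : ℝ × ℝ × ℝ, 4 ≤ |P.1| ∨ 2 ≤ |P.2.1 - 5 / 2| ∨ 2 ≤ |P.2.2| → F P = P) ∧
    (∀ P : ℝ × ℝ × ℝ, (0 ≤ P.2.1 ↔ 0 ≤ (F P).2.1) ∧ (0 < P.2.1 ↔ 0 < (F P).2.1)) ∧
    (∀ P : ℝ × ℝ × ℝ, |P.2.2| ≤ 1 → 0 ≤ P.1 → P.1 ≤ 3 →
      ((7 - P.1) / 8 ≤ |P.2.1 - 5 / 2| ↔ 1 / 2 ≤ |(F P).2.1 - 5 / 2|) ∧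
      ((7 - P.1) / 8 < |P.2.1 - 5 / 2| ↔ 1 / 2 < |(F P).2.1 - 5 / 2|)) ∧
    ∀ p σ t : ℝ, |t| ≤ 1 → 0 ≤ p → p ≤ 3 → |σ| = 1 →
      F (p, 5 / 2 + σ * ((7 - p) / 8), t) = (p, 5 / 2 + σ / 2, t) := by
  set f : ℝ × ℝ × ℝ → ℝ := fun P ↦
    P.1 - cutoff P.2.2 * wallAmplitude P.2.1 * wallShift (P.1 - 5 / 2) with hf
  have hfc : Continuous f := by
    have h1 := continuous_cutoff
    have h2 := continuous_wallAmplitude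
    have h3 := continuous_wallShift
    fun_prop
  have hm : ∀ y : ℝ × ℝ, 0 ≤ cutoff y.2 * wallAmplitude y.1 ∧ cutoff y.2 * wallAmplitude y.1 ≤ 3 / 8 :=
    fun y ↦ by
      obtain ⟨h1, h2⟩ := wallAmplitude_bounds y.1
      obtain ⟨h3, h4⟩ := cutoff_bounds y.2
      exact ⟨mul_nonneg h3 h1, by nlinarith⟩
  have hfm : ∀ y, StrictMono fun x ↦ f (x, y) := by
    intro y x x' hx
    obtain ⟨h1, h2⟩ := hm y
    have h3 := wallShift_sub_le (show x - 5 / 2 ≤ x' - 5 / 2 by linarith)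
    simp only [hf]
    nlinarith
  obtain ⟨G, hG⟩ := exists_homeomorph_fiber hfc hfm (c := 1) (C := 2) one_pos (fun x y ↦ by
    obtain ⟨h1, h2⟩ := hm y
    have h3 : |wallShift (x - 5 / 2)| ≤ 4 := by
      have k1 := abs_le.1 (abs_clamp_le (zero_le_one (α := ℝ)) (2 * (x - 5 / 2)))
      have k2 := abs_le.1 (abs_clamp_le (zero_le_one (α := ℝ)) (x - 5 / 2))
      have k3 := abs_le.1 (abs_clamp_le (zero_le_two (α := ℝ)) (x - 5 / 2))
      unfold wallShift
      exact abs_le.2 ⟨by linarith, by linarith⟩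
    simp only [hf]
    rw [one_mul, sub_sub_cancel_left, abs_neg, abs_mul, abs_of_nonneg h1]
    nlinarith [abs_nonneg (wallShift (x - 5 / 2))])
  set T : ℝ × ℝ × ℝ ≃ₜ ℝ × ℝ × ℝ := ⟨⟨fun P ↦ (P.2.1, P.1, P.2.2), fun P ↦ (P.2.1, P.1, P.2.2),
    fun _ ↦ rfl, fun _ ↦ rfl⟩, by fun_prop, by fun_prop⟩ with hT
  have hF : ∀ P, (T.trans (G.trans T)) P = (P.1, f (P.2.1, P.1, P.2.2), P.2.2) := fun P ↦ by
    change T (G (P.2.1, P.1, P.2.2)) = _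
    rw [hG]; rfl
  have h0 : ∀ y, f (0, y) = 0 := fun y ↦ by
    simp only [hf]
    rw [wallShift_of_two_le (by norm_num [abs_of_neg]), mul_zero, sub_zero]
  have hwall : ∀ p σ t : ℝ, |t| ≤ 1 → 0 ≤ p → p ≤ 3 → |σ| = 1 →
      f (5 / 2 + σ * ((7 - p) / 8), p, t) = 5 / 2 + σ / 2 := fun p σ t ht hp0 hp3 hσ ↦ by
    simp only [hf]
    rw [cutoff_of_le ht, wallAmplitude_of_mem hp0 hp3, add_sub_cancel_left,
      wallShift_mul hσ (by linarith) (by linarith)]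
    ring
  refine ⟨T.trans (G.trans T), fun P ↦ by rw [hF]; exact ⟨rfl, rfl⟩, fun P hP ↦ ?_, fun P ↦ ?_,
    fun P ht hp0 hp3 ↦ ?_, fun p σ t ht hp0 hp3 hσ ↦ ?_⟩
  · rw [hF]
    refine Prod.ext rfl (Prod.ext ?_ rfl)
    simp only [hf]
    rcases hP with h | h | h
    · have h1 : wallAmplitude P.1 = 0 := wallAmplitude_of_ge (by
        have := abs_sub_abs_le_abs_sub P.1 1
        rw [abs_one] at this; linarith)
      rw [h1]; ring
    · rw [wallShift_of_two_le h]; ring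
    · rw [cutoff_of_ge h]; ring
  · rw [hF]
    simp only
    rw [← (hfm (P.1, P.2.2)).le_iff_le, ← (hfm (P.1, P.2.2)).lt_iff_lt, h0]
    exact ⟨Iff.rfl, Iff.rfl⟩
  · rw [hF]
    have h1 := hwall P.1 1 P.2.2 ht hp0 hp3 (by simp)
    have h2 := hwall P.1 (-1) P.2.2 ht hp0 hp3 (by simp)
    have k1 := (hfm (P.1, P.2.2)).le_iff_le (a := 5 / 2 + 1 * ((7 - P.1) / 8)) (b := P.2.1)
    have k2 := (hfm (P.1, P.2.2)).le_iff_le (b := 5 / 2 + -1 * ((7 - P.1) / 8)) (a := P.2.1)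
    have k3 := (hfm (P.1, P.2.2)).lt_iff_lt (a := 5 / 2 + 1 * ((7 - P.1) / 8)) (b := P.2.1)
    have k4 := (hfm (P.1, P.2.2)).lt_iff_lt (b := 5 / 2 + -1 * ((7 - P.1) / 8)) (a := P.2.1)
    simp only [h1, h2] at k1 k2 k3 k4
    simp only
    rw [le_abs, le_abs, lt_abs, lt_abs]
    constructor
    · refine or_congr ?_ ?_
      · rw [le_sub_iff_add_le, le_sub_iff_add_le, add_comm, add_comm (1 / 2 : ℝ), k1, one_mul]
      · constructor
        · intro h; have := k2.2 (by linarith); linarith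
        · intro h; have := k2.1 (by linarith); linarith
    · refine or_congr ?_ ?_
      · rw [lt_sub_iff_add_lt, lt_sub_iff_add_lt, add_comm, add_comm (1 / 2 : ℝ), k3, one_mul]
      · constructor
        · intro h; have := k4.2 (by linarith); linarith
        · intro h; have := k4.1 (by linarith); linarith
  · rw [hF]
    simp only
    rw [hwall p σ t ht hp0 hp3 hσ]

/-- A compactly supported homeomorphism that digs a trench into the wedge. -/
theorem exists_trenchHomeomorph : ∃ Θ : ℝ × ℝ × ℝ ≃ₜ ℝ × ℝ × ℝ, (∀ P, 10 ≤ ‖P‖ → Θ P = P) ∧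
    (∀ P, P ∈ wedge ↔ Θ P ∈ wedge ∧ ¬ ((Θ P).1 < 3 ∧ |(Θ P).2.1 - 5 / 2| < 1 / 2)) ∧
    (∀ P, P ∈ wedgeInt ↔ Θ P ∈ wedgeInt ∧ ¬ ((Θ P).1 ≤ 3 ∧ |(Θ P).2.1 - 5 / 2| ≤ 1 / 2)) ∧
    ∀ σ v t : ℝ, |σ| = 1 → |v| ≤ 1 → |t| ≤ 1 →
      Θ (0, 5 / 2 + σ * (6 - v) / 8, t) = (1 + v, 5 / 2 + σ / 2, t) := by
  obtain ⟨E, hE2, hE, hEp⟩ := exists_digHomeomorph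
  obtain ⟨F, hF1, hF, hFq, hFw, hFf⟩ := exists_straightenHomeomorph
  have h1 : ∀ P, (F (E P)).1 = (E P).1 := fun P ↦ (hF1 _).1
  have h2 : ∀ P, (F (E P)).2.2 = P.2.2 := fun P ↦ by rw [(hF1 _).2, hE2]
  refine ⟨E.trans F, fun P hP ↦ ?_, fun P ↦ ?_, fun P ↦ ?_, fun σ v t hσ hv ht ↦ ?_⟩
  · have hP' : 4 ≤ |P.1| ∨ 2 ≤ |P.2.1 - 5 / 2| ∨ 2 ≤ |P.2.2| := by
      rw [Prod.norm_def, Prod.norm_def, le_max_iff, le_max_iff] at hP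
      simp only [Real.norm_eq_abs] at hP
      rcases hP with h | h | h
      · left; linarith
      · right; left
        have := abs_sub_abs_le_abs_sub P.2.1 (5 / 2)
        rw [abs_of_pos (by norm_num : (0 : ℝ) < 5 / 2)] at this
        linarith
      · right; right; linarith
    have hEP : E P = P := hE P (by rcases hP' with h | h | h <;> [left; (right; left); (right; right)] <;> linarith)
    rw [Homeomorph.trans_apply, hEP, hF P hP']
  · rw [Homeomorph.trans_apply]
    simp only [wedge, mem_ofPred_eq, h1, h2]
    by_cases ht : |P.2.2| ≤ 1
    · have k1 := (hFq (E P)).1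
      rw [hE2] at k1
      rw [(hEp P ht).1, k1, profile_le_iff]
      rcases le_or_gt 0 (E P).1 with h | h
      · rcases le_or_gt 3 (E P).1 with h3 | h3
        · simp [h, h3, not_lt.2 h3]
        · have k2 := (hFw (E P) (by rwa [hE2]) h h3.le).1
          rw [hE2] at k2
          rw [k2, ← not_lt (b := (1 / 2 : ℝ))]
          simp [h, h3, not_le.2 h3, ht]
          tauto
      · simp [not_le.2 h]
    · simp [ht]
  · rw [Homeomorph.trans_apply]
    simp only [wedgeInt, mem_ofPred_eq, h1, h2]
    by_cases ht : |P.2.2| < 1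
    · have k1 := (hFq (E P)).2
      rw [hE2] at k1
      rw [(hEp P ht.le).2.1, k1, profile_lt_iff]
      rcases lt_or_ge 0 (E P).1 with h | h
      · rcases lt_or_ge 3 (E P).1 with h3 | h3
        · simp [h, h3, not_le.2 h3]
        · have k2 := (hFw (E P) (by rw [hE2]; exact ht.le) h.le h3).2
          rw [hE2] at k2
          rw [k2, ← not_le (b := (1 / 2 : ℝ))]
          simp [h, h3, not_lt.2 h3, ht]
          tauto
      · simp [not_lt.2 h]
    · simp [ht]
  · obtain ⟨hv1, hv2⟩ := abs_le.1 hv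
    have k1 : profile (5 / 2 + σ * (6 - v) / 8) = 1 + v := by
      rw [profile, add_sub_cancel_left, abs_div, abs_mul, hσ, one_mul, abs_of_nonneg (by linarith),
        abs_of_nonneg (by norm_num), min_eq_right (by linarith), max_eq_right (by linarith)]
      ring
    have k2 : E (0, 5 / 2 + σ * (6 - v) / 8, t) = (1 + v, 5 / 2 + σ * (6 - v) / 8, t) :=
      Prod.ext (((hEp _ ht).2.2 rfl).trans k1) (hE2 _)
    rw [Homeomorph.trans_apply, k2, ← hFf (1 + v) σ t ht (by linarith) (by linarith) hσ]
    congr 3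
    ring

end Trench

/-! ### A product neighbourhood of a disk in the splitting surface. -/

section FlatBox

variable {M : Type*} [TopologicalSpace M] {g : ℕ} {V W : Set M}

theorem IsHandlebody.exists_isDisk [T2Space M] {H S : Set M} (h : IsHandlebody g H S) {K : ℝ}
    (hK : 0 < K) : ∃ χ : ℂ → M, IsDisk S χ K := by
  obtain ⟨f, hf⟩ := h.exists_isParam le_rfl
  have h1 := (isDisk_foldChart (le_refl (3 * (g : ℝ) + 2)) (Nat.zero_le g) 0).image_of_isCompact
    (isCompact_solid g _) hf.cont hf.inj (solidBdry_subset g _)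
  rw [hf.image_bdry] at h1
  have hc : ((1 / K : ℝ) : ℂ) ≠ 0 := by exact_mod_cast (by positivity : 1 / K ≠ 0)
  refine ⟨_, h1.comp_homeomorph (Homeomorph.mulLeft₀ _ hc) fun z hz ↦ ?_⟩
  rw [mem_closedBall_zero_iff] at hz
  rw [mem_ball_zero_iff, Homeomorph.coe_mulLeft₀, norm_mul, Complex.norm_real,
    Real.norm_of_nonneg (by positivity), one_div, inv_mul_lt_iff₀ hK]
  linarith

/-- A product neighbourhood of a disk in the splitting surface, with the first handlebody on the
positive side. -/
theorem exists_flatBox [T2Space M] (hV : IsHandlebody g V (V ∩ W)) (hW : IsHandlebody g W (V ∩ W))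
    (hVW : V ∪ W = univ) {K : ℝ} (hK : 0 < K) : ∃ b : ℂ × ℝ → M, IsDisk univ b K ∧
      ∀ p ∈ closedBall (0 : ℂ × ℝ) K, (b p ∈ V ↔ 0 ≤ p.2) ∧ (b p ∈ W ↔ p.2 ≤ 0) := by
  obtain ⟨χ, hχ⟩ := hV.exists_isDisk hK
  obtain ⟨c, hc, hci, hc0, hcV, hco⟩ := hV.exists_collar
  obtain ⟨d, hd, hdi, hd0, hdW, hdo⟩ := hW.exists_collar
  obtain ⟨O, hO, hOχ⟩ := hχ.isOpen
  obtain ⟨O₁, hO₁, h1⟩ := hco O hO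
  obtain ⟨O₂, hO₂, h2⟩ := hdo O hO
  have hball : ∀ {p : ℂ × ℝ}, p ∈ closedBall (0 : ℂ × ℝ) K ↔ p.1 ∈ closedBall (0 : ℂ) K ∧ |p.2| ≤ K := by
    intro p
    rw [mem_closedBall_zero_iff, mem_closedBall_zero_iff, Prod.norm_def, max_le_iff,
      Real.norm_eq_abs]
  have hball' : ∀ {p : ℂ × ℝ}, p ∈ ball (0 : ℂ × ℝ) K ↔ p.1 ∈ ball (0 : ℂ) K ∧ |p.2| < K := by
    intro p
    rw [mem_ball_zero_iff, mem_ball_zero_iff, Prod.norm_def, max_lt_iff, Real.norm_eq_abs]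
  -- The collars of the surface in the two handlebodies are joined along it; they agree at height
  -- `0`.
  set b : ℂ × ℝ → M := fun p ↦ if 0 ≤ p.2 then c (χ p.1, p.2 / K) else d (χ p.1, -p.2 / K) with hb
  have hpos : ∀ p : ℂ × ℝ, 0 ≤ p.2 → b p = c (χ p.1, p.2 / K) := fun p h ↦ if_pos h
  have hneg : ∀ p ∈ closedBall (0 : ℂ × ℝ) K, p.2 ≤ 0 → b p = d (χ p.1, -p.2 / K) := by
    intro p hp h
    rcases h.lt_or_eq with h | h
    · exact if_neg (not_le.2 h)
    · have hS := hχ.maps (hball.1 hp).1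
      rw [hpos p h.ge, h, neg_zero, zero_div, hc0 _ hS, hd0 _ hS]
  have hpm : ∀ p ∈ closedBall (0 : ℂ × ℝ) K, 0 ≤ p.2 →
      (χ p.1, p.2 / K) ∈ (V ∩ W) ×ˢ Icc (0 : ℝ) 1 := fun p hp h ↦
    ⟨hχ.maps (hball.1 hp).1, div_nonneg h hK.le, by
      rw [div_le_one hK]; exact (le_abs_self _).trans (hball.1 hp).2⟩
  have hnm : ∀ p ∈ closedBall (0 : ℂ × ℝ) K, p.2 ≤ 0 →
      (χ p.1, -p.2 / K) ∈ (V ∩ W) ×ˢ Icc (0 : ℝ) 1 := fun p hp h ↦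
    ⟨hχ.maps (hball.1 hp).1, div_nonneg (by linarith) hK.le, by
      rw [div_le_one hK]; exact (neg_le_abs _).trans (hball.1 hp).2⟩
  have hcS : ∀ q ∈ (V ∩ W) ×ˢ Icc (0 : ℝ) 1, c q ∈ V ∩ W → q.2 = 0 := fun q hq h ↦ by
    have := hci hq (show (c q, 0) ∈ (V ∩ W) ×ˢ Icc (0 : ℝ) 1 from ⟨h, by simp⟩) (hc0 _ h).symm
    exact congrArg Prod.snd this
  have hdS : ∀ q ∈ (V ∩ W) ×ˢ Icc (0 : ℝ) 1, d q ∈ V ∩ W → q.2 = 0 := fun q hq h ↦ by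
    have := hdi hq (show (d q, 0) ∈ (V ∩ W) ×ˢ Icc (0 : ℝ) 1 from ⟨h, by simp⟩) (hd0 _ h).symm
    exact congrArg Prod.snd this
  have hbV : ∀ p ∈ closedBall (0 : ℂ × ℝ) K, 0 ≤ p.2 → b p ∈ V := fun p hp h ↦ by
    rw [hpos p h]; exact hcV (hpm p hp h)
  have hbW : ∀ p ∈ closedBall (0 : ℂ × ℝ) K, p.2 ≤ 0 → b p ∈ W := fun p hp h ↦ by
    rw [hneg p hp h]; exact hdW (hnm p hp h)
  have hbS : ∀ p ∈ closedBall (0 : ℂ × ℝ) K, b p ∈ V ∩ W → p.2 = 0 := by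
    intro p hp h
    rcases le_total 0 p.2 with h' | h'
    · rw [hpos p h'] at h
      have := hcS _ (hpm p hp h') h
      exact (div_eq_zero_iff.1 this).resolve_right hK.ne'
    · rw [hneg p hp h'] at h
      have := hdS _ (hnm p hp h') h
      exact neg_eq_zero.1 ((div_eq_zero_iff.1 this).resolve_right hK.ne')
  have hmem : ∀ p ∈ closedBall (0 : ℂ × ℝ) K, (b p ∈ V ↔ 0 ≤ p.2) ∧ (b p ∈ W ↔ p.2 ≤ 0) := by
    refine fun p hp ↦ ⟨⟨fun h ↦ ?_, hbV p hp⟩, ⟨fun h ↦ ?_, hbW p hp⟩⟩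
    · rcases le_total 0 p.2 with h' | h'
      · exact h'
      · exact (hbS p hp ⟨h, hbW p hp h'⟩).ge
    · rcases le_total 0 p.2 with h' | h'
      · exact (hbS p hp ⟨hbV p hp h', h⟩).le
      · exact h'
  -- A point is in the image of the open box exactly when it is in the relatively open half in each
  -- handlebody to which it belongs. The points where this fails form a compact set.
  refine ⟨b, ⟨?_, ?_, mapsTo_univ _ _, {x | (x ∈ V → x ∈ O₁) ∧ (x ∈ W → x ∈ O₂)}, ?_, ?_⟩, hmem⟩
  · have hcov : closedBall (0 : ℂ × ℝ) K =
        (closedBall 0 K ∩ {p | 0 ≤ p.2}) ∪ (closedBall 0 K ∩ {p | p.2 ≤ 0}) := by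
      rw [← inter_union_distrib_left, eq_comm, inter_eq_left]
      exact fun p _ ↦ le_total 0 p.2
    have hχc : ContinuousOn (fun p : ℂ × ℝ ↦ χ p.1) (closedBall 0 K) :=
      hχ.cont.comp continuousOn_fst fun p hp ↦ (hball.1 hp).1
    rw [hcov]
    refine ContinuousOn.union_of_isClosed ?_ ?_
      (isClosed_closedBall.inter (isClosed_le continuous_const continuous_snd))
      (isClosed_closedBall.inter (isClosed_le continuous_snd continuous_const))
    · exact (hc.comp ((hχc.mono inter_subset_left).prodMk (by fun_prop))
        fun p hp ↦ hpm p hp.1 hp.2).congr fun p hp ↦ hpos p hp.2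
    · exact (hd.comp ((hχc.mono inter_subset_left).prodMk (by fun_prop))
        fun p hp ↦ hnm p hp.1 hp.2).congr fun p hp ↦ hneg p hp.1 hp.2
  · intro p hp q hq hpq
    have hV' := (hmem p hp).1
    have hW' := (hmem p hp).2
    rw [hpq, (hmem q hq).1] at hV'
    rw [hpq, (hmem q hq).2] at hW'
    rcases le_total 0 p.2 with h | h
    · rw [hpos p h, hpos q (hV'.2 h)] at hpq
      have := hci (hpm p hp h) (hpm q hq (hV'.2 h)) hpq
      rw [Prod.mk.injEq] at this
      exact Prod.ext (hχ.inj (hball.1 hp).1 (hball.1 hq).1 this.1)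
        ((div_left_inj' hK.ne').1 this.2)
    · rw [hneg p hp h, hneg q hq (hW'.2 h)] at hpq
      have := hdi (hnm p hp h) (hnm q hq (hW'.2 h)) hpq
      rw [Prod.mk.injEq] at this
      exact Prod.ext (hχ.inj (hball.1 hp).1 (hball.1 hq).1 this.1)
        (neg_injective ((div_left_inj' hK.ne').1 this.2))
  · obtain ⟨fV, hfV⟩ := hV.exists_isParam le_rfl
    obtain ⟨fW, hfW⟩ := hW.exists_isParam le_rfl
    have : {x | (x ∈ V → x ∈ O₁) ∧ (x ∈ W → x ∈ O₂)} = ((V \ O₁) ∪ (W \ O₂))ᶜ := by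
      ext x; simp
    rw [this]
    exact ((hfV.isCompact.diff hO₁).isClosed.union (hfW.isCompact.diff hO₂).isClosed).isOpen_compl
  · rw [inter_univ]
    ext x
    constructor
    · rintro ⟨p, hp, rfl⟩
      have hpc := ball_subset_closedBall hp
      obtain ⟨hp1, hp2⟩ := hball'.1 hp
      have hχO : χ p.1 ∈ (V ∩ W) ∩ O := by
        rw [inter_comm]; exact hOχ.subset ⟨_, hp1, rfl⟩
      have k1 : 0 ≤ p.2 → b p ∈ O₁ := fun h ↦ by
        rw [hpos p h]
        refine (h1.subset ⟨_, ⟨hχO, (hpm p hpc h).2.1, ?_⟩, rfl⟩).1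
        rw [div_lt_one hK]; exact (le_abs_self _).trans_lt hp2
      have k2 : p.2 ≤ 0 → b p ∈ O₂ := fun h ↦ by
        rw [hneg p hpc h]
        refine (h2.subset ⟨_, ⟨hχO, (hnm p hpc h).2.1, ?_⟩, rfl⟩).1
        rw [div_lt_one hK]; exact (neg_le_abs _).trans_lt hp2
      exact ⟨fun h ↦ k1 ((hmem p hpc).1.1 h), fun h ↦ k2 ((hmem p hpc).2.1 h)⟩
    · rintro ⟨k1, k2⟩
      rcases hVW.symm.subset (mem_univ x) with hx | hx
      · obtain ⟨⟨y, s⟩, ⟨hy, hs⟩, rfl⟩ := h1.symm.subset ⟨k1 hx, hx⟩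
        obtain ⟨w, hw, rfl⟩ := hOχ.symm.subset ⟨hy.2, hy.1⟩
        have hs0 : (0 : ℝ) ≤ s := hs.1
        have hs1 : s < 1 := hs.2
        refine ⟨(w, s * K), hball'.2 ⟨hw, ?_⟩, ?_⟩
        · rw [abs_of_nonneg (by positivity)]; nlinarith
        · rw [hpos _ (by simp only; positivity)]
          simp only
          rw [mul_div_cancel_right₀ _ hK.ne']
      · obtain ⟨⟨y, s⟩, ⟨hy, hs⟩, rfl⟩ := h2.symm.subset ⟨k2 hx, hx⟩
        obtain ⟨w, hw, rfl⟩ := hOχ.symm.subset ⟨hy.2, hy.1⟩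
        have hs0 : (0 : ℝ) ≤ s := hs.1
        have hs1 : s < 1 := hs.2
        have hm : (w, -(s * K)) ∈ ball (0 : ℂ × ℝ) K := hball'.2 ⟨hw, by
          rw [abs_neg, abs_of_nonneg (by positivity)]; nlinarith⟩
        refine ⟨(w, -(s * K)), hm, ?_⟩
        rw [hneg _ (ball_subset_closedBall hm) (by simp only; nlinarith)]
        simp only
        rw [neg_neg, mul_div_cancel_right₀ _ hK.ne']

theorem IsDisk.slice {b : ℂ × ℝ → M} {K : ℝ} {S : Set M} (hb : IsDisk univ b K)
    (hS : ∀ p ∈ closedBall (0 : ℂ × ℝ) K, b p ∈ S ↔ p.2 = 0) : IsDisk S (fun w ↦ b (w, 0)) K := by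
  have hm : ∀ w ∈ closedBall (0 : ℂ) K, (w, (0 : ℝ)) ∈ closedBall (0 : ℂ × ℝ) K := fun w hw ↦ by
    rw [mem_closedBall_zero_iff] at hw ⊢
    rw [Prod.norm_def, norm_zero, max_eq_left (norm_nonneg w)]; exact hw
  have hm' : ∀ w ∈ ball (0 : ℂ) K, (w, (0 : ℝ)) ∈ ball (0 : ℂ × ℝ) K := fun w hw ↦ by
    rw [mem_ball_zero_iff] at hw ⊢
    rw [Prod.norm_def, norm_zero, max_eq_left (norm_nonneg w)]; exact hw
  obtain ⟨O, hO, h1⟩ := hb.isOpen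
  refine ⟨hb.cont.comp (by fun_prop) hm, fun w hw w' hw' h ↦ ?_, fun w hw ↦ (hS _ (hm w hw)).2 rfl,
    O, hO, ?_⟩
  · exact congrArg Prod.fst (hb.inj (hm w hw) (hm w' hw') h)
  · ext x
    constructor
    · rintro ⟨w, hw, rfl⟩
      exact ⟨(h1.subset ⟨_, hm' w hw, rfl⟩).1, (hS _ (hm w (ball_subset_closedBall hw))).2 rfl⟩
    · rintro ⟨hxO, hxS⟩
      obtain ⟨⟨w, z⟩, hp, rfl⟩ := h1.symm.subset ⟨hxO, mem_univ _⟩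
      have hz : z = 0 := (hS _ (ball_subset_closedBall hp)).1 hxS
      subst hz
      rw [mem_ball_zero_iff, Prod.norm_def, max_lt_iff] at hp
      exact ⟨w, mem_ball_zero_iff.2 hp.1, rfl⟩

end FlatBox

/-! ### Straightening the wedge to a half-space. -/

section WedgeModel

/-- A homeomorphism taking the wedge to a half-space. -/
theorem exists_wedgeHomeomorph : ∃ L : ℝ × ℝ × ℝ ≃ₜ ℂ × ℝ,
    (∀ P, (0 ≤ (L P).2 ↔ P ∈ wedge) ∧ ((L P).2 ≤ 0 ↔ P ∉ wedgeInt)) ∧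
    (∀ q t : ℝ, 0 ≤ q → |t| ≤ 1 → L (0, q, t) = (⟨t * (1 + q), -q⟩, 0)) ∧
    (∀ p t : ℝ, 0 ≤ p → |t| ≤ 1 → L (p, 0, t) = (⟨t * (1 + p), p⟩, 0)) ∧
    ∀ p q t : ℝ, 0 ≤ p → 0 ≤ q → |t| = 1 → L (p, q, t) = (⟨t * (1 + (p + q)), p - q⟩, 0) := by
  -- The lower bound `1 / 8` only keeps the factor positive for negative `n`, so that the third
  -- coordinate can be recovered by division.
  set m : ℝ → ℝ := fun n ↦ max (1 + n) (1 / 8) with hm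
  have hm0 : ∀ n, 0 < m n := fun n ↦ lt_of_lt_of_le (by norm_num) (le_max_right _ _)
  have hm1 : ∀ n, 0 ≤ n → m n = 1 + n := fun n hn ↦ max_eq_left (by linarith)
  have hmc : Continuous m := by fun_prop
  -- With `n = p + q`, the wedge is given by `|p - q| ≤ n` and `|t| * (1 + n) - 1 ≤ n`. The last
  -- coordinate is `n` minus the larger left-hand side, so its sign detects the wedge, and the
  -- boundary is sent to the plane at height `0`.
  set F : ℝ × ℝ × ℝ → ℂ × ℝ := fun P ↦ (((P.2.2 * m (P.1 + P.2.1) : ℝ) : ℂ) +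
    ((P.1 - P.2.1 : ℝ) : ℂ) * Complex.I,
    P.1 + P.2.1 - max |P.1 - P.2.1| (|P.2.2 * m (P.1 + P.2.1)| - 1)) with hF
  set n : ℂ × ℝ → ℝ := fun y ↦ y.2 + max |y.1.im| (|y.1.re| - 1) with hn
  have hre : ∀ a b : ℝ, ((a : ℂ) + b * Complex.I).re = a ∧ ((a : ℂ) + b * Complex.I).im = b :=
    fun a b ↦ by simp
  have hnc : Continuous n := by
    have h1 := Complex.continuous_re
    have h2 := Complex.continuous_im
    fun_prop
  have hnF : ∀ P, n (F P) = P.1 + P.2.1 := fun P ↦ by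
    simp only [hn, hF]; rw [(hre _ _).1, (hre _ _).2]; ring
  set G : ℂ × ℝ → ℝ × ℝ × ℝ := fun y ↦
    ((n y + y.1.im) / 2, (n y - y.1.im) / 2, y.1.re / m (n y)) with hG
  have hGc : Continuous G := by
    have h1 := Complex.continuous_re
    have h2 := Complex.continuous_im
    have h3 : Continuous fun y : ℂ × ℝ ↦ y.1.re / m (n y) :=
      Continuous.div (by fun_prop) (by fun_prop) fun y ↦ (hm0 _).ne'
    fun_prop
  have hFc : Continuous F := by fun_prop
  set L : ℝ × ℝ × ℝ ≃ₜ ℂ × ℝ := ⟨⟨F, G, fun P ↦ by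
    simp only [hG]
    rw [hnF]
    have h1 : (F P).1.im = P.1 - P.2.1 := (hre _ _).2
    have h2 : (F P).1.re = P.2.2 * m (P.1 + P.2.1) := (hre _ _).1
    rw [h1, h2, mul_div_cancel_right₀ _ (hm0 _).ne']
    exact Prod.ext (by ring) (Prod.ext (by ring) rfl), fun y ↦ by
    have h1 : (G y).1 + (G y).2.1 = n y := by simp only [hG]; ring
    have h2 : (G y).1 - (G y).2.1 = y.1.im := by simp only [hG]; ring
    simp only [hF]
    rw [h1, h2]
    simp only [hG]
    rw [div_mul_cancel₀ _ (hm0 _).ne', Complex.re_add_im]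
    refine Prod.ext rfl ?_
    simp only [hn]; ring⟩, hFc, hGc⟩ with hL
  have hLF : ∀ P, L P = F P := fun P ↦ rfl
  refine ⟨L, fun P ↦ ?_, fun q t hq ht ↦ ?_, fun p t hp ht ↦ ?_, fun p q t hp hq ht ↦ ?_⟩
  · have h1 : (L P).2 = P.1 + P.2.1 - max |P.1 - P.2.1| (|P.2.2 * m (P.1 + P.2.1)| - 1) := rfl
    rw [h1]
    constructor
    · rw [sub_nonneg, max_le_iff, abs_le]
      constructor
      · rintro ⟨⟨h2, h3⟩, h4⟩
        rw [hm1 _ (by linarith), abs_mul, abs_of_pos (by linarith : 0 < 1 + (P.1 + P.2.1))] at h4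
        refine ⟨by linarith, by linarith, ?_⟩
        by_contra hcon
        push Not at hcon
        nlinarith
      · rintro ⟨h2, h3, h4⟩
        rw [hm1 _ (by linarith), abs_mul, abs_of_pos (by linarith : 0 < 1 + (P.1 + P.2.1))]
        exact ⟨⟨by linarith, by linarith⟩, by nlinarith⟩
    · rw [sub_nonpos, ← not_lt, max_lt_iff, abs_lt, not_iff_not]
      constructor
      · rintro ⟨⟨h2, h3⟩, h4⟩
        rw [hm1 _ (by linarith), abs_mul, abs_of_pos (by linarith : 0 < 1 + (P.1 + P.2.1))] at h4
        refine ⟨by linarith, by linarith, ?_⟩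
        by_contra hcon
        push Not at hcon
        nlinarith
      · rintro ⟨h2, h3, h4⟩
        rw [hm1 _ (by linarith), abs_mul, abs_of_pos (by linarith : 0 < 1 + (P.1 + P.2.1))]
        exact ⟨⟨by linarith, by linarith⟩, by nlinarith⟩
  · rw [hLF]
    simp only [hF]
    rw [hm1 _ (by linarith), abs_mul, abs_of_pos (by linarith : 0 < 1 + (0 + q)), zero_sub, abs_neg,
      abs_of_nonneg hq, zero_add, max_eq_left (by nlinarith), sub_self]
    refine Prod.ext (Complex.ext (hre _ _).1 (hre _ _).2) rfl
  · rw [hLF]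
    simp only [hF]
    rw [hm1 _ (by linarith), abs_mul, abs_of_pos (by linarith : 0 < 1 + (p + 0)), sub_zero,
      abs_of_nonneg hp, add_zero, max_eq_left (by nlinarith), sub_self]
    refine Prod.ext (Complex.ext (hre _ _).1 (hre _ _).2) rfl
  · rw [hLF]
    simp only [hF]
    rw [hm1 _ (by linarith), abs_mul, ht, abs_of_pos (by linarith : 0 < 1 + (p + q)), one_mul,
      add_sub_cancel_left, max_eq_right (abs_le.2 ⟨by linarith, by linarith⟩), sub_self]
    refine Prod.ext (Complex.ext (hre _ _).1 (hre _ _).2) rfl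

end WedgeModel

/-! ### Standard squares on the faces of the wedge. -/

theorem Continuous.exists_mapsTo_ball {E F : Type*} [NormedAddCommGroup E] [ProperSpace E]
    [NormedAddCommGroup F] {f : E → F} (hf : Continuous f) (r : ℝ) :
    ∃ K, 0 < K ∧ MapsTo f (closedBall 0 r) (ball 0 K) := by
  obtain ⟨K, hK, h⟩ := ((isCompact_closedBall (0 : E) r).image hf).isBounded.subset_ball_lt 0 0
  exact ⟨K, hK, mapsTo_iff_image_subset.2 h⟩

theorem Continuous.complexMk {X : Type*} [TopologicalSpace X] {a b : X → ℝ} (ha : Continuous a)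
    (hb : Continuous b) : Continuous fun x ↦ (⟨a x, b x⟩ : ℂ) :=
  Complex.equivRealProdCLM.symm.continuous.comp (ha.prodMk hb)

/-- In the straightened boundary the face `q = 0` has coordinates `(t * (1 + p), p)`. With `p = 5 /
2 + re / 8` the standard feet become the strips that the digging moves onto the walls of the trench;
the absolute value only makes the formula invertible everywhere. -/
theorem exists_sideHomeomorph : ∃ L : ℂ ≃ₜ ℂ, ∀ z : ℂ,
    L z = ⟨z.im * (1 + |5 / 2 + z.re / 8|), 5 / 2 + z.re / 8⟩ := by
  have hpos : ∀ x : ℝ, 0 < 1 + |x| := fun x ↦ by positivity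
  have h1 := Complex.continuous_re
  have h2 := Complex.continuous_im
  refine ⟨⟨⟨fun z ↦ ⟨z.im * (1 + |5 / 2 + z.re / 8|), 5 / 2 + z.re / 8⟩,
    fun w ↦ ⟨8 * (w.im - 5 / 2), w.re / (1 + |w.im|)⟩, fun z ↦ ?_, fun w ↦ ?_⟩, ?_, ?_⟩,
    fun z ↦ rfl⟩
  · refine Complex.ext ?_ ?_
    · simp only; ring
    · exact mul_div_cancel_right₀ _ (hpos _).ne'
  · have h3 : 5 / 2 + 8 * (w.im - 5 / 2) / 8 = w.im := by ring
    refine Complex.ext ?_ ?_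
    · simp only
      rw [h3, div_mul_cancel₀ _ (hpos _).ne']
    · exact h3
  · exact Continuous.complexMk (by fun_prop) (by fun_prop)
  · exact Continuous.complexMk (by fun_prop)
      (Continuous.div (by fun_prop) (by fun_prop) fun w ↦ (hpos _).ne')

/-- In the straightened boundary the two ends of the tunnel are squares turned by 45 degrees about
`±6`. Multiplication by `(1 + I) / 2` about `6`, cut off at distance `5`, produces one of them from
a standard foot. Its mirror image produces the other, and the cutoff prevents interference. -/
theorem exists_endHomeomorph : ∃ L : ℂ ≃ₜ ℂ, ∀ σ y v : ℝ, |σ| = 1 → |y| ≤ 1 → |v| ≤ 1 →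
    L ⟨σ * (6 - v), y⟩ = ⟨σ * (6 - (v + y) / 2), (y - v) / 2⟩ := by
  set μ : ℂ := ⟨1 / 2, 1 / 2⟩ with hμ
  have hμ0 : μ ≠ 0 := fun h ↦ by
    have := congrArg Complex.re h
    norm_num [hμ] at this
  have hμ1 : ‖μ‖ ≤ 1 := by
    refine abs_le_of_sq_le_sq' ?_ zero_le_one |>.2
    rw [← Complex.normSq_eq_norm_sq, Complex.normSq_apply]
    norm_num [hμ]
  obtain ⟨Θ, hΘ, hΘμ⟩ := exists_homeomorph_eq_mul (R := 2) (ρ := 5) two_pos (by norm_num) hμ0 hμ1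
  set A : ℂ ≃ₜ ℂ := (Homeomorph.subRight (6 : ℂ)).trans (Θ.trans (Homeomorph.addRight 6)) with hA
  have hAz : ∀ z, A z = Θ (z - 6) + 6 := fun z ↦ rfl
  set m : ℂ ≃ₜ ℂ := Complex.conjLIE.toHomeomorph.trans (Homeomorph.neg ℂ) with hm
  have hmz : ∀ z : ℂ, m z = ⟨-z.re, z.im⟩ := fun z ↦ by
    have : m z = -(starRingEnd ℂ z) := rfl
    rw [this]
    apply Complex.ext <;> simp
  have hfar : ∀ z : ℂ, z.re ≤ 1 → A z = z := fun z hz ↦ by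
    rw [hAz, hΘ, sub_add_cancel]
    have h1 := Complex.abs_re_le_norm (z - 6)
    have h2 : (z - 6).re = z.re - 6 := by simp
    rw [h2, abs_of_nonpos (by linarith)] at h1
    linarith
  have hnear : ∀ y v : ℝ, |y| ≤ 1 → |v| ≤ 1 →
      A ⟨6 - v, y⟩ = ⟨6 - (v + y) / 2, (y - v) / 2⟩ := fun y v hy hv ↦ by
    have h1 : (⟨6 - v, y⟩ : ℂ) - 6 = ⟨-v, y⟩ := by apply Complex.ext <;> simp
    rw [hAz, h1, hΘμ]
    · apply Complex.ext
      · simp [hμ]; ring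
      · simp [hμ]; ring
    · refine abs_le_of_sq_le_sq' ?_ zero_le_two |>.2
      rw [← Complex.normSq_eq_norm_sq, Complex.normSq_apply]
      have := sq_le_sq' (abs_le.1 hy).1 (abs_le.1 hy).2
      have := sq_le_sq' (abs_le.1 hv).1 (abs_le.1 hv).2
      nlinarith
  refine ⟨(m.trans (A.trans m)).trans A, fun σ y v hσ hy hv ↦ ?_⟩
  have hy' := abs_le.1 hy
  have hv' := abs_le.1 hv
  change A (m (A (m _))) = _
  rcases eq_or_eq_neg_of_abs_eq hσ with rfl | rfl
  · rw [hmz ⟨1 * (6 - v), y⟩, hfar ⟨-(1 * (6 - v)), y⟩ (by simp only; linarith), hmz]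
    simp only
    rw [neg_neg, one_mul, hnear y v hy hv, one_mul]
  · rw [hmz ⟨-1 * (6 - v), y⟩]
    simp only
    rw [neg_one_mul, neg_neg, hnear y v hy hv, hmz, hfar _ (by simp only; linarith), neg_one_mul]

/-! ### A box around a piece of the splitting surface in which `V` is a wedge. -/

section WedgeBox

variable {M : Type*} [TopologicalSpace M] {g : ℕ} {V W : Set M}

/-- A box in which `V` and `W` look like the wedge and the closure of its complement. -/
structure IsWedgeBox (V W : Set M) (β : ℝ × ℝ × ℝ → M) : Prop where
  disk : IsDisk univ β 10
  mem_left : ∀ P ∈ closedBall (0 : ℝ × ℝ × ℝ) 10, β P ∈ V ↔ P ∈ wedge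
  mem_right : ∀ P ∈ closedBall (0 : ℝ × ℝ × ℝ) 10, β P ∈ W ↔ P ∉ wedgeInt

/-- The disks `χ₁` and `χ₂` contain the strips from which the walls of the two trenches will be
made, and `χ₃` contains the ends of the tunnel. In each the relevant squares are the standard feet
of `IsHandlebody.attach`. -/
theorem exists_isWedgeBox [T2Space M] (hV : IsHandlebody g V (V ∩ W))
    (hW : IsHandlebody g W (V ∩ W)) (hVW : V ∪ W = univ) :
    ∃ (β : ℝ × ℝ × ℝ → M) (χ₁ χ₂ χ₃ : ℂ → M), IsWedgeBox V W β ∧ IsDisk (V ∩ W) χ₁ 12 ∧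
      IsDisk (V ∩ W) χ₂ 12 ∧ IsDisk (V ∩ W) χ₃ 12 ∧
      (∀ σ v t : ℝ, |σ| = 1 → |v| ≤ 1 → |t| ≤ 1 →
        χ₁ ⟨σ * (6 - v), t⟩ = β (0, 5 / 2 + σ * (6 - v) / 8, t)) ∧
      (∀ σ v t : ℝ, |σ| = 1 → |v| ≤ 1 → |t| ≤ 1 →
        χ₂ ⟨σ * (6 - v), t⟩ = β (5 / 2 + σ * (6 - v) / 8, 0, t)) ∧
      ∀ σ y v : ℝ, |σ| = 1 → |y| ≤ 1 → |v| ≤ 1 →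
        χ₃ ⟨σ * (6 - v), y⟩ = β (5 / 2 - v / 2, 5 / 2 - y / 2, σ) := by
  obtain ⟨L, hL, hL₁, hL₂, hL₃⟩ := exists_wedgeHomeomorph
  obtain ⟨B, hB⟩ := exists_sideHomeomorph
  obtain ⟨D, hD⟩ := exists_endHomeomorph
  set C : ℂ ≃ₜ ℂ := B.trans Complex.conjLIE.toHomeomorph with hC
  have hCz : ∀ z : ℂ, C z = ⟨z.im * (1 + |5 / 2 + z.re / 8|), -(5 / 2 + z.re / 8)⟩ := fun z ↦ by
    have : C z = starRingEnd ℂ (B z) := rfl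
    rw [this, hB]; rfl
  obtain ⟨K₀, hK₀, m₀⟩ := L.continuous.exists_mapsTo_ball 10
  obtain ⟨K₁, hK₁, m₁⟩ := C.continuous.exists_mapsTo_ball 12
  obtain ⟨K₂, hK₂, m₂⟩ := B.continuous.exists_mapsTo_ball 12
  obtain ⟨K₃, hK₃, m₃⟩ := D.continuous.exists_mapsTo_ball 12
  -- The flat box is taken large enough for the straightened wedge box and for all three coordinate
  -- changes on the surface.
  have hK : 0 < K₀ + K₁ + K₂ + K₃ := by positivity
  obtain ⟨b, hb, hbm⟩ := exists_flatBox hV hW hVW hK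
  set K := K₀ + K₁ + K₂ + K₃ with hKdef
  have hS := hb.slice (S := V ∩ W) fun p hp ↦ by
    rw [mem_inter_iff, (hbm p hp).1, (hbm p hp).2]
    exact ⟨fun h ↦ le_antisymm h.2 h.1, fun h ↦ ⟨h.ge, h.le⟩⟩
  have m₀' : MapsTo L (closedBall 0 10) (ball 0 K) := m₀.mono_right (ball_subset_ball (by linarith))
  have hbound : ∀ {σ v : ℝ}, |σ| = 1 → |v| ≤ 1 → 0 ≤ 5 / 2 + σ * (6 - v) / 8 := by
    intro σ v hσ hv
    obtain ⟨h1, h2⟩ := abs_le.1 hv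
    rcases eq_or_eq_neg_of_abs_eq hσ with rfl | rfl <;> linarith
  refine ⟨fun P ↦ b (L P), _, _, _, ⟨hb.comp_homeomorph L m₀', fun P hP ↦ ?_, fun P hP ↦ ?_⟩,
    hS.comp_homeomorph C (m₁.mono_right (ball_subset_ball (by linarith))),
    hS.comp_homeomorph B (m₂.mono_right (ball_subset_ball (by linarith))),
    hS.comp_homeomorph D (m₃.mono_right (ball_subset_ball (by linarith))), fun σ v t hσ hv ht ↦ ?_,
    fun σ v t hσ hv ht ↦ ?_, fun σ y v hσ hy hv ↦ ?_⟩
  · rw [(hbm _ (ball_subset_closedBall (m₀' hP))).1, (hL P).1]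
  · rw [(hbm _ (ball_subset_closedBall (m₀' hP))).2, (hL P).2]
  · simp only
    rw [hL₁ _ t (hbound hσ hv) ht, hCz]
    simp only
    rw [abs_of_nonneg (hbound hσ hv)]
  · simp only
    rw [hL₂ _ t (hbound hσ hv) ht, hB]
    simp only
    rw [abs_of_nonneg (hbound hσ hv)]
  · obtain ⟨h1, h2⟩ := abs_le.1 hy
    obtain ⟨h3, h4⟩ := abs_le.1 hv
    simp only
    rw [hL₃ _ _ σ (by linarith) (by linarith) hσ, hD σ y v hσ hy hv]
    congr 3 <;> ring

end WedgeBox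

/-! ### Images of splittings under homeomorphisms, and isotopy as an equivalence. -/

section Isotopy

variable {M : Type*} [TopologicalSpace M]

theorem IsHandlebody.image {g : ℕ} {H S : Set M} (h : IsHandlebody g H S) (e : M ≃ₜ M) :
    IsHandlebody g (e '' H) (e '' S) := by
  obtain ⟨f, hf, hr, hb⟩ := h
  refine ⟨e ∘ f, e.isEmbedding.comp hf, ?_, ?_⟩
  · rw [range_comp, hr]
  · rw [image_comp, hb]

/-- The image of a splitting under a homeomorphism. -/
def HeegaardSplitting.map (P : HeegaardSplitting M) (e : M ≃ₜ M) : HeegaardSplitting M where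
  V := e '' P.V
  W := e '' P.W
  union_eq := by rw [← image_union, P.union_eq, image_univ, e.surjective.range_eq]
  exists_genus := by
    obtain ⟨g, h1, h2⟩ := P.exists_genus
    refine ⟨g, ?_⟩
    rw [← image_inter e.injective]
    exact ⟨h1.image e, h2.image e⟩

theorem HeegaardSplitting.HasGenus.map {P : HeegaardSplitting M} {g : ℕ} (h : P.HasGenus g)
    (e : M ≃ₜ M) : (P.map e).HasGenus g := by
  have : (P.map e).V ∩ (P.map e).W = e '' (P.V ∩ P.W) := (image_inter e.injective).symm
  refine ⟨?_, ?_⟩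
  · rw [this]; exact h.1.image e
  · rw [this]; exact h.2.image e

theorem HeegaardSplitting.ext_sets {P Q : HeegaardSplitting M} (hV : P.V = Q.V) (hW : P.W = Q.W) :
    P = Q := by
  cases P; cases Q
  simp only at hV hW
  subst hV hW
  rfl

theorem HeegaardSplitting.Isotopic.hasGenus {P Q : HeegaardSplitting M} (h : P.Isotopic Q) {g : ℕ}
    (hg : P.HasGenus g) : Q.HasGenus g := by
  obtain ⟨F, -, -, hV, hW⟩ := h
  have : P.map (F 1) = Q := HeegaardSplitting.ext_sets hV hW
  exact this ▸ hg.map (F 1)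

theorem HeegaardSplitting.Isotopic.symm {P Q : HeegaardSplitting M} (h : P.Isotopic Q) :
    Q.Isotopic P := by
  obtain ⟨F, hF, h0, hV, hW⟩ := h
  refine ⟨fun a ↦ (F 1).symm.trans (F (unitInterval.symm a)), ?_, fun x ↦ ?_, ?_, ?_⟩
  · exact hF.comp ((unitInterval.continuous_symm.comp continuous_fst).prodMk
      ((F 1).symm.continuous.comp continuous_snd))
  · simp
  · have : ∀ x, ((F 1).symm.trans (F (unitInterval.symm 1))) x = (F 1).symm x := fun x ↦ by simp [h0]
    rw [image_congr fun x _ ↦ this x, ← hV, ← image_comp]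
    simp
  · have : ∀ x, ((F 1).symm.trans (F (unitInterval.symm 1))) x = (F 1).symm x := fun x ↦ by simp [h0]
    rw [image_congr fun x _ ↦ this x, ← hW, ← image_comp]
    simp

theorem HeegaardSplitting.Isotopic.trans {P Q R : HeegaardSplitting M} (h : P.Isotopic Q)
    (h' : Q.Isotopic R) : P.Isotopic R := by
  obtain ⟨F, hF, h0, hV, hW⟩ := h
  obtain ⟨G, hG, h0', hV', hW'⟩ := h'
  refine ⟨fun a ↦ (F a).trans (G a), hG.comp (continuous_fst.prodMk hF), fun x ↦ ?_, ?_, ?_⟩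
  · rw [Homeomorph.trans_apply, h0, h0']
  · change (G 1 ∘ F 1) '' P.V = R.V
    rw [image_comp, hV, hV']
  · change (G 1 ∘ F 1) '' P.W = R.W
    rw [image_comp, hW, hW']

end Isotopy

/-! ### The splittings with a trench, and the drilled tunnel. -/

section TrenchSplitting

variable {M : Type*} [TopologicalSpace M] {g : ℕ} {β : ℝ × ℝ × ℝ → M}

/-- `Q` arises from `P` by digging, in a wedge box, a trench that starts from one side of the wedge. -/
structure IsTrenchSplitting (P Q : HeegaardSplitting M) (β : ℝ × ℝ × ℝ → M) : Prop where
  mem_V : ∀ x ∈ closedBall (0 : ℝ × ℝ × ℝ) 10, β x ∈ Q.V ↔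
    x ∈ wedge ∧ ¬ (x.1 < 3 ∧ |x.2.1 - 5 / 2| < 1 / 2)
  mem_W : ∀ x ∈ closedBall (0 : ℝ × ℝ × ℝ) 10, β x ∈ Q.W ↔
    ¬ (x ∈ wedgeInt ∧ ¬ (x.1 ≤ 3 ∧ |x.2.1 - 5 / 2| ≤ 1 / 2))
  mem_V_of_notMem : ∀ y ∉ β '' closedBall (0 : ℝ × ℝ × ℝ) 10, y ∈ Q.V ↔ y ∈ P.V
  mem_W_of_notMem : ∀ y ∉ β '' closedBall (0 : ℝ × ℝ × ℝ) 10, y ∈ Q.W ↔ y ∈ P.W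

/-- The digging is supported in the box, so Alexander's trick makes it the end of an ambient
isotopy. The disk `χ` is carried along, and its standard feet become the parts `0 ≤ p ≤ 2` of the
two trench walls. -/
theorem exists_isTrenchSplitting [T2Space M] (P : HeegaardSplitting M) (hβ : IsWedgeBox P.V P.W β)
    {χ : ℂ → M} (hχ : IsDisk (P.V ∩ P.W) χ 12)
    (hχβ : ∀ σ v t : ℝ, |σ| = 1 → |v| ≤ 1 → |t| ≤ 1 →
      χ ⟨σ * (6 - v), t⟩ = β (0, 5 / 2 + σ * (6 - v) / 8, t)) :
    ∃ Q : HeegaardSplitting M, P.Isotopic Q ∧ IsTrenchSplitting P Q β ∧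
      ∃ χ' : ℂ → M, IsDisk (Q.V ∩ Q.W) χ' 12 ∧ ∀ σ v t : ℝ, |σ| = 1 → |v| ≤ 1 → |t| ≤ 1 →
        χ' ⟨σ * (6 - v), t⟩ = β (1 + v, 5 / 2 + σ / 2, t) := by
  obtain ⟨Θ, hΘ, hΘV, hΘW, hΘf⟩ := exists_trenchHomeomorph
  obtain ⟨F, hF, hF0, hF1, hFo⟩ := hβ.disk.exists_isotopy Θ hΘ
  have hsymm : ∀ x ∈ closedBall (0 : ℝ × ℝ × ℝ) 10, Θ.symm x ∈ closedBall (0 : ℝ × ℝ × ℝ) 10 := by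
    intro x hx
    by_contra hcon
    rw [mem_closedBall_zero_iff, not_le] at hcon
    have := hΘ _ hcon.le
    rw [Θ.apply_symm_apply] at this
    rw [← this] at hcon
    exact not_le.2 hcon (mem_closedBall_zero_iff.1 hx)
  have hin : ∀ (X : Set M), ∀ x ∈ closedBall (0 : ℝ × ℝ × ℝ) 10,
      β x ∈ F 1 '' X ↔ β (Θ.symm x) ∈ X := by
    intro X x hx
    have h1 : F 1 (β (Θ.symm x)) = β x := by rw [hF1 _ (hsymm x hx), Θ.apply_symm_apply]
    rw [← h1, (F 1).injective.mem_set_image]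
  have hout : ∀ (X : Set M), ∀ y ∉ β '' closedBall (0 : ℝ × ℝ × ℝ) 10, y ∈ F 1 '' X ↔ y ∈ X := by
    intro X y hy
    have h1 : F 1 y = y := hFo y fun h ↦ hy (image_mono ball_subset_closedBall h)
    conv_lhs => rw [← h1]
    exact (F 1).injective.mem_set_image
  refine ⟨P.map (F 1), ⟨F, hF, hF0, rfl, rfl⟩, ⟨fun x hx ↦ ?_, fun x hx ↦ ?_, hout _, hout _⟩,
    fun z ↦ F 1 (χ z), ?_, fun σ v t hσ hv ht ↦ ?_⟩
  · refine (hin P.V x hx).trans ?_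
    rw [hβ.mem_left _ (hsymm x hx), hΘV, Θ.apply_symm_apply]
  · refine (hin P.W x hx).trans ?_
    rw [hβ.mem_right _ (hsymm x hx), hΘW, Θ.apply_symm_apply]
  · have : (P.map (F 1)).V ∩ (P.map (F 1)).W = F 1 '' (P.V ∩ P.W) :=
      (image_inter (F 1).injective).symm
    rw [this]
    exact hχ.image (F 1)
  · simp only
    rw [hχβ σ v t hσ hv ht, hF1, hΘf σ v t hσ hv ht]
    obtain ⟨h1, h2⟩ := abs_le.1 hv
    rw [mem_closedBall_zero_iff, Prod.norm_def, Prod.norm_def, norm_zero]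
    refine max_le (by norm_num) (max_le ?_ (by rw [Real.norm_eq_abs]; linarith))
    rw [Real.norm_eq_abs]
    rcases eq_or_eq_neg_of_abs_eq hσ with rfl | rfl
    · exact abs_le.2 ⟨by linarith, by linarith⟩
    · exact abs_le.2 ⟨by linarith, by linarith⟩

/-- The tunnel through the wedge. -/
def tunnel : Set (ℝ × ℝ × ℝ) := {x | |x.1 - 5 / 2| ≤ 1 / 2 ∧ |x.2.1 - 5 / 2| ≤ 1 / 2 ∧ |x.2.2| ≤ 1}

/-- The tunnel without its side walls. -/
def tunnelInt : Set (ℝ × ℝ × ℝ) :=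
  {x | |x.1 - 5 / 2| < 1 / 2 ∧ |x.2.1 - 5 / 2| < 1 / 2 ∧ |x.2.2| ≤ 1}

theorem isCompact_tunnel : IsCompact tunnel := by
  have : tunnel = Icc (2 : ℝ) 3 ×ˢ Icc (2 : ℝ) 3 ×ˢ Icc (-1 : ℝ) 1 := by
    ext x
    simp only [tunnel, mem_ofPred_eq, mem_prod, mem_Icc, abs_le]
    constructor
    · rintro ⟨⟨h1, h2⟩, ⟨h3, h4⟩, h5⟩
      exact ⟨⟨by linarith, by linarith⟩, ⟨by linarith, by linarith⟩, h5⟩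
    · rintro ⟨⟨h1, h2⟩, ⟨h3, h4⟩, h5⟩
      exact ⟨⟨by linarith, by linarith⟩, ⟨by linarith, by linarith⟩, h5⟩
  rw [this]
  exact isCompact_Icc.prod (isCompact_Icc.prod isCompact_Icc)

theorem mem_box_iff {x : ℝ × ℝ × ℝ} : x ∈ closedBall (0 : ℝ × ℝ × ℝ) 10 ↔
    (-10 ≤ x.1 ∧ x.1 ≤ 10) ∧ (-10 ≤ x.2.1 ∧ x.2.1 ≤ 10) ∧ -10 ≤ x.2.2 ∧ x.2.2 ≤ 10 := by
  rw [mem_closedBall_zero_iff, Prod.norm_def, Prod.norm_def, max_le_iff, max_le_iff,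
    Real.norm_eq_abs, Real.norm_eq_abs, Real.norm_eq_abs, abs_le, abs_le, abs_le]

theorem tunnel_subset : tunnel ⊆ closedBall (0 : ℝ × ℝ × ℝ) 10 := by
  rintro x ⟨h1, h2, h3⟩
  rw [abs_le] at h1 h2 h3
  rw [mem_box_iff]
  refine ⟨⟨?_, ?_⟩, ⟨?_, ?_⟩, ?_, ?_⟩ <;> linarith

theorem tunnelInt_subset : tunnelInt ⊆ tunnel := fun _ h ↦ ⟨h.1.le, h.2.1.le, h.2.2⟩

theorem mem_image_comp_iff {X Y Z : Type*} {β : Y → Z} {K : Set Y} (hβ : InjOn β K) (J : X ≃ Y)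
    {A : Set X} (hA : MapsTo J A K) {y : Y} (hy : y ∈ K) : β y ∈ (fun x ↦ β (J x)) '' A ↔ J.symm y ∈ A := by
  constructor
  · rintro ⟨x, hx, hxy⟩
    rw [← hβ (hA hx) hy hxy, J.symm_apply_apply]
    exact hx
  · intro h
    exact ⟨_, h, by simp⟩

/-- The union of `V₁` and `V₂` for the two trenches. -/
def tunnelV (V : Set M) (β : ℝ × ℝ × ℝ → M) : Set M := V \ β '' tunnelInt

/-- The handlebody complementary to `tunnelV`. -/
def tunnelW (W : Set M) (β : ℝ × ℝ × ℝ → M) : Set M := W ∪ β '' tunnel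

/-- Identities between the modified handlebodies reduce to inequalities between coordinates in the
box, since nothing changes outside. -/
theorem eq_of_box {X Y : Set M} {K : Set (ℝ × ℝ × ℝ)} (h : ∀ x ∈ K, β x ∈ X ↔ β x ∈ Y)
    (h' : ∀ y ∉ β '' K, y ∈ X ↔ y ∈ Y) : X = Y := by
  ext y
  by_cases hy : y ∈ β '' K
  · obtain ⟨x, hx, rfl⟩ := hy
    exact h x hx
  · exact h' y hy

theorem IsWedgeBox.mem_tunnelV {V W : Set M} (hβ : IsWedgeBox V W β)
    {x : ℝ × ℝ × ℝ} (hx : x ∈ closedBall (0 : ℝ × ℝ × ℝ) 10) :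
    β x ∈ tunnelV V β ↔ x ∈ wedge ∧ x ∉ tunnelInt := by
  have h := mem_image_comp_iff hβ.disk.inj (Equiv.refl _)
    (A := tunnelInt) (fun y hy ↦ tunnel_subset (tunnelInt_subset hy)) hx
  exact and_congr (hβ.mem_left x hx) (not_congr h)

theorem IsWedgeBox.mem_tunnelW {V W : Set M} (hβ : IsWedgeBox V W β)
    {x : ℝ × ℝ × ℝ} (hx : x ∈ closedBall (0 : ℝ × ℝ × ℝ) 10) :
    β x ∈ tunnelW W β ↔ x ∉ wedgeInt ∨ x ∈ tunnel := by
  have h := mem_image_comp_iff hβ.disk.inj (Equiv.refl _) (A := tunnel)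
    (fun y hy ↦ tunnel_subset hy) hx
  exact or_congr (hβ.mem_right x hx) h

theorem mem_tunnelV_of_notMem {V : Set M} {y : M} (hy : y ∉ β '' closedBall (0 : ℝ × ℝ × ℝ) 10) :
    y ∈ tunnelV V β ↔ y ∈ V :=
  ⟨fun h ↦ h.1, fun h ↦ ⟨h, fun h' ↦ hy (image_mono (tunnelInt_subset.trans tunnel_subset) h')⟩⟩

theorem mem_tunnelW_of_notMem {W : Set M} {y : M} (hy : y ∉ β '' closedBall (0 : ℝ × ℝ × ℝ) 10) :
    y ∈ tunnelW W β ↔ y ∈ W :=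
  ⟨fun h ↦ h.resolve_right fun h' ↦ hy (image_mono tunnel_subset h'), Or.inl⟩

end TrenchSplitting

/-! ### Both sides of the tunnel splitting as handlebodies of genus `g + 1`. -/

section Attachments

variable {M : Type*} [TopologicalSpace M] {g : ℕ} {β : ℝ × ℝ × ℝ → M}

/-- Coordinates on the one-handle that fills the outer part of the trench. -/
noncomputable def trenchEquiv : ℝ × ℝ × ℝ ≃ ℝ × ℝ × ℝ where
  toFun c := (1 + c.2.2, 5 / 2 + c.1 / 2, c.2.1)
  invFun x := (2 * (x.2.1 - 5 / 2), x.2.2, x.1 - 1)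
  left_inv c := by
    refine Prod.ext ?_ (Prod.ext rfl ?_)
    · simp only; ring
    · simp only; ring
  right_inv x := by
    refine Prod.ext ?_ (Prod.ext ?_ rfl)
    · simp only; ring
    · simp only; ring

/-- Coordinates on the tunnel. -/
noncomputable def tunnelEquiv : ℝ × ℝ × ℝ ≃ ℝ × ℝ × ℝ where
  toFun c := (5 / 2 - c.2.2 / 2, 5 / 2 - c.2.1 / 2, c.1)
  invFun x := (x.2.2, 5 - 2 * x.2.1, 5 - 2 * x.1)
  left_inv c := by
    refine Prod.ext rfl (Prod.ext ?_ ?_)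
    · simp only; ring
    · simp only; ring
  right_inv x := by
    refine Prod.ext ?_ (Prod.ext ?_ rfl)
    · simp only; ring
    · simp only; ring

theorem mem_cube_iff {c : ℝ × ℝ × ℝ} : c ∈ cube ↔
    (-1 ≤ c.1 ∧ c.1 ≤ 1) ∧ (-1 ≤ c.2.1 ∧ c.2.1 ≤ 1) ∧ -1 ≤ c.2.2 ∧ c.2.2 ≤ 1 := Iff.rfl

theorem trenchEquiv_mapsTo : MapsTo trenchEquiv cube (closedBall 0 10) := by
  rintro c ⟨⟨h1, h2⟩, ⟨h3, h4⟩, h5, h6⟩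
  rw [mem_box_iff]
  simp only [trenchEquiv, Equiv.coe_fn_mk]
  refine ⟨⟨?_, ?_⟩, ⟨?_, ?_⟩, ?_, ?_⟩ <;> linarith

theorem tunnelEquiv_mapsTo : MapsTo tunnelEquiv cube (closedBall 0 10) := by
  rintro c ⟨⟨h1, h2⟩, ⟨h3, h4⟩, h5, h6⟩
  rw [mem_box_iff]
  simp only [tunnelEquiv, Equiv.coe_fn_mk]
  refine ⟨⟨?_, ?_⟩, ⟨?_, ?_⟩, ?_, ?_⟩ <;> linarith

theorem notMem_image_comp {J : ℝ × ℝ × ℝ ≃ ℝ × ℝ × ℝ} {A K : Set (ℝ × ℝ × ℝ)} (hA : MapsTo J A K)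
    {y : M} (hy : y ∉ β '' K) : y ∉ (fun c ↦ β (J c)) '' A := by
  rintro ⟨c, hc, rfl⟩
  exact hy ⟨_, hA hc, rfl⟩

/-- The trench has depth `3` and the bridge fills it to depth `2`; what remains open is the tunnel.
-/
theorem image_trenchEquiv {P Q : HeegaardSplitting M} (hβ : IsWedgeBox P.V P.W β)
    (hQ : IsTrenchSplitting P Q β) :
    Q.V ∪ (fun c ↦ β (trenchEquiv c)) '' cube = tunnelV P.V β := by
  refine eq_of_box (β := β) (K := closedBall 0 10) (fun x hx ↦ ?_) fun y hy ↦ ?_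
  · rw [mem_union, mem_image_comp_iff hβ.disk.inj _ trenchEquiv_mapsTo hx, hβ.mem_tunnelV hx,
      hQ.mem_V x hx, mem_cube_iff]
    obtain ⟨p, q, t⟩ := x
    simp only [wedge, tunnelInt, mem_ofPred_eq, trenchEquiv, Equiv.coe_fn_symm_mk, abs_le, abs_lt]
    grind
  · rw [mem_union, mem_tunnelV_of_notMem hy, hQ.mem_V_of_notMem y hy]
    exact or_iff_left (notMem_image_comp trenchEquiv_mapsTo hy)

/-- The bridge is attached to the handlebody with the trench, with its feet on the two walls. -/
theorem isHandlebody_tunnelV [T2Space M] {P Q : HeegaardSplitting M} (hβ : IsWedgeBox P.V P.W β)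
    (hQ : IsTrenchSplitting P Q β) (hg : Q.HasGenus g) {χ : ℂ → M} (hχ : IsDisk (Q.V ∩ Q.W) χ 12)
    (hχβ : ∀ σ v t : ℝ, |σ| = 1 → |v| ≤ 1 → |t| ≤ 1 →
      χ ⟨σ * (6 - v), t⟩ = β (1 + v, 5 / 2 + σ / 2, t)) :
    IsHandlebody (g + 1) (tunnelV P.V β) (tunnelV P.V β ∩ tunnelW P.W β) := by
  have hJ : Continuous trenchEquiv := by
    change Continuous fun c : ℝ × ℝ × ℝ ↦ (1 + c.2.2, 5 / 2 + c.1 / 2, c.2.1)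
    fun_prop
  have h := hg.1.attach hχ (κ := fun c ↦ β (trenchEquiv c))
    (hβ.disk.cont.comp hJ.continuousOn trenchEquiv_mapsTo)
    (hβ.disk.inj.comp trenchEquiv.injective.injOn trenchEquiv_mapsTo)
    (fun c hc hσ ↦ (hχβ _ _ _ hσ (abs_le.2 hc.2.2) (abs_le.2 hc.2.1)).symm)
    (fun c hc hcV ↦ by
      rw [hQ.mem_V _ (trenchEquiv_mapsTo hc)] at hcV
      obtain ⟨⟨h1, h2⟩, -, h3, h4⟩ := hc
      have h5 := hcV.2
      simp only [trenchEquiv, Equiv.coe_fn_mk, abs_lt] at h5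
      grind)
  rw [image_trenchEquiv hβ hQ] at h
  convert h using 1
  refine eq_of_box (β := β) (K := closedBall 0 10) (fun x hx ↦ ?_) fun y hy ↦ ?_
  · rw [mem_union, Set.mem_sdiff, mem_image_comp_iff hβ.disk.inj _
      (trenchEquiv_mapsTo.mono_left (sep_subset _ _)) hx, mem_image_comp_iff hβ.disk.inj _
      (trenchEquiv_mapsTo.mono_left (sep_subset _ _)) hx, mem_inter_iff, mem_inter_iff,
      hβ.mem_tunnelV hx, hβ.mem_tunnelW hx, hQ.mem_V x hx, hQ.mem_W x hx]
    obtain ⟨p, q, t⟩ := x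
    simp only [wedge, wedgeInt, tunnel, tunnelInt, mem_ofPred_eq, trenchEquiv, Equiv.coe_fn_symm_mk,
      mem_cube_iff, abs_le, abs_lt, abs_eq (zero_le_one (α := ℝ))]
    clear h hχβ hχ hg
    grind (splits := 40)
  · rw [mem_union, Set.mem_sdiff, mem_inter_iff, mem_inter_iff, mem_tunnelV_of_notMem hy,
      mem_tunnelW_of_notMem hy, hQ.mem_V_of_notMem y hy, hQ.mem_W_of_notMem y hy]
    have h1 := notMem_image_comp (trenchEquiv_mapsTo.mono_left (sep_subset cube fun c ↦
      |c.1| = 1 ∧ |c.2.1| < 1 ∧ |c.2.2| < 1)) hy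
    have h2 := notMem_image_comp (trenchEquiv_mapsTo.mono_left (sep_subset cube fun c ↦
      |c.2.1| = 1 ∨ |c.2.2| = 1)) hy
    exact ⟨fun h ↦ Or.inl ⟨h, h1⟩, fun h ↦ (h.resolve_right h2).1⟩

/-- Here the handle is the tunnel itself, attached to the original `W` with its feet at the ends `t
= ±1`. No trench is involved, so both trenches lead to the same second handlebody. -/
theorem isHandlebody_tunnelW [T2Space M] {P : HeegaardSplitting M} (hβ : IsWedgeBox P.V P.W β)
    (hg : P.HasGenus g) {χ : ℂ → M} (hχ : IsDisk (P.V ∩ P.W) χ 12)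
    (hχβ : ∀ σ y v : ℝ, |σ| = 1 → |y| ≤ 1 → |v| ≤ 1 →
      χ ⟨σ * (6 - v), y⟩ = β (5 / 2 - v / 2, 5 / 2 - y / 2, σ)) :
    IsHandlebody (g + 1) (tunnelW P.W β) (tunnelV P.V β ∩ tunnelW P.W β) := by
  have hJ : Continuous tunnelEquiv := by
    change Continuous fun c : ℝ × ℝ × ℝ ↦ (5 / 2 - c.2.2 / 2, 5 / 2 - c.2.1 / 2, c.1)
    fun_prop
  have h := hg.2.attach hχ (κ := fun c ↦ β (tunnelEquiv c))
    (hβ.disk.cont.comp hJ.continuousOn tunnelEquiv_mapsTo)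
    (hβ.disk.inj.comp tunnelEquiv.injective.injOn tunnelEquiv_mapsTo)
    (fun c hc hσ ↦ (hχβ _ _ _ hσ (abs_le.2 hc.2.1) (abs_le.2 hc.2.2)).symm)
    (fun c hc hcV ↦ by
      rw [hβ.mem_right _ (tunnelEquiv_mapsTo hc)] at hcV
      obtain ⟨h0, ⟨h1, h2⟩, h3, h4⟩ := hc
      by_contra hcon
      refine hcV ⟨?_, ?_, (abs_le.2 h0).lt_of_ne hcon⟩
      · simp only [tunnelEquiv, Equiv.coe_fn_mk]; linarith
      · simp only [tunnelEquiv, Equiv.coe_fn_mk]; linarith)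
  have hW : P.W ∪ (fun c ↦ β (tunnelEquiv c)) '' cube = tunnelW P.W β := by
    refine eq_of_box (β := β) (K := closedBall 0 10) (fun x hx ↦ ?_) fun y hy ↦ ?_
    · rw [mem_union, mem_image_comp_iff hβ.disk.inj _ tunnelEquiv_mapsTo hx, hβ.mem_tunnelW hx,
        hβ.mem_right x hx, mem_cube_iff]
      obtain ⟨p, q, t⟩ := x
      simp only [tunnel, mem_ofPred_eq, tunnelEquiv, Equiv.coe_fn_symm_mk, abs_le]
      grind
    · rw [mem_union, mem_tunnelW_of_notMem hy]
      exact or_iff_left (notMem_image_comp tunnelEquiv_mapsTo hy)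
  rw [hW] at h
  convert h using 1
  refine eq_of_box (β := β) (K := closedBall 0 10) (fun x hx ↦ ?_) fun y hy ↦ ?_
  · rw [mem_union, Set.mem_sdiff, mem_image_comp_iff hβ.disk.inj _
      (tunnelEquiv_mapsTo.mono_left (sep_subset _ _)) hx, mem_image_comp_iff hβ.disk.inj _
      (tunnelEquiv_mapsTo.mono_left (sep_subset _ _)) hx, mem_inter_iff, mem_inter_iff,
      hβ.mem_tunnelV hx, hβ.mem_tunnelW hx, hβ.mem_left x hx, hβ.mem_right x hx]
    obtain ⟨p, q, t⟩ := x
    simp only [wedge, wedgeInt, tunnel, tunnelInt, mem_ofPred_eq, tunnelEquiv, Equiv.coe_fn_symm_mk,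
      mem_cube_iff, abs_le, abs_lt, abs_eq (zero_le_one (α := ℝ))]
    clear h hχβ hχ hg
    grind (splits := 40)
  · rw [mem_union, Set.mem_sdiff, mem_inter_iff, mem_inter_iff, mem_tunnelV_of_notMem hy,
      mem_tunnelW_of_notMem hy]
    have h1 := notMem_image_comp (tunnelEquiv_mapsTo.mono_left (sep_subset cube fun c ↦
      |c.1| = 1 ∧ |c.2.1| < 1 ∧ |c.2.2| < 1)) hy
    have h2 := notMem_image_comp (tunnelEquiv_mapsTo.mono_left (sep_subset cube fun c ↦
      |c.2.1| = 1 ∨ |c.2.2| = 1)) hy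
    exact ⟨fun h ↦ Or.inl ⟨h, h1⟩, fun h ↦ (h.resolve_right h2).1⟩

end Attachments

/-! ### The bridge across the trench is a stabilization. -/

section Stabilization

/-- The radial homeomorphism between the unit balls of two norms. -/
theorem exists_radialMap {E F : Type*} [NormedAddCommGroup E] [NormedSpace ℝ E]
    [NormedAddCommGroup F] [NormedSpace ℝ F] (e : E ≃L[ℝ] F) : ∃ q : E → F, Continuous q ∧
      Function.Bijective q ∧ (∀ z, ‖q z‖ = ‖z‖) ∧ ∀ z, ‖e z‖ = ‖z‖ → q z = e z := by
  have h0 : ∀ z, z ≠ 0 → ‖e z‖ ≠ 0 := fun z hz ↦ by simpa using hz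
  have hn : ∀ z, ‖(‖z‖ / ‖e z‖) • e z‖ = ‖z‖ := by
    intro z
    by_cases hz : z = 0
    · simp [hz]
    · rw [norm_smul, norm_div, norm_norm, norm_norm, div_mul_cancel₀ _ (h0 z hz)]
  refine ⟨fun z ↦ (‖z‖ / ‖e z‖) • e z, ?_, ⟨fun z w hzw ↦ ?_, fun w ↦ ?_⟩, hn, fun z hz ↦ ?_⟩
  · rw [continuous_iff_continuousAt]
    intro z
    by_cases hz : z = 0
    · subst hz
      have : Tendsto (fun z : E ↦ ‖z‖) (𝓝 0) (𝓝 0) := by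
        simpa using (continuous_norm (E := E)).tendsto 0
      have h1 := (tendsto_zero_iff_norm_tendsto_zero (f := fun z ↦ (‖z‖ / ‖e z‖) • e z)).2
        (this.congr fun z ↦ (hn z).symm)
      simpa [ContinuousAt] using h1
    · exact (continuous_norm.continuousAt.div e.continuous.norm.continuousAt (h0 z hz)).smul
        e.continuous.continuousAt
  · simp only at hzw
    have h1 : ‖z‖ = ‖w‖ := by rw [← hn z, hzw, hn]
    by_cases hz : z = 0
    · rw [hz, norm_zero] at h1
      rw [hz, norm_eq_zero.1 h1.symm]
    have hw : w ≠ 0 := fun h ↦ by simp [h, hz] at h1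
    rw [← h1, ← e.map_smul, ← e.map_smul] at hzw
    have h2 := e.injective hzw
    have h3 : ‖z‖ / ‖e z‖ = ‖z‖ / ‖e w‖ := by
      have := congrArg norm h2
      rw [norm_smul, norm_smul, ← h1, Real.norm_of_nonneg (by positivity),
        Real.norm_of_nonneg (by positivity)] at this
      exact mul_right_cancel₀ (norm_ne_zero_iff.2 hz) this
    rw [← h3] at h2
    exact smul_right_injective E (div_ne_zero (norm_ne_zero_iff.2 hz) (h0 z hz)) h2
  · by_cases hw : w = 0
    · exact ⟨0, by simp [hw]⟩
    have h1 : ‖e.symm w‖ ≠ 0 := by simpa using hw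
    have h2 : ‖w‖ ≠ 0 := norm_ne_zero_iff.2 hw
    refine ⟨(‖w‖ / ‖e.symm w‖) • e.symm w, ?_⟩
    simp only [map_smul, e.apply_symm_apply, norm_smul, norm_div, norm_norm, smul_smul]
    have h3 : ‖w‖ / ‖e.symm w‖ * ‖e.symm w‖ / (‖w‖ / ‖e.symm w‖ * ‖w‖) * (‖w‖ / ‖e.symm w‖) = 1 := by
      field_simp
    rw [h3, one_smul]
  · simp only [hz]
    by_cases h : z = 0
    · simp [h]
    · rw [div_self (norm_ne_zero_iff.2 h), one_smul]

variable {M : Type*} [TopologicalSpace M] {β : ℝ × ℝ × ℝ → M}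

theorem mem_closure_of_box (hβ : ContinuousOn β (closedBall 0 10)) {A : Set M} {x : ℝ × ℝ × ℝ}
    (hx : ‖x‖ ≤ 9) (d : ℝ × ℝ × ℝ) (h : ∀ ε : ℝ, 0 < ε → ε < 1 → β (x + ε • d) ∈ A) :
    β x ∈ closure A := by
  have h1 : ContinuousAt β x := hβ.continuousAt
    (mem_of_superset (isOpen_ball.mem_nhds (mem_ball_zero_iff.2 (by linarith))) ball_subset_closedBall)
  have h2 : Tendsto (fun ε : ℝ ↦ x + ε • d) (𝓝[>] 0) (𝓝 x) := by
    have : Continuous fun ε : ℝ ↦ x + ε • d := by fun_prop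
    simpa using (this.tendsto 0).mono_left nhdsWithin_le_nhds
  refine mem_closure_of_tendsto (h1.tendsto.comp h2) ?_
  filter_upwards [Ioo_mem_nhdsGT (zero_lt_one (α := ℝ))] with ε hε
  exact h ε hε.1 hε.2

theorem IsWedgeBox.isClosed_tunnelW [T2Space M] {V W S : Set M} {g : ℕ} (hβ : IsWedgeBox V W β)
    (hW : IsHandlebody g W S) : IsClosed (tunnelW W β) := by
  refine IsClosed.union ?_ (isCompact_tunnel.image_of_continuousOn
    (hβ.disk.cont.mono tunnel_subset)).isClosed
  obtain ⟨f, hf⟩ := hW.exists_isParam le_rfl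
  exact hf.isCompact.isClosed

/-- Points of the bridge that belong to the second handlebody lie on its free faces `p = 0`, `p = 2`
or `t = ±1`, and there they are limits of points of `Q.W` outside the bridge. The converse inclusion
holds because `tunnelW` is closed. -/
theorem closure_diff_trench [T2Space M] {P Q : HeegaardSplitting M} (hβ : IsWedgeBox P.V P.W β)
    (hQ : IsTrenchSplitting P Q β) :
    tunnelW P.W β = closure (Q.W \ (fun c ↦ β (trenchEquiv c)) '' cube) := by
  have hmem : ∀ x ∈ closedBall (0 : ℝ × ℝ × ℝ) 10,
      (β x ∈ Q.W \ (fun c ↦ β (trenchEquiv c)) '' cube ↔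
        ¬ (x ∈ wedgeInt ∧ ¬ (x.1 ≤ 3 ∧ |x.2.1 - 5 / 2| ≤ 1 / 2)) ∧
        ¬ (|x.1 - 1| ≤ 1 ∧ |x.2.1 - 5 / 2| ≤ 1 / 2 ∧ |x.2.2| ≤ 1)) := by
    intro x hx
    refine and_congr (hQ.mem_W x hx) (not_congr ?_)
    rw [mem_image_comp_iff hβ.disk.inj _ trenchEquiv_mapsTo hx, mem_cube_iff]
    simp only [trenchEquiv, Equiv.coe_fn_symm_mk, abs_le]
    constructor
    · rintro ⟨⟨h1, h2⟩, h3, h4, h5⟩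
      exact ⟨⟨h4, h5⟩, ⟨by linarith, by linarith⟩, h3⟩
    · rintro ⟨⟨h4, h5⟩, ⟨h1, h2⟩, h3⟩
      exact ⟨⟨by linarith, by linarith⟩, h3, h4, h5⟩
  have hout : ∀ y ∉ β '' closedBall (0 : ℝ × ℝ × ℝ) 10,
      (y ∈ Q.W \ (fun c ↦ β (trenchEquiv c)) '' cube ↔ y ∈ P.W) := fun y hy ↦
    ⟨fun h ↦ (hQ.mem_W_of_notMem y hy).1 h.1,
      fun h ↦ ⟨(hQ.mem_W_of_notMem y hy).2 h, notMem_image_comp trenchEquiv_mapsTo hy⟩⟩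
  obtain ⟨g, -, hgW⟩ := P.exists_genus
  apply subset_antisymm
  · intro y hy
    by_cases hyK : y ∈ β '' closedBall (0 : ℝ × ℝ × ℝ) 10
    · obtain ⟨x, hx, rfl⟩ := hyK
      rw [hβ.mem_tunnelW hx] at hy
      by_cases hx1 : |x.1 - 1| ≤ 1 ∧ |x.2.1 - 5 / 2| ≤ 1 / 2 ∧ |x.2.2| ≤ 1
      · obtain ⟨p, q, t⟩ := x
        simp only at hx1
        have hx1' := hx1
        rw [abs_le, abs_le, abs_le] at hx1'
        obtain ⟨⟨hp, hp'⟩, ⟨hq, hq'⟩, ht, ht'⟩ := hx1'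
        have hx9 : ‖(p, q, t)‖ ≤ 9 := by
          rw [Prod.norm_def, Prod.norm_def, max_le_iff, max_le_iff, Real.norm_eq_abs,
            Real.norm_eq_abs, Real.norm_eq_abs, abs_le, abs_le, abs_le]
          refine ⟨⟨?_, ?_⟩, ⟨?_, ?_⟩, ?_, ?_⟩ <;> linarith
        have hcase : p = 0 ∨ p = 2 ∨ t = 1 ∨ t = -1 := by
          rcases hy with h | h
          · by_contra hcon
            push Not at hcon
            refine h ⟨lt_of_le_of_ne (by simp only; linarith) hcon.1.symm, by simp only; linarith, ?_⟩
            exact abs_lt.2 ⟨lt_of_le_of_ne ht hcon.2.2.2.symm, lt_of_le_of_ne ht' hcon.2.2.1⟩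
          · have := (abs_le.1 h.1).1
            simp only at this
            exact Or.inr (Or.inl (by linarith))
        -- Each free face is left in the direction `(a, 0, c)` of its outward normal; the two
        -- conditions say that the moved point is in `Q.W` and off the bridge.
        have hlim : ∀ a c : ℝ, |a| ≤ 1 → |c| ≤ 1 →
            (∀ ε : ℝ, 0 < ε → ε < 1 →
              (p + ε * a ≤ 0 ∨ 1 < |t + ε * c| ∨ p + ε * a ≤ 3) ∧
              (1 < |p + ε * a - 1| ∨ 1 < |t + ε * c|)) →
            β (p, q, t) ∈ closure (Q.W \ (fun c ↦ β (trenchEquiv c)) '' cube) := by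
          intro a c ha hc h
          refine mem_closure_of_box hβ.disk.cont hx9 (a, 0, c) fun ε h0 h1 ↦ ?_
          have hx : (p, q, t) + ε • ((a, 0, c) : ℝ × ℝ × ℝ) = (p + ε * a, q, t + ε * c) := by
            simp
          have ha' : |ε * a| ≤ 1 := by
            rw [abs_mul, abs_of_pos h0]
            exact mul_le_one₀ h1.le (abs_nonneg _) ha
          have hc' : |ε * c| ≤ 1 := by
            rw [abs_mul, abs_of_pos h0]
            exact mul_le_one₀ h1.le (abs_nonneg _) hc
          rw [abs_le] at ha' hc'
          rw [hx, hmem _ (mem_box_iff.2 ⟨⟨by simp only; linarith, by simp only; linarith⟩,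
            ⟨by simp only; linarith, by simp only; linarith⟩,
            by simp only; linarith, by simp only; linarith⟩)]
          obtain ⟨h2, h3⟩ := h ε h0 h1
          refine ⟨fun h4 ↦ ?_, fun h4 ↦ ?_⟩
          · rcases h2 with h2 | h2 | h2
            · exact not_lt.2 h2 h4.1.1
            · exact lt_asymm h2 h4.1.2.2
            · exact h4.2 ⟨h2, hx1.2.1⟩
          · rcases h3 with h3 | h3
            · exact not_lt.2 h4.1 h3
            · exact not_lt.2 h4.2.2 h3
        rcases hcase with rfl | rfl | rfl | rfl
        · refine hlim (-1) 0 (by simp) (by simp) fun ε h0 h1 ↦ ⟨Or.inl (by linarith), Or.inl ?_⟩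
          exact lt_abs.2 (Or.inr (by linarith))
        · refine hlim 1 0 (by simp) (by simp) fun ε h0 h1 ↦
            ⟨Or.inr (Or.inr (by linarith)), Or.inl ?_⟩
          exact lt_abs.2 (Or.inl (by linarith))
        · refine hlim 0 1 (by simp) (by simp) fun ε h0 h1 ↦ ?_
          have : 1 < |1 + ε * 1| := lt_abs.2 (Or.inl (by linarith))
          exact ⟨Or.inr (Or.inl this), Or.inr this⟩
        · refine hlim 0 (-1) (by simp) (by simp) fun ε h0 h1 ↦ ?_
          have : 1 < |-1 + ε * -1| := lt_abs.2 (Or.inr (by linarith))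
          exact ⟨Or.inr (Or.inl this), Or.inr this⟩
      · refine subset_closure ((hmem x hx).2 ⟨fun h ↦ ?_, hx1⟩)
        rcases hy with h' | h'
        · exact h' h.1
        · exact h.2 ⟨by have := (abs_le.1 h'.1).2; linarith, h'.2.1⟩
    · exact subset_closure ((hout y hyK).2 ((mem_tunnelW_of_notMem hyK).1 hy))
  · refine closure_minimal (fun y hy ↦ ?_) (hβ.isClosed_tunnelW hgW)
    by_cases hyK : y ∈ β '' closedBall (0 : ℝ × ℝ × ℝ) 10
    · obtain ⟨x, hx, rfl⟩ := hyK
      rw [hmem x hx] at hy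
      rw [hβ.mem_tunnelW hx]
      by_cases hxw : x ∈ wedgeInt
      · obtain ⟨h1, h2⟩ : x.1 ≤ 3 ∧ |x.2.1 - 5 / 2| ≤ 1 / 2 := not_not.1 fun h ↦ hy.1 ⟨hxw, h⟩
        have h3 : 2 < x.1 := by
          by_contra hcon
          refine hy.2 ⟨abs_le.2 ⟨?_, by linarith⟩, h2, hxw.2.2.le⟩
          have := hxw.1
          linarith
        exact Or.inr ⟨abs_le.2 ⟨by linarith, by linarith⟩, h2, hxw.2.2.le⟩
      · exact Or.inl hxw
    · exact (mem_tunnelW_of_notMem hyK).2 ((hout y hyK).1 hy)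

/-- The core crosses the trench at `p = 1`, `t = 0`. The square descends from it to the floor `p =
3`, with two sides on the walls and one on the floor. Its upper half `p ≤ 2` lies in the bridge, and
the rest in the future tunnel. -/
theorem IsTrenchSplitting.stabilizesTo [T2Space M] {P Q R : HeegaardSplitting M}
    (hβ : IsWedgeBox P.V P.W β) (hQ : IsTrenchSplitting P Q β) (hV : R.V = tunnelV P.V β)
    (hW : R.W = tunnelW P.W β) : Q.StabilizesTo R := by
  obtain ⟨q, hqc, hqb, hqn, hqe⟩ := exists_radialMap Complex.equivRealProdCLM
  have hinB : ∀ a b s : ℝ, |a| ≤ 3 → |b| ≤ 1 → s ∈ Icc (0 : ℝ) 1 →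
      (1 + a, 2 + s, b) ∈ closedBall (0 : ℝ × ℝ × ℝ) 10 := by
    intro a b s ha hb hs
    obtain ⟨hs, hs'⟩ := hs
    rw [abs_le] at ha hb
    rw [mem_box_iff]
    refine ⟨⟨?_, ?_⟩, ⟨?_, ?_⟩, ?_, ?_⟩ <;> simp only <;> linarith
  have hmemV : ∀ a b s : ℝ, |a| ≤ 3 → -1 ≤ a → |b| ≤ 1 → s ∈ Icc (0 : ℝ) 1 →
      (β (1 + a, 2 + s, b) ∈ Q.V ↔ 2 ≤ a ∨ s = 0 ∨ s = 1) := by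
    intro a b s ha ha' hb hs
    rw [hQ.mem_V _ (hinB a b s ha hb hs)]
    obtain ⟨hs, hs'⟩ := hs
    simp only [wedge, mem_ofPred_eq, abs_lt]
    constructor
    · rintro ⟨-, h⟩
      by_contra hcon
      push Not at hcon
      have h1 := lt_of_le_of_ne hs hcon.2.1.symm
      have h2 := lt_of_le_of_ne hs' hcon.2.2
      exact h ⟨by linarith, by linarith, by linarith⟩
    · rintro h
      refine ⟨⟨by linarith, by linarith, hb⟩, ?_⟩
      rintro ⟨h1, h2, h3⟩
      rcases h with h | h | h <;> linarith
  have hmemW : ∀ a b s : ℝ, a ≤ 2 → |a| ≤ 3 → |b| ≤ 1 → s ∈ Icc (0 : ℝ) 1 →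
      β (1 + a, 2 + s, b) ∈ Q.W := by
    intro a b s ha ha' hb hs
    rw [hQ.mem_W _ (hinB a b s ha' hb hs)]
    obtain ⟨hs, hs'⟩ := hs
    refine fun h ↦ h.2 ⟨by simp only; linarith, abs_le.2 ⟨?_, ?_⟩⟩ <;> simp only <;> linarith
  have hq1 : ∀ z : closedBall (0 : ℂ) 1, |(q z).1| ≤ 1 ∧ |(q z).2| ≤ 1 := by
    intro z
    have h1 : ‖q z‖ ≤ 1 := by rw [hqn]; exact mem_closedBall_zero_iff.1 z.2
    rwa [Prod.norm_def, max_le_iff] at h1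
  -- The round disk is turned into the square cross-section radially. Real points keep their
  -- position, so the radius of the disk corresponds to the square of the parallelism.
  have hqx : ∀ x : ℝ, q (x : ℂ) = (x, 0) := by
    intro x
    have : Complex.equivRealProdCLM (x : ℂ) = (x, 0) := by
      simp [Complex.equivRealProdCLM_apply]
    rw [hqe, this]
    rw [this, Complex.norm_real, Prod.norm_def, norm_zero]
    exact max_eq_left (norm_nonneg _)
  set φ : closedBall (0 : ℂ) 1 × unitInterval → M :=
    fun x ↦ β (1 + (q x.1).1, 2 + (x.2 : ℝ), (q x.1).2) with hφ
  have h13 : ∀ {a : ℝ}, |a| ≤ 1 → |a| ≤ 3 := fun h ↦ h.trans (by norm_num)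
  have ht3 : ∀ t : unitInterval, |2 * (t : ℝ)| ≤ 3 := fun t ↦
    abs_le.2 ⟨by linarith [t.2.1], by linarith [t.2.2]⟩
  have hφc : Continuous φ := by
    refine hβ.disk.cont.comp_continuous (by fun_prop) fun x ↦ ?_
    exact hinB _ _ _ (h13 (hq1 x.1).1) (hq1 x.1).2 x.2.2
  have hφi : Function.Injective φ := by
    intro x y hxy
    have h1 := hβ.disk.inj (hinB _ _ _ (h13 (hq1 x.1).1) (hq1 x.1).2 x.2.2)
      (hinB _ _ _ (h13 (hq1 y.1).1) (hq1 y.1).2 y.2.2) hxy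
    simp only [Prod.mk.injEq, add_right_inj] at h1
    exact Prod.ext (Subtype.ext (hqb.1 (Prod.ext h1.1 h1.2.2))) (Subtype.ext h1.2.1)
  have hφr : range φ = (fun c ↦ β (trenchEquiv c)) '' cube := by
    apply subset_antisymm
    · rintro _ ⟨x, rfl⟩
      refine ⟨(2 * (x.2 : ℝ) - 1, (q x.1).2, (q x.1).1), ⟨?_, abs_le.1 (hq1 x.1).2,
        abs_le.1 (hq1 x.1).1⟩, ?_⟩
      · have := x.2.2
        exact ⟨by simp only; linarith [this.1], by simp only; linarith [this.2]⟩
      · simp only [trenchEquiv, Equiv.coe_fn_mk, hφ]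
        congr 3
        ring
    · rintro _ ⟨c, ⟨⟨h1, h2⟩, h3, h4⟩, rfl⟩
      obtain ⟨z, hz⟩ := hqb.2 (c.2.2, c.2.1)
      have hz1 : ‖z‖ ≤ 1 := by
        rw [← hqn, hz, Prod.norm_def]
        exact max_le (abs_le.2 h4) (abs_le.2 h3)
      refine ⟨(⟨z, mem_closedBall_zero_iff.2 hz1⟩, ⟨(c.1 + 1) / 2, by linarith, by linarith⟩), ?_⟩
      simp only [trenchEquiv, Equiv.coe_fn_mk, hφ, hz]
      congr 3
      ring
  refine ⟨φ, ⟨(hφc.isClosedEmbedding hφi).isEmbedding, ?_, fun x ↦ ?_⟩,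
    ⟨fun x ↦ β (1 + 2 * (x.2 : ℝ), 2 + (x.1 : ℝ), 0), ?_, ?_, fun x ↦ ?_, fun s t z hz ↦ ?_,
      fun s t ht ↦ ?_⟩, ?_, ?_⟩
  · rintro _ ⟨x, rfl⟩
    have h1 := hq1 x.1
    exact hmemW _ _ _ (by linarith [(abs_le.1 h1.1).2]) (h13 h1.1) h1.2 x.2.2
  · have h1 := hq1 x.1
    have h2 := abs_le.1 h1.1
    have h3 : φ x ∈ Q.W := hmemW _ _ _ (by linarith [h2.2]) (h13 h1.1) h1.2 x.2.2
    rw [mem_inter_iff, and_iff_left h3]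
    refine (hmemV _ _ _ (h13 h1.1) h2.1 h1.2 x.2.2).trans ?_
    rw [or_iff_right (by linarith [h2.2]), Subtype.ext_iff, Subtype.ext_iff]
    rfl
  · refine (Continuous.isClosedEmbedding ?_ fun x y hxy ↦ ?_).isEmbedding
    · exact hβ.disk.cont.comp_continuous (by fun_prop) fun x ↦
        hinB _ _ _ (ht3 x.2) (by simp) x.1.2
    · have h1 := hβ.disk.inj (hinB _ _ _ (ht3 x.2) (by simp) x.1.2)
        (hinB _ _ _ (ht3 y.2) (by simp) y.1.2) hxy
      simp only [Prod.mk.injEq, add_right_inj] at h1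
      exact Prod.ext (Subtype.ext h1.2.1) (Subtype.ext (by linarith [h1.1]))
  · rintro _ ⟨x, rfl⟩
    exact hmemW _ _ _ (by linarith [x.2.2.2]) (ht3 x.2) (by simp) x.1.2
  · have h3 := hmemW _ _ _ (by linarith [x.2.2.2]) (ht3 x.2) (abs_zero.trans_le zero_le_one) x.1.2
    rw [mem_inter_iff, and_iff_left h3]
    refine (hmemV _ _ _ (ht3 x.2) (by linarith [x.2.2.1]) (by simp) x.1.2).trans ?_
    rw [Subtype.ext_iff, Subtype.ext_iff, Subtype.ext_iff]
    change 2 ≤ 2 * (x.2 : ℝ) ∨ (x.1 : ℝ) = 0 ∨ (x.1 : ℝ) = 1 ↔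
      (x.1 : ℝ) = 0 ∨ (x.1 : ℝ) = 1 ∨ (x.2 : ℝ) = 1
    constructor
    · rintro (h | h | h)
      · exact Or.inr (Or.inr (le_antisymm x.2.2.2 (by linarith)))
      · exact Or.inl h
      · exact Or.inr (Or.inl h)
    · rintro (h | h | h)
      · exact Or.inr (Or.inl h)
      · exact Or.inr (Or.inr h)
      · exact Or.inl (by linarith)
  · simp only [hφ, hz, hqx]
  · rintro ⟨x, hx⟩
    have h1 := hβ.disk.inj (hinB _ _ _ (h13 (hq1 x.1).1) (hq1 x.1).2 x.2.2)
      (hinB _ _ _ (ht3 t) (by simp) s.2) hx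
    simp only [Prod.mk.injEq, add_right_inj] at h1
    have h2 := (abs_le.1 (hq1 x.1).1).2
    linarith [h1.1]
  · rw [hφr, hV, image_trenchEquiv hβ hQ]
  · rw [hφr, hW, closure_diff_trench hβ hQ]

end Stabilization

/-! ### The second trench by symmetry, and the union of the two handlebodies. -/

section Swap

variable {M : Type*} [TopologicalSpace M] {β : ℝ × ℝ × ℝ → M} {V W : Set M}

/-- Exchange of the first two coordinates. -/
def swapFirst : ℝ × ℝ × ℝ ≃ₜ ℝ × ℝ × ℝ where
  toFun x := (x.2.1, x.1, x.2.2)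
  invFun x := (x.2.1, x.1, x.2.2)
  left_inv _ := rfl
  right_inv _ := rfl
  continuous_toFun := by fun_prop
  continuous_invFun := by fun_prop

theorem swapFirst_apply (x : ℝ × ℝ × ℝ) : swapFirst x = (x.2.1, x.1, x.2.2) := rfl

theorem norm_swapFirst (x : ℝ × ℝ × ℝ) : ‖swapFirst x‖ = ‖x‖ := by
  change max ‖x.2.1‖ (max ‖x.1‖ ‖x.2.2‖) = max ‖x.1‖ (max ‖x.2.1‖ ‖x.2.2‖)
  exact max_left_comm _ _ _

theorem image_comp_swapFirst {A : Set (ℝ × ℝ × ℝ)} (hA : ∀ x, swapFirst x ∈ A ↔ x ∈ A) :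
    (fun x ↦ β (swapFirst x)) '' A = β '' A := by
  apply subset_antisymm
  · rintro _ ⟨x, hx, rfl⟩
    exact ⟨_, (hA x).2 hx, rfl⟩
  · rintro _ ⟨x, hx, rfl⟩
    exact ⟨swapFirst x, (hA x).2 hx, rfl⟩

/-- The wedge is symmetric in its first two coordinates, so all results on the trench from `p = 0`
apply to the one from `q = 0`. -/
theorem IsWedgeBox.swapFirst (hβ : IsWedgeBox V W β) :
    IsWedgeBox V W fun x ↦ β (swapFirst x) := by
  have hball : ∀ x, _root_.swapFirst x ∈ closedBall (0 : ℝ × ℝ × ℝ) 10 ↔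
      x ∈ closedBall (0 : ℝ × ℝ × ℝ) 10 := fun x ↦ by
    rw [mem_closedBall_zero_iff, norm_swapFirst, mem_closedBall_zero_iff]
  have hball' : ∀ x, _root_.swapFirst x ∈ ball (0 : ℝ × ℝ × ℝ) 10 ↔
      x ∈ ball (0 : ℝ × ℝ × ℝ) 10 := fun x ↦ by
    rw [mem_ball_zero_iff, norm_swapFirst, mem_ball_zero_iff]
  refine ⟨⟨?_, ?_, fun x _ ↦ mem_univ _, ?_⟩, fun x hx ↦ ?_, fun x hx ↦ ?_⟩
  · exact hβ.disk.cont.comp _root_.swapFirst.continuous.continuousOn fun x hx ↦ (hball x).2 hx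
  · exact hβ.disk.inj.comp _root_.swapFirst.injective.injOn fun x hx ↦ (hball x).2 hx
  · rw [image_comp_swapFirst hball']
    exact hβ.disk.isOpen
  · rw [hβ.mem_left _ ((hball x).2 hx)]
    exact and_left_comm
  · rw [hβ.mem_right _ ((hball x).2 hx)]
    exact not_congr and_left_comm

theorem tunnelV_swapFirst : tunnelV V (fun x ↦ β (swapFirst x)) = tunnelV V β := by
  rw [tunnelV, tunnelV, image_comp_swapFirst fun x ↦ and_left_comm]

theorem tunnelW_swapFirst : tunnelW W (fun x ↦ β (swapFirst x)) = tunnelW W β := by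
  rw [tunnelW, tunnelW, image_comp_swapFirst fun x ↦ and_left_comm]

theorem tunnelV_union_tunnelW (hVW : V ∪ W = univ) :
    tunnelV V β ∪ tunnelW W β = univ := by
  rw [eq_univ_iff_forall] at hVW ⊢
  intro y
  rcases hVW y with h | h
  · by_cases hy : y ∈ β '' tunnelInt
    · exact Or.inr (Or.inr (image_mono tunnelInt_subset hy))
    · exact Or.inl ⟨h, hy⟩
  · exact Or.inr (Or.inl h)

/-- The part of `V` missing from both handlebodies is the intersection of the trenches: `p < 3` and
`q < 3` follow from the width conditions of the respective other trench, and the tunnel remains. -/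
theorem tunnelV_eq_union {P Q₁ Q₂ : HeegaardSplitting M} (hβ : IsWedgeBox P.V P.W β)
    (h₁ : IsTrenchSplitting P Q₁ β) (h₂ : IsTrenchSplitting P Q₂ fun x ↦ β (swapFirst x)) :
    tunnelV P.V β = Q₁.V ∪ Q₂.V := by
  have hball : ∀ x, swapFirst x ∈ closedBall (0 : ℝ × ℝ × ℝ) 10 ↔
      x ∈ closedBall (0 : ℝ × ℝ × ℝ) 10 := fun x ↦ by
    rw [mem_closedBall_zero_iff, norm_swapFirst, mem_closedBall_zero_iff]
  refine eq_of_box (β := β) (K := closedBall 0 10) (fun x hx ↦ ?_) fun y hy ↦ ?_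
  · have h3 := h₂.mem_V (swapFirst x) ((hball x).2 hx)
    rw [hβ.mem_tunnelV hx, mem_union, h₁.mem_V x hx]
    refine Iff.trans ?_ (or_congr_right h3.symm)
    obtain ⟨p, q, t⟩ := x
    simp only [swapFirst_apply, wedge, tunnelInt, mem_ofPred_eq,
      abs_lt, abs_le]
    clear h3 hx hball h₁ h₂ hβ
    grind
  · rw [mem_tunnelV_of_notMem hy, mem_union, h₁.mem_V_of_notMem y hy,
      h₂.mem_V_of_notMem y (by rwa [image_comp_swapFirst hball]), or_self]

end Swap

theorem proposition2p1 {M : Type*} [TopologicalSpace M] [T2Space M] [SecondCountableTopology M]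
    [ChartedSpace (EuclideanSpace ℝ (Fin 3)) M]
    (P₁ P₂ : HeegaardSplitting M) (hiso : P₁.Isotopic P₂) (g : ℕ) (hg : P₁.HasGenus g) :
    P₂.HasGenus g ∧
      ∃ P : HeegaardSplitting M, P.IsUnionStabilization P₁ P₂ ∧ P.HasGenus (g + 1) := by
  refine ⟨hiso.hasGenus hg, ?_⟩
  obtain ⟨β, χ₁, χ₂, χ₃, hβ, hχ₁, hχ₂, hχ₃, h₁, h₂, h₃⟩ :=
    exists_isWedgeBox hg.1 hg.2 P₁.union_eq
  obtain ⟨Q₁, hQ₁, ht₁, χ, hχ, hχβ⟩ := exists_isTrenchSplitting P₁ hβ hχ₁ h₁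
  -- The second trench is dug into `P₁` too; the resulting splitting is isotopic to `P₂` because
  -- `P₁` is.
  obtain ⟨Q₂, hQ₂, ht₂, -⟩ := exists_isTrenchSplitting P₁ hβ.swapFirst hχ₂ h₂
  have hV := isHandlebody_tunnelV hβ ht₁ (hQ₁.hasGenus hg) hχ hχβ
  have hW := isHandlebody_tunnelW hβ hg hχ₃ h₃
  refine ⟨⟨tunnelV P₁.V β, tunnelW P₁.W β, tunnelV_union_tunnelW P₁.union_eq, g + 1, hV, hW⟩,
    ⟨Q₁, Q₂, hQ₁, hiso.symm.trans hQ₂, .single (ht₁.stabilizesTo hβ rfl rfl),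
      .single (ht₂.stabilizesTo hβ.swapFirst ?_ ?_), tunnelV_eq_union hβ ht₁ ht₂⟩, hV, hW⟩
  · exact tunnelV_swapFirst.symm
  · exact tunnelW_swapFirst.symm
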